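/- All manifolds are smooth, finite-dimensional, of constant dimension, Hausdorff and second countable; all vector bundles are smooth of constant finite rank. **$[2]$-manifolds.** A $[2]$-manifold $\mathcal N$ is a smooth manifold $M$ with a sheaf $C^\infty(\mathcal N)=\bigoplus_{k\ge 0}C^\infty(\mathcal N)^k$ of $\mathbb N$-graded, graded commutative, associative, unital $C^\infty(M)$-algebras which is locally freely generated by $r_1$ elements of degree $1$ and $r_2$ elements of degree $2$, for some fixed $r_1,r_2$. A morphism $\mathcal N\to\mathcal N'$ over a smooth map $\mu_0:M\to M'$ is a morphism $C^\infty(\mathcal N')\to (\mu_0)_*C^\infty(\mathcal N)$ of sheaves of graded algebras over $\mu_0^*:C^\infty(M')\to C^\infty(M)$. The category is $[2]\text{-Man}$. **Involutive double vector bundles.** A double vector bundle with sides $A,B$ over $M$ is a manifold $D$ with vector bundle structures $\pi_A:D\to A$ and $\pi_B:D\to B$, where $A\to M$, $B\to M$ are vector bundles, such that the projections form a commutative square and the projection, addition and scalar multiplication of each structure on $D$ are vector bundle morphisms with respect to the other one. Its core consists of the elements projecting to zero in both sides. An involutive double vector bundle $(D;Q,Q;M)$ is a double vector bundle with both sides equal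 to the same vector bundle $q_Q:Q\to M$, with projections $\pi_1,\pi_2:D\to Q$, and a smooth map $\mathcal I:D\to D$ with $\mathcal I^2=\mathrm{id}$, $\pi_1\mathcal I=\pi_2$, $\pi_2\mathcal I=\pi_1$, which is linear from $\pi_1$ to $\pi_2$ and from $\pi_2$ to $\pi_1$, and which is $-\mathrm{id}$ on the core $B^*$. A morphism $D\to D'$ is a morphism $(\Omega;\omega_Q,\omega_Q;\omega_0)$ of double vector bundles with $\Omega\circ\mathcal I=\mathcal I'\circ\Omega$. The category is $\mathrm{IDVB}$. **The functor $\mathcal M$.** For $D$ in $\mathrm{IDVB}$ let $\mathbb E=D^*_{\pi_1}$ be the dual of $\pi_1:D\to Q$, a double vector bundle with sides $Q$ and $B$, with the linear metric on $\mathbb E\to B$ given by $\langle e_1,e_2\rangle=e_1(d)+e_2(\mathcal I d)$ for any $d\in D$ such that $e_1,e_2$ lie over $\pi_1(d),\pi_2(d)$. Let $\mathcal C(\mathbb E)$ be the sheaf over $M$ of smooth linear sections $\chi$ of $\mathbb E\to Q$ with isotropic image. For sections $\tau_1,\tau_2$ of $Q^*$ let $\widetilde{\tau_1\wedge\tau_2}\in\mathcal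 C(\mathbb E)$ be the section with $d\mapsto\tfrac12\big(\tau_1(\pi_1d)\tau_2(\pi_2d)-\tau_2(\pi_1d)\tau_1(\pi_2d)\big)$ as associated function on $D$. Then $\mathcal M(D)$ is $M$ with the sheaf of graded commutative $C^\infty(M)$-algebras generated by $\Gamma(Q^*)$ in degree $1$ and $\mathcal C(\mathbb E)$ in degree $2$, with $\tau_1\cdot\tau_2=\widetilde{\tau_1\wedge\tau_2}$; more precisely, a function of degree $k$ is a section of the bundle of graded algebras $\big(\Lambda^\bullet Q^*_m\otimes S^\bullet\mathcal C(\mathbb E)_m\big)/\big(\tau_1\wedge\tau_2-\widetilde{\tau_1\wedge\tau_2}\big)$, $m\in M$, which is locally a homogeneous polynomial of degree $k$ in smooth sections of $Q^*$ and elements of $\mathcal C(\mathbb E)$, with smooth coefficients. On morphisms $\mathcal M$ is given by $\omega_0$ and the pullbacks $\Gamma(Q'^*)\to\Gamma(Q^*)$, $\mathcal C(\mathbb E')\to\mathcal C(\mathbb E)$ along $\omega_Q$ and $\Omega$. **Theorem.** For every involutive double vector bundle $D$, $\mathcal M(D)$ is a $[2]$-manifold, and over every open subset of $M$ the canonical maps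 $\Gamma(Q^*)\to C^\infty(\mathcal M(D))^1$ and $\mathcal C(\mathbb E)\to C^\infty(\mathcal M(D))^2$ are bijective; so $\mathcal M$ is a functor $\mathrm{IDVB}\to[2]\text{-Man}$. There are a functor $\mathcal G:[2]\text{-Man}\to\mathrm{IDVB}$ and natural isomorphisms $\eta:\mathrm{id}_{\mathrm{IDVB}}\cong\mathcal G\circ\mathcal M$ and $\varepsilon:\mathcal M\circ\mathcal G\cong\mathrm{id}_{[2]\text{-Man}}$ satisfying the triangle identities $\varepsilon_{\mathcal M(D)}\circ\mathcal M(\eta_D)=\mathrm{id}$ and $\mathcal G(\varepsilon_{\mathcal N})\circ\eta_{\mathcal G(\mathcal N)}=\mathrm{id}$; thus $\mathcal M$ and $\mathcal G$ form an equivalence of categories. Moreover $\mathcal G(\mathcal N)$ is the double vector bundle whose charts are the local generators of $\mathcal N$: whenever $\xi_1,\dots,\xi_{r_1}$ (degree $1$) and $\eta_1,\dots,\eta_{r_2}$ (degree $2$) freely generate $C^\infty(\mathcal N)$ over an open set $U$, with images $\tau_i\in\Gamma(Q^*)$ and $\chi_j\in\mathcal C(\mathbb E)$ under $\varepsilon_{\mathcal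 N}^\star$ (for $D=\mathcal G(\mathcal N)$), the map $$d\mapsto\big(m,\ (\tau_i(\pi_1d))_i,\ (\tau_i(\pi_2d))_i,\ (\chi_j(\pi_1d)(d))_j\big),$$ where $m$ is the image of the base point of $d$ under the base map of $\varepsilon_{\mathcal N}$, is a diffeomorphism from the part of $\mathcal G(\mathcal N)$ over $U$ onto $U\times\mathbb R^{r_1}\times\mathbb R^{r_1}\times\mathbb R^{r_2}$. -/

import Mathlib

open CategoryTheory TopologicalSpace
open scoped Manifold ContDiff DirectSum

universe u

namespace GradedGeometry

/-! ## Smooth manifolds and smooth functions on their open subsets -/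

/-- A smooth manifold: finite-dimensional, of constant dimension, without boundary, Hausdorff and
second countable. -/
structure Mfd where
  carrier : Type u
  dim : ℕ
  [top : TopologicalSpace carrier]
  [charted : ChartedSpace (EuclideanSpace ℝ (Fin dim)) carrier]
  [smooth : IsManifold (𝓡 dim) ∞ carrier]
  [t2 : T2Space carrier]
  [secondCountable : SecondCountableTopology carrier]

instance : CoeSort Mfd.{u} (Type u) := ⟨Mfd.carrier⟩

attribute [instance] Mfd.top Mfd.charted Mfd.smooth Mfd.t2 Mfd.secondCountable

/-- Smooth maps between manifolds. -/
abbrev SmoothMap {X Y : Mfd.{u}} (f : X → Y) : Prop := ContMDiff (𝓡 X.dim) (𝓡 Y.dim) ∞ f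

/-- The ring `C^∞(U)` of smooth functions on an open subset `U` of `X`. -/
abbrev Fun (X : Mfd.{u}) (U : Opens X) : Type u := C^∞⟮𝓡 X.dim, U; 𝓘(ℝ, ℝ), ℝ⟯

/-- Smoothness of a real function on an open subset. -/
abbrev SmoothFun {X : Mfd.{u}} {U : Opens X} (f : U → ℝ) : Prop :=
  ContMDiff (𝓡 X.dim) 𝓘(ℝ, ℝ) ∞ f

/-- The preimage of an open set under a smooth map. -/
def preim {X Y : Mfd.{u}} {f : X → Y} (hf : SmoothMap f) (U : Opens Y) : Opens X :=
  ⟨f ⁻¹' U, U.2.preimage hf.continuous⟩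

theorem smoothFun_comp {X Y : Mfd.{u}} {F : X → Y} (hF : SmoothMap F) {U : Opens X} {V : Opens Y}
    (h : ∀ x ∈ U, F x ∈ V) {f : V → ℝ} (hf : SmoothFun f) :
    SmoothFun (fun x : U => f ⟨F x.1, h x.1 x.2⟩) := by
  classical
  let g : Y → ℝ := fun y => if hy : y ∈ V then f ⟨y, hy⟩ else 0
  have hg : ∀ y : V, g y.1 = f y := fun y => by simp [g]
  intro x
  have h1 : ContMDiffAt (𝓡 Y.dim) 𝓘(ℝ, ℝ) ∞ g (F x.1) := by
    have h2 : ContMDiffAt (𝓡 Y.dim) 𝓘(ℝ, ℝ) ∞ (fun y : V => g y.1) ⟨F x.1, h x.1 x.2⟩ := by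
      have : (fun y : V => g y.1) = f := funext hg
      rw [this]
      exact hf _
    exact contMDiffAt_subtype_iff.mp h2
  have h3 : ContMDiffAt (𝓡 X.dim) 𝓘(ℝ, ℝ) ∞ (fun x : U => g (F x.1)) x :=
    (h1.comp x.1 (hF x.1)).comp x (contMDiff_subtype_val x)
  have h4 : (fun x : U => g (F x.1)) = fun x : U => f ⟨F x.1, h x.1 x.2⟩ :=
    funext fun x => hg ⟨F x.1, h x.1 x.2⟩
  rwa [h4] at h3

/-- Pullback of smooth functions along a smooth map `F` with `F(U) ⊆ V`. -/
noncomputable def Fun.pullback {X Y : Mfd.{u}} {F : X → Y} (hF : SmoothMap F) {U : Opens X} {V : Opens Y}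
    (h : ∀ x ∈ U, F x ∈ V) (f : Fun Y V) : Fun X U :=
  ⟨fun x => f ⟨F x.1, h x.1 x.2⟩, smoothFun_comp hF h f.2⟩

/-- Restriction of smooth functions. -/
noncomputable def Fun.res {X : Mfd.{u}} {U V : Opens X} (h : V ≤ U) (f : Fun X U) : Fun X V :=
  Fun.pullback (F := id) contMDiff_id (fun _ hx => h hx) f

/-! ## Manifolds with a sheaf of graded commutative algebras, and `[2]`-manifolds -/

/-- A smooth manifold `M` with a sheaf of `ℕ`-graded, graded commutative, associative, unital
`C^∞(M)`-algebras.  The graded algebra over `U` is `⨁ k, sec U k`; the sheaf condition is imposed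
degree by degree. -/
structure GradedMfd where
  base : Mfd.{u}
  sec : Opens base → ℕ → Type u
  [addCommGroup : ∀ U k, AddCommGroup (sec U k)]
  [module : ∀ U k, Module (Fun base U) (sec U k)]
  [ring : ∀ U, DirectSum.GRing (sec U)]
  [algebra : ∀ U, DirectSum.GAlgebra (Fun base U) (sec U)]
  graded_comm : ∀ (U : Opens base) (i j : ℕ) (a : sec U i) (b : sec U j),
    DirectSum.of (sec U) i a * DirectSum.of (sec U) j b =
      ((-1 : ℤ) ^ (i * j)) • (DirectSum.of (sec U) j b * DirectSum.of (sec U) i a)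
  res : ∀ {U V : Opens base}, V ≤ U → ∀ k, sec U k →+ sec V k
  res_one : ∀ {U V : Opens base} (h : V ≤ U),
    res h 0 (GradedMonoid.GOne.one : sec U 0) = (GradedMonoid.GOne.one : sec V 0)
  res_mul : ∀ {U V : Opens base} (h : V ≤ U) (i j : ℕ) (a : sec U i) (b : sec U j),
    res h (i + j) (GradedMonoid.GMul.mul a b) = GradedMonoid.GMul.mul (res h i a) (res h j b)
  res_smul : ∀ {U V : Opens base} (h : V ≤ U) (k : ℕ) (f : Fun base U) (a : sec U k),
    res h k (f • a) = Fun.res h f • res h k a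
  res_id : ∀ (U : Opens base) (k : ℕ) (a : sec U k), res le_rfl k a = a
  res_res : ∀ {U V W : Opens base} (h : V ≤ U) (h' : W ≤ V) (k : ℕ) (a : sec U k),
    res h' k (res h k a) = res (h'.trans h) k a
  sheaf : ∀ {ι : Type u} (U : ι → Opens base) (k : ℕ) (s : ∀ i, sec (U i) k),
    (∀ i j, res (inf_le_left : U i ⊓ U j ≤ U i) k (s i) =
      res (inf_le_right : U i ⊓ U j ≤ U j) k (s j)) →
    ∃! t : sec (⨆ i, U i) k, ∀ i, res (le_iSup U i) k t = s i

attribute [instance] GradedMfd.addCommGroup GradedMfd.module GradedMfd.ring GradedMfd.algebra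

/-- A morphism `N ⟶ M`: a smooth map `base` of the underlying manifolds and a morphism
`C^∞(M) → base_* C^∞(N)` of sheaves of graded algebras over the pullback of smooth functions. -/
@[ext]
structure GradedMfd.Hom (N M : GradedMfd.{u}) where
  base : N.base → M.base
  smooth : SmoothMap base
  app : ∀ (U : Opens M.base) (k : ℕ), M.sec U k →+ N.sec (preim smooth U) k
  app_one : ∀ U : Opens M.base,
    app U 0 (GradedMonoid.GOne.one : M.sec U 0) = GradedMonoid.GOne.one
  app_mul : ∀ (U : Opens M.base) (i j : ℕ) (a : M.sec U i) (b : M.sec U j),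
    app U (i + j) (GradedMonoid.GMul.mul a b) = GradedMonoid.GMul.mul (app U i a) (app U j b)
  app_smul : ∀ (U : Opens M.base) (k : ℕ) (f : Fun M.base U) (a : M.sec U k),
    app U k (f • a) = (Fun.pullback smooth (fun _ hx => hx) f : Fun N.base (preim smooth U)) •
      app U k a
  app_res : ∀ {U V : Opens M.base} (h : V ≤ U) (k : ℕ) (a : M.sec U k),
    app V k (M.res h k a) =
      N.res (show preim smooth V ≤ preim smooth U from fun _ hx => h hx) k (app U k a)

instance : Category.{u} GradedMfd.{u} where
  Hom := GradedMfd.Hom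
  id M :=
    { base := id
      smooth := contMDiff_id
      app := fun U k => AddMonoidHom.id (M.sec U k)
      app_one := fun _ => rfl
      app_mul := fun _ _ _ _ _ => rfl
      app_smul := fun _ _ _ _ => rfl
      app_res := fun _ _ _ => rfl }
  comp {P N M} g f :=
    { base := fun x => f.base (g.base x)
      smooth := f.smooth.comp g.smooth
      app := fun U k => (g.app (preim f.smooth U) k).comp (f.app U k)
      app_one := fun U => by
        change g.app _ 0 (f.app U 0 _) = _
        rw [f.app_one, g.app_one]; rfl
      app_mul := fun U i j a b => by
        change g.app _ _ (f.app U _ _) = _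
        rw [f.app_mul, g.app_mul]; rfl
      app_smul := fun U k h a => by
        change g.app _ _ (f.app U _ _) = _
        rw [f.app_smul, g.app_smul]; rfl
      app_res := fun h k a => by
        change g.app _ _ (f.app _ _ _) = _
        rw [f.app_res, g.app_res]; rfl }
  id_comp _ := rfl
  comp_id _ := rfl
  assoc _ _ _ := rfl

/-- The monomial `ξ_I · η^α` in the graded algebra over `U`, with the factors `ξ_i`, `i ∈ I`, in
increasing order. -/
noncomputable def GradedMfd.monomial (M : GradedMfd.{u}) {U : Opens M.base} {r₁ r₂ : ℕ}
    (ξ : Fin r₁ → M.sec U 1) (η : Fin r₂ → M.sec U 2) (p : Finset (Fin r₁) × (Fin r₂ → ℕ)) :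
    ⨁ k, M.sec U k :=
  ((p.1.sort (· ≤ ·)).map fun i => DirectSum.of (M.sec U) 1 (ξ i)).prod *
    ((List.finRange r₂).map fun j => DirectSum.of (M.sec U) 2 (η j) ^ p.2 j).prod

/-- The sheaf of algebras is freely generated over `U` by the `ξ_i` (degree 1) and the `η_j`
(degree 2): over every open `V ⊆ U` the monomials `ξ_I η^α` form a basis of the `C^∞(V)`-module of
sections, that is, the algebra is `C^∞(V) ⊗ Λ[ξ] ⊗ S[η]`. -/
def GradedMfd.IsFreelyGenerated (M : GradedMfd.{u}) (U : Opens M.base) {r₁ r₂ : ℕ}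
    (ξ : Fin r₁ → M.sec U 1) (η : Fin r₂ → M.sec U 2) : Prop :=
  ∀ (V : Opens M.base) (h : V ≤ U),
    LinearIndependent (Fun M.base V)
      (M.monomial (fun i => M.res h 1 (ξ i)) (fun j => M.res h 2 (η j))) ∧
    Submodule.span (Fun M.base V)
      (Set.range (M.monomial (fun i => M.res h 1 (ξ i)) (fun j => M.res h 2 (η j)))) = ⊤

/-- `[2]`-manifolds: the sheaf is locally freely generated by `r₁` elements of degree 1 and `r₂`
elements of degree 2. -/
def IsTwoManifold : ObjectProperty GradedMfd.{u} := fun M =>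
  ∃ r₁ r₂ : ℕ, ∀ x : M.base, ∃ U : Opens M.base, x ∈ U ∧
    ∃ (ξ : Fin r₁ → M.sec U 1) (η : Fin r₂ → M.sec U 2), M.IsFreelyGenerated U ξ η

/-- The category `[2]-Man`. -/
abbrev TwoMan := IsTwoManifold.{u}.FullSubcategory

/-! ## Vector bundles, double vector bundles and involutive double vector bundles -/

/-- A smooth vector bundle structure on `E` over `B`: a smooth projection, vector space structures
on its fibres, and local trivialisations `e ↦ (proj e, Θ e)` with smooth inverse `Ψ`. -/
structure VBundle (E B : Mfd.{u}) where
  proj : E → B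
  smooth_proj : SmoothMap proj
  [addCommGroup : ∀ b, AddCommGroup {e : E // proj e = b}]
  [module : ∀ b, Module ℝ {e : E // proj e = b}]
  rank : ℕ
  locally_trivial : ∀ b₀ : B, ∃ U : Opens B, b₀ ∈ U ∧
    ∃ (Θ : E → EuclideanSpace ℝ (Fin rank)) (Ψ : B × EuclideanSpace ℝ (Fin rank) → E),
      ContMDiffOn (𝓡 E.dim) (𝓡 rank) ∞ Θ (proj ⁻¹' U) ∧
      ContMDiffOn ((𝓡 B.dim).prod (𝓡 rank)) (𝓡 E.dim) ∞ Ψ ((U : Set B) ×ˢ Set.univ) ∧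
      (∀ b ∈ U, ∀ v, proj (Ψ (b, v)) = b ∧ Θ (Ψ (b, v)) = v) ∧
      (∀ e, proj e ∈ U → Ψ (proj e, Θ e) = e) ∧
      ∀ b ∈ U, IsLinearMap ℝ (fun x : {e : E // proj e = b} => Θ x.1)

attribute [instance] VBundle.addCommGroup VBundle.module

namespace VBundle

variable {E B E' B' : Mfd.{u}}

/-- The fibre over `b`. -/
abbrev Fib (π : VBundle E B) (b : B) : Type u := {e : E // π.proj e = b}

/-- Addition of two elements of the same fibre. -/
def add (π : VBundle E B) (e e' : E) (h : π.proj e = π.proj e') : E :=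
  ((⟨e, rfl⟩ : π.Fib (π.proj e)) + ⟨e', h.symm⟩ : π.Fib (π.proj e)).1

/-- Scalar multiplication. -/
def smul (π : VBundle E B) (r : ℝ) (e : E) : E :=
  (r • (⟨e, rfl⟩ : π.Fib (π.proj e)) : π.Fib (π.proj e)).1

/-- The zero section. -/
def zero (π : VBundle E B) (b : B) : E := (0 : π.Fib b).1

theorem proj_add (π : VBundle E B) (e e' : E) (h : π.proj e = π.proj e') :
    π.proj (π.add e e' h) = π.proj e :=
  ((⟨e, rfl⟩ : π.Fib (π.proj e)) + ⟨e', h.symm⟩ : π.Fib (π.proj e)).2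

theorem proj_smul (π : VBundle E B) (r : ℝ) (e : E) : π.proj (π.smul r e) = π.proj e :=
  (r • (⟨e, rfl⟩ : π.Fib (π.proj e)) : π.Fib (π.proj e)).2

theorem proj_zero (π : VBundle E B) (b : B) : π.proj (π.zero b) = b := (0 : π.Fib b).2

theorem add_coe (π : VBundle E B) {b : B} (x y : π.Fib b) :
    π.add x.1 y.1 (x.2.trans y.2.symm) = (x + y).1 := by
  obtain ⟨e, rfl⟩ := x
  rfl

theorem smul_coe (π : VBundle E B) {b : B} (r : ℝ) (x : π.Fib b) :
    π.smul r x.1 = (r • x).1 := by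
  obtain ⟨e, rfl⟩ := x
  rfl

/-- `F : E → E'` is a morphism of vector bundles over `f : B → B'`. -/
structure IsMorphism (π : VBundle E B) (π' : VBundle E' B') (F : E → E') (f : B → B') : Prop where
  smooth : SmoothMap F
  smooth_base : SmoothMap f
  comm : ∀ e, π'.proj (F e) = f (π.proj e)
  linear : ∀ b, IsLinearMap ℝ
    (fun x : π.Fib b => (⟨F x.1, (comm x.1).trans (congrArg f x.2)⟩ : π'.Fib (f b)))

namespace IsMorphism

variable {E'' B'' : Mfd.{u}} {π : VBundle E B} {π' : VBundle E' B'} {π'' : VBundle E'' B''}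
  {F : E → E'} {f : B → B'}

/-- The linear map induced on the fibres over `b`. -/
def fibMap (h : IsMorphism π π' F f) (b : B) : π.Fib b →ₗ[ℝ] π'.Fib (f b) :=
  (h.linear b).mk' _

theorem map_add (h : IsMorphism π π' F f) (e e' : E) (he : π.proj e = π.proj e') :
    F (π.add e e' he) = π'.add (F e) (F e') (by rw [h.comm, h.comm, he]) := by
  have h1 := congrArg Subtype.val ((h.linear (π.proj e)).map_add ⟨e, rfl⟩ ⟨e', he.symm⟩)
  rw [← π'.add_coe] at h1
  exact h1

theorem map_smul (h : IsMorphism π π' F f) (r : ℝ) (e : E) :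
    F (π.smul r e) = π'.smul r (F e) := by
  have h1 := congrArg Subtype.val ((h.linear (π.proj e)).map_smul r ⟨e, rfl⟩)
  rw [← π'.smul_coe] at h1
  exact h1

theorem map_zero (h : IsMorphism π π' F f) (b : B) : F (π.zero b) = π'.zero (f b) :=
  congrArg Subtype.val (h.fibMap b).map_zero

theorem id (π : VBundle E B) : IsMorphism π π id id where
  smooth := contMDiff_id
  smooth_base := contMDiff_id
  comm _ := rfl
  linear _ := ⟨fun _ _ => rfl, fun _ _ => rfl⟩

theorem comp {F' : E' → E''} {f' : B' → B''} (h' : IsMorphism π' π'' F' f')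
    (h : IsMorphism π π' F f) : IsMorphism π π'' (fun e => F' (F e)) (fun b => f' (f b)) where
  smooth := h'.smooth.comp h.smooth
  smooth_base := h'.smooth_base.comp h.smooth_base
  comm e := by rw [h'.comm, h.comm]
  linear b := ((h'.fibMap (f b)).comp (h.fibMap b)).isLinear

end IsMorphism

end VBundle

/-- A double vector bundle structure on `D` with side bundles `A` and `B` over `M`: two vector
bundle structures such that the projections, the addition and the scalar multiplication of each
are vector bundle morphisms with respect to the other one. -/
structure DVBundle {A B M : Mfd.{u}} (qA : VBundle A M) (qB : VBundle B M) (D : Mfd.{u}) where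
  πA : VBundle D A
  πB : VBundle D B
  πB_morphism : VBundle.IsMorphism πA qB πB.proj qA.proj
  πA_morphism : VBundle.IsMorphism πB qA πA.proj qB.proj
  add_add : ∀ (d₁ d₂ d₃ d₄ : D) (h₁₂ : πA.proj d₁ = πA.proj d₂) (h₃₄ : πA.proj d₃ = πA.proj d₄)
    (h₁₃ : πB.proj d₁ = πB.proj d₃) (h₂₄ : πB.proj d₂ = πB.proj d₄)
    (hB : πB.proj (πA.add d₁ d₂ h₁₂) = πB.proj (πA.add d₃ d₄ h₃₄))
    (hA : πA.proj (πB.add d₁ d₃ h₁₃) = πA.proj (πB.add d₂ d₄ h₂₄)),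
    πB.add (πA.add d₁ d₂ h₁₂) (πA.add d₃ d₄ h₃₄) hB =
      πA.add (πB.add d₁ d₃ h₁₃) (πB.add d₂ d₄ h₂₄) hA
  smulA_addB : ∀ (r : ℝ) (d₁ d₂ : D) (h : πB.proj d₁ = πB.proj d₂)
    (h' : πB.proj (πA.smul r d₁) = πB.proj (πA.smul r d₂)),
    πA.smul r (πB.add d₁ d₂ h) = πB.add (πA.smul r d₁) (πA.smul r d₂) h'
  smulB_addA : ∀ (r : ℝ) (d₁ d₂ : D) (h : πA.proj d₁ = πA.proj d₂)
    (h' : πA.proj (πB.smul r d₁) = πA.proj (πB.smul r d₂)),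
    πB.smul r (πA.add d₁ d₂ h) = πA.add (πB.smul r d₁) (πB.smul r d₂) h'
  smul_smul : ∀ (r s : ℝ) (d : D), πB.smul r (πA.smul s d) = πA.smul s (πB.smul r d)

/-- An involutive double vector bundle `(D, Q, Q, M)`: a double vector bundle with both sides equal
to `Q → M`, and an involution `inv` which is a morphism of double vector bundles exchanging the two
sides, over the identity of `Q`, and which is minus the identity on the core, that is, on the
elements which both projections send to zero. -/
structure IDVB where
  M : Mfd.{u}
  Q : Mfd.{u}
  D : Mfd.{u}
  q : VBundle Q M
  dvb : DVBundle q q D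
  inv : D → D
  inv_inv : ∀ d, inv (inv d) = d
  inv_morphism₁ : VBundle.IsMorphism dvb.πA dvb.πB inv id
  inv_morphism₂ : VBundle.IsMorphism dvb.πB dvb.πA inv id
  inv_core : ∀ (m : M) (c : D), dvb.πA.proj c = q.zero m → dvb.πB.proj c = q.zero m →
    inv c = dvb.πA.smul (-1) c

namespace IDVB

/-- The first vector bundle structure `π₁ : D → Q`. -/
abbrev p₁ (X : IDVB.{u}) : VBundle X.D X.Q := X.dvb.πA

/-- The second vector bundle structure `π₂ : D → Q`. -/
abbrev p₂ (X : IDVB.{u}) : VBundle X.D X.Q := X.dvb.πB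

/-- Morphisms of involutive double vector bundles: morphisms of double vector bundles commuting
with the involutions. -/
@[ext]
structure Hom (X Y : IDVB.{u}) where
  Ω : X.D → Y.D
  ωQ : X.Q → Y.Q
  ω₀ : X.M → Y.M
  morphism₁ : VBundle.IsMorphism X.p₁ Y.p₁ Ω ωQ
  morphism₂ : VBundle.IsMorphism X.p₂ Y.p₂ Ω ωQ
  morphismQ : VBundle.IsMorphism X.q Y.q ωQ ω₀
  comm_inv : ∀ d, Ω (X.inv d) = Y.inv (Ω d)

instance : Category.{u} IDVB.{u} where
  Hom := Hom
  id X := ⟨id, id, id, .id _, .id _, .id _, fun _ => rfl⟩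
  comp f g := ⟨fun d => g.Ω (f.Ω d), fun x => g.ωQ (f.ωQ x), fun m => g.ω₀ (f.ω₀ m),
    g.morphism₁.comp f.morphism₁, g.morphism₂.comp f.morphism₂, g.morphismQ.comp f.morphismQ,
    fun d => by rw [f.comm_inv, g.comm_inv]⟩
  id_comp _ := rfl
  comp_id _ := rfl
  assoc _ _ _ := rfl

end IDVB

/-! ## The graded commutative algebra on generators of degrees 1 and 2 -/

section TwoAlg

variable {V W V' W' V'' W'' : Type u} [AddCommGroup V] [Module ℝ V] [AddCommGroup W] [Module ℝ W]
  [AddCommGroup V'] [Module ℝ V'] [AddCommGroup W'] [Module ℝ W']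
  [AddCommGroup V''] [Module ℝ V''] [AddCommGroup W''] [Module ℝ W'']

/-- The relations: the elements of `W` are central, and the product of `v, v' ∈ V` is the element
`β v v'` of `W`. -/
inductive TwoAlg.Rel (β : V → V → W) : TensorAlgebra ℝ (V × W) → TensorAlgebra ℝ (V × W) → Prop
  | central (w : W) (x : V × W) : Rel β
      (TensorAlgebra.ι ℝ ((0 : V), w) * TensorAlgebra.ι ℝ x)
      (TensorAlgebra.ι ℝ x * TensorAlgebra.ι ℝ ((0 : V), w))
  | product (v v' : V) : Rel β
      (TensorAlgebra.ι ℝ (v, (0 : W)) * TensorAlgebra.ι ℝ (v', (0 : W)))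
      (TensorAlgebra.ι ℝ ((0 : V), β v v'))

/-- The graded commutative algebra generated by `V` in degree 1 and `W` in degree 2, in which the
product of two elements of `V` is given by the skew-symmetric map `β : V × V → W`. -/
def TwoAlg (β : V → V → W) : Type u := RingQuot (TwoAlg.Rel β)

namespace TwoAlg

variable (β : V → V → W) (β' : V' → V' → W') (β'' : V'' → V'' → W'')

noncomputable instance : Ring (TwoAlg β) := inferInstanceAs (Ring (RingQuot (Rel β)))

noncomputable instance : Algebra ℝ (TwoAlg β) :=
  inferInstanceAs (Algebra ℝ (RingQuot (Rel β)))

/-- The quotient map. -/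
noncomputable def mk : TensorAlgebra ℝ (V × W) →ₐ[ℝ] TwoAlg β := RingQuot.mkAlgHom ℝ (Rel β)

/-- The inclusion of the generators of degree 1. -/
noncomputable def deg1 : V →ₗ[ℝ] TwoAlg β :=
  (mk β).toLinearMap ∘ₗ TensorAlgebra.ι ℝ ∘ₗ LinearMap.inl ℝ V W

/-- The inclusion of the generators of degree 2. -/
noncomputable def deg2 : W →ₗ[ℝ] TwoAlg β :=
  (mk β).toLinearMap ∘ₗ TensorAlgebra.ι ℝ ∘ₗ LinearMap.inr ℝ V W

theorem deg1_mul_deg1 (v v' : V) : deg1 β v * deg1 β v' = deg2 β (β v v') := by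
  have h := RingQuot.mkAlgHom_rel ℝ (Rel.product (β := β) v v')
  rw [_root_.map_mul] at h
  exact h

theorem deg2_mul_deg1 (w : W) (v : V) : deg2 β w * deg1 β v = deg1 β v * deg2 β w := by
  have h := RingQuot.mkAlgHom_rel ℝ (Rel.central (β := β) w (v, 0))
  rw [_root_.map_mul, _root_.map_mul] at h
  exact h

theorem deg2_mul_deg2 (w w' : W) : deg2 β w * deg2 β w' = deg2 β w' * deg2 β w := by
  have h := RingQuot.mkAlgHom_rel ℝ (Rel.central (β := β) w (0, w'))
  rw [_root_.map_mul, _root_.map_mul] at h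
  exact h

variable {β β' β''}

/-- Functoriality of the construction. -/
noncomputable def map (f : V →ₗ[ℝ] V') (g : W →ₗ[ℝ] W')
    (h : ∀ v v', g (β v v') = β' (f v) (f v')) : TwoAlg β →ₐ[ℝ] TwoAlg β' :=
  RingQuot.liftAlgHom ℝ ⟨TensorAlgebra.lift ℝ
      ((deg1 β' ∘ₗ f) ∘ₗ LinearMap.fst ℝ V W + (deg2 β' ∘ₗ g) ∘ₗ LinearMap.snd ℝ V W), by
    intro x y r
    induction r with
    | central w x =>
      simp [add_mul, mul_add, deg2_mul_deg1, deg2_mul_deg2]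
    | product v v' =>
      simp [deg1_mul_deg1, h]⟩

theorem map_deg1 (f : V →ₗ[ℝ] V') (g : W →ₗ[ℝ] W')
    (h : ∀ v v', g (β v v') = β' (f v) (f v')) (v : V) :
    map f g h (deg1 β v) = deg1 β' (f v) := by
  have := RingQuot.liftAlgHom_mkAlgHom_apply ℝ (TensorAlgebra.lift ℝ
      ((deg1 β' ∘ₗ f) ∘ₗ LinearMap.fst ℝ V W + (deg2 β' ∘ₗ g) ∘ₗ LinearMap.snd ℝ V W))
      (s := Rel β) (by
        intro x y r
        induction r with
        | central w x => simp [add_mul, mul_add, deg2_mul_deg1, deg2_mul_deg2]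
        | product v v' => simp [deg1_mul_deg1, h]) (TensorAlgebra.ι ℝ (v, 0))
  refine this.trans ?_
  simp

theorem map_deg2 (f : V →ₗ[ℝ] V') (g : W →ₗ[ℝ] W')
    (h : ∀ v v', g (β v v') = β' (f v) (f v')) (w : W) :
    map f g h (deg2 β w) = deg2 β' (g w) := by
  have := RingQuot.liftAlgHom_mkAlgHom_apply ℝ (TensorAlgebra.lift ℝ
      ((deg1 β' ∘ₗ f) ∘ₗ LinearMap.fst ℝ V W + (deg2 β' ∘ₗ g) ∘ₗ LinearMap.snd ℝ V W))
      (s := Rel β) (by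
        intro x y r
        induction r with
        | central w x => simp [add_mul, mul_add, deg2_mul_deg1, deg2_mul_deg2]
        | product v v' => simp [deg1_mul_deg1, h]) (TensorAlgebra.ι ℝ (0, w))
  refine this.trans ?_
  simp

theorem hom_ext {A : Type u} [Ring A] [Algebra ℝ A] {F G : TwoAlg β →ₐ[ℝ] A}
    (h1 : ∀ v, F (deg1 β v) = G (deg1 β v)) (h2 : ∀ w, F (deg2 β w) = G (deg2 β w)) : F = G := by
  refine RingQuot.ringQuot_ext' ℝ (s := Rel β) F G (TensorAlgebra.hom_ext (LinearMap.ext ?_))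
  rintro ⟨v, w⟩
  have e : ((v, w) : V × W) = (v, 0) + (0, w) := by simp
  rw [e, _root_.map_add, _root_.map_add]
  exact congrArg₂ (· + ·) (h1 v) (h2 w)

theorem map_map (f : V →ₗ[ℝ] V') (g : W →ₗ[ℝ] W') (h : ∀ v v', g (β v v') = β' (f v) (f v'))
    (f' : V' →ₗ[ℝ] V'') (g' : W' →ₗ[ℝ] W'') (h' : ∀ v v', g' (β' v v') = β'' (f' v) (f' v'))
    (f'' : V →ₗ[ℝ] V'') (g'' : W →ₗ[ℝ] W'') (h'' : ∀ v v', g'' (β v v') = β'' (f'' v) (f'' v'))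
    (hf : ∀ v, f'' v = f' (f v)) (hg : ∀ w, g'' w = g' (g w)) (a : TwoAlg β) :
    map f'' g'' h'' a = map f' g' h' (map f g h a) := by
  have e : map f'' g'' h'' = (map f' g' h').comp (map f g h) :=
    hom_ext (fun v => by simp [map_deg1, hf]) (fun w => by simp [map_deg2, hg])
  rw [e]
  rfl

theorem map_id_apply (f : V →ₗ[ℝ] V) (g : W →ₗ[ℝ] W) (h : ∀ v v', g (β v v') = β (f v) (f v'))
    (hf : ∀ v, f v = v) (hg : ∀ w, g w = w) (a : TwoAlg β) : map f g h a = a := by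
  have e : map f g h = AlgHom.id ℝ (TwoAlg β) :=
    hom_ext (fun v => by simp [map_deg1, hf]) (fun w => by simp [map_deg2, hg])
  rw [e]
  rfl

end TwoAlg

end TwoAlg

/-! ## The dual metric double vector bundle and its isotropic linear sections -/

namespace IDVB

variable (X : IDVB.{u})

/-- The projection of `D` onto the double base `M`. -/
def toBase (d : X.D) : X.M := X.q.proj (X.p₁.proj d)

theorem smooth_toBase : SmoothMap X.toBase := X.q.smooth_proj.comp X.p₁.smooth_proj

theorem proj_p₂ (d : X.D) : X.q.proj (X.p₂.proj d) = X.toBase d := X.dvb.πB_morphism.comm d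

theorem p₁_inv (d : X.D) : X.p₁.proj (X.inv d) = X.p₂.proj d := X.inv_morphism₂.comm d

theorem p₂_inv (d : X.D) : X.p₂.proj (X.inv d) = X.p₁.proj d := X.inv_morphism₁.comm d

variable {X}

/-- The fibre over `m` of the core `C` of `D`. -/
def Core (X : IDVB.{u}) (m : X.M) : Type u :=
  {c : X.D // X.p₁.proj c = X.q.zero m ∧ X.p₂.proj c = X.q.zero m}

/-- The fibre over `x ∈ Q` of the dual `𝔼 = D^*_{π₁}` of the vector bundle `π₁ : D → Q`. -/
abbrev EFib (X : IDVB.{u}) (x : X.Q) : Type u := Module.Dual ℝ (X.p₁.Fib x)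

theorem p₂_zero {m : X.M} (x : X.q.Fib m) (c : X.Core m) :
    X.p₂.proj (X.p₁.zero x.1) = X.p₂.proj c.1 := by
  rw [X.dvb.πB_morphism.map_zero, x.2, c.2.2]

/-- The element `0_x +₂ c` of `D`, for `x ∈ Q` and `c` in the core. -/
def zeroAdd {m : X.M} (x : X.q.Fib m) (c : X.Core m) : X.p₁.Fib x.1 :=
  ⟨X.p₂.add (X.p₁.zero x.1) c.1 (p₂_zero x c), by
    rw [X.dvb.πA_morphism.map_add]
    simp only [X.p₁.proj_zero, c.2.1]
    exact (X.q.add_coe x (0 : X.q.Fib m)).trans (by rw [add_zero])⟩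

/-- The projection `π_B` of an element `Φ ∈ 𝔼` over `x ∈ Q` to the second side `B = C^*` of `𝔼`:
`π_B(Φ)(c) = Φ(0_x +₂ c)`. -/
def projB {m : X.M} (x : X.q.Fib m) (Φ : X.EFib x.1) : X.Core m → ℝ := fun c => Φ (zeroAdd x c)

theorem p₁_add₂ {m : X.M} (x y : X.q.Fib m) (d : X.p₁.Fib x.1) (e : X.p₁.Fib y.1)
    (h : X.p₂.proj d.1 = X.p₂.proj e.1) : X.p₁.proj (X.p₂.add d.1 e.1 h) = (x + y).1 := by
  rw [X.dvb.πA_morphism.map_add]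
  simp only [d.2, e.2]
  exact X.q.add_coe x y

theorem p₁_smul₂ {m : X.M} (r : ℝ) (x : X.q.Fib m) (d : X.p₁.Fib x.1) :
    X.p₁.proj (X.p₂.smul r d.1) = (r • x).1 := by
  rw [X.dvb.πA_morphism.map_smul, d.2]
  exact X.q.smul_coe r x

/-- The second projection `d ↦ π₂(d)` from the fibre of `π₁` over `x ∈ Q_m` to `Q_m`. -/
def snd {m : X.M} (x : X.q.Fib m) : X.p₁.Fib x.1 →ₗ[ℝ] X.q.Fib m where
  toFun d := ⟨X.p₂.proj d.1, by rw [X.proj_p₂, toBase, d.2, x.2]⟩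
  map_add' d e := by
    obtain ⟨x, rfl⟩ := x
    exact (X.dvb.πB_morphism.fibMap x).map_add d e
  map_smul' r d := by
    obtain ⟨x, rfl⟩ := x
    exact (X.dvb.πB_morphism.fibMap x).map_smul r d

/-- The involution from the fibre of `π₁` over `x` to the fibre of `π₁` over `π₂(d)`. -/
def invFib {m : X.M} (x : X.q.Fib m) (d : X.p₁.Fib x.1) : X.p₁.Fib (snd x d).1 :=
  ⟨X.inv d.1, X.p₁_inv d.1⟩

/-- The linear metric of `𝔼`: if `Φ, Ψ ∈ 𝔼` lie over `x, y ∈ Q_m` and over the same point of `B`,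
then `⟨Φ, Ψ⟩ = Φ(d) + Ψ(inv d)` for any `d ∈ D` with `π₁(d) = x` and `π₂(d) = y`. -/
def metric {m : X.M} (x : X.q.Fib m) (d : X.p₁.Fib x.1) (Φ : X.EFib x.1)
    (Ψ : X.EFib (snd x d).1) : ℝ :=
  Φ d + Ψ (invFib x d)

/-- `χ : Q_m → 𝔼` is, over the point `m`, a linear section of `𝔼 → Q` with isotropic image.
`linear`: `χ` takes values in one fibre of `𝔼 → B`; `add`, `smul`: it is additive and homogeneous
for the vector space structure of that fibre, which is given by
`(Φ +_B Ψ)(d +₂ e) = Φ(d) + Ψ(e)` and `(r ·_B Φ)(r ·₂ d) = r Φ(d)`;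
`isotropic`: any two of its values are orthogonal. -/
structure IsIsotropicLinear {m : X.M} (χ : ∀ x : X.q.Fib m, X.EFib x.1) : Prop where
  linear : ∃ b : X.Core m → ℝ, ∀ x, projB x (χ x) = b
  add : ∀ (x y : X.q.Fib m) (d : X.p₁.Fib x.1) (e : X.p₁.Fib y.1)
    (h : X.p₂.proj d.1 = X.p₂.proj e.1),
    χ (x + y) ⟨X.p₂.add d.1 e.1 h, p₁_add₂ x y d e h⟩ = χ x d + χ y e
  smul : ∀ (r : ℝ) (x : X.q.Fib m) (d : X.p₁.Fib x.1),
    χ (r • x) ⟨X.p₂.smul r d.1, p₁_smul₂ r x d⟩ = r * χ x d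
  isotropic : ∀ (x : X.q.Fib m) (d : X.p₁.Fib x.1), metric x d (χ x) (χ (snd x d)) = 0

/-- The fibre over `m` of the vector bundle whose sections are the isotropic linear sections. -/
def isotropicFib (X : IDVB.{u}) (m : X.M) : Submodule ℝ (∀ x : X.q.Fib m, X.EFib x.1) where
  carrier := {χ | IsIsotropicLinear χ}
  zero_mem' :=
    { linear := ⟨0, fun _ => rfl⟩
      add := fun _ _ _ _ _ => by simp
      smul := fun _ _ _ => by simp
      isotropic := fun _ _ => by simp [metric] }
  add_mem' {χ χ'} h h' :=
    { linear := by
        obtain ⟨b, hb⟩ := h.linear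
        obtain ⟨b', hb'⟩ := h'.linear
        refine ⟨b + b', fun x => ?_⟩
        rw [← hb x, ← hb' x]
        rfl
      add := fun x y d e hh => by
        have h1 := h.add x y d e hh
        have h2 := h'.add x y d e hh
        simp only [Pi.add_apply, LinearMap.add_apply, h1, h2]
        ring
      smul := fun r x d => by
        have h1 := h.smul r x d
        have h2 := h'.smul r x d
        simp only [Pi.add_apply, LinearMap.add_apply, h1, h2]
        ring
      isotropic := fun x d => by
        have h1 := h.isotropic x d
        have h2 := h'.isotropic x d
        simp only [metric] at h1 h2
        simp only [metric, Pi.add_apply, LinearMap.add_apply]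
        linarith }
  smul_mem' c χ h :=
    { linear := by
        obtain ⟨b, hb⟩ := h.linear
        refine ⟨c • b, fun x => ?_⟩
        rw [← hb x]
        rfl
      add := fun x y d e hh => by
        have h1 := h.add x y d e hh
        simp only [Pi.smul_apply, LinearMap.smul_apply, smul_eq_mul, h1]
        ring
      smul := fun r x d => by
        have h1 := h.smul r x d
        simp only [Pi.smul_apply, LinearMap.smul_apply, smul_eq_mul, h1]
        ring
      isotropic := fun x d => by
        have h1 := h.isotropic x d
        simp only [metric] at h1
        simp only [metric, Pi.smul_apply, LinearMap.smul_apply, smul_eq_mul]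
        rw [← mul_add, h1, mul_zero] }

/-- The core-linear section defined by `τ ∧ τ'`:
`d ↦ 1/2 (τ(π₁ d) τ'(π₂ d) - τ'(π₁ d) τ(π₂ d))`. -/
noncomputable def wedgeFun {m : X.M} (τ τ' : Module.Dual ℝ (X.q.Fib m)) (x : X.q.Fib m) :
    X.EFib x.1 :=
  (1 / 2 : ℝ) • (τ x • (τ' ∘ₗ snd x) - τ' x • (τ ∘ₗ snd x))

theorem wedgeFun_apply {m : X.M} (τ τ' : Module.Dual ℝ (X.q.Fib m)) (x : X.q.Fib m)
    (d : X.p₁.Fib x.1) :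
    wedgeFun τ τ' x d = 1 / 2 * (τ x * τ' (snd x d) - τ' x * τ (snd x d)) := by
  simp [wedgeFun]

theorem snd_zeroAdd {m : X.M} (x : X.q.Fib m) (c : X.Core m) : snd x (zeroAdd x c) = 0 := by
  apply Subtype.ext
  change X.p₂.proj (X.p₂.add _ _ (p₂_zero x c)) = X.q.zero m
  rw [X.p₂.proj_add, X.dvb.πB_morphism.map_zero, x.2]

theorem isIsotropicLinear_wedgeFun {m : X.M} (τ τ' : Module.Dual ℝ (X.q.Fib m)) :
    IsIsotropicLinear (wedgeFun τ τ') where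
  linear := ⟨0, fun x => funext fun c => by
    rw [projB, wedgeFun_apply, snd_zeroAdd]
    simp⟩
  add x y d e h := by
    have h1 : snd (x + y) ⟨X.p₂.add d.1 e.1 h, p₁_add₂ x y d e h⟩ = snd x d :=
      Subtype.ext (X.p₂.proj_add _ _ h)
    have h2 : snd y e = snd x d := Subtype.ext h.symm
    rw [wedgeFun_apply, wedgeFun_apply, wedgeFun_apply, h1, h2, _root_.map_add, _root_.map_add]
    ring
  smul r x d := by
    have h1 : snd (r • x) ⟨X.p₂.smul r d.1, p₁_smul₂ r x d⟩ = snd x d :=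
      Subtype.ext (X.p₂.proj_smul _ _)
    rw [wedgeFun_apply, wedgeFun_apply, h1, _root_.map_smul, _root_.map_smul]
    simp only [smul_eq_mul]
    ring
  isotropic x d := by
    have h1 : snd (snd x d) (invFib x d) = x := by
      apply Subtype.ext
      change X.p₂.proj (X.inv d.1) = x.1
      rw [X.p₂_inv, d.2]
    rw [metric, wedgeFun_apply, wedgeFun_apply, h1]
    ring

/-- The core-linear section defined by `τ ∧ τ'`, as an isotropic linear section. -/
noncomputable def wedge {m : X.M} (τ τ' : Module.Dual ℝ (X.q.Fib m)) : X.isotropicFib m :=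
  ⟨wedgeFun τ τ', isIsotropicLinear_wedgeFun τ τ'⟩

theorem wedge_comm {m : X.M} (τ τ' : Module.Dual ℝ (X.q.Fib m)) : wedge τ τ' = -wedge τ' τ := by
  apply Subtype.ext
  funext x
  ext d
  change wedgeFun τ τ' x d = -(wedgeFun τ' τ x d)
  rw [wedgeFun_apply, wedgeFun_apply]
  ring

/-- A smooth section over `U ⊆ M` of `Q^*`; smoothness means that the corresponding fibrewise linear
function on `Q|_U` is smooth. -/
structure DualSection (X : IDVB.{u}) (U : Opens X.M) where
  toFun : ∀ m : U, Module.Dual ℝ (X.q.Fib m.1)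
  smooth : SmoothFun (fun e : preim X.q.smooth_proj U => toFun ⟨X.q.proj e.1, e.2⟩ ⟨e.1, rfl⟩)

/-- An element of `𝒞(𝔼)` over `U ⊆ M`: a smooth linear section `χ` of `𝔼 → Q` over `Q|_U` with
isotropic image.  Smoothness means that the corresponding function `ℓ_χ : d ↦ χ(π₁ d)(d)` on `D|_U`
is smooth. -/
structure IsotropicSection (X : IDVB.{u}) (U : Opens X.M) where
  toFun : ∀ m : U, X.isotropicFib m.1
  smooth : SmoothFun (fun d : preim X.smooth_toBase U =>
    (toFun ⟨X.toBase d.1, d.2⟩).1 ⟨X.p₁.proj d.1, rfl⟩ ⟨d.1, rfl⟩)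

namespace Hom

variable {Y Z : IDVB.{u}}

/-- Pullback of elements of `Q^*`. -/
def dualMap (f : Hom X Y) (m : X.M) :
    Module.Dual ℝ (Y.q.Fib (f.ω₀ m)) →ₗ[ℝ] Module.Dual ℝ (X.q.Fib m) :=
  (f.morphismQ.fibMap m).dualMap

/-- The morphism induced on the core. -/
def coreMap (f : Hom X Y) {m : X.M} (c : X.Core m) : Y.Core (f.ω₀ m) :=
  ⟨f.Ω c.1, by rw [f.morphism₁.comm, c.2.1, f.morphismQ.map_zero],
    by rw [f.morphism₂.comm, c.2.2, f.morphismQ.map_zero]⟩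

/-- The map induced on the fibres of `π₁`. -/
def dFib (f : Hom X Y) {m : X.M} (x : X.q.Fib m) :
    X.p₁.Fib x.1 →ₗ[ℝ] Y.p₁.Fib (f.morphismQ.fibMap m x).1 :=
  f.morphism₁.fibMap x.1

/-- Pullback of isotropic linear sections over a point. -/
def isotropicFun (f : Hom X Y) {m : X.M} (χ : ∀ y : Y.q.Fib (f.ω₀ m), Y.EFib y.1)
    (x : X.q.Fib m) : X.EFib x.1 :=
  (χ (f.morphismQ.fibMap m x)) ∘ₗ f.dFib x

theorem isotropicFun_apply (f : Hom X Y) {m : X.M} (χ : ∀ y : Y.q.Fib (f.ω₀ m), Y.EFib y.1)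
    (x : X.q.Fib m) (d : X.p₁.Fib x.1) (y : Y.q.Fib (f.ω₀ m)) (e : Y.p₁.Fib y.1)
    (h : f.Ω d.1 = e.1) : f.isotropicFun χ x d = χ y e := by
  have hy : f.morphismQ.fibMap m x = y := by
    apply Subtype.ext
    change f.ωQ x.1 = y.1
    rw [← e.2, ← h, f.morphism₁.comm, d.2]
  subst hy
  change χ _ _ = χ _ _
  congr 1
  exact Subtype.ext h

theorem isIsotropicLinear (f : Hom X Y) {m : X.M} {χ : ∀ y : Y.q.Fib (f.ω₀ m), Y.EFib y.1}
    (hχ : IsIsotropicLinear χ) : IsIsotropicLinear (f.isotropicFun χ (m := m)) where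
  linear := by
    obtain ⟨b, hb⟩ := hχ.linear
    refine ⟨fun c => b (f.coreMap c), fun x => funext fun c => ?_⟩
    rw [← hb (f.morphismQ.fibMap m x)]
    refine f.isotropicFun_apply χ x _ _ (zeroAdd (f.morphismQ.fibMap m x) (f.coreMap c)) ?_
    change f.Ω (X.p₂.add _ _ (p₂_zero x c)) =
      Y.p₂.add _ _ (p₂_zero (f.morphismQ.fibMap m x) (f.coreMap c))
    rw [f.morphism₂.map_add]
    simp only [f.morphism₁.map_zero]
    rfl
  add x y d e h := by
    have hh : Y.p₂.proj (f.Ω d.1) = Y.p₂.proj (f.Ω e.1) := by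
      rw [f.morphism₂.comm, f.morphism₂.comm, h]
    have h1 := hχ.add (f.morphismQ.fibMap m x) (f.morphismQ.fibMap m y) (f.dFib x d)
      (f.dFib y e) hh
    refine Eq.trans ?_ h1
    exact f.isotropicFun_apply χ _ _ _ _ (f.morphism₂.map_add _ _ h)
  smul r x d := by
    have h1 := hχ.smul r (f.morphismQ.fibMap m x) (f.dFib x d)
    refine Eq.trans ?_ h1
    exact f.isotropicFun_apply χ _ _ _ _ (f.morphism₂.map_smul _ _)
  isotropic x d := by
    have h1 := hχ.isotropic (f.morphismQ.fibMap m x) (f.dFib x d)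
    refine Eq.trans ?_ h1
    rw [metric, metric]
    refine congrArg₂ (· + ·) rfl ?_
    exact f.isotropicFun_apply χ _ _ _ _ (f.comm_inv d.1)

/-- Pullback of isotropic linear sections over a point, as a linear map. -/
def isotropicMap (f : Hom X Y) (m : X.M) : Y.isotropicFib (f.ω₀ m) →ₗ[ℝ] X.isotropicFib m where
  toFun χ := ⟨f.isotropicFun χ.1, f.isIsotropicLinear χ.2⟩
  map_add' _ _ := rfl
  map_smul' _ _ := rfl

theorem isotropicMap_wedge (f : Hom X Y) (m : X.M) (τ τ' : Module.Dual ℝ (Y.q.Fib (f.ω₀ m))) :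
    f.isotropicMap m (wedge τ τ') = wedge (f.dualMap m τ) (f.dualMap m τ') := by
  apply Subtype.ext
  funext x
  ext d
  change f.isotropicFun (wedgeFun τ τ') x d = wedgeFun (f.dualMap m τ) (f.dualMap m τ') x d
  rw [f.isotropicFun_apply _ x d (f.morphismQ.fibMap m x) (f.dFib x d) rfl,
    wedgeFun_apply, wedgeFun_apply]
  have h : snd (f.morphismQ.fibMap m x) (f.dFib x d) =
      f.morphismQ.fibMap m (snd x d) := Subtype.ext (f.morphism₂.comm d.1)
  rw [h]
  rfl

/-- Pullback of smooth sections of `Q^*`. -/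
def pullDual (f : Hom X Y) {U : Opens Y.M} (τ : Y.DualSection U) :
    X.DualSection (preim f.morphismQ.smooth_base U) where
  toFun m := f.dualMap m.1 (τ.toFun ⟨f.ω₀ m.1, m.2⟩)
  smooth := by
    have h := smoothFun_comp f.morphismQ.smooth (U := preim X.q.smooth_proj
      (preim f.morphismQ.smooth_base U)) (V := preim Y.q.smooth_proj U)
      (fun x hx => by
        change Y.q.proj (f.ωQ x) ∈ U
        rw [f.morphismQ.comm]
        exact hx) τ.smooth
    convert h using 2 with e
    have key : ∀ (m : Y.M) (hm : m ∈ U) (h1 : m = Y.q.proj (f.ωQ e.1))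
        (h2 : Y.q.proj (f.ωQ e.1) ∈ U),
        τ.toFun ⟨m, hm⟩ ⟨f.ωQ e.1, h1.symm⟩ = τ.toFun ⟨_, h2⟩ ⟨f.ωQ e.1, rfl⟩ := by
      rintro m hm rfl h2
      rfl
    exact key _ _ (f.morphismQ.comm e.1).symm _

/-- Pullback of elements of `𝒞(𝔼)`. -/
def pullIsotropic (f : Hom X Y) {U : Opens Y.M} (χ : Y.IsotropicSection U) :
    X.IsotropicSection (preim f.morphismQ.smooth_base U) where
  toFun m := f.isotropicMap m.1 (χ.toFun ⟨f.ω₀ m.1, m.2⟩)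
  smooth := by
    have hb : ∀ d, Y.toBase (f.Ω d) = f.ω₀ (X.toBase d) := fun d => by
      rw [toBase, f.morphism₁.comm, f.morphismQ.comm]
      rfl
    have h := smoothFun_comp f.morphism₁.smooth (U := preim X.smooth_toBase
      (preim f.morphismQ.smooth_base U)) (V := preim Y.smooth_toBase U)
      (fun d hd => by
        change Y.toBase (f.Ω d) ∈ U
        rw [hb]
        exact hd) χ.smooth
    convert h using 2 with d
    have key : ∀ (m : Y.M) (hm : m ∈ U) (x : Y.Q) (h1 : m = Y.toBase (f.Ω d.1))
        (hx : x = Y.p₁.proj (f.Ω d.1)) (h3 : Y.q.proj x = m)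
        (h2 : Y.toBase (f.Ω d.1) ∈ U),
        (χ.toFun ⟨m, hm⟩).1 ⟨x, h3⟩ ⟨f.Ω d.1, hx.symm⟩ =
          (χ.toFun ⟨_, h2⟩).1 ⟨Y.p₁.proj (f.Ω d.1), rfl⟩ ⟨f.Ω d.1, rfl⟩ := by
      rintro m hm x rfl rfl h3 h2
      rfl
    exact key _ _ _ (hb d.1).symm (f.morphism₁.comm d.1).symm _ _

end Hom

end IDVB

/-! ## The functor `ℳ` -/

namespace IDVB

/-- The fibre over `m` of the bundle of graded algebras of `ℳ(X)`. -/
abbrev FibAlg (X : IDVB.{u}) (m : X.M) : Type u :=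
  TwoAlg (V := Module.Dual ℝ (X.q.Fib m)) (W := X.isotropicFib m) wedge

/-- All (set-theoretic) sections over `U` of the bundle of algebras. -/
def Sec (X : IDVB.{u}) (U : Opens X.M) : Type u := ∀ m : U, X.FibAlg m.1

variable {X Y Z : IDVB.{u}}

noncomputable instance (U : Opens X.M) : Ring (X.Sec U) :=
  inferInstanceAs (Ring (∀ m : U, X.FibAlg m.1))

/-- A smooth function as a section. -/
noncomputable def funSec (U : Opens X.M) : Fun X.M U →+* X.Sec U where
  toFun f := fun m => algebraMap ℝ (X.FibAlg m.1) (f m)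
  map_one' := funext fun _ => (algebraMap ℝ _).map_one
  map_mul' _ _ := funext fun _ => (algebraMap ℝ _).map_mul _ _
  map_zero' := funext fun _ => (algebraMap ℝ _).map_zero
  map_add' _ _ := funext fun _ => (algebraMap ℝ _).map_add _ _

noncomputable instance (U : Opens X.M) : Algebra (Fun X.M U) (X.Sec U) :=
  (funSec U).toAlgebra' fun f s =>
    funext fun m => Algebra.commutes (R := ℝ) (A := X.FibAlg m.1) (f m) (s m)

theorem smul_sec {U : Opens X.M} (f : Fun X.M U) (s : X.Sec U) : f • s = funSec U f * s := rfl

/-- Restriction of sections. -/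
def Sec.res {U V : Opens X.M} (h : V ≤ U) (s : X.Sec U) : X.Sec V := fun m => s ⟨m.1, h m.2⟩

/-- A section of `Q^*` as a section of the bundle of algebras. -/
noncomputable def secOfDual {U : Opens X.M} (τ : X.DualSection U) : X.Sec U :=
  fun m => TwoAlg.deg1 _ (τ.toFun m)

/-- An element of `𝒞(𝔼)` as a section of the bundle of algebras. -/
noncomputable def secOfIsotropic {U : Opens X.M} (χ : X.IsotropicSection U) : X.Sec U :=
  fun m => TwoAlg.deg2 _ (χ.toFun m)

/-- Homogeneous polynomials of degree `k`, with smooth functions on `U` as coefficients, in smooth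
sections of `Q^*` over `U` (degree 1) and elements of `𝒞(𝔼)` over `U` (degree 2). -/
inductive IsPoly {U : Opens X.M} : ℕ → X.Sec U → Prop
  | func (f : Fun X.M U) : IsPoly 0 (funSec U f)
  | deg1 (τ : X.DualSection U) : IsPoly 1 (secOfDual τ)
  | deg2 (χ : X.IsotropicSection U) : IsPoly 2 (secOfIsotropic χ)
  | zero (k : ℕ) : IsPoly k 0
  | add {k : ℕ} {s t : X.Sec U} : IsPoly k s → IsPoly k t → IsPoly k (s + t)
  | mul {k l : ℕ} {s t : X.Sec U} : IsPoly k s → IsPoly l t → IsPoly (k + l) (s * t)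

theorem IsPoly.smul {U : Opens X.M} {k : ℕ} {s : X.Sec U} (h : IsPoly k s) (f : Fun X.M U) :
    IsPoly k (f • s) := by
  have := (IsPoly.func f).mul h
  rwa [zero_add] at this

/-- Restriction of sections of `Q^*`. -/
def DualSection.res {U V : Opens X.M} (h : V ≤ U) (τ : X.DualSection U) : X.DualSection V where
  toFun m := τ.toFun ⟨m.1, h m.2⟩
  smooth := smoothFun_comp (F := id) contMDiff_id (U := preim X.q.smooth_proj V)
    (V := preim X.q.smooth_proj U) (fun _ hx => h hx) τ.smooth

/-- Restriction of elements of `𝒞(𝔼)`. -/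
def IsotropicSection.res {U V : Opens X.M} (h : V ≤ U) (χ : X.IsotropicSection U) :
    X.IsotropicSection V where
  toFun m := χ.toFun ⟨m.1, h m.2⟩
  smooth := smoothFun_comp (F := id) contMDiff_id (U := preim X.smooth_toBase V)
    (V := preim X.smooth_toBase U) (fun _ hx => h hx) χ.smooth

theorem IsPoly.res {U V : Opens X.M} (h : V ≤ U) {k : ℕ} {s : X.Sec U} (hs : IsPoly k s) :
    IsPoly k (Sec.res h s) := by
  induction hs with
  | func f => exact IsPoly.func (Fun.res h f)
  | deg1 τ => exact IsPoly.deg1 (τ.res h)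
  | deg2 χ => exact IsPoly.deg2 (χ.res h)
  | zero k => exact IsPoly.zero k
  | add _ _ h1 h2 => exact h1.add h2
  | mul _ _ h1 h2 => exact h1.mul h2

theorem deg1_mul_deg1_comm {m : X.M} (v v' : Module.Dual ℝ (X.q.Fib m)) :
    (TwoAlg.deg1 wedge v * TwoAlg.deg1 wedge v' : X.FibAlg m) =
      -(TwoAlg.deg1 wedge v' * TwoAlg.deg1 wedge v) := by
  rw [TwoAlg.deg1_mul_deg1, TwoAlg.deg1_mul_deg1, wedge_comm]
  exact LinearMap.map_neg (TwoAlg.deg2 (wedge (m := m))) (wedge v' v)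

/-- Graded commutation. -/
def GComm {U : Opens X.M} (i j : ℕ) (s t : X.Sec U) : Prop :=
  s * t = ((-1 : ℤ) ^ (i * j)) • (t * s)

theorem GComm.symm {U : Opens X.M} {i j : ℕ} {s t : X.Sec U} (h : GComm i j s t) :
    GComm j i t s := by
  unfold GComm at *
  rw [h, smul_smul, mul_comm j i, ← mul_pow]
  simp

theorem GComm.zero {U : Opens X.M} {i j : ℕ} {s : X.Sec U} : GComm i j s 0 := by
  simp [GComm]

theorem GComm.add {U : Opens X.M} {i j : ℕ} {s t t' : X.Sec U} (h : GComm i j s t)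
    (h' : GComm i j s t') : GComm i j s (t + t') := by
  unfold GComm at *
  rw [mul_add, add_mul, smul_add, h, h']

theorem GComm.mul {U : Opens X.M} {i j k : ℕ} {s t t' : X.Sec U} (h : GComm i j s t)
    (h' : GComm i k s t') : GComm i (j + k) s (t * t') := by
  unfold GComm at *
  rw [← mul_assoc, h, smul_mul_assoc, mul_assoc, h', mul_smul_comm, smul_smul, mul_assoc, mul_add,
    pow_add]

theorem GComm.func {U : Opens X.M} {i : ℕ} {s : X.Sec U} (f : Fun X.M U) :
    GComm i 0 s (funSec U f) := by
  unfold GComm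
  rw [mul_zero, pow_zero, one_smul]
  exact (Algebra.commutes f s).symm

theorem IsPoly.gcomm {U : Opens X.M} {i j : ℕ} {s t : X.Sec U} (hs : IsPoly i s)
    (ht : IsPoly j t) : GComm i j s t := by
  induction ht with
  | func f => exact GComm.func f
  | zero k => exact GComm.zero
  | add _ _ h1 h2 => exact h1.add h2
  | mul _ _ h1 h2 => exact h1.mul h2
  | deg1 τ =>
    apply GComm.symm
    induction hs with
    | func f => exact GComm.func f
    | zero k => exact GComm.zero
    | add _ _ h1 h2 => exact h1.add h2
    | mul _ _ h1 h2 => exact h1.mul h2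
    | deg1 τ' =>
      unfold GComm
      rw [mul_one, pow_one, neg_smul, one_smul]
      exact funext fun m => deg1_mul_deg1_comm _ _
    | deg2 χ =>
      unfold GComm
      rw [show (-1 : ℤ) ^ (1 * 2) = 1 by norm_num, one_smul]
      exact funext fun m => (TwoAlg.deg2_mul_deg1 _ _ _).symm
  | deg2 χ' =>
    apply GComm.symm
    induction hs with
    | func f => exact GComm.func f
    | zero k => exact GComm.zero
    | add _ _ h1 h2 => exact h1.add h2
    | mul _ _ h1 h2 => exact h1.mul h2
    | deg1 τ =>
      unfold GComm
      rw [show (-1 : ℤ) ^ (2 * 1) = 1 by norm_num, one_smul]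
      exact funext fun m => TwoAlg.deg2_mul_deg1 _ _ _
    | deg2 χ =>
      unfold GComm
      rw [show (-1 : ℤ) ^ (2 * 2) = 1 by norm_num, one_smul]
      exact funext fun m => TwoAlg.deg2_mul_deg2 _ _ _

/-- The functions of degree `k` on `ℳ(X)` over `U`: the sections of the bundle of algebras which
are locally homogeneous polynomials of degree `k` in smooth sections of `Q^*` and elements of
`𝒞(𝔼)`. -/
noncomputable def graded (X : IDVB.{u}) (U : Opens X.M) (k : ℕ) :
    Submodule (Fun X.M U) (X.Sec U) where
  carrier := {s | ∀ m ∈ U, ∃ (V : Opens X.M) (h : V ≤ U), m ∈ V ∧ IsPoly k (Sec.res h s)}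
  zero_mem' := fun m hm => ⟨U, le_rfl, hm, IsPoly.zero k⟩
  add_mem' {s t} hs ht := fun m hm => by
    obtain ⟨V, h, hV, h1⟩ := hs m hm
    obtain ⟨V', h', hV', h1'⟩ := ht m hm
    exact ⟨V ⊓ V', inf_le_left.trans h, ⟨hV, hV'⟩,
      (h1.res (inf_le_left : V ⊓ V' ≤ V)).add (h1'.res (inf_le_right : V ⊓ V' ≤ V'))⟩
  smul_mem' f s hs := fun m hm => by
    obtain ⟨V, h, hV, h1⟩ := hs m hm
    exact ⟨V, h, hV, h1.smul (Fun.res h f)⟩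

theorem IsPoly.mem_graded {U : Opens X.M} {k : ℕ} {s : X.Sec U} (h : IsPoly k s) :
    s ∈ X.graded U k :=
  fun _ hm => ⟨U, le_rfl, hm, h⟩

instance (U : Opens X.M) : SetLike.GradedMonoid (X.graded U) where
  one_mem := by
    have h := (IsPoly.func (X := X) (1 : Fun X.M U)).mem_graded
    rwa [_root_.map_one] at h
  mul_mem {i j s t} hs ht := fun m hm => by
    obtain ⟨V, h, hV, h1⟩ := hs m hm
    obtain ⟨V', h', hV', h1'⟩ := ht m hm
    exact ⟨V ⊓ V', inf_le_left.trans h, ⟨hV, hV'⟩,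
      (h1.res (inf_le_left : V ⊓ V' ≤ V)).mul (h1'.res (inf_le_right : V ⊓ V' ≤ V'))⟩

theorem gcomm_of_mem {U : Opens X.M} {i j : ℕ} {s t : X.Sec U} (hs : s ∈ X.graded U i)
    (ht : t ∈ X.graded U j) : GComm i j s t := by
  refine funext fun m => ?_
  obtain ⟨V, h, hV, h1⟩ := hs m.1 m.2
  obtain ⟨V', h', hV', h1'⟩ := ht m.1 m.2
  exact congrFun ((h1.res (inf_le_left : V ⊓ V' ≤ V)).gcomm
    (h1'.res (inf_le_right : V ⊓ V' ≤ V'))) ⟨m.1, hV, hV'⟩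

theorem of_eq_of {U : Opens X.M} {i j : ℕ} (h : i = j) (a : X.graded U i) (b : X.graded U j)
    (hab : a.1 = b.1) :
    DirectSum.of (fun k => X.graded U k) i a = DirectSum.of (fun k => X.graded U k) j b := by
  subst h
  exact congrArg _ (Subtype.ext hab)

/-- Restriction of functions of degree `k`. -/
noncomputable def gradedRes {U V : Opens X.M} (h : V ≤ U) (k : ℕ) :
    X.graded U k →+ X.graded V k where
  toFun s := ⟨Sec.res h s.1, fun m hm => by
    obtain ⟨W, hW, hm', h1⟩ := s.2 m (h hm)
    exact ⟨W ⊓ V, inf_le_right, ⟨hm', hm⟩, h1.res (inf_le_left : W ⊓ V ≤ W)⟩⟩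
  map_zero' := rfl
  map_add' _ _ := rfl

/-- The object `ℳ(X)`. -/
@[reducible]
noncomputable def toGradedMfd (X : IDVB.{u}) : GradedMfd.{u} where
  base := X.M
  sec U k := X.graded U k
  graded_comm U i j a b := by
    rw [DirectSum.of_mul_of, DirectSum.of_mul_of, ← _root_.map_zsmul]
    exact of_eq_of (add_comm i j) _ _ (gcomm_of_mem a.2 b.2)
  res h k := gradedRes h k
  res_one _ := rfl
  res_mul _ _ _ _ _ := rfl
  res_smul _ _ _ _ := rfl
  res_id _ _ _ := rfl
  res_res _ _ _ _ := rfl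
  sheaf {ι} U k s hs := by
    have key : ∀ i j (m : X.M) (hi : m ∈ U i) (hj : m ∈ U j),
        (s i).1 ⟨m, hi⟩ = (s j).1 ⟨m, hj⟩ := fun i j m hi hj =>
      congrFun (congrArg Subtype.val (hs i j)) ⟨m, hi, hj⟩
    have ex : ∀ m : (⨆ i, U i : Opens X.M), ∃ i, m.1 ∈ U i := fun m => Opens.mem_iSup.mp m.2
    choose c hc using ex
    have hres : ∀ i, Sec.res (le_iSup U i) (fun m => (s (c m)).1 ⟨m.1, hc m⟩) = (s i).1 :=
      fun i => funext fun m => key _ _ _ _ _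
    refine ⟨⟨fun m => (s (c m)).1 ⟨m.1, hc m⟩, fun m hm => ?_⟩, fun i => Subtype.ext (hres i),
      fun t ht => ?_⟩
    · obtain ⟨i, hi⟩ := Opens.mem_iSup.mp hm
      obtain ⟨V, hV, hm', h1⟩ := (s i).2 m hi
      refine ⟨V, hV.trans (le_iSup U i), hm', ?_⟩
      rw [← hres i] at h1
      exact h1
    · apply Subtype.ext
      funext m
      exact congrFun (congrArg Subtype.val (ht (c m))) ⟨m.1, hc m⟩

/-- Pullback of sections along a morphism. -/
noncomputable def Hom.pullAlg (f : Hom X Y) (m : X.M) : Y.FibAlg (f.ω₀ m) →ₐ[ℝ] X.FibAlg m :=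
  TwoAlg.map (f.dualMap m) (f.isotropicMap m) (f.isotropicMap_wedge m)

/-- Pullback of sections along a morphism. -/
noncomputable def Hom.pullSec (f : Hom X Y) {U : Opens Y.M} (s : Y.Sec U) :
    X.Sec (preim f.morphismQ.smooth_base U) :=
  fun m => f.pullAlg m.1 (s ⟨f.ω₀ m.1, m.2⟩)

theorem IsPoly.pull (f : Hom X Y) {U : Opens Y.M} {k : ℕ} {s : Y.Sec U} (hs : IsPoly k s) :
    IsPoly k (f.pullSec s) := by
  induction hs with
  | func g =>
    have h : f.pullSec (funSec U g) = funSec _ (Fun.pullback f.morphismQ.smooth_base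
        (U := preim f.morphismQ.smooth_base U) (fun _ hx => hx) g) :=
      funext fun m => (f.pullAlg m.1).commutes _
    rw [h]
    exact IsPoly.func _
  | deg1 τ =>
    have h : f.pullSec (secOfDual τ) = secOfDual (f.pullDual τ) :=
      funext fun m => TwoAlg.map_deg1 _ _ _ _
    rw [h]
    exact IsPoly.deg1 _
  | deg2 χ =>
    have h : f.pullSec (secOfIsotropic χ) = secOfIsotropic (f.pullIsotropic χ) :=
      funext fun m => TwoAlg.map_deg2 _ _ _ _
    rw [h]
    exact IsPoly.deg2 _
  | zero k =>
    have h : f.pullSec (0 : Y.Sec U) = 0 := funext fun m => (f.pullAlg m.1).map_zero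
    rw [h]
    exact IsPoly.zero k
  | @add k s t _ _ h1 h2 =>
    have h : f.pullSec (s + t) = f.pullSec s + f.pullSec t :=
      funext fun m => (f.pullAlg m.1).map_add _ _
    rw [h]
    exact h1.add h2
  | @mul k l s t _ _ h1 h2 =>
    have h : f.pullSec (s * t) = f.pullSec s * f.pullSec t :=
      funext fun m => (f.pullAlg m.1).map_mul _ _
    rw [h]
    exact h1.mul h2

/-- The morphism `ℳ(f)`: pullback of functions along `f`. -/
noncomputable def Hom.toGradedMfd (f : Hom X Y) : GradedMfd.Hom X.toGradedMfd Y.toGradedMfd where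
  base := f.ω₀
  smooth := f.morphismQ.smooth_base
  app U k :=
    { toFun := fun s => ⟨f.pullSec s.1, fun m hm => by
        obtain ⟨W, hW, hm', h1⟩ := s.2 (f.ω₀ m) hm
        exact ⟨preim f.morphismQ.smooth_base W, fun _ hx => hW hx, hm', h1.pull f⟩⟩
      map_zero' := Subtype.ext (funext fun m => (f.pullAlg m.1).map_zero)
      map_add' := fun _ _ => Subtype.ext (funext fun m => (f.pullAlg m.1).map_add _ _) }
  app_one U := Subtype.ext (funext fun m => (f.pullAlg m.1).map_one)
  app_mul U i j a b := Subtype.ext (funext fun m => (f.pullAlg m.1).map_mul _ _)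
  app_smul U k g a := Subtype.ext (funext fun m => by
    refine ((f.pullAlg m.1).map_mul _ _).trans ?_
    exact congrArg₂ (· * ·) ((f.pullAlg m.1).commutes _) rfl)
  app_res _ _ _ := rfl

theorem Hom.pullAlg_id (X : IDVB.{u}) (m : X.M) (a : X.FibAlg m) :
    Hom.pullAlg (𝟙 X : X ⟶ X) m a = a :=
  TwoAlg.map_id_apply _ _ _ (fun _ => rfl) (fun _ => rfl) a

theorem Hom.pullAlg_comp (f : X ⟶ Y) (g : Y ⟶ Z) (m : X.M) (a : Z.FibAlg (g.ω₀ (f.ω₀ m))) :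
    Hom.pullAlg (f ≫ g) m a = Hom.pullAlg f m (Hom.pullAlg g (f.ω₀ m) a) :=
  TwoAlg.map_map _ _ _ _ _ _ _ _ _ (fun _ => rfl) (fun _ => rfl) a

/-- The functor `ℳ`, with values in manifolds with a sheaf of graded commutative algebras. -/
@[reducible]
noncomputable def functions : IDVB.{u} ⥤ GradedMfd.{u} where
  obj := toGradedMfd
  map f := Hom.toGradedMfd f
  map_id X := by
    refine GradedMfd.Hom.ext rfl (heq_of_eq ?_)
    funext U k
    refine AddMonoidHom.ext fun (s : X.graded U k) => Subtype.ext (funext fun m => ?_)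
    exact Hom.pullAlg_id X m.1 (s.1 m)
  map_comp {X Y Z} f g := by
    refine GradedMfd.Hom.ext rfl (heq_of_eq ?_)
    funext U k
    refine AddMonoidHom.ext fun (s : Z.graded U k) => Subtype.ext (funext fun m => ?_)
    exact Hom.pullAlg_comp f g m.1 (s.1 ⟨_, m.2⟩)

/-- The canonical map `Γ_U(Q^*) → C^∞_U(ℳ(X))^1`. -/
noncomputable def ofDual (X : IDVB.{u}) {U : Opens X.M} (τ : X.DualSection U) :
    X.toGradedMfd.sec U 1 :=
  ⟨secOfDual τ, (IsPoly.deg1 τ).mem_graded⟩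

/-- The canonical map `𝒞_U(𝔼) → C^∞_U(ℳ(X))^2`. -/
noncomputable def ofIsotropic (X : IDVB.{u}) {U : Opens X.M} (χ : X.IsotropicSection U) :
    X.toGradedMfd.sec U 2 :=
  ⟨secOfIsotropic χ, (IsPoly.deg2 χ).mem_graded⟩

/-- The functor `ℳ : IDVB ⥤ [2]-Man`, given that its values are `[2]`-manifolds. -/
noncomputable abbrev functorM (h : ∀ X : IDVB.{u}, IsTwoManifold (functions.obj X)) :
    IDVB.{u} ⥤ TwoMan.{u} :=
  IsTwoManifold.lift functions h

end IDVB

/-! ## The geometrisation of a `[2]`-manifold -/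

/-- `X`, with the isomorphism `e` from `ℳ(X)` to `N`, is the geometrisation `𝒢(N)` of the
`[2]`-manifold `N`: free generators `ξ` (degree 1) and `η` (degree 2) of `N` over an open set `U` are
coordinates of `X` over `U`.  Explicitly, `e` identifies the `ξ i` with smooth sections `τ i` of
`Q^*` and the `η j` with isotropic linear sections `χ j`, and
`d ↦ (m, τ(π₁ d), τ(π₂ d), χ(π₁ d)(d))`, where `m` corresponds to the base point of `d`, is a
diffeomorphism `D|_U → U × ℝ^{r₁} × ℝ^{r₁} × ℝ^{r₂}`, with inverse `Ψ`: a double vector bundle chart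
in which the involution is `(m, a, b, c) ↦ (m, b, a, -c)`.  The changes of charts are
the changes of generators. -/
def IsGeometrization (N : GradedMfd.{u}) (X : IDVB.{u}) 
    (e : GradedMfd.Hom X.toGradedMfd N) : Prop :=
  ∀ (U : Opens N.base) (r₁ r₂ : ℕ) (ξ : Fin r₁ → N.sec U 1) (η : Fin r₂ → N.sec U 2),
    N.IsFreelyGenerated U ξ η →
    ∃ (τ : Fin r₁ → X.DualSection (preim e.smooth U))
      (χ : Fin r₂ → X.IsotropicSection (preim e.smooth U))
      (Ψ : N.base × EuclideanSpace ℝ (Fin r₁) × EuclideanSpace ℝ (Fin r₁) ×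
        EuclideanSpace ℝ (Fin r₂) → X.D),
      (∀ i, e.app U 1 (ξ i) = X.ofDual (τ i)) ∧
      (∀ j, e.app U 2 (η j) = X.ofIsotropic (χ j)) ∧
      ContMDiffOn ((𝓡 N.base.dim).prod ((𝓡 r₁).prod ((𝓡 r₁).prod (𝓡 r₂)))) (𝓡 X.D.dim) ∞ Ψ
        ((U : Set N.base) ×ˢ Set.univ) ∧
      ∀ m ∈ U, ∀ a b c, ∀ d : X.D, d = Ψ (m, a, b, c) ↔
        ∃ h : e.base (X.toBase d) ∈ U, e.base (X.toBase d) = m ∧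
          (∀ i, (τ i).toFun ⟨X.toBase d, h⟩ ⟨X.p₁.proj d, rfl⟩ = a i) ∧
          (∀ i, (τ i).toFun ⟨X.toBase d, h⟩ ⟨X.p₂.proj d, X.proj_p₂ d⟩ = b i) ∧
          (∀ j, ((χ j).toFun ⟨X.toBase d, h⟩).1 ⟨X.p₁.proj d, rfl⟩ ⟨d, rfl⟩ = c j)

end GradedGeometry

open GradedGeometry

/-!
# Involutive double vector bundles and `[2]`-manifolds

The quasi-inverse of `ℳ` sends a graded manifold `N` to its space of points. A point over `m`
(`GradedMfd.DPt`) consists of two linear functionals `φ₁`, `φ₂` on the germs at `m` of functions of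
degree 1 and one functional `ψ` on the germs of functions of degree 2, all linear over evaluation
of smooth functions at `m`, with `ψ (a b) = ½ (φ₁ a · φ₂ b - φ₁ b · φ₂ a)`. Since functions of
degree 2 are generated by the `η_j` and the products `ξ_i ξ_k`, the values of `φ₁`, `φ₂` on `ξ_i`
and of `ψ` on `η_j` can be prescribed freely and determine the point (`DPt.exists_of_free`): free
generators are coordinates. For fixed `φ₁` the condition is linear in `(φ₂, ψ)`, for fixed `φ₂` it
is linear in `(φ₁, ψ)`, and `(φ₁, φ₂, ψ) ↦ (φ₂, φ₁, -ψ)` preserves it. This makes the points an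
involutive double vector bundle, `LocalGenerators.toIDVB`, whose base `Q` is the dual of the bundle
of functions of degree 1.

For an involutive double vector bundle `X`, sections `τ_i` of `Q^*` and `χ_j` of `𝒞(𝔼)` which are
coordinates on the part of `D` over an open set are called a frame (`IDVB.IsFrame`). Frames exist
locally (`exists_frame`): the fibre coordinates of a local trivialisation of `π₁` are linear along
`π₁`; their derivative at zero in the fibre direction of `π₂` (`linearize`) is doubly linear and
has the same values on the core, and a linear map applied to its skew part under the involution
gives `χ_j` which are coordinates on the core. Expanding doubly linear functions in the coordinates
of a frame shows that the frame generates the functions; that the monomials are independent is seen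
by mapping the fibre algebras to free models. Hence `ℳ(X)` is a `[2]`-manifold (`isTwoManifold`),
and sections of `Q^*` and of `𝒞(𝔼)` are the functions of degree 1 and 2 (`bijective_ofDual`,
`bijective_ofIsotropic`).

An element of `D` evaluates functions of degree 1 at its two projections and functions of degree 2
at itself, which is a point of `ℳ(X)`. As a frame gives coordinates on both sides, `D` is the space
of points of `ℳ(X)` (`injective_toTD`, `surjective_toTD`), naturally in `X`. So a morphism of
involutive double vector bundles is determined by the induced morphism of functions, and a morphism
of functions induces a map of points which is smooth and linear, again by testing on frames:
`ℳ` is faithful (`Hom.toGradedMfd_injective`) and full (`toGradedMfd_realize`). It is essentially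
surjective, since the functions on the double vector bundle of points of `N` are those of `N`
(`isIso_toHom`).

The functor `𝒢` and the isomorphisms `η`, `ε` are those of the resulting adjoint equivalence. The
statement about charts holds for every isomorphism `ℳ(X) ≅ N`, whatever the construction of `X`:
free generators of `N` correspond to a frame of `X` (`isFrame_of_iso`, `isGeometrization`).
-/

namespace GradedGeometry

/-! ### Monomials in anticommuting and central elements -/

section Monomials

variable {A B : Type*} [Ring A] [Ring B] {r₁ r₂ : ℕ}

/-- The monomial `ξ_I η^α` in a ring, with the factors `ξ_i` in increasing order. -/
def mono (ξ : Fin r₁ → A) (η : Fin r₂ → A) (p : Finset (Fin r₁) × (Fin r₂ → ℕ)) : A :=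
  ((p.1.sort (· ≤ ·)).map ξ).prod * ((List.finRange r₂).map fun j => η j ^ p.2 j).prod

/-- The degree of the monomial `ξ_I η^α`, for `ξ_i` of degree 1 and `η_j` of degree 2. -/
def monoDeg (p : Finset (Fin r₁) × (Fin r₂ → ℕ)) : ℕ := p.1.card + 2 * ∑ j, p.2 j

/-- The relations of free graded commutative generators: the `ξ_i` anticommute and have square
zero, the `η_j` commute with all the generators. -/
structure SuperCommute (ξ : Fin r₁ → A) (η : Fin r₂ → A) : Prop where
  anti : ∀ i j, ξ i * ξ j = -(ξ j * ξ i)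
  sq : ∀ i, ξ i * ξ i = 0
  comm : ∀ j i, Commute (η j) (ξ i)
  comm' : ∀ j k, Commute (η j) (η k)

theorem map_mono (f : A →+* B) (ξ : Fin r₁ → A) (η : Fin r₂ → A)
    (p : Finset (Fin r₁) × (Fin r₂ → ℕ)) :
    f (mono ξ η p) = mono (fun i => f (ξ i)) (fun j => f (η j)) p := by
  simp [mono, map_list_prod, List.map_map, Function.comp_def]

theorem mono_prod (ξ : Fin r₁ → A) (η : Fin r₂ → A) (ξ' : Fin r₁ → B) (η' : Fin r₂ → B)
    (p : Finset (Fin r₁) × (Fin r₂ → ℕ)) :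
    mono (fun i => (ξ i, ξ' i)) (fun j => (η j, η' j)) p = (mono ξ η p, mono ξ' η' p) :=
  Prod.ext (map_mono (RingHom.fst A B) _ _ p) (map_mono (RingHom.snd A B) _ _ p)

theorem mono_one (ξ : Fin r₁ → A) (η : Fin r₂ → A) : mono ξ η (∅, 0) = 1 := by
  simp [mono, List.map_const']

theorem mono_single_left (ξ : Fin r₁ → A) (η : Fin r₂ → A) (i : Fin r₁) :
    mono ξ η ({i}, 0) = ξ i := by
  simp [mono, List.map_const']

/-- The monomial of the exponents `Pi.single j 1` in central variables is the `j`-th variable. -/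
theorem prod_pow_single (η : Fin r₂ → A) (j : Fin r₂) :
    ((List.finRange r₂).map fun k => η k ^ (Pi.single j 1 : Fin r₂ → ℕ) k).prod = η j := by
  have : (fun k => η k ^ (Pi.single j 1 : Fin r₂ → ℕ) k) =
      fun k => if k = j then η j else 1 := by
    funext k
    by_cases h : k = j
    · subst h; simp
    · simp [h]
  rw [this]
  have key : ∀ l : List (Fin r₂), l.Nodup →
      (l.map fun k => if k = j then η j else 1).prod = if j ∈ l then η j else 1 := by
    intro l hl
    induction l with
    | nil => simp
    | cons x l ih =>
      rw [List.map_cons, List.prod_cons, ih (List.nodup_cons.mp hl).2]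
      by_cases h : x = j
      · subst h
        simp [(List.nodup_cons.mp hl).1]
      · simp [h, Ne.symm h]
  rw [key _ (List.nodup_finRange r₂)]
  simp

theorem mono_single_right (ξ : Fin r₁ → A) (η : Fin r₂ → A) (j : Fin r₂) :
    mono ξ η (∅, Pi.single j 1) = η j := by
  rw [mono, prod_pow_single]
  simp

theorem mono_pair (ξ : Fin r₁ → A) (η : Fin r₂ → A) {i k : Fin r₁} (h : i < k) :
    mono ξ η ({i, k}, 0) = ξ i * ξ k := by
  have h1 : ({i, k} : Finset (Fin r₁)).sort (· ≤ ·) = [i, k] := by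
    rw [Finset.sort_insert]
    · simp
    · intro b hb
      rw [Finset.mem_singleton.mp hb]
      exact h.le
    · simpa using h.ne
  simp [mono, h1, List.map_const']

/-- Reordering a product of anticommuting elements changes it at most by a sign. -/
theorem list_prod_perm {ξ : Fin r₁ → A} (anti : ∀ i j, ξ i * ξ j = -(ξ j * ξ i))
    {l l' : List (Fin r₁)} (h : l.Perm l') :
    (l.map ξ).prod = (l'.map ξ).prod ∨ (l.map ξ).prod = -(l'.map ξ).prod := by
  induction h with
  | nil => exact Or.inl rfl
  | cons x _ ih => rcases ih with h | h <;> simp [h]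
  | swap x y l =>
    right
    simp only [List.map_cons, List.prod_cons]
    rw [← mul_assoc, anti y x, neg_mul, mul_assoc]
  | trans _ _ h1 h2 =>
    rcases h1 with h | h <;> rcases h2 with h' | h' <;> simp [h, h']

/-- A product of `ξ`s in any order is, up to sign, a sorted product or zero. -/
theorem list_prod_sort {ξ : Fin r₁ → A} (anti : ∀ i j, ξ i * ξ j = -(ξ j * ξ i))
    (sq : ∀ i, ξ i * ξ i = 0) (l : List (Fin r₁)) :
    (l.map ξ).prod = 0 ∨ ∃ I : Finset (Fin r₁), I.card = l.length ∧
      ((l.map ξ).prod = ((I.sort (· ≤ ·)).map ξ).prod ∨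
        (l.map ξ).prod = -((I.sort (· ≤ ·)).map ξ).prod) := by
  by_cases hl : l.Nodup
  · right
    refine ⟨l.toFinset, List.toFinset_card_of_nodup hl, list_prod_perm anti ?_⟩
    exact ((Finset.sort_perm_toList _ _).trans (List.toFinset_toList hl)).symm
  · left
    obtain ⟨x, hx⟩ := List.exists_duplicate_iff_not_nodup.mpr hl
    obtain ⟨t, ht⟩ := (List.duplicate_iff_sublist.mp hx).exists_perm_append
    have := list_prod_perm anti ht
    have h0 : ((([x, x] : List (Fin r₁)) ++ t).map ξ).prod = 0 := by
      simp only [List.cons_append, List.nil_append, List.map_cons, List.prod_cons]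
      rw [← mul_assoc, sq, zero_mul]
    rcases this with h | h <;> rw [h, h0]
    exact neg_zero

theorem prod_pow_mul {η : Fin r₂ → A} (comm' : ∀ j k, Commute (η j) (η k)) (α β : Fin r₂ → ℕ)
    (l : List (Fin r₂)) :
    (l.map fun j => η j ^ α j).prod * (l.map fun j => η j ^ β j).prod =
      (l.map fun j => η j ^ (α j + β j)).prod := by
  induction l with
  | nil => simp
  | cons x l ih =>
    have hc : Commute (l.map fun j => η j ^ α j).prod (η x ^ β x) := by
      refine Commute.list_prod_left _ _ fun y hy => ?_
      obtain ⟨k, _, rfl⟩ := List.mem_map.mp hy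
      exact (comm' k x).pow_pow _ _
    simp only [List.map_cons, List.prod_cons]
    rw [mul_assoc, ← mul_assoc _ (η x ^ β x), hc.eq, pow_add, ← ih]
    simp only [mul_assoc]

/-- The product of two monomials is zero or, up to sign, again a monomial. Which of these happens
is not tracked: applied in a product ring, the same disjunct holds for both factors, and this is
all that `exists_extension` needs. -/
theorem SuperCommute.mono_mul {ξ : Fin r₁ → A} {η : Fin r₂ → A} (h : SuperCommute ξ η)
    (p q : Finset (Fin r₁) × (Fin r₂ → ℕ)) :
    mono ξ η p * mono ξ η q = 0 ∨
      ∃ p', monoDeg p' = monoDeg p + monoDeg q ∧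
        (mono ξ η p * mono ξ η q = mono ξ η p' ∨ mono ξ η p * mono ξ η q = -mono ξ η p') := by
  have hc : Commute ((List.finRange r₂).map fun j => η j ^ p.2 j).prod
      ((q.1.sort (· ≤ ·)).map ξ).prod := by
    refine Commute.list_prod_left _ _ fun y hy => Commute.list_prod_right _ _ fun z hz => ?_
    obtain ⟨k, _, rfl⟩ := List.mem_map.mp hy
    obtain ⟨i, _, rfl⟩ := List.mem_map.mp hz
    exact (h.comm k i).pow_left _
  have e : mono ξ η p * mono ξ η q =
      ((p.1.sort (· ≤ ·) ++ q.1.sort (· ≤ ·)).map ξ).prod *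
        ((List.finRange r₂).map fun j => η j ^ (p.2 j + q.2 j)).prod := by
    rw [← prod_pow_mul h.comm', List.map_append, List.prod_append, mono, mono, mul_assoc,
      ← mul_assoc _ _ ((List.finRange r₂).map fun j => η j ^ q.2 j).prod, hc.eq]
    simp only [mul_assoc]
  rcases list_prod_sort h.anti h.sq (p.1.sort (· ≤ ·) ++ q.1.sort (· ≤ ·)) with h0 | ⟨I, hI, h1⟩
  · left
    rw [e, h0, zero_mul]
  · right
    refine ⟨(I, p.2 + q.2), ?_, ?_⟩
    · simp only [monoDeg, hI, List.length_append, Finset.length_sort, Pi.add_apply,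
        Finset.sum_add_distrib]
      ring
    · rw [e]
      rcases h1 with h1 | h1
      · left; rw [h1]; rfl
      · right; rw [h1, neg_mul]; rfl

/-- A graded commutative algebra with a basis of monomials in `ξ` and `η` is free: there is a ring
homomorphism, semilinear over `ev`, with prescribed values on the generators, provided that these
values satisfy the same commutation relations. -/
theorem exists_extension {R : Type*} [CommRing R] [Algebra R A] [Algebra ℝ B] (ev : R →+* ℝ)
    {ξ : Fin r₁ → A} {η : Fin r₂ → A} (hA : SuperCommute ξ η)
    (hli : LinearIndependent R (mono ξ η))
    (hsp : Submodule.span R (Set.range (mono ξ η)) = ⊤)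
    {ξ' : Fin r₁ → B} {η' : Fin r₂ → B} (hB : SuperCommute ξ' η') :
    ∃ T : A →+* B, (∀ (r : R) a, T (r • a) = ev r • T a) ∧ (∀ i, T (ξ i) = ξ' i) ∧
      ∀ j, T (η j) = η' j := by
  classical
  let b := Module.Basis.mk hli hsp.ge
  have hb : ∀ p, b p = mono ξ η p := fun p => by simp [b]
  let T : A → B := fun a => (b.repr a).sum fun p r => ev r • mono ξ' η' p
  have hadd : ∀ a a', T (a + a') = T a + T a' := fun a a' => by
    simp only [T, _root_.map_add]
    exact Finsupp.sum_add_index' (by simp) (by simp [add_smul])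
  have hsmul : ∀ (r : R) a, T (r • a) = ev r • T a := fun r a => by
    simp only [T, _root_.map_smul]
    rw [Finsupp.sum_smul_index' (by simp), Finsupp.smul_sum]
    simp [mul_smul]
  have hmono : ∀ p, T (mono ξ η p) = mono ξ' η' p := fun p => by
    simp only [T, ← hb p, Module.Basis.repr_self]
    rw [Finsupp.sum_single_index (by simp)]
    simp
  have hzero : T 0 = 0 := by simp [T]
  have hneg : ∀ a, T (-a) = -T a := fun a => by
    have := hadd a (-a)
    rw [add_neg_cancel, hzero] at this
    exact eq_neg_of_add_eq_zero_right this.symm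
  -- the same signs occur in `A` and in `B`, because they occur in `A × B`
  have hAB : SuperCommute (fun i => (ξ i, ξ' i)) (fun j => (η j, η' j)) :=
    ⟨fun i j => Prod.ext (hA.anti i j) (hB.anti i j), fun i => Prod.ext (hA.sq i) (hB.sq i),
      fun j i => Prod.ext (hA.comm j i) (hB.comm j i),
      fun j k => Prod.ext (hA.comm' j k) (hB.comm' j k)⟩
  have hmm : ∀ p q, T (mono ξ η p * mono ξ η q) = mono ξ' η' p * mono ξ' η' q := fun p q => by
    have := hAB.mono_mul p q
    simp only [mono_prod, Prod.mk_mul_mk, Prod.neg_mk, Prod.mk.injEq, Prod.mk_eq_zero] at this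
    rcases this with h | ⟨p', -, h | h⟩
    · rw [h.1, h.2, hzero]
    · rw [h.1, h.2, hmono]
    · rw [h.1, h.2, hneg, hmono]
  have hmul : ∀ a a', T (a * a') = T a * T a' := by
    have hspan : ∀ a, a ∈ Submodule.span R (Set.range (mono ξ η)) := fun a => hsp ▸ trivial
    intro a a'
    induction hspan a using Submodule.span_induction with
    | mem x hx =>
      obtain ⟨p, rfl⟩ := hx
      induction hspan a' using Submodule.span_induction with
      | mem y hy =>
        obtain ⟨q, rfl⟩ := hy
        rw [hmm, hmono, hmono]
      | zero => rw [mul_zero, hzero, mul_zero]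
      | add y z _ _ h1 h2 => rw [mul_add, hadd, hadd, h1, h2, mul_add]
      | smul r y _ h1 => rw [mul_smul_comm, hsmul, hsmul, h1, mul_smul_comm]
    | zero => rw [zero_mul, hzero, zero_mul]
    | add y z _ _ h1 h2 => rw [add_mul, hadd, hadd, h1, h2, add_mul]
    | smul r y _ h1 => rw [smul_mul_assoc, hsmul, hsmul, h1, smul_mul_assoc]
  refine ⟨{ toFun := T, map_one' := ?_, map_mul' := hmul, map_zero' := hzero, map_add' := hadd },
    hsmul, fun i => ?_, fun j => ?_⟩
  · rw [← mono_one ξ η, hmono, mono_one]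
  · have := hmono ({i}, 0)
    rwa [mono_single_left, mono_single_left] at this
  · have := hmono (∅, Pi.single j 1)
    rwa [mono_single_right, mono_single_right] at this

/-- The exterior algebra on `r₁` generators over the polynomial ring in `r₂` variables: a concrete
algebra in which the monomials are visibly independent. -/
abbrev ModelAlg (r₁ r₂ : ℕ) : Type :=
  ExteriorAlgebra (MvPolynomial (Fin r₂) ℝ) (Fin r₁ → MvPolynomial (Fin r₂) ℝ)

/-- The generators of degree 1. -/
noncomputable def modelθ (r₁ r₂ : ℕ) (i : Fin r₁) : ModelAlg r₁ r₂ :=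
  ExteriorAlgebra.ι (MvPolynomial (Fin r₂) ℝ) (Pi.single i 1)

/-- The generators of degree 2. -/
noncomputable def modelY (r₁ r₂ : ℕ) (j : Fin r₂) : ModelAlg r₁ r₂ :=
  algebraMap (MvPolynomial (Fin r₂) ℝ) _ (MvPolynomial.X j)

theorem superCommute_model (r₁ r₂ : ℕ) : SuperCommute (modelθ r₁ r₂) (modelY r₁ r₂) where
  anti _ _ := eq_neg_of_add_eq_zero_left (ExteriorAlgebra.ι_add_mul_swap _ _)
  sq _ := ExteriorAlgebra.ι_sq_zero _
  comm _ _ := Algebra.commutes _ _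
  comm' _ _ := Algebra.commutes _ _

/-- The monomials of the model algebra are products of the standard bases. -/
theorem mono_model (r₁ r₂ : ℕ) (p : Finset (Fin r₁) × (Fin r₂ → ℕ)) :
    mono (modelθ r₁ r₂) (modelY r₁ r₂) p =
      MvPolynomial.basisMonomials (Fin r₂) ℝ (Finsupp.equivFunOnFinite.symm p.2) •
        (Pi.basisFun (MvPolynomial (Fin r₂) ℝ) (Fin r₁)).ExteriorAlgebra p.1 := by
  have h1 : ((p.1.sort (· ≤ ·)).map (modelθ r₁ r₂)).prod =
      (Pi.basisFun (MvPolynomial (Fin r₂) ℝ) (Fin r₁)).ExteriorAlgebra p.1 := by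
    rw [ExteriorAlgebra.basis_apply_ofCard _ rfl, ExteriorAlgebra.ιMulti_family,
      ExteriorAlgebra.ιMulti_apply]
    congr 1
    refine List.ext_getElem (by simp) fun n h2 h3 => ?_
    simp [modelθ, Set.powersetCard.ofFinEmbEquiv_symm_apply, Finset.orderEmbOfFin_apply]
  have h2 : ((List.finRange r₂).map fun j => modelY r₁ r₂ j ^ p.2 j).prod =
      algebraMap (MvPolynomial (Fin r₂) ℝ) _
        (MvPolynomial.basisMonomials (Fin r₂) ℝ (Finsupp.equivFunOnFinite.symm p.2)) := by
    rw [MvPolynomial.coe_basisMonomials]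
    beta_reduce
    rw [MvPolynomial.monomial_eq, _root_.map_mul]
    simp [modelY, Finsupp.prod_fintype, ← List.ofFn_eq_map]
    rw [← List.prod_ofFn, map_list_prod, List.map_ofFn]
    simp [Function.comp_def]
  rw [mono, h1, h2, ← Algebra.commutes, ← Algebra.smul_def]

theorem linearIndependent_model (r₁ r₂ : ℕ) :
    LinearIndependent ℝ (mono (modelθ r₁ r₂) (modelY r₁ r₂)) := by
  let b := (MvPolynomial.basisMonomials (Fin r₂) ℝ).smulTower
    (Pi.basisFun (MvPolynomial (Fin r₂) ℝ) (Fin r₁)).ExteriorAlgebra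
  have h := b.linearIndependent.comp
    (fun p : Finset (Fin r₁) × (Fin r₂ → ℕ) => (Finsupp.equivFunOnFinite.symm p.2, p.1))
    (fun p q h => by
      simp only [Prod.mk.injEq, EmbeddingLike.apply_eq_iff_eq] at h
      exact Prod.ext h.2 h.1)
  have e : mono (modelθ r₁ r₂) (modelY r₁ r₂) =
      b ∘ fun p => (Finsupp.equivFunOnFinite.symm p.2, p.1) := by
    funext p
    simp [b, mono_model, Module.Basis.smulTower_apply]
  rw [e]
  exact h

end Monomials

/-! ### Vector bundles -/

namespace VBundle

variable {E B : Mfd.{u}} (π : VBundle E B)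

theorem add_zero' (e : E) (h : π.proj e = π.proj (π.zero (π.proj e))) :
    π.add e (π.zero (π.proj e)) h = e :=
  (π.add_coe (⟨e, rfl⟩ : π.Fib (π.proj e)) 0).trans (congrArg Subtype.val (_root_.add_zero _))

theorem zero_smul' (e : E) : π.smul 0 e = π.zero (π.proj e) :=
  congrArg Subtype.val (_root_.zero_smul ℝ (⟨e, rfl⟩ : π.Fib (π.proj e)))

theorem one_smul' (e : E) : π.smul 1 e = e :=
  congrArg Subtype.val (_root_.one_smul ℝ (⟨e, rfl⟩ : π.Fib (π.proj e)))

theorem smul_smul' (r s : ℝ) (e : E) : π.smul r (π.smul s e) = π.smul (r * s) e :=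
  (π.smul_coe r (s • ⟨e, rfl⟩ : π.Fib (π.proj e))).trans
    (congrArg Subtype.val (_root_.smul_smul r s _))

theorem add_smul' (r s : ℝ) (e : E) (h : π.proj (π.smul r e) = π.proj (π.smul s e)) :
    π.smul (r + s) e = π.add (π.smul r e) (π.smul s e) h :=
  (congrArg Subtype.val (_root_.add_smul r s (⟨e, rfl⟩ : π.Fib (π.proj e)))).trans
    (π.add_coe _ _).symm

theorem add_comm' (e e' : E) (h : π.proj e = π.proj e') :
    π.add e e' h = π.add e' e h.symm :=
  ((congrArg Subtype.val (_root_.add_comm (⟨e, rfl⟩ : π.Fib (π.proj e)) ⟨e', h.symm⟩))).trans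
    (π.add_coe (⟨e', h.symm⟩ : π.Fib (π.proj e)) ⟨e, rfl⟩).symm

theorem eq_zero_of_add_self (e : E) (h : π.add e e rfl = e) : e = π.zero (π.proj e) :=
  congrArg Subtype.val (add_eq_left.mp
    (Subtype.ext h : (⟨e, rfl⟩ : π.Fib (π.proj e)) + ⟨e, rfl⟩ = ⟨e, rfl⟩))

theorem add_neg' (e : E) (h : π.proj e = π.proj (π.smul (-1) e)) :
    π.add e (π.smul (-1) e) h = π.zero (π.proj e) :=
  (π.add_coe (⟨e, rfl⟩ : π.Fib (π.proj e)) ((-1 : ℝ) • ⟨e, rfl⟩)).trans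
    (congrArg Subtype.val (by rw [neg_one_smul, add_neg_cancel]))

/-- A local trivialisation of a vector bundle, bundled: the fibre coordinate `Θ` over `U` and the
inverse `Ψ` of the chart `(proj, Θ)`. Nothing is said about `Θ` and `Ψ` outside `U`. -/
structure LocalTriv where
  U : Opens B
  Θ : E → EuclideanSpace ℝ (Fin π.rank)
  Ψ : B × EuclideanSpace ℝ (Fin π.rank) → E
  smooth_Θ : ContMDiffOn (𝓡 E.dim) (𝓡 π.rank) ∞ Θ (π.proj ⁻¹' U)
  smooth_Ψ : ContMDiffOn ((𝓡 B.dim).prod (𝓡 π.rank)) (𝓡 E.dim) ∞ Ψ ((U : Set B) ×ˢ Set.univ)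
  proj_Ψ : ∀ b ∈ U, ∀ v, π.proj (Ψ (b, v)) = b
  Θ_Ψ : ∀ b ∈ U, ∀ v, Θ (Ψ (b, v)) = v
  Ψ_Θ : ∀ e, π.proj e ∈ U → Ψ (π.proj e, Θ e) = e
  linear : ∀ b ∈ U, IsLinearMap ℝ (fun x : π.Fib b => Θ x.1)

theorem exists_localTriv (b₀ : B) : ∃ T : π.LocalTriv, b₀ ∈ T.U := by
  obtain ⟨U, hU, Θ, Ψ, h1, h2, h3, h4, h5⟩ := π.locally_trivial b₀
  exact ⟨⟨U, Θ, Ψ, h1, h2, fun b hb v => (h3 b hb v).1, fun b hb v => (h3 b hb v).2, h4, h5⟩, hU⟩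

variable {π}

namespace LocalTriv

variable (T : π.LocalTriv)

theorem Θ_smoothAt {e : E} (h : π.proj e ∈ T.U) : ContMDiffAt (𝓡 E.dim) (𝓡 π.rank) ∞ T.Θ e :=
  T.smooth_Θ.contMDiffAt ((T.U.2.preimage π.smooth_proj.continuous).mem_nhds h)

theorem Ψ_smoothAt {b : B} (h : b ∈ T.U) (v : EuclideanSpace ℝ (Fin π.rank)) :
    ContMDiffAt ((𝓡 B.dim).prod (𝓡 π.rank)) (𝓡 E.dim) ∞ T.Ψ (b, v) :=
  T.smooth_Ψ.contMDiffAt ((T.U.2.prod isOpen_univ).mem_nhds ⟨h, trivial⟩)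

/-- The linear isomorphism of a fibre with the model space. -/
def fibEquiv {b : B} (h : b ∈ T.U) : π.Fib b ≃ₗ[ℝ] EuclideanSpace ℝ (Fin π.rank) where
  toFun x := T.Θ x.1
  map_add' := (T.linear b h).map_add
  map_smul' := (T.linear b h).map_smul
  invFun v := ⟨T.Ψ (b, v), T.proj_Ψ b h v⟩
  left_inv x := Subtype.ext <| by
    obtain ⟨e, rfl⟩ := x
    exact T.Ψ_Θ e h
  right_inv v := T.Θ_Ψ b h v

theorem Θ_add (e e' : E) (h : π.proj e = π.proj e') (hU : π.proj e ∈ T.U) :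
    T.Θ (π.add e e' h) = T.Θ e + T.Θ e' :=
  (T.linear _ hU).map_add ⟨e, rfl⟩ ⟨e', h.symm⟩

theorem Θ_smul (r : ℝ) (e : E) (hU : π.proj e ∈ T.U) : T.Θ (π.smul r e) = r • T.Θ e :=
  (T.linear _ hU).map_smul r ⟨e, rfl⟩

theorem Θ_zero (b : B) (hU : b ∈ T.U) : T.Θ (π.zero b) = 0 :=
  (T.fibEquiv hU).map_zero

theorem Ψ_zero (b : B) (hU : b ∈ T.U) : T.Ψ (b, 0) = π.zero b :=
  congrArg Subtype.val (T.fibEquiv hU).symm.map_zero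

end LocalTriv

variable (π)

instance (b : B) : FiniteDimensional ℝ (π.Fib b) := by
  obtain ⟨T, hT⟩ := π.exists_localTriv b
  exact (T.fibEquiv hT).symm.finiteDimensional

theorem finrank_fib (b : B) : Module.finrank ℝ (π.Fib b) = π.rank := by
  obtain ⟨T, hT⟩ := π.exists_localTriv b
  rw [(T.fibEquiv hT).finrank_eq, finrank_euclideanSpace_fin]

theorem smooth_smul : ContMDiff (𝓘(ℝ, ℝ).prod (𝓡 E.dim)) (𝓡 E.dim) ∞
    (fun p : ℝ × E => π.smul p.1 p.2) := by
  rintro ⟨r, e⟩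
  obtain ⟨T, hT⟩ := π.exists_localTriv (π.proj e)
  have hopen : IsOpen {p : ℝ × E | π.proj p.2 ∈ T.U} :=
    T.U.2.preimage (π.smooth_proj.continuous.comp continuous_snd)
  have h1 : ContMDiffAt (𝓘(ℝ, ℝ).prod (𝓡 E.dim)) (𝓡 E.dim) ∞
      (fun p : ℝ × E => T.Ψ (π.proj p.2, p.1 • T.Θ p.2)) (r, e) := by
    have hΘ : ContMDiffAt (𝓘(ℝ, ℝ).prod (𝓡 E.dim)) (𝓡 π.rank) ∞
        (fun p : ℝ × E => T.Θ p.2) (r, e) :=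
      ContMDiffAt.comp (r, e) (T.Θ_smoothAt hT) contMDiffAt_snd
    have hp : ContMDiffAt (𝓘(ℝ, ℝ).prod (𝓡 E.dim)) (𝓡 B.dim) ∞
        (fun p : ℝ × E => π.proj p.2) (r, e) :=
      ContMDiffAt.comp (r, e) (π.smooth_proj e) contMDiffAt_snd
    exact ContMDiffAt.comp (r, e) (g := T.Ψ) (T.Ψ_smoothAt hT _)
      (hp.prodMk (contMDiffAt_fst.smul hΘ))
  refine h1.congr_of_eventuallyEq ?_
  filter_upwards [hopen.mem_nhds (show π.proj e ∈ T.U from hT)] with p hp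
  rw [← T.Θ_smul _ _ hp]
  have := T.Ψ_Θ (π.smul p.1 p.2) (by rw [π.proj_smul]; exact hp)
  rw [π.proj_smul] at this
  exact this.symm

theorem smooth_zero : SmoothMap π.zero := by
  intro b
  obtain ⟨T, hT⟩ := π.exists_localTriv b
  have h1 : ContMDiffAt (𝓡 B.dim) (𝓡 E.dim) ∞ (fun b' => T.Ψ (b', 0)) b :=
    ContMDiffAt.comp b (T.Ψ_smoothAt hT 0) (contMDiffAt_id.prodMk contMDiffAt_const)
  refine h1.congr_of_eventuallyEq ?_
  filter_upwards [T.U.2.mem_nhds hT] with b' hb'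
  exact (T.Ψ_zero b' hb').symm

/-- A fibrewise linear smooth map to a normed space is, in a local trivialisation, a smooth family
of continuous linear maps. -/
theorem exists_matrix {F : Type*} [NormedAddCommGroup F] [NormedSpace ℝ F] (W : Opens B) (g : E → F)
    (hg : ContMDiffOn (𝓡 E.dim) 𝓘(ℝ, F) ∞ g (π.proj ⁻¹' W))
    (hl : ∀ b ∈ W, IsLinearMap ℝ (fun x : π.Fib b => g x.1)) (T : π.LocalTriv) :
    ∃ A : B → EuclideanSpace ℝ (Fin π.rank) →L[ℝ] F,
      (∀ b ∈ W ⊓ T.U, ContMDiffAt (𝓡 B.dim)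
        𝓘(ℝ, EuclideanSpace ℝ (Fin π.rank) →L[ℝ] F) ∞ A b) ∧
      ∀ b ∈ W ⊓ T.U, ∀ v, A b v = g (T.Ψ (b, v)) := by
  let e := EuclideanSpace.basisFun (Fin π.rank) ℝ
  refine ⟨fun b => ∑ i, (EuclideanSpace.proj (𝕜 := ℝ) i).smulRight (g (T.Ψ (b, e i))),
    fun b hb => ?_, fun b hb v => ?_⟩
  · refine ContMDiffAt.sum fun i _ => ?_
    have h1 : ContMDiffAt (𝓡 B.dim) 𝓘(ℝ, F) ∞ (fun b => g (T.Ψ (b, e i))) b := by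
      refine ContMDiffAt.comp b (g := g) (hg.contMDiffAt
        ((W.2.preimage π.smooth_proj.continuous).mem_nhds ?_))
        (ContMDiffAt.comp b (T.Ψ_smoothAt hb.2 _) (contMDiffAt_id.prodMk contMDiffAt_const))
      change π.proj (T.Ψ (b, e i)) ∈ W
      rw [T.proj_Ψ b hb.2]
      exact hb.1
    exact (ContinuousLinearMap.smulRightL ℝ (EuclideanSpace ℝ (Fin π.rank)) F
      (EuclideanSpace.proj (𝕜 := ℝ) i)).contDiff.contMDiff.contMDiffAt.comp b h1
  · let G : π.Fib b →ₗ[ℝ] F := (hl b hb.1).mk' _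
    have h1 : ∀ v, g (T.Ψ (b, v)) = (G ∘ₗ (T.fibEquiv hb.2).symm.toLinearMap) v := fun v => rfl
    rw [h1]
    conv_rhs => rw [← e.sum_repr v]
    rw [_root_.map_sum]
    simp [e, h1]

/-- A fibrewise bijective, fibrewise linear smooth map `g` to a vector space gives a trivialisation:
the inverse of `(proj, g)` is smooth. In a local trivialisation this is the smoothness of matrix
inversion. -/
theorem smooth_of_fibrewise_bijective {F : Type*} [NormedAddCommGroup F] [NormedSpace ℝ F]
    (W : Opens B) (g : E → F)
    (hg : ContMDiffOn (𝓡 E.dim) 𝓘(ℝ, F) ∞ g (π.proj ⁻¹' W))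
    (hl : ∀ b ∈ W, IsLinearMap ℝ (fun x : π.Fib b => g x.1))
    (hbij : ∀ b ∈ W, Function.Bijective (fun x : π.Fib b => g x.1))
    (σ : B × F → E) (hσ : ∀ b ∈ W, ∀ v, π.proj (σ (b, v)) = b ∧ g (σ (b, v)) = v) :
    ContMDiffOn ((𝓡 B.dim).prod 𝓘(ℝ, F)) (𝓡 E.dim) ∞ σ ((W : Set B) ×ˢ Set.univ) := by
  rintro ⟨b, v⟩ ⟨hb, -⟩
  refine ContMDiffAt.contMDiffWithinAt ?_
  obtain ⟨T, hT⟩ := π.exists_localTriv b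
  obtain ⟨A, hA, hAg⟩ := π.exists_matrix W g hg hl T
  have hfib : ∀ b' ∈ W ⊓ T.U, Function.Bijective (A b') := fun b' hb' => by
    have : (A b' : _ → F) = (fun x : π.Fib b' => g x.1) ∘ (T.fibEquiv hb'.2).symm :=
      funext fun v => hAg b' hb' v
    rw [this]
    exact (hbij b' hb'.1).comp (T.fibEquiv hb'.2).symm.bijective
  let L : ∀ b' ∈ W ⊓ T.U, EuclideanSpace ℝ (Fin π.rank) ≃ₗ[ℝ] F := fun b' hb' =>
    LinearEquiv.ofBijective (A b').toLinearMap (hfib b' hb')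
  have : FiniteDimensional ℝ F := (L b ⟨hb, hT⟩).finiteDimensional
  let L' : ∀ b' ∈ W ⊓ T.U, EuclideanSpace ℝ (Fin π.rank) ≃L[ℝ] F := fun b' hb' =>
    (L b' hb').toContinuousLinearEquiv
  have hL' : ∀ b' (hb' : b' ∈ W ⊓ T.U), (L' b' hb' : _ →L[ℝ] F) = A b' := fun b' hb' => rfl
  have hinv : ContMDiffAt (𝓡 B.dim) 𝓘(ℝ, F →L[ℝ] EuclideanSpace ℝ (Fin π.rank)) ∞
      (fun b' => (A b').inverse) b := by
    have h1 := contDiffAt_map_inverse (n := ∞) (L' b ⟨hb, hT⟩)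
    rw [hL' b ⟨hb, hT⟩] at h1
    exact h1.contMDiffAt.comp b (hA b ⟨hb, hT⟩)
  have h2 : ContMDiffAt ((𝓡 B.dim).prod 𝓘(ℝ, F)) (𝓡 E.dim) ∞
      (fun p : B × F => T.Ψ (p.1, (A p.1).inverse p.2)) (b, v) := by
    have h3 : ContMDiffAt ((𝓡 B.dim).prod 𝓘(ℝ, F))
        𝓘(ℝ, F →L[ℝ] EuclideanSpace ℝ (Fin π.rank)) ∞
        (fun p : B × F => (A p.1).inverse) (b, v) :=
      ContMDiffAt.comp (b, v) hinv contMDiffAt_fst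
    exact ContMDiffAt.comp (b, v) (g := T.Ψ) (T.Ψ_smoothAt hT _)
      (contMDiffAt_fst.prodMk (h3.clm_apply contMDiffAt_snd))
  refine h2.congr_of_eventuallyEq ?_
  have hopen : IsOpen ({p : B × F | p.1 ∈ W ⊓ T.U}) := (W ⊓ T.U).2.preimage continuous_fst
  filter_upwards [hopen.mem_nhds (show b ∈ W ⊓ T.U from ⟨hb, hT⟩)] with p hp
  have h4 := hσ p.1 hp.1 p.2
  have h5 : (A p.1).inverse p.2 = T.Θ (σ p) := by
    rw [← hL' p.1 hp, ContinuousLinearMap.inverse_equiv]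
    change (L' p.1 hp).symm p.2 = _
    rw [ContinuousLinearEquiv.symm_apply_eq]
    change _ = A p.1 _
    have := T.Ψ_Θ (σ p) (by rw [h4.1]; exact hp.2)
    rw [h4.1] at this
    rw [hAg p.1 hp, this]
    exact h4.2.symm
  rw [h5]
  have := T.Ψ_Θ (σ p) (by rw [h4.1]; exact hp.2)
  rw [h4.1] at this
  exact this.symm

end VBundle

/-! ### Doubly linear functions on a double vector bundle -/

theorem VBundle.eq_of_add_neg {E B : Mfd.{u}} (π : VBundle E B) {e e' : E}
    (h : π.proj e = π.proj e') (h' : π.proj e = π.proj (π.smul (-1) e'))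
    (h0 : π.add e (π.smul (-1) e') h' = π.zero (π.proj e)) : e = e' := by
  have h1 : π.smul (-1) e' = (-(⟨e', h.symm⟩ : π.Fib (π.proj e))).1 :=
    (π.smul_coe (-1) (⟨e', h.symm⟩ : π.Fib (π.proj e))).trans
      (congrArg Subtype.val (neg_one_smul ℝ _))
  have h2 : π.add e (π.smul (-1) e') h' =
      ((⟨e, rfl⟩ : π.Fib (π.proj e)) + -⟨e', h.symm⟩).1 := by
    rw [← π.add_coe]
    congr 1
  have h3 : (⟨e, rfl⟩ : π.Fib (π.proj e)) + -⟨e', h.symm⟩ = 0 := Subtype.ext (h2 ▸ h0)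
  exact congrArg Subtype.val (add_neg_eq_zero.mp h3)

namespace IDVB

section DoublyLinear

variable (X : IDVB.{u})

theorem toBase_add₁ (d e : X.D) (h) : X.toBase (X.p₁.add d e h) = X.toBase d := by
  rw [toBase, X.p₁.proj_add]; rfl

theorem toBase_smul₁ (r : ℝ) (d : X.D) : X.toBase (X.p₁.smul r d) = X.toBase d := by
  rw [toBase, X.p₁.proj_smul]; rfl

theorem toBase_add₂ (d e : X.D) (h) : X.toBase (X.p₂.add d e h) = X.toBase d := by
  rw [← X.proj_p₂, X.p₂.proj_add, X.proj_p₂]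

theorem toBase_smul₂ (r : ℝ) (d : X.D) : X.toBase (X.p₂.smul r d) = X.toBase d := by
  rw [← X.proj_p₂, X.p₂.proj_smul, X.proj_p₂]

theorem toBase_inv (d : X.D) : X.toBase (X.inv d) = X.toBase d := by
  rw [toBase, X.p₁_inv, X.proj_p₂]

theorem toBase_zero₁ (x : X.Q) : X.toBase (X.p₁.zero x) = X.q.proj x := by
  rw [toBase, X.p₁.proj_zero]

theorem p₁_zero₂ (x : X.Q) : X.p₁.proj (X.p₂.zero x) = X.q.zero (X.q.proj x) :=
  X.dvb.πA_morphism.map_zero x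

theorem p₂_zero₁ (x : X.Q) : X.p₂.proj (X.p₁.zero x) = X.q.zero (X.q.proj x) :=
  X.dvb.πB_morphism.map_zero x

/-- The two zero sections of `D` agree on the zero section of the side: the second zero vector `w`
satisfies `w +₂ w = w`, and multiplication by `0` in the first structure is additive for `+₂`. -/
theorem zero₁_zero (m : X.M) : X.p₁.zero (X.q.zero m) = X.p₂.zero (X.q.zero m) := by
  set w := X.p₂.zero (X.q.zero m) with hw
  have hw1 : X.p₁.proj w = X.q.zero m := by rw [hw, p₁_zero₂, X.q.proj_zero]
  have hz : X.p₁.smul 0 w = X.p₁.zero (X.q.zero m) := by rw [X.p₁.zero_smul', hw1]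
  have hww : X.p₂.add w w rfl = w := by
    have := X.p₂.add_zero' w (X.p₂.proj_zero _).symm
    have h2 : X.p₂.zero (X.p₂.proj w) = w := by rw [hw, X.p₂.proj_zero]
    simpa only [h2] using this
  have h := X.dvb.smulA_addB 0 w w rfl rfl
  change X.p₁.smul 0 (X.p₂.add w w rfl) = X.p₂.add (X.p₁.smul 0 w) (X.p₁.smul 0 w) rfl at h
  rw [hww] at h
  have h1 := X.p₂.eq_zero_of_add_self _ h.symm
  rw [hz, p₂_zero₁, X.q.proj_zero] at h1
  exact h1

/-- On the core the two additions agree, by the interchange law for `(c +₁ 0) +₂ (0 +₁ c')`. -/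
theorem core_add {m : X.M} (c c' : X.D) (h1 : X.p₁.proj c = X.q.zero m)
    (h2 : X.p₂.proj c = X.q.zero m) (h1' : X.p₁.proj c' = X.q.zero m)
    (h2' : X.p₂.proj c' = X.q.zero m) :
    X.p₂.add c c' (h2.trans h2'.symm) = X.p₁.add c c' (h1.trans h1'.symm) := by
  set z := X.p₁.zero (X.q.zero m) with hz
  have hz1 : X.p₁.proj z = X.q.zero m := X.p₁.proj_zero _
  have hz2 : X.p₂.proj z = X.q.zero m := by rw [hz, zero₁_zero, X.p₂.proj_zero]
  have e1 : X.p₁.add c z (h1.trans hz1.symm) = c := by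
    have := X.p₁.add_zero' c (X.p₁.proj_zero _).symm
    simpa only [h1, ← hz] using this
  have e2 : X.p₁.add z c' (hz1.trans h1'.symm) = c' := by
    have := X.p₁.add_zero' c' (X.p₁.proj_zero _).symm
    rw [X.p₁.add_comm'] at this
    simpa only [h1', ← hz] using this
  have e3 : X.p₂.add c z (h2.trans hz2.symm) = c := by
    have := X.p₂.add_zero' c (X.p₂.proj_zero _).symm
    simpa only [h2, ← zero₁_zero, ← hz] using this
  have e4 : X.p₂.add z c' (hz2.trans h2'.symm) = c' := by
    have := X.p₂.add_zero' c' (X.p₂.proj_zero _).symm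
    rw [X.p₂.add_comm'] at this
    simpa only [h2', ← zero₁_zero, ← hz] using this
  have key := X.dvb.add_add c z z c' (h1.trans hz1.symm) (hz1.trans h1'.symm)
    (h2.trans hz2.symm) (hz2.trans h2'.symm)
    ((congrArg X.p₂.proj e1).trans ((h2.trans h2'.symm).trans (congrArg X.p₂.proj e2).symm))
    ((congrArg X.p₁.proj e3).trans ((h1.trans h1'.symm).trans (congrArg X.p₁.proj e4).symm))
  change X.p₂.add (X.p₁.add c z _) (X.p₁.add z c' _) _ =
    X.p₁.add (X.p₂.add c z _) (X.p₂.add z c' _) _ at key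
  simpa only [e1, e2, e3, e4] using key

/-- Functions on `D|_U` which are linear for both vector bundle structures. The function is defined
on all of `D`; nothing is required outside `U`. -/
structure IsDoublyLinear (U : Set X.M) {V : Type*} [AddCommGroup V] [Module ℝ V]
    (F : X.D → V) : Prop where
  add₁ : ∀ d e h, X.toBase d ∈ U → F (X.p₁.add d e h) = F d + F e
  smul₁ : ∀ (r : ℝ) d, X.toBase d ∈ U → F (X.p₁.smul r d) = r • F d
  add₂ : ∀ d e h, X.toBase d ∈ U → F (X.p₂.add d e h) = F d + F e
  smul₂ : ∀ (r : ℝ) d, X.toBase d ∈ U → F (X.p₂.smul r d) = r • F d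

variable {X}

namespace IsDoublyLinear

variable {U : Set X.M} {V : Type*} [AddCommGroup V] [Module ℝ V] {F : X.D → V}

theorem mono_set (h : X.IsDoublyLinear U F) {U' : Set X.M} (hU : U' ⊆ U) :
    X.IsDoublyLinear U' F :=
  ⟨fun d e h' hd => h.add₁ d e h' (hU hd), fun r d hd => h.smul₁ r d (hU hd),
    fun d e h' hd => h.add₂ d e h' (hU hd), fun r d hd => h.smul₂ r d (hU hd)⟩

theorem map_zero₁ (h : X.IsDoublyLinear U F) (x : X.Q) (hx : X.q.proj x ∈ U) :
    F (X.p₁.zero x) = 0 := by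
  have h1 := h.smul₁ 0 (X.p₁.zero x) (by rwa [toBase_zero₁])
  rwa [X.p₁.zero_smul', X.p₁.proj_zero, zero_smul] at h1

theorem isLinear₁ (h : X.IsDoublyLinear U F) (x : X.Q) (hx : X.q.proj x ∈ U) :
    IsLinearMap ℝ (fun d : X.p₁.Fib x => F d.1) := by
  constructor
  · rintro ⟨d, rfl⟩ e
    rw [← X.p₁.add_coe]
    exact h.add₁ _ _ _ hx
  · rintro r ⟨d, rfl⟩
    rw [← X.p₁.smul_coe]
    exact h.smul₁ _ _ hx

/-- The skew-symmetric part of a doubly linear function is doubly linear, because the involution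
exchanges the two structures. -/
theorem skew (h : X.IsDoublyLinear U F) :
    X.IsDoublyLinear U (fun d => (1 / 2 : ℝ) • (F d - F (X.inv d))) where
  add₁ d e h' hd := by
    rw [X.inv_morphism₁.map_add, h.add₁ _ _ _ hd, h.add₂ _ _ _ (by rwa [toBase_inv])]
    module
  smul₁ r d hd := by
    rw [X.inv_morphism₁.map_smul, h.smul₁ _ _ hd, h.smul₂ _ _ (by rwa [toBase_inv])]
    module
  add₂ d e h' hd := by
    rw [X.inv_morphism₂.map_add, h.add₂ _ _ _ hd, h.add₁ _ _ _ (by rwa [toBase_inv])]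
    module
  smul₂ r d hd := by
    rw [X.inv_morphism₂.map_smul, h.smul₂ _ _ hd, h.smul₁ _ _ (by rwa [toBase_inv])]
    module

/-- If a doubly linear function is injective on the core over `m`, then it is injective on the
kernel of `π₂` in every fibre of `π₁` over `m`: such a kernel is a translate of the core. -/
theorem eq_zero_of_core (h : X.IsDoublyLinear U F) {m : X.M} (hm : m ∈ U)
    (hc : ∀ c : X.D, X.p₁.proj c = X.q.zero m → X.p₂.proj c = X.q.zero m → F c = 0 →
      c = X.p₁.zero (X.q.zero m)) (d : X.D) (hd : X.p₂.proj d = X.q.zero m) (hF : F d = 0) :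
    d = X.p₁.zero (X.p₁.proj d) := by
  have hdm : X.toBase d = m := by rw [← X.proj_p₂, hd, X.q.proj_zero]
  have hq : X.q.proj (X.p₁.proj d) = m := hdm
  set z := X.p₁.zero (X.p₁.proj d) with hz
  have hz2 : X.p₂.proj z = X.q.zero m := by rw [hz, p₂_zero₁, hq]
  have hz1 : X.p₁.proj z = X.p₁.proj d := X.p₁.proj_zero _
  have h' : X.p₂.proj d = X.p₂.proj (X.p₂.smul (-1) z) := by rw [X.p₂.proj_smul, hd, hz2]
  refine X.p₂.eq_of_add_neg (hd.trans hz2.symm) h' ?_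
  rw [hd, ← zero₁_zero]
  refine hc _ ?_ (by rw [X.p₂.proj_add, hd]) ?_
  · rw [X.dvb.πA_morphism.map_add]
    simp only [X.dvb.πA_morphism.map_smul]
    simp only [hz1]
    rw [X.q.add_neg', hq]
  · rw [h.add₂ _ _ _ (by rwa [hdm]), h.smul₂ _ _ (by
      rw [hz, toBase_zero₁, hq]; exact hm), hF, h.map_zero₁ _ (by rwa [hq])]
    simp

end IsDoublyLinear

/-! ### Linearisation of fibrewise linear functions -/

variable (T : X.p₁.LocalTriv)

/-- The linearisation along the second structure of the fibre coordinates of a local trivialisation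
of the first structure: the derivative of `Θ (t ·₂ d)` at `t = 0`. It is meaningful where `0 ·₂ d`
lies in the domain of the trivialisation, that is, over the base points whose zero vector does. -/
noncomputable def linearize (d : X.D) : EuclideanSpace ℝ (Fin X.p₁.rank) :=
  deriv (fun t : ℝ => T.Θ (X.p₂.smul t d)) 0

theorem proj_smul₂_zero (d : X.D) :
    X.p₁.proj (X.p₂.smul 0 d) = X.q.zero (X.toBase d) := by
  rw [X.p₂.zero_smul', p₁_zero₂, X.proj_p₂]

theorem smoothAt_smul₂ {d : X.D} (hd : X.q.zero (X.toBase d) ∈ T.U) :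
    ContMDiffAt ((𝓡 X.D.dim).prod 𝓘(ℝ, ℝ)) (𝓡 X.p₁.rank) ∞
      (fun p : X.D × ℝ => T.Θ (X.p₂.smul p.2 p.1)) (d, 0) := by
  have h1 : ContMDiffAt ((𝓡 X.D.dim).prod 𝓘(ℝ, ℝ)) (𝓡 X.D.dim) ∞
      (fun p : X.D × ℝ => X.p₂.smul p.2 p.1) (d, 0) :=
    ContMDiffAt.comp (d, (0 : ℝ)) (X.p₂.smooth_smul (0, d))
      (contMDiffAt_snd.prodMk contMDiffAt_fst)
  refine ContMDiffAt.comp (d, (0 : ℝ)) (g := T.Θ) (T.Θ_smoothAt ?_) h1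
  rwa [proj_smul₂_zero]

theorem smoothAt_linearize {d : X.D} (hd : X.q.zero (X.toBase d) ∈ T.U) :
    ContMDiffAt (𝓡 X.D.dim) (𝓡 X.p₁.rank) ∞ (linearize T) d := by
  have h := ContMDiffAt.mfderiv (m := ∞) (n := ∞) (x₀ := d)
    (fun (d : X.D) (t : ℝ) => T.Θ (X.p₂.smul t d)) (fun _ => 0) (smoothAt_smul₂ T hd)
    contMDiffAt_const (by simp)
  have h1 : ContMDiffAt (𝓡 X.D.dim) 𝓘(ℝ, ℝ →L[ℝ] EuclideanSpace ℝ (Fin X.p₁.rank)) ∞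
      (fun d => fderiv ℝ (fun t : ℝ => T.Θ (X.p₂.smul t d)) 0) d := by
    have e := inTangentCoordinates_model_space (I := 𝓘(ℝ, ℝ)) (I' := 𝓡 X.p₁.rank)
      (fun _ : X.D => (0 : ℝ)) (fun d : X.D => T.Θ (X.p₂.smul 0 d))
      (fun d => fderiv ℝ (fun t : ℝ => T.Θ (X.p₂.smul t d)) 0) d
    simp only [mfderiv_eq_fderiv] at h
    rw [← e]
    exact h
  exact h1.clm_apply (contMDiffAt_const (c := (1 : ℝ)))

theorem smoothAt_smul₂_path {d : X.D} (hd : X.q.zero (X.toBase d) ∈ T.U) :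
    DifferentiableAt ℝ (fun t : ℝ => T.Θ (X.p₂.smul t d)) 0 := by
  have h : ContMDiffAt 𝓘(ℝ, ℝ) (𝓡 X.p₁.rank) ∞ (fun t : ℝ => T.Θ (X.p₂.smul t d)) 0 :=
    ContMDiffAt.comp (0 : ℝ) (g := fun p : X.D × ℝ => T.Θ (X.p₂.smul p.2 p.1))
      (smoothAt_smul₂ T hd) (contMDiffAt_const.prodMk contMDiffAt_id)
  exact h.contDiffAt.differentiableAt (by simp)

theorem eventually_mem {d : X.D} (hd : X.q.zero (X.toBase d) ∈ T.U) :
    ∀ᶠ t : ℝ in nhds 0, X.p₁.proj (X.p₂.smul t d) ∈ T.U := by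
  have hc : Continuous (fun t : ℝ => X.p₁.proj (X.p₂.smul t d)) :=
    X.p₁.smooth_proj.continuous.comp
      (X.p₂.smooth_smul.continuous.comp (continuous_id.prodMk continuous_const))
  refine (T.U.2.preimage hc).mem_nhds ?_
  change X.p₁.proj (X.p₂.smul 0 d) ∈ T.U
  rwa [proj_smul₂_zero]

/-- The linearisation is linear for the first structure because `Θ` is and `t ·₂` is a morphism of
the first structure; it is linear for the second one because it is a differential at zero. -/
theorem isDoublyLinear_linearize :
    X.IsDoublyLinear {m | X.q.zero m ∈ T.U} (linearize T) where
  add₁ d e h hd := by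
    have he : X.q.zero (X.toBase e) ∈ T.U := by
      rw [toBase, ← h]; exact hd
    rw [linearize, linearize, linearize, ← deriv_add (smoothAt_smul₂_path T hd)
      (smoothAt_smul₂_path T he)]
    refine Filter.EventuallyEq.deriv_eq ?_
    filter_upwards [eventually_mem T hd] with t ht
    have h' : X.p₁.proj (X.p₂.smul t d) = X.p₁.proj (X.p₂.smul t e) := by
      rw [X.dvb.πA_morphism.map_smul, X.dvb.πA_morphism.map_smul, h]
    have := X.dvb.smulB_addA t d e h h'
    change X.p₂.smul t (X.p₁.add d e h) = X.p₁.add (X.p₂.smul t d) (X.p₂.smul t e) h' at this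
    rw [this, T.Θ_add _ _ _ ht]
    rfl
  smul₁ r d hd := by
    rw [linearize, linearize, ← deriv_const_smul _ (smoothAt_smul₂_path T hd)]
    refine Filter.EventuallyEq.deriv_eq ?_
    filter_upwards [eventually_mem T hd] with t ht
    have := X.dvb.smul_smul t r d
    change X.p₂.smul t (X.p₁.smul r d) = X.p₁.smul r (X.p₂.smul t d) at this
    rw [this, T.Θ_smul _ _ ht]
    rfl
  add₂ d e h hd := by
    obtain ⟨T', hT'⟩ := X.p₂.exists_localTriv (X.p₂.proj d)
    -- on the fibre of `π₂` the linearisation is the differential at zero of the coordinates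
    have hg : DifferentiableAt ℝ (fun w => T.Θ (T'.Ψ (X.p₂.proj d, w))) 0 := by
      have h1 : ContMDiffAt (𝓡 X.p₂.rank) (𝓡 X.p₁.rank) ∞
          (fun w => T.Θ (T'.Ψ (X.p₂.proj d, w))) 0 := by
        refine ContMDiffAt.comp (0 : EuclideanSpace ℝ (Fin X.p₂.rank)) (g := T.Θ)
          (T.Θ_smoothAt ?_) (ContMDiffAt.comp (0 : EuclideanSpace ℝ (Fin X.p₂.rank))
            (T'.Ψ_smoothAt hT' 0) (contMDiffAt_const.prodMk contMDiffAt_id))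
        rw [T'.Ψ_zero _ hT', p₁_zero₂, X.proj_p₂]
        exact hd
      exact h1.contDiffAt.differentiableAt (by simp)
    have key : ∀ d' : X.D, X.p₂.proj d' = X.p₂.proj d →
        linearize T d' = fderiv ℝ (fun w => T.Θ (T'.Ψ (X.p₂.proj d, w))) 0 (T'.Θ d') := by
      intro d' hd'
      have e1 : (fun t : ℝ => T.Θ (X.p₂.smul t d')) =
          fun t : ℝ => T.Θ (T'.Ψ (X.p₂.proj d, t • T'.Θ d')) := by
        funext t
        have h2 := T'.Ψ_Θ (X.p₂.smul t d') (by rwa [X.p₂.proj_smul, hd'])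
        rw [X.p₂.proj_smul, hd', T'.Θ_smul _ _ (by rwa [hd'])] at h2
        rw [h2]
      rw [linearize, e1]
      have h3 : HasDerivAt (fun t : ℝ => t • T'.Θ d') (T'.Θ d') 0 := by
        simpa using (hasDerivAt_id (0 : ℝ)).smul_const (T'.Θ d')
      have h4 := HasFDerivAt.comp_hasDerivAt (0 : ℝ)
        (l := fun w => T.Θ (T'.Ψ (X.p₂.proj d, w))) (by
          simpa using hg.hasFDerivAt) h3
      exact h4.deriv
    rw [key _ rfl, key e h.symm, key _ (X.p₂.proj_add d e h), T'.Θ_add _ _ _ hT', _root_.map_add]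
  smul₂ r d hd := by
    have e1 : (fun t : ℝ => T.Θ (X.p₂.smul t (X.p₂.smul r d))) =
        fun t : ℝ => (fun s => T.Θ (X.p₂.smul s d)) (r * t) := by
      funext t
      rw [X.p₂.smul_smul', mul_comm]
    rw [linearize, e1]
    have := deriv_comp_mul_left r (fun s => T.Θ (X.p₂.smul s d)) 0
    rw [mul_zero] at this
    exact this

/-- On the core the linearisation changes nothing: there the two additions agree, so the scalar
multiplications agree by continuity. -/
theorem linearize_core {m : X.M} (hm : X.q.zero m ∈ T.U) (c : X.D)
    (h1 : X.p₁.proj c = X.q.zero m) (h2 : X.p₂.proj c = X.q.zero m) : linearize T c = T.Θ c := by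
  have hm' : X.toBase c = m := by rw [toBase, h1, X.q.proj_zero]
  have hp1 : ∀ t, X.p₁.proj (X.p₂.smul t c) = X.q.zero m := fun t => by
    rw [X.dvb.πA_morphism.map_smul, h1]
    exact (X.q.smul_coe t (0 : X.q.Fib m)).trans (congrArg Subtype.val (smul_zero t))
  have hp2 : ∀ t, X.p₂.proj (X.p₂.smul t c) = X.q.zero m := fun t => by
    rw [X.p₂.proj_smul, h2]
  let f : ℝ →+ EuclideanSpace ℝ (Fin X.p₁.rank) := AddMonoidHom.mk'
    (fun t => T.Θ (X.p₂.smul t c)) fun s t => by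
      rw [X.p₂.add_smul' s t c ((hp2 s).trans (hp2 t).symm),
        core_add X _ _ (hp1 s) (hp2 s) (hp1 t) (hp2 t), T.Θ_add _ _ _ (by rwa [hp1])]
  have hf : Continuous f := by
    refine continuous_iff_continuousAt.mpr fun t => ?_
    refine ContinuousAt.comp (f := fun t : ℝ => X.p₂.smul t c)
      (T.Θ_smoothAt (by rwa [hp1])).continuousAt ?_
    exact (X.p₂.smooth_smul.continuous.comp
      (continuous_id.prodMk continuous_const)).continuousAt
  have h3 : HasDerivAt (fun t : ℝ => T.Θ (X.p₂.smul t c)) (f.toRealLinearMap hf 1) 0 :=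
    (f.toRealLinearMap hf).hasDerivAt
  rw [linearize, h3.deriv]
  change T.Θ (X.p₂.smul 1 c) = _
  rw [X.p₂.one_smul']

end DoublyLinear

end IDVB

/-! ### Local coordinates of an involutive double vector bundle -/

namespace IDVB

variable {X : IDVB.{u}}

theorem snd_zero_surjective (m : X.M) : Function.Surjective (snd (0 : X.q.Fib m)) := fun y =>
  ⟨⟨X.p₂.zero y.1, by rw [p₁_zero₂, y.2]; rfl⟩, Subtype.ext (X.p₂.proj_zero _)⟩

theorem rank_q_le (m : X.M) : X.q.rank ≤ X.p₁.rank := by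
  rw [← X.q.finrank_fib m, ← X.p₁.finrank_fib (0 : X.q.Fib m).1]
  have h1 := LinearMap.finrank_range_add_finrank_ker (snd (0 : X.q.Fib m))
  rw [LinearMap.range_eq_top.mpr (snd_zero_surjective m), finrank_top] at h1
  omega

theorem core_eq_zero_of_Θ (T : X.p₁.LocalTriv) {m : X.M} (hm : X.q.zero m ∈ T.U) (c : X.D)
    (h1 : X.p₁.proj c = X.q.zero m) (h : T.Θ c = 0) : c = X.p₁.zero (X.q.zero m) := by
  have h2 := T.Ψ_Θ c (by rwa [h1])
  rw [h1, h, T.Ψ_zero _ hm] at h2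
  exact h2.symm

theorem toBase_eq_of_core {m : X.M} {c : X.D} (h1 : X.p₁.proj c = X.q.zero m) :
    X.toBase c = m := by rw [toBase, h1, X.q.proj_zero]

/-- A doubly linear skew-symmetric function near a point `m₀` which is injective on the core over
`m₀`, with values in a space of the dimension of the core: the skew-symmetric part of the
linearisation of a trivialisation. Skew-symmetrisation loses nothing on the core, where the
involution is `-1`. -/
theorem exists_skew_injective_core (T : X.p₁.LocalTriv) (m₀ : X.M) (hm₀ : X.q.zero m₀ ∈ T.U) :
    ∃ F : X.D → EuclideanSpace ℝ (Fin (X.p₁.rank - X.q.rank)),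
      ContMDiffOn (𝓡 X.D.dim) 𝓘(ℝ, EuclideanSpace ℝ (Fin (X.p₁.rank - X.q.rank))) ∞ F
        {d | X.q.zero (X.toBase d) ∈ T.U} ∧
      X.IsDoublyLinear {m | X.q.zero m ∈ T.U} F ∧
      (∀ d, F (X.inv d) = -F d) ∧
      ∀ c : X.D, X.p₁.proj c = X.q.zero m₀ → X.p₂.proj c = X.q.zero m₀ → F c = 0 →
        c = X.p₁.zero (X.q.zero m₀) := by
  -- the core over `m₀` is the kernel of `π₂` on the fibre of `π₁` over the zero vector
  let K := LinearMap.ker (snd (0 : X.q.Fib m₀))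
  have hK : Module.finrank ℝ K = X.p₁.rank - X.q.rank := by
    have h1 := LinearMap.finrank_range_add_finrank_ker (snd (0 : X.q.Fib m₀))
    rw [LinearMap.range_eq_top.mpr (snd_zero_surjective m₀), finrank_top, X.q.finrank_fib,
      X.p₁.finrank_fib] at h1
    change Module.finrank ℝ (LinearMap.ker (snd (0 : X.q.Fib m₀))) = _
    omega
  let S := K.map (T.fibEquiv hm₀).toLinearMap
  have hS : Module.finrank ℝ S = X.p₁.rank - X.q.rank := by
    rw [← hK]
    exact (LinearEquiv.finrank_map_eq (T.fibEquiv hm₀) K)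
  let e : S ≃ₗ[ℝ] EuclideanSpace ℝ (Fin (X.p₁.rank - X.q.rank)) :=
    LinearEquiv.ofFinrankEq _ _ (by rw [hS, finrank_euclideanSpace_fin])
  obtain ⟨l, hl⟩ := LinearMap.exists_extend e.toLinearMap
  have hl' : ∀ s : S, l s.1 = e s := fun s => LinearMap.congr_fun hl s
  have hG : X.IsDoublyLinear {m | X.q.zero m ∈ T.U} (fun d => l (linearize T d)) := by
    have h := isDoublyLinear_linearize T
    exact ⟨fun d d' h' hd => by simp only [h.add₁ d d' h' hd, _root_.map_add],
      fun r d hd => by simp only [h.smul₁ r d hd, _root_.map_smul],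
      fun d d' h' hd => by simp only [h.add₂ d d' h' hd, _root_.map_add],
      fun r d hd => by simp only [h.smul₂ r d hd, _root_.map_smul]⟩
  have hsm : ∀ d, X.q.zero (X.toBase d) ∈ T.U →
      ContMDiffAt (𝓡 X.D.dim) 𝓘(ℝ, EuclideanSpace ℝ (Fin (X.p₁.rank - X.q.rank))) ∞
        (fun d => l (linearize T d)) d := fun d hd =>
    l.toContinuousLinearMap.contDiff.contMDiff.contMDiffAt.comp d (smoothAt_linearize T hd)
  refine ⟨_, ?_, hG.skew, fun d => ?_, fun c h1 h2 hc => ?_⟩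
  · intro d hd
    refine ContMDiffAt.contMDiffWithinAt ?_
    have h2 := (hsm (X.inv d) (by rwa [toBase_inv])).comp d (X.inv_morphism₁.smooth d)
    exact ContMDiffAt.smul (I := 𝓘(ℝ, ℝ)) (contMDiffAt_const (c := (1 / 2 : ℝ))) ((hsm d hd).sub h2)
  · simp only [X.inv_inv]
    module
  · refine core_eq_zero_of_Θ T hm₀ c h1 ?_
    have h3 := X.inv_core m₀ c h1 h2
    simp only [h3] at hc
    rw [hG.smul₁ (-1) c (by rwa [toBase_eq_of_core h1]), linearize_core T hm₀ c h1 h2] at hc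
    have h4 : l (T.Θ c) = 0 := by
      rw [← hc]; module
    have h5 : T.Θ c ∈ S := ⟨⟨c, h1⟩, Subtype.ext h2, rfl⟩
    have h6 : e ⟨T.Θ c, h5⟩ = 0 := by rw [← hl', h4]
    exact congrArg Subtype.val ((e.map_eq_zero_iff).mp h6)

/-- Around every point there are fibre coordinates `t` of `Q` and skew-symmetric doubly linear
functions `c` which together are coordinates of the fibres of `π₁ : D → Q`. -/
theorem exists_localCoordinates (m₀ : X.M) :
    ∃ (U : Opens X.M) (t : X.Q → EuclideanSpace ℝ (Fin X.q.rank))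
      (c : X.D → EuclideanSpace ℝ (Fin (X.p₁.rank - X.q.rank))), m₀ ∈ U ∧
      ContMDiffOn (𝓡 X.Q.dim) 𝓘(ℝ, EuclideanSpace ℝ (Fin X.q.rank)) ∞ t (X.q.proj ⁻¹' U) ∧
      (∀ m ∈ U, IsLinearMap ℝ (fun x : X.q.Fib m => t x.1)) ∧
      (∀ m ∈ U, Function.Bijective (fun x : X.q.Fib m => t x.1)) ∧
      ContMDiffOn (𝓡 X.D.dim) 𝓘(ℝ, EuclideanSpace ℝ (Fin (X.p₁.rank - X.q.rank))) ∞ c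
        (X.toBase ⁻¹' U) ∧
      X.IsDoublyLinear U c ∧ (∀ d, c (X.inv d) = -c d) ∧
      ∀ x, X.q.proj x ∈ U →
        Function.Bijective (fun d : X.p₁.Fib x => (t (X.p₂.proj d.1), c d.1)) := by
  obtain ⟨T, hT⟩ := X.p₁.exists_localTriv (X.q.zero m₀)
  obtain ⟨S, hS⟩ := X.q.exists_localTriv m₀
  obtain ⟨F, hF, hFl, hFs, hFc⟩ := exists_skew_injective_core T m₀ hT
  let U₀ : Opens X.M := S.U ⊓ ⟨_, T.U.2.preimage X.q.smooth_zero.continuous⟩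
  have hU₀ : m₀ ∈ U₀ := ⟨hS, hT⟩
  have hFl₀ : X.IsDoublyLinear U₀ F := hFl.mono_set fun m hm => hm.2
  let H : X.D → EuclideanSpace ℝ (Fin X.q.rank) ×
      EuclideanSpace ℝ (Fin (X.p₁.rank - X.q.rank)) := fun d => (S.Θ (X.p₂.proj d), F d)
  have hHl : ∀ x, X.q.proj x ∈ U₀ → IsLinearMap ℝ (fun d : X.p₁.Fib x => H d.1) := by
    intro x hx
    have h1 := hFl₀.isLinear₁ x hx
    have h2 := (S.linear (X.q.proj x) hx.1)
    have h3 : (fun d : X.p₁.Fib x => H d.1) = (h2.mk' _ ∘ₗ snd ⟨x, rfl⟩).prod (h1.mk' _) := rfl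
    rw [h3]
    exact LinearMap.isLinear _
  let W : Opens X.Q := ⟨_, U₀.2.preimage X.q.smooth_proj.continuous⟩
  have hHs : ContMDiffOn (𝓡 X.D.dim) 𝓘(ℝ, EuclideanSpace ℝ (Fin X.q.rank) ×
      EuclideanSpace ℝ (Fin (X.p₁.rank - X.q.rank))) ∞ H (X.p₁.proj ⁻¹' W) := by
    intro d hd
    refine ContMDiffWithinAt.prodMk_space ?_ ((hF d hd.2).mono fun d hd => hd.2)
    refine ContMDiffAt.contMDiffWithinAt ?_
    refine ContMDiffAt.comp d (g := S.Θ) (S.Θ_smoothAt ?_) (X.p₂.smooth_proj d)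
    rw [X.proj_p₂]
    exact hd.1
  -- injectivity of `F` on the core over `m` is injectivity of the matrix of `H` at the zero vector
  obtain ⟨A, hA, hAH⟩ := X.p₁.exists_matrix W H hHs hHl T
  have hzW : ∀ m ∈ U₀, X.q.zero m ∈ W ⊓ T.U := fun m hm =>
    ⟨show X.q.proj (X.q.zero m) ∈ U₀ by rwa [X.q.proj_zero], hm.2⟩
  have hkey : ∀ m ∈ U₀, (∀ c : X.D, X.p₁.proj c = X.q.zero m → X.p₂.proj c = X.q.zero m →
      F c = 0 → c = X.p₁.zero (X.q.zero m)) ↔ Function.Injective (A (X.q.zero m)) := by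
    intro m hm
    rw [injective_iff_map_eq_zero]
    constructor
    · intro h v hv
      rw [hAH _ (hzW m hm)] at hv
      have hp : X.p₁.proj (T.Ψ (X.q.zero m, v)) = X.q.zero m := T.proj_Ψ _ hm.2 v
      have hv1 : S.Θ (X.p₂.proj (T.Ψ (X.q.zero m, v))) = 0 := congrArg Prod.fst hv
      have hb : X.q.proj (X.p₂.proj (T.Ψ (X.q.zero m, v))) = m := by
        rw [X.proj_p₂, toBase_eq_of_core hp]
      have h2 : X.p₂.proj (T.Ψ (X.q.zero m, v)) = X.q.zero m := by
        rw [← S.Ψ_Θ (X.p₂.proj (T.Ψ (X.q.zero m, v))) (by rw [hb]; exact hm.1), hv1,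
          S.Ψ_zero _ (by rw [hb]; exact hm.1), hb]
      have h3 := h _ hp h2 (congrArg Prod.snd hv)
      rw [← T.Θ_Ψ _ hm.2 v, h3, T.Θ_zero _ hm.2]
    · intro h c h1 h2 hc
      refine core_eq_zero_of_Θ T hm.2 c h1 (h _ ?_)
      rw [hAH _ (hzW m hm)]
      have h3 := T.Ψ_Θ c (by rw [h1]; exact hm.2)
      rw [h1] at h3
      rw [h3]
      refine Prod.ext ?_ hc
      change S.Θ (X.p₂.proj c) = 0
      rw [h2, S.Θ_zero _ hm.1]
  -- injectivity at `m₀` persists nearby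
  have hcont : ContinuousAt (fun m => A (X.q.zero m)) m₀ :=
    ContinuousAt.comp (f := X.q.zero) (hA _ (hzW m₀ hU₀)).continuousAt
      X.q.smooth_zero.continuous.continuousAt
  have hnear : ∀ᶠ m in nhds m₀, Function.Injective (A (X.q.zero m)) :=
    hcont.eventually (ContinuousLinearMap.isOpen_injective.mem_nhds ((hkey m₀ hU₀).mp hFc))
  obtain ⟨V, hV, hVo, hm₀V⟩ := eventually_nhds_iff.mp hnear
  let U : Opens X.M := U₀ ⊓ ⟨V, hVo⟩
  refine ⟨U, S.Θ, F, ⟨hU₀, hm₀V⟩, S.smooth_Θ.mono fun x hx => hx.1.1,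
    fun m hm => S.linear m hm.1.1, fun m hm => (S.fibEquiv hm.1.1).bijective,
    hF.mono fun d hd => hd.1.2, hFl₀.mono_set fun m hm => hm.1, hFs, fun x hx => ?_⟩
  let L : X.p₁.Fib x →ₗ[ℝ] EuclideanSpace ℝ (Fin X.q.rank) ×
      EuclideanSpace ℝ (Fin (X.p₁.rank - X.q.rank)) := (hHl x hx.1).mk' _
  have hinj : Function.Injective L := by
    rw [injective_iff_map_eq_zero]
    rintro ⟨d, rfl⟩ hd
    have hd1 : S.Θ (X.p₂.proj d) = 0 := congrArg Prod.fst hd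
    have hd2 : F d = 0 := congrArg Prod.snd hd
    have hb : X.q.proj (X.p₂.proj d) = X.toBase d := X.proj_p₂ d
    have h2 : X.p₂.proj d = X.q.zero (X.toBase d) := by
      rw [← S.Ψ_Θ (X.p₂.proj d) (by rw [hb]; exact hx.1.1), hd1, hb]
      exact S.Ψ_zero _ hx.1.1
    exact Subtype.ext (hFl₀.eq_zero_of_core hx.1 ((hkey _ hx.1).mpr (hV _ hx.2)) d h2 hd2)
  have hdim : Module.finrank ℝ (X.p₁.Fib x) = Module.finrank ℝ
      (EuclideanSpace ℝ (Fin X.q.rank) × EuclideanSpace ℝ (Fin (X.p₁.rank - X.q.rank))) := by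
    rw [X.p₁.finrank_fib, Module.finrank_prod, finrank_euclideanSpace_fin,
      finrank_euclideanSpace_fin]
    have := rank_q_le m₀
    omega
  exact ⟨hinj, (LinearMap.injective_iff_surjective_of_finrank_eq_finrank hdim).mp hinj⟩

end IDVB

/-! ### Sections as functions on the total spaces -/

theorem smoothOn_of_smoothFun {X : Mfd.{u}} {U : Opens X} {f : U → ℝ} (hf : SmoothFun f)
    {g : X → ℝ} (h : ∀ x : U, g x.1 = f x) :
    ContMDiffOn (𝓡 X.dim) 𝓘(ℝ, ℝ) ∞ g U := fun x hx => by
  have : (fun y : U => g y.1) = f := funext h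
  have h1 : ContMDiffAt (𝓡 X.dim) 𝓘(ℝ, ℝ) ∞ (fun y : U => g y.1) ⟨x, hx⟩ := by
    rw [this]; exact hf _
  exact (contMDiffAt_subtype_iff.mp h1).contMDiffWithinAt

theorem smoothFun_of_smoothOn {X : Mfd.{u}} {U : Opens X} {g : X → ℝ}
    (hg : ContMDiffOn (𝓡 X.dim) 𝓘(ℝ, ℝ) ∞ g U) : SmoothFun (fun x : U => g x.1) := fun x =>
  contMDiffAt_subtype_iff.mpr (hg.contMDiffAt (U.2.mem_nhds x.2))

/-- A smooth function on `U` from a function on `X` which is smooth on `U`. -/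
noncomputable def Fun.ofSmoothOn {X : Mfd.{u}} (U : Opens X) (g : X → ℝ)
    (hg : ContMDiffOn (𝓡 X.dim) 𝓘(ℝ, ℝ) ∞ g U) : Fun X U :=
  ⟨fun x => g x.1, smoothFun_of_smoothOn hg⟩

namespace IDVB

variable {X : IDVB.{u}}

/-- The function on `Q` defined by a section of `Q^*` over `U`, extended by zero. -/
noncomputable def DualSection.ev {U : Opens X.M} (σ : X.DualSection U) (x : X.Q) : ℝ := by
  classical exact if h : X.q.proj x ∈ U then σ.toFun ⟨_, h⟩ ⟨x, rfl⟩ else 0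

theorem DualSection.ev_eq {U : Opens X.M} (σ : X.DualSection U) (m : U) (x : X.q.Fib m.1) :
    σ.ev x.1 = σ.toFun m x := by
  obtain ⟨m, hm⟩ := m
  obtain ⟨x, hx⟩ := x
  change X.q.proj x = m at hx
  subst hx
  exact dif_pos hm

theorem DualSection.smooth_ev {U : Opens X.M} (σ : X.DualSection U) :
    ContMDiffOn (𝓡 X.Q.dim) 𝓘(ℝ, ℝ) ∞ σ.ev (X.q.proj ⁻¹' U) :=
  smoothOn_of_smoothFun (U := preim X.q.smooth_proj U) σ.smooth fun x => σ.ev_eq ⟨_, x.2⟩ ⟨x.1, rfl⟩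

theorem DualSection.linear_ev {U : Opens X.M} (σ : X.DualSection U) (m : X.M) (hm : m ∈ U) :
    IsLinearMap ℝ (fun x : X.q.Fib m => σ.ev x.1) := by
  have : (fun x : X.q.Fib m => σ.ev x.1) = σ.toFun ⟨m, hm⟩ := funext fun x => σ.ev_eq ⟨m, hm⟩ x
  rw [this]
  exact LinearMap.isLinear _

/-- The section of `Q^*` over `U` given by a fibrewise linear function on `Q|_U`. -/
def DualSection.ofFun (U : Opens X.M) (t : X.Q → ℝ)
    (ht : ContMDiffOn (𝓡 X.Q.dim) 𝓘(ℝ, ℝ) ∞ t (X.q.proj ⁻¹' U))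
    (hl : ∀ m ∈ U, IsLinearMap ℝ (fun x : X.q.Fib m => t x.1)) : X.DualSection U where
  toFun m := (hl m.1 m.2).mk' _
  smooth := smoothFun_of_smoothOn (U := preim X.q.smooth_proj U) ht

theorem DualSection.ev_ofFun {U : Opens X.M} {t : X.Q → ℝ} {ht} {hl} {x : X.Q}
    (hx : X.q.proj x ∈ U) : (DualSection.ofFun U t ht hl).ev x = t x :=
  (DualSection.ofFun U t ht hl).ev_eq ⟨_, hx⟩ ⟨x, rfl⟩

/-- The value at `d ∈ D` of the doubly linear function corresponding to an isotropic linear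
section. -/
def isoEv {m : X.M} (χ : X.isotropicFib m) (d : X.D) (h : X.toBase d = m) : ℝ :=
  χ.1 ⟨X.p₁.proj d, h⟩ ⟨d, rfl⟩

theorem isoEv_eq {m : X.M} (χ : X.isotropicFib m) (x : X.q.Fib m) (d : X.p₁.Fib x.1)
    (h : X.toBase d.1 = m) : isoEv χ d.1 h = χ.1 x d := by
  obtain ⟨x, hx⟩ := x
  obtain ⟨d, hd⟩ := d
  change X.p₁.proj d = x at hd
  subst hd
  rfl

theorem toBase_fib {m : X.M} (x : X.q.Fib m) (d : X.p₁.Fib x.1) : X.toBase d.1 = m := by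
  rw [toBase, d.2, x.2]

theorem isoEv_ext {m : X.M} {χ χ' : X.isotropicFib m}
    (h : ∀ d hd, isoEv χ d hd = isoEv χ' d hd) : χ = χ' :=
  Subtype.ext (funext fun x => LinearMap.ext fun d => by
    rw [← isoEv_eq χ x d (toBase_fib x d), ← isoEv_eq χ' x d (toBase_fib x d)]
    exact h _ _)

theorem isoEv_congr {m : X.M} (χ : X.isotropicFib m) {d d' : X.D} (e : d = d') (h h') :
    isoEv χ d h = isoEv χ d' h' := by
  subst e; rfl

section Laws

variable {m : X.M} (χ : X.isotropicFib m)

theorem isoEv_add₁ (d e : X.D) (h) (hd : X.toBase d = m) (he : X.toBase e = m) (hde) :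
    isoEv χ (X.p₁.add d e h) hde = isoEv χ d hd + isoEv χ e he := by
  let x : X.q.Fib m := ⟨X.p₁.proj d, hd⟩
  have h1 := (χ.1 x).map_add ⟨d, rfl⟩ ⟨e, h.symm⟩
  rw [← isoEv_eq χ x ⟨d, rfl⟩ hd, ← isoEv_eq χ x ⟨e, h.symm⟩ he] at h1
  rw [← h1, ← isoEv_eq χ x _ (by rw [← X.p₁.add_coe, toBase_add₁]; exact hd)]
  exact isoEv_congr χ rfl _ _

theorem isoEv_smul₁ (r : ℝ) (d : X.D) (hd : X.toBase d = m) (hde) :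
    isoEv χ (X.p₁.smul r d) hde = r * isoEv χ d hd := by
  let x : X.q.Fib m := ⟨X.p₁.proj d, hd⟩
  have h1 := (χ.1 x).map_smul r ⟨d, rfl⟩
  rw [← isoEv_eq χ x ⟨d, rfl⟩ hd] at h1
  refine Eq.trans ?_ h1
  rw [← isoEv_eq χ x _ (by rw [← X.p₁.smul_coe, toBase_smul₁]; exact hd)]
  exact isoEv_congr χ rfl _ _

theorem isoEv_add₂ (d e : X.D) (h) (hd : X.toBase d = m) (he : X.toBase e = m) (hde) :
    isoEv χ (X.p₂.add d e h) hde = isoEv χ d hd + isoEv χ e he := by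
  have h1 := χ.2.add ⟨X.p₁.proj d, hd⟩ ⟨X.p₁.proj e, he⟩ ⟨d, rfl⟩ ⟨e, rfl⟩ h
  refine Eq.trans ?_ h1
  exact isoEv_eq χ _ ⟨_, p₁_add₂ (X := X) ⟨X.p₁.proj d, hd⟩ ⟨X.p₁.proj e, he⟩ ⟨d, rfl⟩ ⟨e, rfl⟩ h⟩ _

theorem isoEv_smul₂ (r : ℝ) (d : X.D) (hd : X.toBase d = m) (hde) :
    isoEv χ (X.p₂.smul r d) hde = r * isoEv χ d hd := by
  have h1 := χ.2.smul r ⟨X.p₁.proj d, hd⟩ ⟨d, rfl⟩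
  refine Eq.trans ?_ h1
  exact isoEv_eq χ _ ⟨_, p₁_smul₂ (X := X) r ⟨X.p₁.proj d, hd⟩ ⟨d, rfl⟩⟩ _

theorem isoEv_inv (d : X.D) (hd : X.toBase d = m) (hde) :
    isoEv χ (X.inv d) hde = -isoEv χ d hd := by
  have h1 := χ.2.isotropic ⟨X.p₁.proj d, hd⟩ ⟨d, rfl⟩
  rw [metric, ← isoEv_eq χ _ _ hd, ← isoEv_eq χ _ _ hde] at h1
  exact eq_neg_of_add_eq_zero_right h1

theorem isoEv_wedge (v v' : Module.Dual ℝ (X.q.Fib m)) (d : X.D) (hd : X.toBase d = m) :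
    isoEv (wedge v v') d hd = 1 / 2 *
      (v ⟨X.p₁.proj d, hd⟩ * v' ⟨X.p₂.proj d, (X.proj_p₂ d).trans hd⟩ -
        v' ⟨X.p₁.proj d, hd⟩ * v ⟨X.p₂.proj d, (X.proj_p₂ d).trans hd⟩) :=
  wedgeFun_apply v v' ⟨X.p₁.proj d, hd⟩ ⟨d, rfl⟩

end Laws

/-- Evaluation at a point of `D` as a linear functional. -/
def isoEvLin {m : X.M} (d : X.D) (h : X.toBase d = m) : X.isotropicFib m →ₗ[ℝ] ℝ where
  toFun χ := isoEv χ d h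
  map_add' _ _ := rfl
  map_smul' _ _ := rfl

/-- A skew-symmetric doubly linear function over `m` as an isotropic linear section: isotropy is
skew-symmetry under the involution. -/
def isoMk (m : X.M) (F : X.D → ℝ) (hF : X.IsDoublyLinear {m} F)
    (hs : ∀ d, X.toBase d = m → F (X.inv d) = -F d) : X.isotropicFib m where
  val x := (hF.isLinear₁ x.1 x.2).mk' _
  property :=
    { linear := by
        refine ⟨fun c => F c.1, fun x => funext fun c => ?_⟩
        change F (X.p₂.add _ _ (p₂_zero x c)) = _
        rw [hF.add₂ _ _ _ (by rw [toBase_zero₁]; exact x.2), hF.map_zero₁ _ x.2, zero_add]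
      add := fun x y d e h => hF.add₂ _ _ h (toBase_fib x d)
      smul := fun r x d => hF.smul₂ _ _ (toBase_fib x d)
      isotropic := fun x d => by
        change F d.1 + F (X.inv d.1) = 0
        rw [hs _ (toBase_fib x d), add_neg_cancel] }

/-- The function on `D` defined by an isotropic section over `U`, extended by zero. -/
noncomputable def IsotropicSection.ev {U : Opens X.M} (χ : X.IsotropicSection U) (d : X.D) : ℝ := by
  classical exact if h : X.toBase d ∈ U then isoEv (χ.toFun ⟨_, h⟩) d rfl else 0

theorem IsotropicSection.ev_eq {U : Opens X.M} (χ : X.IsotropicSection U) (m : U) (d : X.D)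
    (hd : X.toBase d = m.1) : χ.ev d = isoEv (χ.toFun m) d hd := by
  obtain ⟨m, hm⟩ := m
  change X.toBase d = m at hd
  subst hd
  exact dif_pos hm

theorem IsotropicSection.smooth_ev {U : Opens X.M} (χ : X.IsotropicSection U) :
    ContMDiffOn (𝓡 X.D.dim) 𝓘(ℝ, ℝ) ∞ χ.ev (X.toBase ⁻¹' U) :=
  smoothOn_of_smoothFun (U := preim X.smooth_toBase U) χ.smooth fun d =>
    χ.ev_eq ⟨_, d.2⟩ d.1 rfl

theorem IsotropicSection.doublyLinear_ev {U : Opens X.M} (χ : X.IsotropicSection U) :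
    X.IsDoublyLinear U χ.ev where
  add₁ d e h hd := by
    have he : X.toBase e = X.toBase d := by rw [toBase, ← h]; rfl
    rw [χ.ev_eq ⟨_, hd⟩ d rfl, χ.ev_eq ⟨_, hd⟩ e he, χ.ev_eq ⟨_, hd⟩ _ (toBase_add₁ X d e h),
      isoEv_add₁]
  smul₁ r d hd := by
    rw [χ.ev_eq ⟨_, hd⟩ d rfl, χ.ev_eq ⟨_, hd⟩ _ (toBase_smul₁ X r d), isoEv_smul₁, smul_eq_mul]
  add₂ d e h hd := by
    have he : X.toBase e = X.toBase d := by rw [← X.proj_p₂, ← h, X.proj_p₂]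
    rw [χ.ev_eq ⟨_, hd⟩ d rfl, χ.ev_eq ⟨_, hd⟩ e he, χ.ev_eq ⟨_, hd⟩ _ (toBase_add₂ X d e h),
      isoEv_add₂]
  smul₂ r d hd := by
    rw [χ.ev_eq ⟨_, hd⟩ d rfl, χ.ev_eq ⟨_, hd⟩ _ (toBase_smul₂ X r d), isoEv_smul₂, smul_eq_mul]

theorem IsotropicSection.ev_inv {U : Opens X.M} (χ : X.IsotropicSection U) (d : X.D)
    (hd : X.toBase d ∈ U) : χ.ev (X.inv d) = -χ.ev d := by
  rw [χ.ev_eq ⟨_, hd⟩ d rfl, χ.ev_eq ⟨_, hd⟩ _ (toBase_inv X d), isoEv_inv]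

/-- An isotropic section from a skew-symmetric doubly linear function on `D`. -/
def IsotropicSection.ofFun (U : Opens X.M) (F : X.D → ℝ)
    (hF : ContMDiffOn (𝓡 X.D.dim) 𝓘(ℝ, ℝ) ∞ F (X.toBase ⁻¹' U))
    (hl : X.IsDoublyLinear U F) (hs : ∀ d, X.toBase d ∈ U → F (X.inv d) = -F d) :
    X.IsotropicSection U where
  toFun m := isoMk m.1 F (hl.mono_set (Set.singleton_subset_iff.mpr m.2))
    fun d hd => hs d (by rw [hd]; exact m.2)
  smooth := smoothFun_of_smoothOn (U := preim X.smooth_toBase U) hF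

theorem IsotropicSection.ev_ofFun {U : Opens X.M} {F : X.D → ℝ} {hF} {hl} {hs} {d : X.D}
    (hd : X.toBase d ∈ U) : (IsotropicSection.ofFun U F hF hl hs).ev d = F d :=
  (IsotropicSection.ofFun U F hF hl hs).ev_eq ⟨_, hd⟩ d rfl

/-! ### Frames -/

/-- `τ_i` and `χ_j` are a frame over `U` if `d ↦ (m, τ(π₁ d), τ(π₂ d), χ(d))` is a bijection from
`D|_U` onto `U × ℝ^{r₁} × ℝ^{r₁} × ℝ^{r₂}`, where `m` is the base point of `d`. -/
def IsFrame {U : Opens X.M} {r₁ r₂ : ℕ} (τ : Fin r₁ → X.DualSection U)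
    (χ : Fin r₂ → X.IsotropicSection U) : Prop :=
  ∀ m ∈ U, ∀ (a b : Fin r₁ → ℝ) (c : Fin r₂ → ℝ), ∃! d : X.D, X.toBase d = m ∧
    (∀ i, (τ i).ev (X.p₁.proj d) = a i) ∧ (∀ i, (τ i).ev (X.p₂.proj d) = b i) ∧
    ∀ j, (χ j).ev d = c j

/-- Every point has a neighbourhood with a frame: the components of the fibre coordinates of
`exists_localCoordinates`. -/
theorem exists_frame (m₀ : X.M) : ∃ (U : Opens X.M) (τ : Fin X.q.rank → X.DualSection U)
    (χ : Fin (X.p₁.rank - X.q.rank) → X.IsotropicSection U), m₀ ∈ U ∧ IsFrame τ χ := by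
  obtain ⟨U, t, c, hU, ht, htl, htb, hc, hcl, hcs, hb⟩ := exists_localCoordinates m₀
  have ht' : ∀ i, ContMDiffOn (𝓡 X.Q.dim) 𝓘(ℝ, ℝ) ∞ (fun x => t x i) (X.q.proj ⁻¹' U) := fun i =>
    (EuclideanSpace.proj (𝕜 := ℝ) i).contDiff.contMDiff.comp_contMDiffOn ht
  have hc' : ∀ i, ContMDiffOn (𝓡 X.D.dim) 𝓘(ℝ, ℝ) ∞ (fun d => c d i) (X.toBase ⁻¹' U) := fun i =>
    (EuclideanSpace.proj (𝕜 := ℝ) i).contDiff.contMDiff.comp_contMDiffOn hc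
  let τ : Fin X.q.rank → X.DualSection U := fun i => DualSection.ofFun U (fun x => t x i) (ht' i)
    fun m hm => ⟨fun x y => by rw [(htl m hm).map_add]; rfl,
      fun r x => by rw [(htl m hm).map_smul]; rfl⟩
  let χ : Fin (X.p₁.rank - X.q.rank) → X.IsotropicSection U := fun j =>
    IsotropicSection.ofFun U (fun d => c d j) (hc' j)
      ⟨fun d e h hd => by rw [hcl.add₁ d e h hd]; rfl, fun r d hd => by rw [hcl.smul₁ r d hd]; rfl,
        fun d e h hd => by rw [hcl.add₂ d e h hd]; rfl,
        fun r d hd => by rw [hcl.smul₂ r d hd]; rfl⟩ fun d _ => by rw [hcs]; rfl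
  refine ⟨U, τ, χ, hU, fun m hm a b c' => ?_⟩
  obtain ⟨⟨x, rfl⟩, hx⟩ := (htb m hm).2 (WithLp.toLp 2 a)
  obtain ⟨⟨d, rfl⟩, hd⟩ := (hb x hm).2 (WithLp.toLp 2 b, WithLp.toLp 2 c')
  have hτ : ∀ i y, X.q.proj y ∈ U → (τ i).ev y = t y i := fun i y hy => DualSection.ev_ofFun hy
  have hχ : ∀ j d, X.toBase d ∈ U → (χ j).ev d = c d j := fun j d hd =>
    IsotropicSection.ev_ofFun hd
  have hd1 : t (X.p₂.proj d) = WithLp.toLp 2 b := congrArg Prod.fst hd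
  have hd2 : c d = WithLp.toLp 2 c' := congrArg Prod.snd hd
  change t (X.p₁.proj d) = _ at hx
  refine ⟨d, ⟨rfl, fun i => ?_, fun i => ?_, fun j => ?_⟩, ?_⟩
  · rw [hτ _ _ hm, hx]
  · rw [hτ _ _ (by rw [X.proj_p₂]; exact hm), hd1]
  · rw [hχ _ _ hm, hd2]
  · rintro d' ⟨h0, h1, h2, h3⟩
    have hm' : X.toBase d' ∈ U := by rw [h0]; exact hm
    have e1 : X.p₁.proj d' = X.p₁.proj d := by
      have := (htb _ hm).1 (a₁ := ⟨X.p₁.proj d', h0⟩) (a₂ := ⟨X.p₁.proj d, rfl⟩) (by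
        change t (X.p₁.proj d') = t (X.p₁.proj d)
        rw [hx]
        ext i
        rw [← hτ i _ hm', h1])
      exact congrArg Subtype.val this
    have e2 := (hb _ hm).1 (a₁ := ⟨d', e1⟩) (a₂ := ⟨d, rfl⟩) (by
      change (t (X.p₂.proj d'), c d') = (t (X.p₂.proj d), c d)
      rw [hd1, hd2]
      refine Prod.ext ?_ ?_
      · ext i
        change t (X.p₂.proj d') i = _
        rw [← hτ i _ (by rw [X.proj_p₂]; exact hm'), h2]
      · ext j
        change c d' j = _
        rw [← hχ j _ hm', h3])
    exact congrArg Subtype.val e2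

end IDVB

/-! ### Coordinates and expansions with respect to a frame -/

/-- A function which is linear in `(b, c)` and in `(a, c)` is the sum of a linear function of `c`
and a bilinear function of `(a, b)`. -/
theorem expand_doublyLinear {r₁ r₂ : ℕ} (g : (Fin r₁ → ℝ) → (Fin r₁ → ℝ) → (Fin r₂ → ℝ) → ℝ)
    (h1 : ∀ a b b' c c', g a (b + b') (c + c') = g a b c + g a b' c')
    (h2 : ∀ (r : ℝ) a b c, g a (r • b) (r • c) = r * g a b c)
    (h3 : ∀ a a' b c c', g (a + a') b (c + c') = g a b c + g a' b c')
    (h4 : ∀ (r : ℝ) a b c, g (r • a) b (r • c) = r * g a b c) (a b : Fin r₁ → ℝ)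
    (c : Fin r₂ → ℝ) :
    g a b c = ∑ j, c j * g 0 0 (Pi.single j 1) +
      ∑ i, ∑ k, a i * b k * g (Pi.single i 1) (Pi.single k 1) 0 := by
  have e1 : g a b c = g a b 0 + g 0 0 c := by
    have e2 := h1 a b 0 0 c
    have e3 := h3 a 0 0 0 c
    have e4 := h2 0 a 0 0
    simp only [zero_smul, zero_mul, add_zero, zero_add] at e2 e3 e4
    rw [e2, e3, e4, zero_add]
  let L0 : (Fin r₂ → ℝ) →ₗ[ℝ] ℝ :=
    { toFun := fun c => g 0 0 c
      map_add' := fun c c' => by simpa using h1 0 0 0 c c'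
      map_smul' := fun r c => by simpa using h2 r 0 0 c }
  let L : (Fin r₁ → ℝ) →ₗ[ℝ] (Fin r₁ → ℝ) →ₗ[ℝ] ℝ := LinearMap.mk₂ ℝ (fun a b => g a b 0)
    (fun a a' b => by simpa using h3 a a' b 0 0) (fun r a b => by simpa using h4 r a b 0)
    (fun a b b' => by simpa using h1 a b b' 0 0) (fun r a b => by simpa using h2 r a b 0)
  have e0 : g 0 0 c = ∑ j, c j * g 0 0 (Pi.single j 1) := by
    change L0 c = ∑ j, c j * L0 (Pi.single j 1)
    conv_lhs => rw [pi_eq_sum_univ' c]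
    simp
  have e5 : g a b 0 = ∑ i, ∑ k, a i * b k * g (Pi.single i 1) (Pi.single k 1) 0 := by
    change L a b = ∑ i, ∑ k, a i * b k * L (Pi.single i 1) (Pi.single k 1)
    conv_lhs => rw [pi_eq_sum_univ' a, pi_eq_sum_univ' b]
    simp only [_root_.map_sum, LinearMap.sum_apply, _root_.map_smul, LinearMap.smul_apply,
      smul_eq_mul, Finset.mul_sum]
    rw [Finset.sum_comm]
    exact Finset.sum_congr rfl fun i _ => Finset.sum_congr rfl fun k _ => by ring
  rw [e1, e0, e5, add_comm]

namespace IDVB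

variable {X : IDVB.{u}} {U : Opens X.M} {r₁ r₂ : ℕ} {τ : Fin r₁ → X.DualSection U}
  {χ : Fin r₂ → X.IsotropicSection U}

namespace IsFrame

/-- The point of `D` over `m` with given coordinates with respect to a frame; outside the domain of
the frame it is a zero vector. -/
noncomputable def pt (h : IsFrame τ χ) (m : X.M) (a b : Fin r₁ → ℝ) (c : Fin r₂ → ℝ) : X.D := by
  classical exact if hm : m ∈ U then (h m hm a b c).choose else X.p₁.zero (X.q.zero m)

variable (h : IsFrame τ χ) {m : X.M}

theorem pt_spec (hm : m ∈ U) (a b : Fin r₁ → ℝ) (c : Fin r₂ → ℝ) :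
    X.toBase (h.pt m a b c) = m ∧ (∀ i, (τ i).ev (X.p₁.proj (h.pt m a b c)) = a i) ∧
      (∀ i, (τ i).ev (X.p₂.proj (h.pt m a b c)) = b i) ∧ ∀ j, (χ j).ev (h.pt m a b c) = c j := by
  have : h.pt m a b c = (h m hm a b c).choose := dif_pos hm
  rw [this]
  exact (h m hm a b c).choose_spec.1

theorem eq_of_coords (h : IsFrame τ χ) (hm : m ∈ U) {d d' : X.D} (hd : X.toBase d = m)
    (hd' : X.toBase d' = m)
    (h1 : ∀ i, (τ i).ev (X.p₁.proj d) = (τ i).ev (X.p₁.proj d'))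
    (h2 : ∀ i, (τ i).ev (X.p₂.proj d) = (τ i).ev (X.p₂.proj d'))
    (h3 : ∀ j, (χ j).ev d = (χ j).ev d') : d = d' :=
  (h m hm _ _ _).unique ⟨hd, h1, h2, h3⟩ ⟨hd', fun _ => rfl, fun _ => rfl, fun _ => rfl⟩

theorem pt_unique (hm : m ∈ U) {a b : Fin r₁ → ℝ} {c : Fin r₂ → ℝ} {d : X.D} (hd : X.toBase d = m)
    (h1 : ∀ i, (τ i).ev (X.p₁.proj d) = a i) (h2 : ∀ i, (τ i).ev (X.p₂.proj d) = b i)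
    (h3 : ∀ j, (χ j).ev d = c j) : d = h.pt m a b c :=
  (h m hm a b c).unique ⟨hd, h1, h2, h3⟩ (h.pt_spec hm a b c)

/-- The `τ_i` separate the points of the fibres of `Q`. A frame is a condition on `D` only; the
claim follows by embedding `Q` into `D` as the zero section of `π₁`. -/
theorem injective_dual (h : IsFrame τ χ) (hm : m ∈ U) {x y : X.Q} (hx : X.q.proj x = m)
    (hy : X.q.proj y = m)
    (hxy : ∀ i, (τ i).ev x = (τ i).ev y) : x = y := by
  have hz : ∀ x, X.q.proj x = m → ∀ j, (χ j).ev (X.p₁.zero x) = 0 := fun x hx j =>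
    (χ j).doublyLinear_ev.map_zero₁ x (by rw [hx]; exact hm)
  have := h.eq_of_coords hm (d := X.p₁.zero x) (d' := X.p₁.zero y)
    (by rw [toBase_zero₁, hx]) (by rw [toBase_zero₁, hy])
    (fun i => by rw [X.p₁.proj_zero, X.p₁.proj_zero, hxy])
    (fun i => by rw [p₂_zero₁, p₂_zero₁, hx, hy]) (fun j => by rw [hz x hx, hz y hy])
  have h2 := congrArg X.p₁.proj this
  rwa [X.p₁.proj_zero, X.p₁.proj_zero] at h2

theorem p₁_pt_eq (hm : m ∈ U) (a b b' : Fin r₁ → ℝ) (c c' : Fin r₂ → ℝ) :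
    X.p₁.proj (h.pt m a b c) = X.p₁.proj (h.pt m a b' c') := by
  have h1 := h.pt_spec hm a b c
  have h2 := h.pt_spec hm a b' c'
  exact h.injective_dual hm h1.1 h2.1 fun i => by rw [h1.2.1, h2.2.1]

theorem p₂_pt_eq (hm : m ∈ U) (a a' b : Fin r₁ → ℝ) (c c' : Fin r₂ → ℝ) :
    X.p₂.proj (h.pt m a b c) = X.p₂.proj (h.pt m a' b c') := by
  have h1 := h.pt_spec hm a b c
  have h2 := h.pt_spec hm a' b c'
  exact h.injective_dual hm ((X.proj_p₂ _).trans h1.1) ((X.proj_p₂ _).trans h2.1)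
    fun i => by rw [h1.2.2.1, h2.2.2.1]

theorem ev_add (σ : X.DualSection U) {m : X.M} (hm : m ∈ U) (x y : X.Q) (hx : X.q.proj x = m)
    (hxy : X.q.proj x = X.q.proj y) : σ.ev (X.q.add x y hxy) = σ.ev x + σ.ev y := by
  subst hx
  exact (σ.linear_ev _ hm).map_add ⟨x, rfl⟩ ⟨y, hxy.symm⟩

theorem ev_smul (σ : X.DualSection U) {m : X.M} (hm : m ∈ U) (r : ℝ) (x : X.Q)
    (hx : X.q.proj x = m) : σ.ev (X.q.smul r x) = r * σ.ev x := by
  subst hx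
  exact (σ.linear_ev _ hm).map_smul r ⟨x, rfl⟩

theorem pt_add₁ (hm : m ∈ U) (a b b' : Fin r₁ → ℝ) (c c' : Fin r₂ → ℝ) :
    h.pt m a (b + b') (c + c') =
      X.p₁.add (h.pt m a b c) (h.pt m a b' c') (h.p₁_pt_eq hm a b b' c c') := by
  have h1 := h.pt_spec hm a b c
  have h2 := h.pt_spec hm a b' c'
  refine (h.pt_unique hm ?_ (fun i => ?_) (fun i => ?_) fun j => ?_).symm
  · rw [toBase_add₁, h1.1]
  · rw [X.p₁.proj_add, h1.2.1]
  · rw [X.dvb.πB_morphism.map_add, ev_add (τ i) hm _ _ ((X.proj_p₂ _).trans h1.1), h1.2.2.1,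
      h2.2.2.1]; rfl
  · rw [(χ j).doublyLinear_ev.add₁ _ _ _ (by rw [h1.1]; exact hm), h1.2.2.2, h2.2.2.2]; rfl

theorem pt_smul₁ (hm : m ∈ U) (r : ℝ) (a b : Fin r₁ → ℝ) (c : Fin r₂ → ℝ) :
    h.pt m a (r • b) (r • c) = X.p₁.smul r (h.pt m a b c) := by
  have h1 := h.pt_spec hm a b c
  refine (h.pt_unique hm ?_ (fun i => ?_) (fun i => ?_) fun j => ?_).symm
  · rw [toBase_smul₁, h1.1]
  · rw [X.p₁.proj_smul, h1.2.1]
  · rw [X.dvb.πB_morphism.map_smul, ev_smul (τ i) hm _ _ ((X.proj_p₂ _).trans h1.1), h1.2.2.1]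
    rfl
  · rw [(χ j).doublyLinear_ev.smul₁ _ _ (by rw [h1.1]; exact hm), h1.2.2.2]; rfl

theorem pt_add₂ (hm : m ∈ U) (a a' b : Fin r₁ → ℝ) (c c' : Fin r₂ → ℝ) :
    h.pt m (a + a') b (c + c') =
      X.p₂.add (h.pt m a b c) (h.pt m a' b c') (h.p₂_pt_eq hm a a' b c c') := by
  have h1 := h.pt_spec hm a b c
  have h2 := h.pt_spec hm a' b c'
  refine (h.pt_unique hm ?_ (fun i => ?_) (fun i => ?_) fun j => ?_).symm
  · rw [toBase_add₂, h1.1]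
  · rw [X.dvb.πA_morphism.map_add, ev_add (τ i) hm _ _ h1.1, h1.2.1, h2.2.1]; rfl
  · rw [X.p₂.proj_add, h1.2.2.1]
  · rw [(χ j).doublyLinear_ev.add₂ _ _ _ (by rw [h1.1]; exact hm), h1.2.2.2, h2.2.2.2]; rfl

theorem pt_smul₂ (hm : m ∈ U) (r : ℝ) (a b : Fin r₁ → ℝ) (c : Fin r₂ → ℝ) :
    h.pt m (r • a) b (r • c) = X.p₂.smul r (h.pt m a b c) := by
  have h1 := h.pt_spec hm a b c
  refine (h.pt_unique hm ?_ (fun i => ?_) (fun i => ?_) fun j => ?_).symm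
  · rw [toBase_smul₂, h1.1]
  · rw [X.dvb.πA_morphism.map_smul, ev_smul (τ i) hm _ _ h1.1, h1.2.1]; rfl
  · rw [X.p₂.proj_smul, h1.2.2.1]
  · rw [(χ j).doublyLinear_ev.smul₂ _ _ (by rw [h1.1]; exact hm), h1.2.2.2]; rfl

theorem inv_pt (hm : m ∈ U) (a b : Fin r₁ → ℝ) (c : Fin r₂ → ℝ) :
    X.inv (h.pt m a b c) = h.pt m b a (-c) := by
  have h1 := h.pt_spec hm a b c
  refine h.pt_unique hm ?_ (fun i => ?_) (fun i => ?_) fun j => ?_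
  · rw [toBase_inv, h1.1]
  · rw [X.p₁_inv, h1.2.2.1]
  · rw [X.p₂_inv, h1.2.1]
  · rw [(χ j).ev_inv _ (by rw [h1.1]; exact hm), h1.2.2.2]; rfl

/-- The vector of `Q` over `m` with given coordinates. -/
noncomputable def qpt (m : X.M) (a : Fin r₁ → ℝ) : X.Q := X.p₁.proj (h.pt m a 0 0)

theorem proj_qpt (hm : m ∈ U) (a : Fin r₁ → ℝ) : X.q.proj (h.qpt m a) = m :=
  (h.pt_spec hm a 0 0).1

theorem ev_qpt (hm : m ∈ U) (a : Fin r₁ → ℝ) (i : Fin r₁) : (τ i).ev (h.qpt m a) = a i :=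
  (h.pt_spec hm a 0 0).2.1 i

theorem p₁_pt (hm : m ∈ U) (a b : Fin r₁ → ℝ) (c : Fin r₂ → ℝ) :
    X.p₁.proj (h.pt m a b c) = h.qpt m a :=
  h.p₁_pt_eq hm _ _ _ _ _

theorem p₂_pt (hm : m ∈ U) (a b : Fin r₁ → ℝ) (c : Fin r₂ → ℝ) :
    X.p₂.proj (h.pt m a b c) = h.qpt m b := by
  have h1 := h.pt_spec hm a b c
  exact h.injective_dual hm ((X.proj_p₂ _).trans h1.1) (h.proj_qpt hm b)
    fun i => by rw [h1.2.2.1, h.ev_qpt hm]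

/-! ### Smoothness of the inverse charts -/

/-- The inverse chart of `Q` is smooth. -/
theorem smooth_qpt : ContMDiffOn ((𝓡 X.M.dim).prod (𝓡 r₁)) (𝓡 X.Q.dim) ∞
    (fun p : X.M × EuclideanSpace ℝ (Fin r₁) => h.qpt p.1 p.2) ((U : Set X.M) ×ˢ Set.univ) := by
  refine X.q.smooth_of_fibrewise_bijective U (fun x => WithLp.toLp 2 fun i => (τ i).ev x) ?_
    (fun m hm => ?_) (fun m hm => ⟨?_, ?_⟩) _ (fun m hm v => ⟨h.proj_qpt hm _, ?_⟩)
  · exact PiLp.contDiff_toLp.contMDiff.comp_contMDiffOn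
      (contMDiffOn_pi_space.mpr fun i => (τ i).smooth_ev)
  · refine ⟨fun x y => ?_, fun r x => ?_⟩
    · ext i
      exact ((τ i).linear_ev m hm).map_add x y
    · ext i
      exact ((τ i).linear_ev m hm).map_smul r x
  · intro x y hxy
    refine Subtype.ext (h.injective_dual hm x.2 y.2 fun i => ?_)
    exact congrArg (fun v : EuclideanSpace ℝ (Fin r₁) => v i) hxy
  · intro v
    refine ⟨⟨h.qpt m v, h.proj_qpt hm v⟩, ?_⟩
    ext i
    exact h.ev_qpt hm v i
  · ext i
    exact h.ev_qpt hm v i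

theorem smooth_evCoords {U : Opens X.M} {r : ℕ} (σ : Fin r → X.DualSection U) :
    ContMDiffOn (𝓡 X.Q.dim) (𝓡 r) ∞ (fun x => WithLp.toLp 2 fun i => (σ i).ev x)
      (X.q.proj ⁻¹' U) :=
  PiLp.contDiff_toLp.contMDiff.comp_contMDiffOn
    (contMDiffOn_pi_space.mpr fun i => (σ i).smooth_ev)

/-- The inverse chart of `D` as a bundle over `Q` is smooth: over the domain of the frame,
`(τ ∘ π₂, χ)` is a fibrewise linear isomorphism for `π₁`. -/
theorem smooth_pt_over : ContMDiffOn
    ((𝓡 X.Q.dim).prod 𝓘(ℝ, EuclideanSpace ℝ (Fin r₁) × EuclideanSpace ℝ (Fin r₂))) (𝓡 X.D.dim) ∞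
    (fun p : X.Q × (EuclideanSpace ℝ (Fin r₁) × EuclideanSpace ℝ (Fin r₂)) =>
      h.pt (X.q.proj p.1) (fun i => (τ i).ev p.1) p.2.1 p.2.2)
    ((X.q.proj ⁻¹' U) ×ˢ Set.univ) := by
  have hp : ∀ x, X.q.proj x ∈ U → ∀ b c, X.p₁.proj (h.pt (X.q.proj x)
      (fun i => (τ i).ev x) b c) = x := fun x hx b c => by
    rw [h.p₁_pt hx]
    exact h.injective_dual hx (h.proj_qpt hx _) rfl fun i => h.ev_qpt hx _ i
  refine X.p₁.smooth_of_fibrewise_bijective (preim X.q.smooth_proj U)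
    (fun d => (WithLp.toLp 2 fun i => (τ i).ev (X.p₂.proj d), WithLp.toLp 2 fun j => (χ j).ev d))
    ?_ (fun x hx => ⟨fun d e => ?_, fun r d => ?_⟩) (fun x hx => ⟨fun d e hde => ?_, fun v => ?_⟩) _
    (fun x hx v => ⟨hp x hx _ _, ?_⟩)
  · refine ContMDiffOn.prodMk_space ?_ ?_
    · have hs : ∀ d ∈ X.p₁.proj ⁻¹' (preim X.q.smooth_proj U), X.p₂.proj d ∈ X.q.proj ⁻¹' U :=
        fun d hd => by
          change X.q.proj (X.p₂.proj d) ∈ U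
          rw [X.proj_p₂]
          exact hd
      exact (smooth_evCoords τ).comp X.p₂.smooth_proj.contMDiffOn hs
    · exact PiLp.contDiff_toLp.contMDiff.comp_contMDiffOn
        (contMDiffOn_pi_space.mpr fun i => (χ i).smooth_ev)
  · have hx' : X.q.proj x ∈ U := hx
    refine Prod.ext ?_ ?_
    · ext i
      exact (congrArg (τ i).ev (congrArg Subtype.val ((snd ⟨x, rfl⟩).map_add d e))).trans
        (((τ i).linear_ev _ hx').map_add (snd ⟨x, rfl⟩ d) (snd ⟨x, rfl⟩ e))
    · ext j
      exact ((χ j).doublyLinear_ev.isLinear₁ x hx').map_add d e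
  · have hx' : X.q.proj x ∈ U := hx
    refine Prod.ext ?_ ?_
    · ext i
      exact (congrArg (τ i).ev (congrArg Subtype.val ((snd ⟨x, rfl⟩).map_smul r d))).trans
        (((τ i).linear_ev _ hx').map_smul r (snd ⟨x, rfl⟩ d))
    · ext j
      exact ((χ j).doublyLinear_ev.isLinear₁ x hx').map_smul r d
  · have hb : ∀ d : X.p₁.Fib x, X.toBase d.1 = X.q.proj x := fun d => by rw [toBase, d.2]
    have h1 := congrArg Prod.fst hde
    have h2 := congrArg Prod.snd hde
    refine Subtype.ext (h.eq_of_coords hx (hb d) (hb e) (fun i => by rw [d.2, e.2])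
      (fun i => ?_) fun j => ?_)
    · exact congrArg (fun v : EuclideanSpace ℝ (Fin r₁) => v i) h1
    · exact congrArg (fun v : EuclideanSpace ℝ (Fin r₂) => v j) h2
  · have h1 := h.pt_spec hx (fun i => (τ i).ev x) v.1 v.2
    refine ⟨⟨_, hp x hx v.1 v.2⟩, Prod.ext ?_ ?_⟩
    · ext i
      exact h1.2.2.1 i
    · ext j
      exact h1.2.2.2 j
  · have h1 := h.pt_spec hx (fun i => (τ i).ev x) v.1 v.2
    refine Prod.ext ?_ ?_
    · ext i
      exact h1.2.2.1 i
    · ext j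
      exact h1.2.2.2 j

/-- The inverse chart of `D` is smooth. -/
theorem smooth_pt : ContMDiffOn ((𝓡 X.M.dim).prod ((𝓡 r₁).prod ((𝓡 r₁).prod (𝓡 r₂)))) (𝓡 X.D.dim) ∞
    (fun p : X.M × EuclideanSpace ℝ (Fin r₁) × EuclideanSpace ℝ (Fin r₁) ×
      EuclideanSpace ℝ (Fin r₂) => h.pt p.1 p.2.1 p.2.2.1 p.2.2.2)
    ((U : Set X.M) ×ˢ Set.univ) := by
  have h1 : ContMDiffOn ((𝓡 X.M.dim).prod ((𝓡 r₁).prod ((𝓡 r₁).prod (𝓡 r₂)))) (𝓡 X.Q.dim) ∞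
      (fun p : X.M × EuclideanSpace ℝ (Fin r₁) × EuclideanSpace ℝ (Fin r₁) ×
        EuclideanSpace ℝ (Fin r₂) => h.qpt p.1 p.2.1) ((U : Set X.M) ×ˢ Set.univ) :=
    h.smooth_qpt.comp (contMDiff_fst.prodMk (contMDiff_fst.comp contMDiff_snd)).contMDiffOn
      fun p hp => ⟨hp.1, trivial⟩
  have h2 : ContMDiff ((𝓡 X.M.dim).prod ((𝓡 r₁).prod ((𝓡 r₁).prod (𝓡 r₂))))
      𝓘(ℝ, EuclideanSpace ℝ (Fin r₁) × EuclideanSpace ℝ (Fin r₂)) ∞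
      (fun p : X.M × EuclideanSpace ℝ (Fin r₁) × EuclideanSpace ℝ (Fin r₁) ×
        EuclideanSpace ℝ (Fin r₂) => (p.2.2.1, p.2.2.2)) :=
    ContMDiff.prodMk_space (contMDiff_fst.comp (contMDiff_snd.comp contMDiff_snd))
      (contMDiff_snd.comp (contMDiff_snd.comp contMDiff_snd))
  have h3 := h.smooth_pt_over.comp (h1.prodMk h2.contMDiffOn)
    fun p hp => ⟨show X.q.proj (h.qpt p.1 p.2.1) ∈ U by rw [h.proj_qpt hp.1]; exact hp.1, trivial⟩
  refine h3.congr fun p hp => ?_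
  simp only [Function.comp_apply]
  rw [h.proj_qpt hp.1]
  congr 1
  funext i
  exact (h.ev_qpt hp.1 _ i).symm

/-- A map into `D` is smooth where its coordinates with respect to a frame are. -/
theorem smoothAt_D (h : IsFrame τ χ) {Z : Mfd.{u}} {F : Z → X.D} {z : Z} (hz : X.toBase (F z) ∈ U)
    (h0 : ContMDiffAt (𝓡 Z.dim) (𝓡 X.M.dim) ∞ (fun z => X.toBase (F z)) z)
    (h1 : ∀ i, ContMDiffAt (𝓡 Z.dim) 𝓘(ℝ, ℝ) ∞ (fun z => (τ i).ev (X.p₁.proj (F z))) z)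
    (h2 : ∀ i, ContMDiffAt (𝓡 Z.dim) 𝓘(ℝ, ℝ) ∞ (fun z => (τ i).ev (X.p₂.proj (F z))) z)
    (h3 : ∀ j, ContMDiffAt (𝓡 Z.dim) 𝓘(ℝ, ℝ) ∞ (fun z => (χ j).ev (F z)) z) :
    ContMDiffAt (𝓡 Z.dim) (𝓡 X.D.dim) ∞ F z := by
  have toE : ∀ {r : ℕ} {f : Fin r → Z → ℝ}, (∀ i, ContMDiffAt (𝓡 Z.dim) 𝓘(ℝ, ℝ) ∞ (f i) z) →
      ContMDiffAt (𝓡 Z.dim) (𝓡 r) ∞ (fun z => WithLp.toLp 2 fun i => f i z) z := fun hf =>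
    PiLp.contDiff_toLp.contMDiff.contMDiffAt.comp z (contMDiffAt_pi_space.mpr hf)
  have h4 := (h.smooth_pt.contMDiffAt ((U.2.prod isOpen_univ).mem_nhds (x :=
      (X.toBase (F z), WithLp.toLp 2 fun i => (τ i).ev (X.p₁.proj (F z)),
        WithLp.toLp 2 fun i => (τ i).ev (X.p₂.proj (F z)),
        WithLp.toLp 2 fun j => (χ j).ev (F z))) ⟨hz, trivial⟩)).comp z
    (h0.prodMk ((toE h1).prodMk ((toE h2).prodMk (toE h3))))
  refine h4.congr_of_eventuallyEq ?_
  filter_upwards [h0.continuousAt.preimage_mem_nhds (U.2.mem_nhds hz)] with z' hz'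
  exact h.pt_unique hz' rfl (fun _ => rfl) (fun _ => rfl) fun _ => rfl

/-- A map into `Q` is smooth where its coordinates with respect to a frame are. -/
theorem smoothAt_Q (h : IsFrame τ χ) {Z : Mfd.{u}} {F : Z → X.Q} {z : Z} (hz : X.q.proj (F z) ∈ U)
    (h0 : ContMDiffAt (𝓡 Z.dim) (𝓡 X.M.dim) ∞ (fun z => X.q.proj (F z)) z)
    (h1 : ∀ i, ContMDiffAt (𝓡 Z.dim) 𝓘(ℝ, ℝ) ∞ (fun z => (τ i).ev (F z)) z) :
    ContMDiffAt (𝓡 Z.dim) (𝓡 X.Q.dim) ∞ F z := by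
  have h2 : ContMDiffAt (𝓡 Z.dim) (𝓡 r₁) ∞
      (fun z => WithLp.toLp 2 fun i => (τ i).ev (F z)) z :=
    PiLp.contDiff_toLp.contMDiff.contMDiffAt.comp z (contMDiffAt_pi_space.mpr h1)
  have h4 := (h.smooth_qpt.contMDiffAt ((U.2.prod isOpen_univ).mem_nhds (x :=
      (X.q.proj (F z), WithLp.toLp 2 fun i => (τ i).ev (F z))) ⟨hz, trivial⟩)).comp z
    (h0.prodMk h2)
  refine h4.congr_of_eventuallyEq ?_
  filter_upwards [h0.continuousAt.preimage_mem_nhds (U.2.mem_nhds hz)] with z' hz'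
  exact h.injective_dual hz' rfl (h.proj_qpt hz' _)
    fun i => (h.ev_qpt hz' (fun i => (τ i).ev (F z')) i).symm

/-! ### Expansion of sections in a frame -/

/-- Every covector is a combination of the `τ_i`. -/
theorem dual_expand (hm : m ∈ U) (v : Module.Dual ℝ (X.q.Fib m)) :
    v = ∑ i, v ⟨h.qpt m (Pi.single i 1), h.proj_qpt hm _⟩ • (τ i).toFun ⟨m, hm⟩ := by
  let E : X.q.Fib m →ₗ[ℝ] (Fin r₁ → ℝ) := LinearMap.pi fun i => (τ i).toFun ⟨m, hm⟩
  have hE : ∀ x i, E x i = (τ i).ev x.1 := fun x i => ((τ i).ev_eq ⟨m, hm⟩ x).symm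
  have hinj : Function.Injective E := fun x y hxy => Subtype.ext <|
    h.injective_dual hm x.2 y.2 fun i => by rw [← hE, ← hE, hxy]
  have hEq : ∀ a, E ⟨h.qpt m a, h.proj_qpt hm _⟩ = a := fun a => funext fun i => by
    rw [hE, h.ev_qpt hm]
  refine LinearMap.ext fun x => ?_
  have hx : x = ∑ i, E x i • (⟨h.qpt m (Pi.single i 1), h.proj_qpt hm _⟩ : X.q.Fib m) := by
    apply hinj
    rw [_root_.map_sum]
    simp only [_root_.map_smul, hEq]
    exact pi_eq_sum_univ' _
  conv_lhs => rw [hx]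
  simp only [_root_.map_sum, _root_.map_smul, LinearMap.sum_apply, LinearMap.smul_apply,
    smul_eq_mul]
  exact Finset.sum_congr rfl fun i _ => mul_comm _ _

/-- Every isotropic linear section is a combination of the `χ_j` and the `τ_i ∧ τ_k`: its function
on `D` has no other terms in coordinates, and its bilinear part in `(a, b)` is skew-symmetric. -/
theorem iso_expand (hm : m ∈ U) (s : X.isotropicFib m) :
    s = ∑ j, isoEv s (h.pt m 0 0 (Pi.single j 1)) (h.pt_spec hm _ _ _).1 • (χ j).toFun ⟨m, hm⟩ +
      ∑ i, ∑ k, isoEv s (h.pt m (Pi.single i 1) (Pi.single k 1) 0) (h.pt_spec hm _ _ _).1 •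
        wedge ((τ i).toFun ⟨m, hm⟩) ((τ k).toFun ⟨m, hm⟩) := by
  refine isoEv_ext fun d hd => ?_
  let a : Fin r₁ → ℝ := fun i => (τ i).ev (X.p₁.proj d)
  let b : Fin r₁ → ℝ := fun i => (τ i).ev (X.p₂.proj d)
  let c : Fin r₂ → ℝ := fun i => (χ i).ev d
  have hpt : ∀ a b c, X.toBase (h.pt m a b c) = m := fun a b c => (h.pt_spec hm a b c).1
  have hd' : d = h.pt m a b c := h.pt_unique hm hd (fun _ => rfl) (fun _ => rfl) fun _ => rfl
  let g : (Fin r₁ → ℝ) → (Fin r₁ → ℝ) → (Fin r₂ → ℝ) → ℝ := fun a b c =>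
    isoEv s (h.pt m a b c) (hpt a b c)
  have hg := expand_doublyLinear g
    (fun a b b' c c' => by
      rw [← isoEv_add₁ s _ _ (h.p₁_pt_eq hm a b b' c c') (hpt _ _ _) (hpt _ _ _)
        (by rw [toBase_add₁, hpt])]
      exact isoEv_congr s (h.pt_add₁ hm a b b' c c') _ _)
    (fun r a b c => by
      rw [← isoEv_smul₁ s _ _ (hpt _ _ _) (by rw [toBase_smul₁, hpt])]
      exact isoEv_congr s (h.pt_smul₁ hm r a b c) _ _)
    (fun a a' b c c' => by
      rw [← isoEv_add₂ s _ _ (h.p₂_pt_eq hm a a' b c c') (hpt _ _ _) (hpt _ _ _)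
        (by rw [toBase_add₂, hpt])]
      exact isoEv_congr s (h.pt_add₂ hm a a' b c c') _ _)
    (fun r a b c => by
      rw [← isoEv_smul₂ s _ _ (hpt _ _ _) (by rw [toBase_smul₂, hpt])]
      exact isoEv_congr s (h.pt_smul₂ hm r a b c) _ _) a b c
  have hskew : ∀ i k, g (Pi.single i 1) (Pi.single k 1) 0 =
      -g (Pi.single k 1) (Pi.single i 1) 0 := fun i k => by
    rw [← isoEv_inv s _ (hpt _ _ _) (by rw [toBase_inv, hpt])]
    refine isoEv_congr s ?_ _ _
    rw [h.inv_pt hm, neg_zero]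
  have h1 : isoEv s d hd = g a b c := isoEv_congr s hd' _ _
  have hw : ∀ i k, isoEv (wedge ((τ i).toFun ⟨m, hm⟩) ((τ k).toFun ⟨m, hm⟩)) d hd =
      1 / 2 * (a i * b k - a k * b i) := fun i k => by
    rw [isoEv_wedge, ← (τ i).ev_eq ⟨m, hm⟩, ← (τ k).ev_eq ⟨m, hm⟩, ← (τ i).ev_eq ⟨m, hm⟩,
      ← (τ k).ev_eq ⟨m, hm⟩]
  have h2 : ∀ t : X.isotropicFib m, isoEv t d hd = isoEvLin d hd t := fun _ => rfl
  have hχ : ∀ j, isoEv ((χ j).toFun ⟨m, hm⟩) d hd = c j := fun j =>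
    ((χ j).ev_eq ⟨m, hm⟩ d hd).symm
  rw [h1, hg, h2, _root_.map_add]
  simp only [_root_.map_sum, _root_.map_smul]
  simp only [← h2, hw, hχ, smul_eq_mul]
  congr 1
  · exact Finset.sum_congr rfl fun j _ => mul_comm _ _
  · change ∑ i, ∑ k, a i * b k * g (Pi.single i 1) (Pi.single k 1) 0 =
      ∑ i, ∑ k, g (Pi.single i 1) (Pi.single k 1) 0 * (1 / 2 * (a i * b k - a k * b i))
    have e1 : ∑ i, ∑ k, a i * b k * g (Pi.single i 1) (Pi.single k 1) 0 =
        ∑ i, ∑ k, -(a k * b i * g (Pi.single i 1) (Pi.single k 1) 0) := by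
      rw [Finset.sum_comm]
      exact Finset.sum_congr rfl fun i _ => Finset.sum_congr rfl fun k _ => by
        rw [hskew k i]; ring
    have e2 : ∑ i, ∑ k, g (Pi.single i 1) (Pi.single k 1) 0 * (1 / 2 * (a i * b k - a k * b i)) =
        1 / 2 * (∑ i, ∑ k, a i * b k * g (Pi.single i 1) (Pi.single k 1) 0 +
          ∑ i, ∑ k, -(a k * b i * g (Pi.single i 1) (Pi.single k 1) 0)) := by
      simp only [← Finset.sum_add_distrib, Finset.mul_sum]
      exact Finset.sum_congr rfl fun i _ => Finset.sum_congr rfl fun k _ => by ring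
    rw [e2, ← e1]
    ring

end IsFrame

end IDVB

/-! ### Homomorphisms out of the fibre algebras -/

namespace TwoAlg

variable {V W : Type u} [AddCommGroup V] [Module ℝ V] [AddCommGroup W] [Module ℝ W]
  {β : V → V → W}

/-- The universal property of the algebra on generators of degrees 1 and 2. -/
theorem exists_lift {B : Type*} [Ring B] [Algebra ℝ B] (f : V →ₗ[ℝ] B) (g : W →ₗ[ℝ] B)
    (h1 : ∀ w v, Commute (g w) (f v)) (h2 : ∀ w w', Commute (g w) (g w'))
    (h : ∀ v v', g (β v v') = f v * f v') :
    ∃ F : TwoAlg β →ₐ[ℝ] B, (∀ v, F (deg1 β v) = f v) ∧ ∀ w, F (deg2 β w) = g w := by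
  have hr : ∀ ⦃x y : TensorAlgebra ℝ (V × W)⦄, Rel β x y →
      TensorAlgebra.lift ℝ (f ∘ₗ LinearMap.fst ℝ V W + g ∘ₗ LinearMap.snd ℝ V W) x =
        TensorAlgebra.lift ℝ (f ∘ₗ LinearMap.fst ℝ V W + g ∘ₗ LinearMap.snd ℝ V W) y := by
    intro x y r
    induction r with
    | central w x => simp [add_mul, mul_add, (h1 w x.1).eq, (h2 w x.2).eq]
    | product v v' => simp [h]
  refine ⟨RingQuot.liftAlgHom ℝ ⟨_, hr⟩, fun v => ?_, fun w => ?_⟩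
  · refine (RingQuot.liftAlgHom_mkAlgHom_apply ℝ _ hr (TensorAlgebra.ι ℝ (v, 0))).trans ?_
    simp
  · refine (RingQuot.liftAlgHom_mkAlgHom_apply ℝ _ hr (TensorAlgebra.ι ℝ (0, w))).trans ?_
    simp

end TwoAlg

section

variable {B : Type*} [Ring B] {r₁ r₂ : ℕ} {ξ : Fin r₁ → B} {η : Fin r₂ → B}

/-- Products of two odd generators are central. -/
theorem SuperCommute.pair_comm (h : SuperCommute ξ η) (i k l : Fin r₁) :
    Commute (ξ i * ξ k) (ξ l) := by
  rw [Commute, SemiconjBy, mul_assoc, h.anti k l, mul_neg, ← mul_assoc, h.anti i l, neg_mul,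
    neg_neg, mul_assoc]

/-- Homomorphisms from the algebra on generators of degrees 1 and 2 to an algebra with graded
commutative elements `ξ_i`, `η_j`: elements of degree 1 go to combinations of the `ξ_i`, elements of
degree 2 to combinations of the `η_j` and the `ξ_i ξ_j`. The condition on the coefficients `g`, `k`
says that the relation `v v' = β(v, v')` is respected. -/
theorem SuperCommute.exists_model [Algebra ℝ B] {V W : Type u} [AddCommGroup V] [Module ℝ V]
    [AddCommGroup W] [Module ℝ W] {β : V → V → W} (h : SuperCommute ξ η) (f : Fin r₁ → V →ₗ[ℝ] ℝ)
    (g : Fin r₂ → W →ₗ[ℝ] ℝ) (k : Fin r₁ → Fin r₁ → W →ₗ[ℝ] ℝ)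
    (hg : ∀ j v v', g j (β v v') = 0)
    (hk : ∀ i j v v', k i j (β v v') = 1 / 2 * (f i v * f j v' - f i v' * f j v)) :
    ∃ F : TwoAlg β →ₐ[ℝ] B, (∀ v, F (TwoAlg.deg1 β v) = ∑ i, f i v • ξ i) ∧
      ∀ w, F (TwoAlg.deg2 β w) = ∑ j, g j w • η j + ∑ i, ∑ j, k i j w • (ξ i * ξ j) := by
  have hfl : ∀ v, (∑ i, (f i).smulRight (ξ i)) v = ∑ i, f i v • ξ i := fun v => by
    simp [LinearMap.sum_apply]
  have hgl : ∀ w, ((∑ j, (g j).smulRight (η j)) + ∑ i, ∑ j, (k i j).smulRight (ξ i * ξ j)) w =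
      ∑ j, g j w • η j + ∑ i, ∑ j, k i j w • (ξ i * ξ j) := fun w => by
    simp [LinearMap.sum_apply]
  have hc : ∀ w x, (∀ j, Commute (η j) x) →
      (∀ i j, Commute (ξ i * ξ j) x) →
      Commute (∑ j, g j w • η j + ∑ i, ∑ j, k i j w • (ξ i * ξ j)) x := fun w x h1 h2 =>
    (Commute.sum_left _ _ _ fun j _ => (h1 j).smul_left _).add_left
      (Commute.sum_left _ _ _ fun i _ => Commute.sum_left _ _ _ fun j _ => (h2 i j).smul_left _)
  obtain ⟨F, hF1, hF2⟩ := TwoAlg.exists_lift (β := β) (∑ i, (f i).smulRight (ξ i))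
    ((∑ j, (g j).smulRight (η j)) + ∑ i, ∑ j, (k i j).smulRight (ξ i * ξ j))
    (fun w v => by
      rw [hfl, hgl]
      refine Commute.sum_right _ _ _ fun l _ => Commute.smul_right ?_ _
      exact hc w _ (fun j => h.comm j l) fun i j => h.pair_comm i j l)
    (fun w w' => by
      rw [hgl, hgl]
      refine hc w _ (fun j => (hc w' _ (fun l => ?_)
        fun l l' => ?_).symm) fun i j => (hc w' _ (fun l => ?_)
        fun l l' => ?_).symm
      · exact h.comm' l j
      · exact ((h.comm j l).mul_right (h.comm j l')).symm
      · exact (h.comm l i).mul_right (h.comm l j)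
      · exact (h.pair_comm l l' i).mul_right (h.pair_comm l l' j))
    (fun v v' => by
      rw [hfl, hfl, hgl, Finset.sum_mul_sum]
      simp only [hg, hk, zero_smul, Finset.sum_const_zero, zero_add]
      have e1 : ∀ i j, (f i v • ξ i) * (f j v' • ξ j) = (f i v * f j v') • (ξ i * ξ j) :=
        fun i j => smul_mul_smul_comm _ _ _ _
      simp only [e1]
      have e2 : ∑ i, ∑ j, (f i v * f j v') • (ξ i * ξ j) =
          -∑ i, ∑ j, (f i v' * f j v) • (ξ i * ξ j) := by
        rw [Finset.sum_comm, ← Finset.sum_neg_distrib]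
        refine Finset.sum_congr rfl fun i _ => ?_
        rw [← Finset.sum_neg_distrib]
        refine Finset.sum_congr rfl fun j _ => ?_
        rw [h.anti j i, smul_neg, mul_comm]
      have e3 : ∑ i, ∑ j, (1 / 2 * (f i v * f j v' - f i v' * f j v)) • (ξ i * ξ j) =
          (1 / 2 : ℝ) • (∑ i, ∑ j, (f i v * f j v') • (ξ i * ξ j) -
            ∑ i, ∑ j, (f i v' * f j v) • (ξ i * ξ j)) := by
        simp only [← Finset.sum_sub_distrib, Finset.smul_sum, ← sub_smul, smul_smul]
      rw [e3]
      have e4 := eq_neg_iff_add_eq_zero.mp e2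
      rw [← neg_eq_iff_eq_neg.mpr e2, sub_neg_eq_add, ← two_smul ℝ, smul_smul]
      norm_num)
  exact ⟨F, fun v => by rw [hF1, hfl], fun w => by rw [hF2, hgl]⟩

end

namespace IDVB

variable {X : IDVB.{u}}

/-- A point `d ∈ D` over `m` defines a homomorphism from the fibre algebra at `m` to the exterior
algebra on two generators, from which `τ(π₁ d)`, `τ(π₂ d)` and `χ(d)` can be read off. -/
theorem exists_test_hom {m : X.M} (d : X.D) (hd : X.toBase d = m) :
    ∃ F : X.FibAlg m →ₐ[ℝ] ModelAlg 2 0,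
      (∀ v, F (TwoAlg.deg1 wedge v) = v ⟨X.p₁.proj d, hd⟩ • modelθ 2 0 0 +
        v ⟨X.p₂.proj d, (X.proj_p₂ d).trans hd⟩ • modelθ 2 0 1) ∧
      ∀ s, F (TwoAlg.deg2 wedge s) = (2 * isoEv s d hd) • (modelθ 2 0 0 * modelθ 2 0 1) := by
  obtain ⟨F, h1, h2⟩ := (superCommute_model 2 0).exists_model (V := Module.Dual ℝ (X.q.Fib m))
    (W := X.isotropicFib m) (β := wedge)
    ![Module.Dual.eval ℝ _ ⟨X.p₁.proj d, hd⟩,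
      Module.Dual.eval ℝ _ ⟨X.p₂.proj d, (X.proj_p₂ d).trans hd⟩]
    Fin.elim0 ![![0, isoEvLin d hd], ![-isoEvLin d hd, 0]] (fun j => j.elim0) (by
      have hw : ∀ v v', isoEvLin d hd (wedge v v') = _ := fun v v' => isoEv_wedge v v' d hd
      intro i j v v'
      fin_cases i <;> fin_cases j <;> simp [hw] <;> ring)
  refine ⟨F, fun v => ?_, fun s => ?_⟩
  · rw [h1]
    simp [Fin.sum_univ_two]
  · rw [h2]
    simp only [Finset.univ_eq_empty, Finset.sum_empty, Fin.sum_univ_two, zero_add]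
    rw [(superCommute_model 2 0).anti 1 0]
    simp [isoEvLin]
    rw [← two_smul ℝ, smul_smul]
    rfl

theorem modelθ_pair_ne_zero : modelθ 2 0 0 * modelθ 2 0 1 ≠ 0 := by
  have h := (linearIndependent_model 2 0).ne_zero ({0, 1}, 0)
  rwa [mono_pair _ _ (show (0 : Fin 2) < 1 by decide)] at h

/-- No elements of degree 1 are lost in the fibre algebra: they are separated by the homomorphisms
of the points of `D`. -/
theorem deg1_injective (m : X.M) :
    Function.Injective (TwoAlg.deg1 (wedge (X := X) (m := m))) := by
  rw [injective_iff_map_eq_zero]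
  refine fun v hv => LinearMap.ext fun x => ?_
  obtain ⟨x, hx⟩ := x
  obtain ⟨F, h1, -⟩ := exists_test_hom (X.p₁.zero x) ((toBase_zero₁ X x).trans hx)
  have h2 := h1 v
  rw [hv, _root_.map_zero] at h2
  have h3 : (0 : ModelAlg 2 0) = (v ⟨x, hx⟩) • (modelθ 2 0 0 * modelθ 2 0 1) := by
    have h4 := congrArg (· * modelθ 2 0 1) h2
    simp only [zero_mul, add_mul, smul_mul_assoc, (superCommute_model 2 0).sq, smul_zero,
      add_zero] at h4
    rw [h4]
    congr 2
    exact Subtype.ext (X.p₁.proj_zero x)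
  exact (smul_eq_zero.mp h3.symm).resolve_right modelθ_pair_ne_zero

/-- No elements of degree 2 are lost in the fibre algebra. -/
theorem deg2_injective (m : X.M) :
    Function.Injective (TwoAlg.deg2 (wedge (X := X) (m := m))) := by
  rw [injective_iff_map_eq_zero]
  refine fun s hs => isoEv_ext fun d hd => ?_
  obtain ⟨F, -, h1⟩ := exists_test_hom d hd
  have h2 := h1 s
  rw [hs, _root_.map_zero] at h2
  have := (smul_eq_zero.mp h2.symm).resolve_right modelθ_pair_ne_zero
  have h3 : isoEv s d hd = 0 := by linarith
  rw [h3]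
  rfl

variable {U : Opens X.M} {r₁ r₂ : ℕ} {τ : Fin r₁ → X.DualSection U}
  {χ : Fin r₂ → X.IsotropicSection U}

/-- Generators of degrees 1 and 2 in a fibre algebra commute in the graded sense. -/
theorem superCommute_fib (m : X.M) (v : Fin r₁ → Module.Dual ℝ (X.q.Fib m))
    (s : Fin r₂ → X.isotropicFib m) :
    SuperCommute (fun i => (TwoAlg.deg1 wedge (v i) : X.FibAlg m))
      (fun j => TwoAlg.deg2 wedge (s j)) where
  anti i j := deg1_mul_deg1_comm _ _
  sq i := by
    have h : wedge (v i) (v i) = 0 := by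
      refine isoEv_ext fun d hd => ?_
      have h1 : ∀ a b : ℝ, 1 / 2 * (a * b - a * b) = 0 := fun a b => by ring
      exact (isoEv_wedge _ _ d hd).trans (h1 _ _)
    rw [TwoAlg.deg1_mul_deg1, h, _root_.map_zero]
  comm j i := TwoAlg.deg2_mul_deg1 _ _ _
  comm' j k := TwoAlg.deg2_mul_deg2 _ _ _

/-- The monomials in a frame are independent in every fibre algebra: there is a homomorphism to the
model algebra which takes the frame to the standard generators, with coefficients given by the
points of `D` whose coordinates are standard basis vectors. -/
theorem IsFrame.linearIndependent_fib (h : IsFrame τ χ) {m : X.M} (hm : m ∈ U) :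
    LinearIndependent ℝ (mono (fun i => (TwoAlg.deg1 wedge ((τ i).toFun ⟨m, hm⟩) : X.FibAlg m))
      (fun j => TwoAlg.deg2 wedge ((χ j).toFun ⟨m, hm⟩))) := by
  have hq : ∀ a, X.q.proj (h.qpt m a) = m := h.proj_qpt hm
  have hp : ∀ a b c, X.toBase (h.pt m a b c) = m := fun a b c => (h.pt_spec hm a b c).1
  obtain ⟨F, h1, h2⟩ := (superCommute_model r₁ r₂).exists_model
    (V := Module.Dual ℝ (X.q.Fib m)) (W := X.isotropicFib m) (β := wedge)
    (fun i => Module.Dual.eval ℝ _ ⟨h.qpt m (Pi.single i 1), hq _⟩)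
    (fun j => isoEvLin (h.pt m 0 0 (Pi.single j 1)) (hp _ _ _))
    (fun i k => isoEvLin (h.pt m (Pi.single i 1) (Pi.single k 1) 0) (hp _ _ _))
    (fun j v v' => by
      refine (isoEv_wedge v v' _ _).trans ?_
      have h0 : (⟨X.p₁.proj (h.pt m 0 0 (Pi.single j 1)), hp _ _ _⟩ : X.q.Fib m) = 0 := by
        refine Subtype.ext (h.injective_dual hm (hp _ _ _) (X.q.proj_zero m) fun i => ?_)
        refine (congrArg (τ i).ev (h.p₁_pt hm _ _ _)).trans ((h.ev_qpt hm _ i).trans ?_)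
        exact ((τ i).linear_ev m hm).map_zero.symm
      rw [h0, _root_.map_zero, _root_.map_zero]
      ring)
    (fun i k v v' => by
      refine (isoEv_wedge v v' _ _).trans ?_
      have h0 : (⟨X.p₁.proj (h.pt m (Pi.single i 1) (Pi.single k 1) 0), hp _ _ _⟩ : X.q.Fib m) =
        ⟨h.qpt m (Pi.single i 1), hq _⟩ := Subtype.ext (h.p₁_pt hm _ _ _)
      have h1 : (⟨X.p₂.proj (h.pt m (Pi.single i 1) (Pi.single k 1) 0),
          (X.proj_p₂ _).trans (hp _ _ _)⟩ : X.q.Fib m) =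
        ⟨h.qpt m (Pi.single k 1), hq _⟩ := Subtype.ext (h.p₂_pt hm _ _ _)
      rw [h0, h1]
      rfl)
  have e1 : ∀ i, F (TwoAlg.deg1 wedge ((τ i).toFun ⟨m, hm⟩)) = modelθ r₁ r₂ i := fun i => by
    rw [h1]
    have e : ∀ k, Module.Dual.eval ℝ (X.q.Fib m) ⟨h.qpt m (Pi.single k 1), hq _⟩
        ((τ i).toFun ⟨m, hm⟩) = if i = k then 1 else 0 := fun k => by
      rw [Module.Dual.eval_apply, ← (τ i).ev_eq ⟨m, hm⟩, h.ev_qpt hm, Pi.single_apply]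
    simp only [e, ite_smul, one_smul, zero_smul]
    simp
  have e2 : ∀ j, F (TwoAlg.deg2 wedge ((χ j).toFun ⟨m, hm⟩)) = modelY r₁ r₂ j := fun j => by
    rw [h2]
    have e : ∀ a b c, isoEvLin (h.pt m a b c) (hp _ _ _) ((χ j).toFun ⟨m, hm⟩) = c j :=
      fun a b c => by
        change isoEv _ _ _ = _
        rw [← (χ j).ev_eq, (h.pt_spec hm _ _ _).2.2.2]
    simp only [e, Pi.single_apply, ite_smul, one_smul, zero_smul]
    simp
  have h3 := linearIndependent_model r₁ r₂
  refine LinearIndependent.of_comp F.toLinearMap ?_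
  convert h3 using 1
  funext p
  have h4 := map_mono (F : X.FibAlg m →+* ModelAlg r₁ r₂) (fun i => TwoAlg.deg1 wedge
    ((τ i).toFun ⟨m, hm⟩)) (fun j => TwoAlg.deg2 wedge ((χ j).toFun ⟨m, hm⟩)) p
  refine h4.trans ?_
  congr 1
  · exact funext e1
  · exact funext e2

end IDVB

/-! ### Homogeneity of monomials -/

section Homogeneous

variable {A : ℕ → Type*} [∀ k, AddCommGroup (A k)] [DirectSum.GRing A] {r₁ r₂ : ℕ}

theorem exists_of_mul {k l : ℕ} {a b : ⨁ k, A k} (ha : ∃ x, a = DirectSum.of A k x)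
    (hb : ∃ y, b = DirectSum.of A l y) : ∃ z, a * b = DirectSum.of A (k + l) z := by
  obtain ⟨x, rfl⟩ := ha
  obtain ⟨y, rfl⟩ := hb
  exact ⟨_, DirectSum.of_mul_of _ _⟩

theorem exists_of_list_prod {ι : Type*} (l : List ι) (f : ι → ⨁ k, A k) (n : ι → ℕ)
    (h : ∀ i, ∃ x, f i = DirectSum.of A (n i) x) :
    ∃ x, (l.map f).prod = DirectSum.of A (l.map n).sum x := by
  induction l with
  | nil => exact ⟨GradedMonoid.GOne.one, rfl⟩
  | cons i l ih =>
    simp only [List.map_cons, List.prod_cons]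
    exact exists_of_mul (h i) ih

theorem exists_of_pow {k : ℕ} {a : ⨁ k, A k} (ha : ∃ x, a = DirectSum.of A k x) (n : ℕ) :
    ∃ x, a ^ n = DirectSum.of A (k * n) x := by
  induction n with
  | zero =>
    exact (⟨GradedMonoid.GOne.one, pow_zero a⟩ : ∃ x, a ^ 0 = DirectSum.of A 0 x)
  | succ n ih =>
    rw [pow_succ, Nat.mul_succ]
    exact exists_of_mul ih ha

/-- The monomial `ξ_I η^α` is homogeneous of degree `|I| + 2 |α|`. -/
theorem exists_of_mono (ξ : Fin r₁ → A 1) (η : Fin r₂ → A 2)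
    (p : Finset (Fin r₁) × (Fin r₂ → ℕ)) :
    ∃ x, mono (fun i => DirectSum.of A 1 (ξ i)) (fun j => DirectSum.of A 2 (η j)) p =
      DirectSum.of A (monoDeg p) x := by
  have h1 := exists_of_list_prod (A := A) (p.1.sort (· ≤ ·)) (fun i => DirectSum.of A 1 (ξ i))
    (fun _ => 1) fun i => ⟨_, rfl⟩
  have h2 := exists_of_list_prod (A := A) (List.finRange r₂)
    (fun j => DirectSum.of A 2 (η j) ^ p.2 j) (fun j => 2 * p.2 j)
    fun j => exists_of_pow ⟨_, rfl⟩ _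
  have e : monoDeg p = ((p.1.sort (· ≤ ·)).map fun _ => 1).sum +
      ((List.finRange r₂).map fun j => 2 * p.2 j).sum := by
    rw [monoDeg, Finset.mul_sum, ← List.ofFn_eq_map, List.sum_ofFn]
    simp
  rw [e]
  exact exists_of_mul h1 h2

theorem finite_monoDeg (r₁ r₂ k : ℕ) :
    {p : Finset (Fin r₁) × (Fin r₂ → ℕ) | monoDeg p = k}.Finite := by
  refine ((Set.finite_univ (α := Finset (Fin r₁))).prod
    (Set.finite_Iic (fun _ : Fin r₂ => k))).subset fun p hp => ⟨trivial, fun j => ?_⟩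
  have h1 : p.2 j ≤ ∑ j, p.2 j :=
    Finset.single_le_sum (fun _ _ => Nat.zero_le _) (Finset.mem_univ j)
  change p.2 j ≤ k
  rw [← show monoDeg p = k from hp, monoDeg]
  omega

/-- The set of monomials of degree `k`. -/
noncomputable def monosOfDeg (r₁ r₂ k : ℕ) : Finset (Finset (Fin r₁) × (Fin r₂ → ℕ)) :=
  (finite_monoDeg r₁ r₂ k).toFinset

theorem mem_monosOfDeg {r₁ r₂ k : ℕ} {p : Finset (Fin r₁) × (Fin r₂ → ℕ)} :
    p ∈ monosOfDeg r₁ r₂ k ↔ monoDeg p = k := by simp [monosOfDeg]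

end Homogeneous

namespace IDVB

variable {X : IDVB.{u}} {U V : Opens X.M}

/-! ### Operations on sections -/

/-- The sum of two sections of `Q^*`. -/
def DualSection.add (σ σ' : X.DualSection U) : X.DualSection U where
  toFun m := σ.toFun m + σ'.toFun m
  smooth := σ.smooth.add σ'.smooth

/-- The product of a smooth function and a section of `Q^*`. -/
noncomputable def DualSection.smul (f : Fun X.M U) (σ : X.DualSection U) : X.DualSection U where
  toFun m := f m • σ.toFun m
  smooth := (Fun.pullback X.q.smooth_proj (U := preim X.q.smooth_proj U) (fun _ hx => hx) f).2.mul
    σ.smooth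

/-- The zero section of `Q^*`. -/
def DualSection.zero (U : Opens X.M) : X.DualSection U where
  toFun _ := 0
  smooth := contMDiff_const

/-- The sum of two elements of `𝒞(𝔼)`. -/
def IsotropicSection.add (χ χ' : X.IsotropicSection U) : X.IsotropicSection U where
  toFun m := χ.toFun m + χ'.toFun m
  smooth := χ.smooth.add χ'.smooth

/-- The product of a smooth function and an element of `𝒞(𝔼)`. -/
noncomputable def IsotropicSection.smul (f : Fun X.M U) (χ : X.IsotropicSection U) :
    X.IsotropicSection U where
  toFun m := f m • χ.toFun m
  smooth := (Fun.pullback X.smooth_toBase (U := preim X.smooth_toBase U) (fun _ hx => hx) f).2.mul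
    χ.smooth

/-- The zero element of `𝒞(𝔼)`. -/
def IsotropicSection.zero (U : Opens X.M) : X.IsotropicSection U where
  toFun _ := 0
  smooth := contMDiff_const

/-- The element of `𝒞(𝔼)` defined by two sections of `Q^*`. -/
noncomputable def IsotropicSection.wedge (σ σ' : X.DualSection U) : X.IsotropicSection U where
  toFun m := IDVB.wedge (σ.toFun m) (σ'.toFun m)
  smooth := by
    have h1 : ∀ σ : X.DualSection U, SmoothFun (fun d : preim X.smooth_toBase U =>
        σ.toFun ⟨X.toBase d.1, d.2⟩ ⟨X.p₁.proj d.1, rfl⟩) := fun σ =>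
      smoothFun_comp X.p₁.smooth_proj (V := preim X.q.smooth_proj U) (fun _ hd => hd) σ.smooth
    have h2 : ∀ σ : X.DualSection U, SmoothFun (fun d : preim X.smooth_toBase U =>
        σ.toFun ⟨X.toBase d.1, d.2⟩ ⟨X.p₂.proj d.1, X.proj_p₂ d.1⟩) := fun σ => by
      have h := smoothFun_comp X.p₂.smooth_proj (U := preim X.smooth_toBase U)
        (V := preim X.q.smooth_proj U) (fun d hd => by
          change X.q.proj (X.p₂.proj d) ∈ U
          rw [X.proj_p₂]
          exact hd) σ.smooth
      refine (contMDiff_congr fun d => ?_).mp h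
      exact (σ.ev_eq ⟨_, _⟩ ⟨X.p₂.proj d.1, rfl⟩).symm.trans
        (σ.ev_eq ⟨_, d.2⟩ ⟨X.p₂.proj d.1, X.proj_p₂ d.1⟩)
    have h3 : SmoothFun (fun _ : preim X.smooth_toBase U => (1 / 2 : ℝ)) := contMDiff_const
    refine (contMDiff_congr fun d => ?_).mp
      (h3.mul (((h1 σ).mul (h2 σ')).sub ((h1 σ').mul (h2 σ))))
    exact (wedgeFun_apply (σ.toFun _) (σ'.toFun _) ⟨X.p₁.proj d.1, rfl⟩ ⟨d.1, rfl⟩).symm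

/-! ### Functions of low degree -/

/-- A polynomial of degree 0, 1 or 2 in sections of `Q^*` and elements of `𝒞(𝔼)` is a smooth
function, a section of `Q^*` or an element of `𝒞(𝔼)`. In degree 2 this uses that the products
`τ τ'` are themselves elements of `𝒞(𝔼)`. -/
theorem IsPoly.exists_low {k : ℕ} {s : X.Sec U} (h : IsPoly k s) :
    (k = 0 → ∃ f, s = funSec U f) ∧ (k = 1 → ∃ σ : X.DualSection U, s = secOfDual σ) ∧
      (k = 2 → ∃ χ : X.IsotropicSection U, s = secOfIsotropic χ) := by
  induction h with
  | func f => exact ⟨fun _ => ⟨f, rfl⟩, fun h => by omega, fun h => by omega⟩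
  | deg1 τ => exact ⟨fun h => by omega, fun _ => ⟨τ, rfl⟩, fun h => by omega⟩
  | deg2 χ => exact ⟨fun h => by omega, fun h => by omega, fun _ => ⟨χ, rfl⟩⟩
  | zero k =>
    exact ⟨fun _ => ⟨0, (_root_.map_zero _).symm⟩,
      fun _ => ⟨.zero U, funext fun m => (_root_.map_zero _).symm⟩,
      fun _ => ⟨.zero U, funext fun m => (_root_.map_zero _).symm⟩⟩
  | add _ _ h1 h2 =>
    refine ⟨fun hk => ?_, fun hk => ?_, fun hk => ?_⟩
    · obtain ⟨f, rfl⟩ := h1.1 hk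
      obtain ⟨g, rfl⟩ := h2.1 hk
      exact ⟨f + g, (_root_.map_add _ _ _).symm⟩
    · obtain ⟨f, rfl⟩ := h1.2.1 hk
      obtain ⟨g, rfl⟩ := h2.2.1 hk
      exact ⟨f.add g, funext fun m =>
        ((TwoAlg.deg1 wedge).map_add (f.toFun m) (g.toFun m)).symm⟩
    · obtain ⟨f, rfl⟩ := h1.2.2 hk
      obtain ⟨g, rfl⟩ := h2.2.2 hk
      exact ⟨f.add g, funext fun m =>
        ((TwoAlg.deg2 wedge).map_add (f.toFun m) (g.toFun m)).symm⟩
  | @mul k l s t hs ht h1 h2 =>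
    have hσ : ∀ f (σ : X.DualSection U), funSec U f * secOfDual σ = secOfDual (σ.smul f) :=
      fun f σ => funext fun m => (Algebra.smul_def (R := ℝ) (f m) (secOfDual σ m)).symm.trans
        ((TwoAlg.deg1 wedge).map_smul (f m) (σ.toFun m)).symm
    have hχ : ∀ f (χ : X.IsotropicSection U),
        funSec U f * secOfIsotropic χ = secOfIsotropic (χ.smul f) :=
      fun f σ => funext fun m => (Algebra.smul_def (R := ℝ) (f m) (secOfIsotropic σ m)).symm.trans
        ((TwoAlg.deg2 wedge).map_smul (f m) (σ.toFun m)).symm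
    refine ⟨fun hk => ?_, fun hk => ?_, fun hk => ?_⟩
    · obtain ⟨f, rfl⟩ := h1.1 (by omega)
      obtain ⟨g, rfl⟩ := h2.1 (by omega)
      exact ⟨f * g, (_root_.map_mul _ _ _).symm⟩
    · rcases (show (k = 0 ∧ l = 1) ∨ (k = 1 ∧ l = 0) by omega) with ⟨hk, hl⟩ | ⟨hk, hl⟩
      · obtain ⟨f, rfl⟩ := h1.1 hk
        obtain ⟨g, rfl⟩ := h2.2.1 hl
        exact ⟨_, hσ f g⟩
      · obtain ⟨f, rfl⟩ := h1.2.1 hk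
        obtain ⟨g, rfl⟩ := h2.1 hl
        exact ⟨_, (Algebra.commutes g (secOfDual f)).symm.trans (hσ g f)⟩
    · rcases (show (k = 0 ∧ l = 2) ∨ (k = 1 ∧ l = 1) ∨ (k = 2 ∧ l = 0) by omega) with
        ⟨hk, hl⟩ | ⟨hk, hl⟩ | ⟨hk, hl⟩
      · obtain ⟨f, rfl⟩ := h1.1 hk
        obtain ⟨g, rfl⟩ := h2.2.2 hl
        exact ⟨_, hχ f g⟩
      · obtain ⟨f, rfl⟩ := h1.2.1 hk
        obtain ⟨g, rfl⟩ := h2.2.1 hl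
        exact ⟨.wedge f g, funext fun m => TwoAlg.deg1_mul_deg1 _ _ _⟩
      · obtain ⟨f, rfl⟩ := h1.2.2 hk
        obtain ⟨g, rfl⟩ := h2.1 hl
        exact ⟨_, (Algebra.commutes g (secOfIsotropic f)).symm.trans (hχ g f)⟩

/-- A section of the bundle of algebras which is locally a smooth section of `Q^*` is one. -/
theorem exists_dual_of_local {s : X.Sec U} (h : ∀ m ∈ U, ∃ (V : Opens X.M) (hV : V ≤ U), m ∈ V ∧
    ∃ σ : X.DualSection V, Sec.res hV s = secOfDual σ) :
    ∃ σ : X.DualSection U, secOfDual σ = s := by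
  have hv : ∀ m : U, ∃ v, TwoAlg.deg1 wedge v = s m := fun m => by
    obtain ⟨V, hV, hm, σ, hσ⟩ := h m.1 m.2
    exact ⟨_, (congrFun hσ ⟨m.1, hm⟩).symm⟩
  choose v hv using hv
  refine ⟨⟨v, fun e => ?_⟩, funext hv⟩
  obtain ⟨V, hV, hm, σ, hσ⟩ := h _ e.2
  have h1 : ∀ m (hm : m ∈ V), v ⟨m, hV hm⟩ = σ.toFun ⟨m, hm⟩ := fun m hm =>
    deg1_injective m ((hv _).trans (congrFun hσ ⟨m, hm⟩))
  have h2 : ContMDiffAt (𝓡 X.Q.dim) 𝓘(ℝ, ℝ) ∞ (fun e : preim X.q.smooth_proj U => σ.ev e.1) e :=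
    contMDiffAt_subtype_iff.mpr (σ.smooth_ev.contMDiffAt
      ((V.2.preimage X.q.smooth_proj.continuous).mem_nhds hm))
  refine h2.congr_of_eventuallyEq ?_
  filter_upwards [((V.2.preimage X.q.smooth_proj.continuous).preimage
    continuous_subtype_val).mem_nhds hm] with x hx
  have hx' : X.q.proj x.1 ∈ V := hx
  rw [h1 _ hx']
  exact (σ.ev_eq ⟨_, hx'⟩ ⟨x.1, rfl⟩).symm

/-- A section of the bundle of algebras which is locally an element of `𝒞(𝔼)` is one. -/
theorem exists_isotropic_of_local {s : X.Sec U} (h : ∀ m ∈ U, ∃ (V : Opens X.M) (hV : V ≤ U),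
    m ∈ V ∧ ∃ χ : X.IsotropicSection V, Sec.res hV s = secOfIsotropic χ) :
    ∃ χ : X.IsotropicSection U, secOfIsotropic χ = s := by
  have hv : ∀ m : U, ∃ v, TwoAlg.deg2 wedge v = s m := fun m => by
    obtain ⟨V, hV, hm, σ, hσ⟩ := h m.1 m.2
    exact ⟨_, (congrFun hσ ⟨m.1, hm⟩).symm⟩
  choose v hv using hv
  refine ⟨⟨v, fun e => ?_⟩, funext hv⟩
  obtain ⟨V, hV, hm, σ, hσ⟩ := h _ e.2
  have h1 : ∀ m (hm : m ∈ V), v ⟨m, hV hm⟩ = σ.toFun ⟨m, hm⟩ := fun m hm =>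
    deg2_injective m ((hv _).trans (congrFun hσ ⟨m, hm⟩))
  have h2 : ContMDiffAt (𝓡 X.D.dim) 𝓘(ℝ, ℝ) ∞ (fun e : preim X.smooth_toBase U => σ.ev e.1) e :=
    contMDiffAt_subtype_iff.mpr (σ.smooth_ev.contMDiffAt
      ((V.2.preimage X.smooth_toBase.continuous).mem_nhds hm))
  refine h2.congr_of_eventuallyEq ?_
  filter_upwards [((V.2.preimage X.smooth_toBase.continuous).preimage
    continuous_subtype_val).mem_nhds hm] with x hx
  have hx' : X.toBase x.1 ∈ V := hx
  rw [h1 _ hx']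
  exact (σ.ev_eq ⟨_, hx'⟩ x.1 rfl).symm

theorem secOfDual_injective : Function.Injective (secOfDual (X := X) (U := U)) := fun σ σ' h => by
  have : σ.toFun = σ'.toFun := funext fun m => deg1_injective m.1 (congrFun h m)
  cases σ; cases σ'
  congr

theorem secOfIsotropic_injective : Function.Injective (secOfIsotropic (X := X) (U := U)) :=
  fun σ σ' h => by
    have : σ.toFun = σ'.toFun := funext fun m => deg2_injective m.1 (congrFun h m)
    cases σ; cases σ'
    congr

/-- Every function of degree 1 on `ℳ(X)` is a section of `Q^*`: it is one locally, and the local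
sections are unique and therefore glue. -/
theorem bijective_ofDual (X : IDVB.{u}) (U : Opens X.M) :
    Function.Bijective (X.ofDual (U := U)) := by
  refine ⟨fun σ σ' h => secOfDual_injective (congrArg Subtype.val h), fun s => ?_⟩
  obtain ⟨σ, hσ⟩ := exists_dual_of_local (s := s.1) fun m hm => by
    obtain ⟨V, hV, hm', h⟩ := s.2 m hm
    exact ⟨V, hV, hm', h.exists_low.2.1 rfl⟩
  exact ⟨σ, Subtype.ext hσ⟩

/-- Every function of degree 2 on `ℳ(X)` is an element of `𝒞(𝔼)`. -/
theorem bijective_ofIsotropic (X : IDVB.{u}) (U : Opens X.M) :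
    Function.Bijective (X.ofIsotropic (U := U)) := by
  refine ⟨fun σ σ' h => secOfIsotropic_injective (congrArg Subtype.val h), fun s => ?_⟩
  obtain ⟨σ, hσ⟩ := exists_isotropic_of_local (s := s.1) fun m hm => by
    obtain ⟨V, hV, hm', h⟩ := s.2 m hm
    exact ⟨V, hV, hm', h.exists_low.2.2 rfl⟩
  exact ⟨σ, Subtype.ext hσ⟩

/-! ### Frames freely generate -/

/-- The value of a section at a point. -/
noncomputable def Sec.eval (m : U) : X.Sec U →+* X.FibAlg m.1 :=
  Pi.evalRingHom (fun m : U => X.FibAlg m.1) m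

theorem Sec.eval_smul (m : U) (f : Fun X.M U) (s : X.Sec U) :
    Sec.eval m (f • s) = f m • Sec.eval m s :=
  (Algebra.smul_def (R := ℝ) (f m) (Sec.eval m s)).symm

theorem Sec.ext_eval {s t : X.Sec U} (h : ∀ m, Sec.eval m s = Sec.eval m t) : s = t := funext h

variable {r₁ r₂ : ℕ} {τ : Fin r₁ → X.DualSection U} {χ : Fin r₂ → X.IsotropicSection U}

theorem superCommute_sec (τ : Fin r₁ → X.DualSection U) (χ : Fin r₂ → X.IsotropicSection U) :
    SuperCommute (fun i => secOfDual (τ i)) (fun j => secOfIsotropic (χ j)) where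
  anti i j := funext fun m => (superCommute_fib m.1 (fun i => (τ i).toFun m)
    (fun j => (χ j).toFun m)).anti i j
  sq i := funext fun m => (superCommute_fib m.1 (fun i => (τ i).toFun m)
    (fun j => (χ j).toFun m)).sq i
  comm j i := funext fun m => (superCommute_fib m.1 (fun i => (τ i).toFun m)
    (fun j => (χ j).toFun m)).comm j i
  comm' j k := funext fun m => (superCommute_fib m.1 (fun i => (τ i).toFun m)
    (fun j => (χ j).toFun m)).comm' j k

theorem DualSection.ev_res (h : V ≤ U) (σ : X.DualSection U) {x : X.Q} (hx : X.q.proj x ∈ V) :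
    (σ.res h).ev x = σ.ev x :=
  ((σ.res h).ev_eq ⟨_, hx⟩ ⟨x, rfl⟩).trans (σ.ev_eq ⟨_, h hx⟩ ⟨x, rfl⟩).symm

theorem IsotropicSection.ev_res (h : V ≤ U) (σ : X.IsotropicSection U) {d : X.D}
    (hd : X.toBase d ∈ V) : (σ.res h).ev d = σ.ev d :=
  ((σ.res h).ev_eq ⟨_, hd⟩ d rfl).trans (σ.ev_eq ⟨_, h hd⟩ d rfl).symm

theorem IsFrame.res (hf : IsFrame τ χ) (h : V ≤ U) :
    IsFrame (fun i => (τ i).res h) (fun j => (χ j).res h) := fun m hm a b c => by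
  have key : ∀ d, (X.toBase d = m ∧ (∀ i, ((τ i).res h).ev (X.p₁.proj d) = a i) ∧
      (∀ i, ((τ i).res h).ev (X.p₂.proj d) = b i) ∧ ∀ j, ((χ j).res h).ev d = c j) ↔
      (X.toBase d = m ∧ (∀ i, (τ i).ev (X.p₁.proj d) = a i) ∧
      (∀ i, (τ i).ev (X.p₂.proj d) = b i) ∧ ∀ j, (χ j).ev d = c j) := by
    intro d
    refine and_congr_right fun hd => ?_
    subst hd
    have h1 : X.q.proj (X.p₂.proj d) ∈ V := by rw [X.proj_p₂]; exact hm
    simp only [fun i => (τ i).ev_res h (show X.q.proj (X.p₁.proj d) ∈ V from hm),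
      fun i => (τ i).ev_res h h1, fun j => (χ j).ev_res h hm]
  exact (existsUnique_congr key).mpr (hf m (h hm) a b c)

theorem mono_mem_span {k : ℕ} {p : Finset (Fin r₁) × (Fin r₂ → ℕ)} (hp : monoDeg p = k) :
    mono (fun i => secOfDual (τ i)) (fun j => secOfIsotropic (χ j)) p ∈
      Submodule.span (Fun X.M U) (mono (fun i => secOfDual (τ i))
        (fun j => secOfIsotropic (χ j)) '' (monosOfDeg r₁ r₂ k)) :=
  Submodule.subset_span ⟨p, mem_monosOfDeg.mpr hp, rfl⟩

/-- Over the domain of a frame, polynomials of degree `k` are combinations of monomials of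
degree `k` in the frame. -/
theorem IsPoly.mem_span (hf : IsFrame τ χ) {k : ℕ} {s : X.Sec U} (h : IsPoly k s) :
    s ∈ Submodule.span (Fun X.M U) (mono (fun i => secOfDual (τ i))
        (fun j => secOfIsotropic (χ j)) '' (monosOfDeg r₁ r₂ k)) := by
  have hpair : ∀ i k, secOfDual (τ i) * secOfDual (τ k) ∈ Submodule.span (Fun X.M U)
      (mono (fun i => secOfDual (τ i)) (fun j => secOfIsotropic (χ j)) ''
        (monosOfDeg r₁ r₂ 2)) := by
    have hlt : ∀ i k, i < k → secOfDual (τ i) * secOfDual (τ k) ∈ Submodule.span (Fun X.M U)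
        (mono (fun i => secOfDual (τ i)) (fun j => secOfIsotropic (χ j)) ''
          (monosOfDeg r₁ r₂ 2)) := fun i k hik => by
      have := mono_mem_span (τ := τ) (χ := χ) (k := 2) (p := ({i, k}, 0))
        (by simp [monoDeg, Finset.card_pair hik.ne])
      rwa [mono_pair _ _ hik] at this
    intro i k
    rcases lt_trichotomy i k with hik | rfl | hik
    · exact hlt i k hik
    · rw [(superCommute_sec τ χ).sq]
      exact Submodule.zero_mem _
    · rw [(superCommute_sec τ χ).anti]
      exact Submodule.neg_mem _ (hlt k i hik)
  induction h with
  | func f =>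
    have := mono_mem_span (τ := τ) (χ := χ) (k := 0) (p := (∅, 0)) (by simp [monoDeg])
    rw [mono_one] at this
    have h1 := Submodule.smul_mem _ f this
    rwa [smul_sec, mul_one] at h1
  | deg1 σ =>
    have hs : ∀ i, ContMDiffOn (𝓡 X.M.dim) 𝓘(ℝ, ℝ) ∞
        (fun m => σ.ev (hf.qpt m (Pi.single i 1))) U := fun i =>
      σ.smooth_ev.comp (hf.smooth_qpt.comp (f := fun m => (m, WithLp.toLp 2 (Pi.single i 1)))
        (contMDiff_id.prodMk contMDiff_const).contMDiffOn fun m hm => ⟨hm, trivial⟩)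
        fun m hm => show X.q.proj (hf.qpt m (Pi.single i 1)) ∈ U by rwa [hf.proj_qpt hm]
    have e : secOfDual σ = ∑ i, Fun.ofSmoothOn U _ (hs i) • secOfDual (τ i) := by
      refine Sec.ext_eval fun m => ?_
      rw [_root_.map_sum]
      simp only [Sec.eval_smul]
      refine (congrArg (TwoAlg.deg1 wedge) (hf.dual_expand m.2 (σ.toFun m))).trans ?_
      rw [_root_.map_sum]
      refine Finset.sum_congr rfl fun i _ => ?_
      rw [_root_.map_smul, ← σ.ev_eq m]
      rfl
    rw [e]
    refine Submodule.sum_mem _ fun i _ => Submodule.smul_mem _ _ ?_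
    have := mono_mem_span (τ := τ) (χ := χ) (k := 1) (p := ({i}, 0)) (by simp [monoDeg])
    rwa [mono_single_left] at this
  | deg2 σ =>
    have hs : ∀ a b c, ContMDiffOn (𝓡 X.M.dim) 𝓘(ℝ, ℝ) ∞
        (fun m => σ.ev (hf.pt m a b c)) U := fun a b c =>
      σ.smooth_ev.comp (hf.smooth_pt.comp
        (f := fun m => (m, WithLp.toLp 2 a, WithLp.toLp 2 b, WithLp.toLp 2 c))
        (contMDiff_id.prodMk contMDiff_const).contMDiffOn fun m hm => ⟨hm, trivial⟩)
        fun m hm => show X.toBase (hf.pt m a b c) ∈ U by rwa [(hf.pt_spec hm a b c).1]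
    have e : secOfIsotropic σ = ∑ j, Fun.ofSmoothOn U _ (hs 0 0 (Pi.single j 1)) •
        secOfIsotropic (χ j) + ∑ i, ∑ k, Fun.ofSmoothOn U _ (hs (Pi.single i 1) (Pi.single k 1) 0) •
          (secOfDual (τ i) * secOfDual (τ k)) := by
      refine Sec.ext_eval fun m => ?_
      simp only [_root_.map_add, _root_.map_sum, Sec.eval_smul, _root_.map_mul]
      refine (congrArg (TwoAlg.deg2 wedge) (hf.iso_expand m.2 (σ.toFun m))).trans ?_
      simp only [_root_.map_add, _root_.map_sum, _root_.map_smul, ← TwoAlg.deg1_mul_deg1,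
        ← σ.ev_eq m]
      rfl
    rw [e]
    refine Submodule.add_mem _ (Submodule.sum_mem _ fun j _ => Submodule.smul_mem _ _ ?_)
      (Submodule.sum_mem _ fun i _ => Submodule.sum_mem _ fun k _ =>
        Submodule.smul_mem _ _ (hpair i k))
    have := mono_mem_span (τ := τ) (χ := χ) (k := 2) (p := (∅, Pi.single j 1)) (by simp [monoDeg])
    rwa [mono_single_right] at this
  | zero k => exact Submodule.zero_mem _
  | add _ _ h1 h2 => exact Submodule.add_mem _ h1 h2
  | @mul k l s t hs ht h1 h2 =>
    clear hs ht
    induction h1 using Submodule.span_induction with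
    | mem x hx =>
      obtain ⟨p, hp, rfl⟩ := hx
      induction h2 using Submodule.span_induction with
      | mem y hy =>
        obtain ⟨q, hq, rfl⟩ := hy
        have hp' := mem_monosOfDeg.mp hp
        have hq' := mem_monosOfDeg.mp hq
        rcases (superCommute_sec τ χ).mono_mul p q with h0 | ⟨p', hd, h0 | h0⟩
        · rw [h0]
          exact Submodule.zero_mem _
        · rw [h0]
          exact mono_mem_span (by rw [hd, hp', hq'])
        · rw [h0]
          exact Submodule.neg_mem _ (mono_mem_span (by rw [hd, hp', hq']))
      | zero => rw [mul_zero]; exact Submodule.zero_mem _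
      | add y z _ _ h1 h2 => rw [mul_add]; exact Submodule.add_mem _ h1 h2
      | smul r y _ h1 => rw [mul_smul_comm]; exact Submodule.smul_mem _ _ h1
    | zero => rw [zero_mul]; exact Submodule.zero_mem _
    | add y z _ _ h1 h2 => rw [add_mul]; exact Submodule.add_mem _ h1 h2
    | smul r y _ h1 => rw [smul_mul_assoc]; exact Submodule.smul_mem _ _ h1

/-- Over the domain of a frame, functions of degree `k` are combinations of monomials of degree `k`
in the frame: the local coefficients are unique, hence glue. -/
theorem exists_coefficients (hf : IsFrame τ χ) {k : ℕ} {s : X.Sec U} (hs : s ∈ X.graded U k) :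
    ∃ g : Finset (Fin r₁) × (Fin r₂ → ℕ) → Fun X.M U, s = ∑ p ∈ monosOfDeg r₁ r₂ k,
      g p • mono (fun i => secOfDual (τ i)) (fun j => secOfIsotropic (χ j)) p := by
  have hmono : ∀ (V : Opens X.M) (hV : V ≤ U) (m : X.M) (hm : m ∈ V) p,
      Sec.eval ⟨m, hm⟩ (mono (fun i => secOfDual ((τ i).res hV))
        (fun j => secOfIsotropic ((χ j).res hV)) p) =
      mono (fun i => (TwoAlg.deg1 wedge ((τ i).toFun ⟨m, hV hm⟩) : X.FibAlg m))
      (fun j => TwoAlg.deg2 wedge ((χ j).toFun ⟨m, hV hm⟩)) p := fun V hV m hm p => map_mono _ _ _ p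
  have hloc : ∀ m ∈ U, ∃ (V : Opens X.M) (hV : V ≤ U), m ∈ V ∧
      ∃ g : Finset (Fin r₁) × (Fin r₂ → ℕ) → Fun X.M V, ∀ (x : X.M) (hx : x ∈ V),
        s ⟨x, hV hx⟩ = ∑ p ∈ monosOfDeg r₁ r₂ k, g p ⟨x, hx⟩ •
          mono (fun i => (TwoAlg.deg1 wedge ((τ i).toFun ⟨x, hV hx⟩) : X.FibAlg x))
            (fun j => TwoAlg.deg2 wedge ((χ j).toFun ⟨x, hV hx⟩)) p := fun m hm => by
    obtain ⟨V, hV, hm', h⟩ := hs m hm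
    obtain ⟨g, hg⟩ := (Submodule.mem_span_image_finset_iff_exists_fun _).mp
      (h.mem_span (hf.res hV))
    refine ⟨V, hV, hm', Function.extend Subtype.val g 0, fun x hx => ?_⟩
    have := congrArg (Sec.eval ⟨x, hx⟩) hg
    rw [_root_.map_sum] at this
    rw [← Finset.sum_coe_sort]
    refine this.symm.trans (Finset.sum_congr rfl fun p _ => ?_)
    rw [Sec.eval_smul, hmono, Subtype.val_injective.extend_apply]
  have hcoef : ∀ m : U, ∃ c : Finset (Fin r₁) × (Fin r₂ → ℕ) → ℝ,
      s m = ∑ p ∈ monosOfDeg r₁ r₂ k, c p •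
        mono (fun i => (TwoAlg.deg1 wedge ((τ i).toFun m) : X.FibAlg m.1))
          (fun j => TwoAlg.deg2 wedge ((χ j).toFun m)) p := fun m => by
    obtain ⟨V, hV, hm', g, hg⟩ := hloc m.1 m.2
    exact ⟨fun p => g p ⟨m.1, hm'⟩, hg m.1 hm'⟩
  choose c hc using hcoef
  -- the pointwise coefficients agree with the local smooth ones by independence in the fibres
  have hsm : ∀ p ∈ monosOfDeg r₁ r₂ k, SmoothFun (fun m => c m p) := fun p hp m => by
    obtain ⟨V, hV, hm', g, hg⟩ := hloc m.1 m.2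
    have heq : ∀ (x : X.M) (hx : x ∈ V), c ⟨x, hV hx⟩ p = g p ⟨x, hx⟩ := fun x hx => by
      have h1 := (hc ⟨x, hV hx⟩).symm.trans (hg x hx)
      rw [← sub_eq_zero, ← Finset.sum_sub_distrib] at h1
      simp only [← sub_smul] at h1
      exact sub_eq_zero.mp
        (linearIndependent_iff'.mp (hf.linearIndependent_fib (hV hx)) _ _ h1 p hp)
    obtain ⟨G, hG⟩ : ∃ G : X.M → ℝ, ∀ x : V, G x.1 = g p x := by
      classical
      exact ⟨fun x => if hx : x ∈ V then g p ⟨x, hx⟩ else 0, fun x => dif_pos x.2⟩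
    have h2 : ContMDiffAt (𝓡 X.M.dim) 𝓘(ℝ, ℝ) ∞ (fun x : U => G x.1) m :=
      contMDiffAt_subtype_iff.mpr
        ((smoothOn_of_smoothFun (g p).2 hG).contMDiffAt (V.2.mem_nhds hm'))
    refine h2.congr_of_eventuallyEq ?_
    filter_upwards [(V.2.preimage continuous_subtype_val).mem_nhds hm'] with x hx
    exact (heq x.1 hx).trans (hG ⟨x.1, hx⟩).symm
  classical
  obtain ⟨G, hG⟩ : ∃ G : Finset (Fin r₁) × (Fin r₂ → ℕ) → Fun X.M U,
      ∀ p ∈ monosOfDeg r₁ r₂ k, ∀ m, G p m = c m p :=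
    ⟨fun p => if hp : p ∈ monosOfDeg r₁ r₂ k then ⟨fun m => c m p, hsm p hp⟩ else 0,
      fun p hp m => congrArg (fun f : Fun X.M U => f m) (dif_pos hp)⟩
  refine ⟨G, Sec.ext_eval fun m => ?_⟩
  rw [_root_.map_sum]
  refine (hc m).trans (Finset.sum_congr rfl fun p hp => ?_)
  rw [Sec.eval_smul, hG p hp]
  exact congrArg _ (hmono U le_rfl m.1 m.2 p).symm

/-- The monomials of the graded algebra, seen as sections of the bundle of algebras. -/
theorem coe_monomial (τ : Fin r₁ → X.DualSection U) (χ : Fin r₂ → X.IsotropicSection U)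
    (p : Finset (Fin r₁) × (Fin r₂ → ℕ)) :
    DirectSum.coeAlgHom (X.graded U) (X.toGradedMfd.monomial (fun i => X.ofDual (τ i))
      (fun j => X.ofIsotropic (χ j)) p) =
      mono (fun i => secOfDual (τ i)) (fun j => secOfIsotropic (χ j)) p := by
  let φ : (⨁ k, X.graded U k) →+* X.Sec U := (DirectSum.coeAlgHom (X.graded U)).toRingHom
  refine (map_mono (A := ⨁ k, X.graded U k) (B := X.Sec U) φ _ _ p).trans ?_
  congr 1
  · funext i
    exact DirectSum.coeAlgHom_of (X.graded U) 1 _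
  · funext i
    exact DirectSum.coeAlgHom_of (X.graded U) 2 _

/-- Independence of the monomials over the smooth functions follows from independence at points. -/
theorem IsFrame.linearIndependent (hf : IsFrame τ χ) :
    LinearIndependent (Fun X.M U) (X.toGradedMfd.monomial (fun i => X.ofDual (τ i))
      (fun j => X.ofIsotropic (χ j))) := by
  refine LinearIndependent.of_comp (DirectSum.coeAlgHom (X.graded U)).toLinearMap ?_
  rw [linearIndependent_iff']
  intro S g hg p hp
  refine DFunLike.ext _ _ fun m => ?_
  have h1 := congrArg (Sec.eval m) hg
  rw [_root_.map_sum, _root_.map_zero] at h1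
  have h2 : ∀ p, Sec.eval m (g p • (DirectSum.coeAlgHom (X.graded U)).toLinearMap
      (X.toGradedMfd.monomial (fun i => X.ofDual (τ i)) (fun j => X.ofIsotropic (χ j)) p)) =
      g p m • mono (fun i => (TwoAlg.deg1 wedge ((τ i).toFun m) : X.FibAlg m.1))
        (fun j => TwoAlg.deg2 wedge ((χ j).toFun m)) p := fun p => by
    rw [Sec.eval_smul]
    exact congrArg _ ((congrArg (Sec.eval m) (coe_monomial τ χ p)).trans (map_mono _ _ _ p))
  refine linearIndependent_iff'.mp (hf.linearIndependent_fib m.2) S (fun p => g p m) ?_ p hp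
  rw [← h1]
  exact Finset.sum_congr rfl fun p _ => (h2 p).symm

theorem IsFrame.span_eq_top (hf : IsFrame τ χ) :
    Submodule.span (Fun X.M U) (Set.range (X.toGradedMfd.monomial (fun i => X.ofDual (τ i))
      (fun j => X.ofIsotropic (χ j)))) = ⊤ := by
  rw [eq_top_iff]
  rintro a -
  induction a using DirectSum.induction_on with
  | zero => exact Submodule.zero_mem _
  | add a b h1 h2 => exact Submodule.add_mem _ h1 h2
  | of k s =>
    obtain ⟨g, hg⟩ := exists_coefficients hf s.2
    have hy : ∀ p : monosOfDeg r₁ r₂ k, ∃ y : X.graded U k,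
        X.toGradedMfd.monomial (fun i => X.ofDual (τ i)) (fun j => X.ofIsotropic (χ j)) p.1 =
          DirectSum.of (fun k => X.graded U k) k y ∧
        y.1 = mono (fun i => secOfDual (τ i)) (fun j => secOfIsotropic (χ j)) p.1 := by
      rintro ⟨p, hp⟩
      obtain rfl := mem_monosOfDeg.mp hp
      obtain ⟨y, hy⟩ := exists_of_mono (A := fun k => X.graded U k) (fun i => X.ofDual (τ i))
        (fun j => X.ofIsotropic (χ j)) p
      refine ⟨y, hy, ?_⟩
      rw [← coe_monomial]
      exact ((congrArg (DirectSum.coeAlgHom (X.graded U)) hy).trans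
        (DirectSum.coeAlgHom_of (X.graded U) _ y)).symm
    choose y hy1 hy2 using hy
    have e : s = ∑ p : monosOfDeg r₁ r₂ k, g p.1 • y p := by
      refine Subtype.ext ?_
      rw [hg, Submodule.coe_sum, ← Finset.sum_coe_sort]
      exact Finset.sum_congr rfl fun p _ => congrArg _ (hy2 p).symm
    have e2 : DirectSum.of (fun k => X.graded U k) k s = ∑ p : monosOfDeg r₁ r₂ k, g p.1 •
        X.toGradedMfd.monomial (fun i => X.ofDual (τ i)) (fun j => X.ofIsotropic (χ j)) p.1 := by
      simp only [hy1]
      conv_lhs => rw [e]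
      change DirectSum.lof (Fun X.M U) ℕ (fun k => X.graded U k) k _ = _
      rw [_root_.map_sum]
      exact Finset.sum_congr rfl fun p _ => _root_.map_smul _ _ _
    refine e2 ▸ Submodule.sum_mem _ fun p _ =>
      Submodule.smul_mem _ _ (Submodule.subset_span ⟨_, rfl⟩)

/-- A frame over `U` freely generates the functions on `ℳ(X)` over `U`. -/
theorem IsFrame.isFreelyGenerated (hf : IsFrame τ χ) :
    X.toGradedMfd.IsFreelyGenerated U (fun i => X.ofDual (τ i)) (fun j => X.ofIsotropic (χ j)) :=
  fun _ hV => ⟨(hf.res hV).linearIndependent, (hf.res hV).span_eq_top⟩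

/-- `ℳ(X)` is a `[2]`-manifold: frames exist locally and freely generate. -/
theorem isTwoManifold (X : IDVB.{u}) : IsTwoManifold (functions.obj X) :=
  ⟨_, _, fun m => by
    obtain ⟨U, τ, χ, hm, hf⟩ := exists_frame (X := X) m
    exact ⟨U, hm, _, _, hf.isFreelyGenerated⟩⟩

end IDVB

/-! ### Functions of low degree on free generators -/

theorem monoDeg_eq_one {r₁ r₂ : ℕ} {p : Finset (Fin r₁) × (Fin r₂ → ℕ)} (h : monoDeg p = 1) :
    ∃ i, p = ({i}, 0) := by
  obtain ⟨I, α⟩ := p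
  simp only [monoDeg] at h
  obtain ⟨i, hi⟩ := Finset.card_eq_one.mp (show I.card = 1 by omega)
  have hα : ∑ j, α j = 0 := by omega
  refine ⟨i, Prod.ext hi (funext fun j => ?_)⟩
  exact (Finset.sum_eq_zero_iff.mp hα) j (Finset.mem_univ _)

theorem monoDeg_eq_two {r₁ r₂ : ℕ} {p : Finset (Fin r₁) × (Fin r₂ → ℕ)} (h : monoDeg p = 2) :
    (∃ j, p = (∅, Pi.single j 1)) ∨ ∃ i k, i < k ∧ p = ({i, k}, 0) := by
  obtain ⟨I, α⟩ := p
  simp only [monoDeg] at h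
  rcases (show (I.card = 0 ∧ ∑ j, α j = 1) ∨ (I.card = 2 ∧ ∑ j, α j = 0) by omega) with
    ⟨h1, h2⟩ | ⟨h1, h2⟩
  · left
    obtain ⟨j, hj⟩ : ∃ j, α j ≠ 0 := by
      by_contra! h0
      simp [h0] at h2
    have h3 := Finset.add_sum_erase Finset.univ α (Finset.mem_univ j)
    have h4 : ∑ x ∈ Finset.univ.erase j, α x = 0 := by omega
    refine ⟨j, Prod.ext (Finset.card_eq_zero.mp h1) (funext fun l => ?_)⟩
    by_cases hl : l = j
    · subst hl
      simp only [Pi.single_eq_same]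
      omega
    · simp only [Pi.single_eq_of_ne hl]
      exact (Finset.sum_eq_zero_iff.mp h4) l (Finset.mem_erase.mpr ⟨hl, Finset.mem_univ _⟩)
  · right
    have hα : α = 0 := funext fun j => (Finset.sum_eq_zero_iff.mp h2) j (Finset.mem_univ _)
    obtain ⟨i, k, hik, rfl⟩ := Finset.card_eq_two.mp h1
    rcases lt_or_gt_of_ne hik with h | h
    · exact ⟨i, k, h, by rw [hα]⟩
    · exact ⟨k, i, h, by rw [hα, Finset.pair_comm]⟩

/-- The value of a smooth function at a point, as a ring homomorphism. -/
noncomputable def Fun.eval {M : Mfd.{u}} {U : Opens M} {m : M} (hm : m ∈ U) : Fun M U →+* ℝ where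
  toFun f := f ⟨m, hm⟩
  map_one' := rfl
  map_mul' _ _ := rfl
  map_zero' := rfl
  map_add' _ _ := rfl

namespace GradedMfd

variable {N : GradedMfd.{u}} {U V W : Opens N.base} {m : N.base} {r₁ r₂ : ℕ}

/-- The product of two elements of degree 1. -/
def mul₁₁ (a b : N.sec U 1) : N.sec U 2 := GradedMonoid.GMul.mul a b

theorem of_mul_of₁₁ (a b : N.sec U 1) :
    DirectSum.of (N.sec U) 1 a * DirectSum.of (N.sec U) 1 b =
      DirectSum.of (N.sec U) 2 (mul₁₁ a b) :=
  DirectSum.of_mul_of a b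

theorem res_mul₁₁ (h : V ≤ U) (a b : N.sec U 1) :
    N.res h 2 (mul₁₁ a b) = mul₁₁ (N.res h 1 a) (N.res h 1 b) := N.res_mul h 1 1 a b

/-- Restriction of functions of arbitrary degree. -/
noncomputable def resHom (N : GradedMfd.{u}) {U V : Opens N.base} (h : V ≤ U) :
    (⨁ k, N.sec U k) →+* ⨁ k, N.sec V k :=
  DirectSum.toSemiring (fun k => (DirectSum.of (N.sec V) k).comp (N.res h k))
    (congrArg (DirectSum.of (N.sec V) 0) (N.res_one h))
    fun {i j} a b => (congrArg (DirectSum.of (N.sec V) (i + j)) (N.res_mul h i j a b)).trans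
      (DirectSum.of_mul_of _ _).symm

theorem resHom_of (h : V ≤ U) (k : ℕ) (a : N.sec U k) :
    N.resHom h (DirectSum.of (N.sec U) k a) = DirectSum.of (N.sec V) k (N.res h k a) :=
  DirectSum.toSemiring_of _ _ _ _ _

theorem smul_of (k : ℕ) (f : Fun N.base U) (a : N.sec U k) :
    f • DirectSum.of (N.sec U) k a = DirectSum.of (N.sec U) k (f • a) :=
  (_root_.map_smul (DirectSum.lof (Fun N.base U) ℕ (N.sec U) k) f a).symm

theorem resHom_smul (h : V ≤ U) (f : Fun N.base U) (a : ⨁ k, N.sec U k) :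
    N.resHom h (f • a) = Fun.res h f • N.resHom h a := by
  induction a using DirectSum.induction_on with
  | zero => rw [smul_zero, _root_.map_zero, smul_zero]
  | of k a => rw [smul_of, resHom_of, resHom_of, N.res_smul, smul_of]
  | add a b h1 h2 => rw [smul_add, _root_.map_add, h1, h2, _root_.map_add, smul_add]

/-- Graded commutativity of sections of degrees 1 and 2. An odd section has square zero because `2`
is invertible in the smooth functions. -/
theorem superCommute (ξ : Fin r₁ → N.sec U 1) (η : Fin r₂ → N.sec U 2) :
    SuperCommute (fun i => DirectSum.of (N.sec U) 1 (ξ i))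
      (fun j => DirectSum.of (N.sec U) 2 (η j)) := by
  have anti : ∀ i j, DirectSum.of (N.sec U) 1 (ξ i) * DirectSum.of (N.sec U) 1 (ξ j) =
      -(DirectSum.of (N.sec U) 1 (ξ j) * DirectSum.of (N.sec U) 1 (ξ i)) := fun i j => by
    have := N.graded_comm U 1 1 (ξ i) (ξ j)
    rwa [mul_one, pow_one, neg_smul, one_smul] at this
  refine ⟨anti, fun i => ?_, fun j i => ?_, fun j k => ?_⟩
  · have h1 := eq_neg_iff_add_eq_zero.mp (anti i i)
    rw [← two_smul (Fun N.base U)] at h1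
    have h2 := congrArg (algebraMap ℝ (Fun N.base U) (1 / 2) • ·) h1
    simp only [smul_zero, smul_smul] at h2
    have h3 : algebraMap ℝ (Fun N.base U) (1 / 2) * 2 = 1 := by
      rw [← map_ofNat (algebraMap ℝ (Fun N.base U)) 2, ← _root_.map_mul]
      norm_num
    rwa [h3, one_smul] at h2
  · have := N.graded_comm U 2 1 (η j) (ξ i)
    rwa [show (-1 : ℤ) ^ (2 * 1) = 1 by norm_num, one_smul] at this
  · have := N.graded_comm U 2 2 (η j) (η k)
    rwa [show (-1 : ℤ) ^ (2 * 2) = 1 by norm_num, one_smul] at this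

variable {ξ : Fin r₁ → N.sec U 1} {η : Fin r₂ → N.sec U 2}

theorem IsFreelyGenerated.restrict (h : N.IsFreelyGenerated U ξ η) (hV : V ≤ U) :
    N.IsFreelyGenerated V (fun i => N.res hV 1 (ξ i)) (fun j => N.res hV 2 (η j)) := fun W hW => by
  simp only [N.res_res]
  exact h W _

theorem IsFreelyGenerated.linearIndependent (h : N.IsFreelyGenerated U ξ η) :
    LinearIndependent (Fun N.base U) (mono (fun i => DirectSum.of (N.sec U) 1 (ξ i))
      (fun j => DirectSum.of (N.sec U) 2 (η j))) := by
  have := (h U le_rfl).1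
  simp only [N.res_id] at this
  exact this

theorem IsFreelyGenerated.span_eq_top (h : N.IsFreelyGenerated U ξ η) :
    Submodule.span (Fun N.base U) (Set.range (mono (fun i => DirectSum.of (N.sec U) 1 (ξ i))
      (fun j => DirectSum.of (N.sec U) 2 (η j)))) = ⊤ := by
  have := (h U le_rfl).2
  simp only [N.res_id] at this
  exact this

/-- The degree `k` part of a freely generated algebra is spanned by the monomials of degree `k`,
because each monomial is homogeneous. Stated as an induction principle for submodules. -/
theorem IsFreelyGenerated.mem_span_component (h : N.IsFreelyGenerated U ξ η) {k : ℕ}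
    (a : N.sec U k) (S : Submodule (Fun N.base U) (N.sec U k))
    (hS : ∀ p, monoDeg p = k → ∀ x, mono (fun i => DirectSum.of (N.sec U) 1 (ξ i))
      (fun j => DirectSum.of (N.sec U) 2 (η j)) p = DirectSum.of (N.sec U) k x → x ∈ S) :
    a ∈ S := by
  have h1 : ∀ b : ⨁ k, N.sec U k, DirectSum.component (Fun N.base U) ℕ (N.sec U) k b ∈ S := by
    intro b
    have hb : b ∈ Submodule.span (Fun N.base U) (Set.range
      (mono (fun i => DirectSum.of (N.sec U) 1 (ξ i))
        (fun j => DirectSum.of (N.sec U) 2 (η j)))) := h.span_eq_top ▸ trivial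
    induction hb using Submodule.span_induction with
    | mem x hx =>
      obtain ⟨p, rfl⟩ := hx
      obtain ⟨y, hy⟩ := exists_of_mono ξ η p
      rw [hy]
      by_cases hp : monoDeg p = k
      · subst hp
        have : DirectSum.component (Fun N.base U) ℕ (N.sec U) (monoDeg p)
          (DirectSum.of (N.sec U) (monoDeg p) y) = y := DirectSum.of_eq_same _ _
        rw [this]
        exact hS p rfl y hy
      · have : DirectSum.component (Fun N.base U) ℕ (N.sec U) k
          (DirectSum.of (N.sec U) (monoDeg p) y) = 0 := DirectSum.of_eq_of_ne _ _ _ (Ne.symm hp)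
        rw [this]
        exact S.zero_mem
    | zero => rw [_root_.map_zero]; exact S.zero_mem
    | add x y _ _ h1 h2 => rw [_root_.map_add]; exact S.add_mem h1 h2
    | smul f x _ h1 => rw [_root_.map_smul]; exact S.smul_mem _ h1
  have h2 := h1 (DirectSum.of (N.sec U) k a)
  rwa [show DirectSum.component (Fun N.base U) ℕ (N.sec U) k (DirectSum.of (N.sec U) k a) = a from
    DirectSum.of_eq_same _ _] at h2

/-- The `ξ_i` span the functions of degree 1. -/
theorem IsFreelyGenerated.mem_span₁ (h : N.IsFreelyGenerated U ξ η) (a : N.sec U 1) :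
    a ∈ Submodule.span (Fun N.base U) (Set.range ξ) := by
  refine h.mem_span_component a _ fun p hp x hx => ?_
  obtain ⟨i, rfl⟩ := monoDeg_eq_one hp
  rw [mono_single_left] at hx
  exact Submodule.subset_span ⟨i, DirectSum.of_injective _ hx⟩

/-- The `η_j` and the `ξ_i ξ_k` with `i < k` span the functions of degree 2. -/
theorem IsFreelyGenerated.mem_span₂ (h : N.IsFreelyGenerated U ξ η) (a : N.sec U 2) :
    a ∈ Submodule.span (Fun N.base U)
      (Set.range (Sum.elim η fun q : {q : Fin r₁ × Fin r₁ // q.1 < q.2} =>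
        mul₁₁ (ξ q.1.1) (ξ q.1.2))) := by
  refine h.mem_span_component a _ fun p hp x hx => ?_
  rcases monoDeg_eq_two hp with ⟨j, rfl⟩ | ⟨i, k, hik, rfl⟩
  · rw [mono_single_right] at hx
    exact Submodule.subset_span ⟨Sum.inl j, DirectSum.of_injective _ hx⟩
  · rw [mono_pair _ _ hik, of_mul_of₁₁] at hx
    exact Submodule.subset_span ⟨Sum.inr ⟨(i, k), hik⟩, DirectSum.of_injective _ hx⟩

/-- Semilinear ring homomorphisms agree if they agree on free generators. -/
theorem IsFreelyGenerated.hom_ext (h : N.IsFreelyGenerated U ξ η) {R B : Type*} [CommRing R]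
    [Ring B] [Module R B] (ev : Fun N.base U → R) {T T' : (⨁ k, N.sec U k) →+* B}
    (hT : ∀ f a, T (f • a) = ev f • T a) (hT' : ∀ f a, T' (f • a) = ev f • T' a)
    (h1 : ∀ i, T (DirectSum.of (N.sec U) 1 (ξ i)) = T' (DirectSum.of (N.sec U) 1 (ξ i)))
    (h2 : ∀ j, T (DirectSum.of (N.sec U) 2 (η j)) = T' (DirectSum.of (N.sec U) 2 (η j)))
    (a : ⨁ k, N.sec U k) : T a = T' a := by
  have ha : a ∈ Submodule.span (Fun N.base U) (Set.range
    (mono (fun i => DirectSum.of (N.sec U) 1 (ξ i))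
      (fun j => DirectSum.of (N.sec U) 2 (η j)))) := h.span_eq_top ▸ trivial
  induction ha using Submodule.span_induction with
  | mem x hx =>
    obtain ⟨p, rfl⟩ := hx
    simp only [map_mono, h1, h2]
  | zero => rw [_root_.map_zero, _root_.map_zero]
  | add x y _ _ h1 h2 => rw [_root_.map_add, h1, h2, _root_.map_add]
  | smul f x _ h1 => rw [hT, hT', h1]

/-- Algebra homomorphisms out of the germs of functions at `m`, over the evaluation at `m`, have
arbitrary values on free generators, as long as these commute in the graded sense. A homomorphism
out of germs is given as a family over the neighbourhoods of `m`, compatible with restriction. -/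
theorem IsFreelyGenerated.exists_germ_hom (h : N.IsFreelyGenerated U ξ η) (hm : m ∈ U) {B : Type*}
    [Ring B] [Algebra ℝ B] {ξ' : Fin r₁ → B} {η' : Fin r₂ → B} (hB : SuperCommute ξ' η') :
    ∃ T : ∀ V : Opens N.base, m ∈ V → (⨁ k, N.sec V k) →+* B,
      (∀ V hV (f : Fun N.base V) a, T V hV (f • a) = f ⟨m, hV⟩ • T V hV a) ∧
      (∀ (V W : Opens N.base) (hWV : W ≤ V) (hW : m ∈ W) a,
        T W hW (N.resHom hWV a) = T V (hWV hW) a) ∧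
      (∀ i, T U hm (DirectSum.of (N.sec U) 1 (ξ i)) = ξ' i) ∧
      ∀ j, T U hm (DirectSum.of (N.sec U) 2 (η j)) = η' j := by
  have hS : ∀ (W : Opens N.base) (hW : W ≤ U) (hm : m ∈ W), ∃ S : (⨁ k, N.sec W k) →+* B,
      (∀ (f : Fun N.base W) a, S (f • a) = f ⟨m, hm⟩ • S a) ∧
      (∀ i, S (DirectSum.of (N.sec W) 1 (N.res hW 1 (ξ i))) = ξ' i) ∧
      ∀ j, S (DirectSum.of (N.sec W) 2 (N.res hW 2 (η j))) = η' j := fun W hW hm =>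
    exists_extension (Fun.eval hm) (superCommute _ _) (h.restrict hW).linearIndependent
      (h.restrict hW).span_eq_top hB
  choose S hS1 hS2 hS3 using hS
  have hcompat : ∀ (V W : Opens N.base) (hV : V ≤ U) (hWV : W ≤ V) (hmW : m ∈ W) a,
      S W (hWV.trans hV) hmW (N.resHom hWV a) = S V hV (hWV hmW) a := fun V W hV hWV hmW a => by
    refine (h.restrict hV).hom_ext (T := (S W (hWV.trans hV) hmW).comp (N.resHom hWV))
      (Fun.eval (hWV hmW)) (fun f a => ?_) (fun f a => hS1 V hV _ f a) (fun i => ?_)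
      (fun j => ?_) a
    · rw [RingHom.comp_apply, resHom_smul, hS1]
      rfl
    · rw [RingHom.comp_apply, resHom_of, N.res_res, hS2, hS2]
    · rw [RingHom.comp_apply, resHom_of, N.res_res, hS3, hS3]
  have hrr : ∀ {V W W' : Opens N.base} (h1 : W ≤ V) (h2 : W' ≤ W) (a : ⨁ k, N.sec V k),
      N.resHom h2 (N.resHom h1 a) = N.resHom (h2.trans h1) a := fun h1 h2 a => by
    induction a using DirectSum.induction_on with
    | zero => simp only [_root_.map_zero]
    | of k a => rw [resHom_of, resHom_of, resHom_of, N.res_res]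
    | add a b ha hb => simp only [_root_.map_add, ha, hb]
  refine ⟨fun V hV => (S (V ⊓ U) inf_le_right ⟨hV, hm⟩).comp (N.resHom inf_le_left),
    fun V hV f a => ?_, fun V W hWV hW a => ?_, fun i => ?_, fun j => ?_⟩
  · exact (congrArg _ (resHom_smul _ _ _)).trans (hS1 _ _ _ _ _)
  · rw [RingHom.comp_apply, RingHom.comp_apply, hrr,
      ← hcompat (V ⊓ U) (W ⊓ U) inf_le_right (inf_le_inf_right U hWV) ⟨hW, hm⟩, hrr]
  · rw [RingHom.comp_apply, resHom_of]
    exact hS2 _ _ _ i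
  · rw [RingHom.comp_apply, resHom_of]
    exact hS3 _ _ _ j

/-! ### Points of the total spaces -/

/-- The real-valued functionals on the germs at `m` of functions of degree `k` which are linear
over the evaluation at `m`: the dual space of the fibre at `m` of the bundle of functions of
degree `k`. Such a functional is encoded as a family over the neighbourhoods of `m`, compatible
with restriction. -/
def functionals (N : GradedMfd.{u}) (m : N.base) (k : ℕ) :
    Submodule ℝ (∀ U : {U : Opens N.base // m ∈ U}, N.sec U.1 k → ℝ) where
  carrier := {φ | (∀ U a b, φ U (a + b) = φ U a + φ U b) ∧
    (∀ U (f : Fun N.base U.1) a, φ U (f • a) = f ⟨m, U.2⟩ * φ U a) ∧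
    ∀ (U V : Opens N.base) (h : V ≤ U) (hV : m ∈ V) a,
      φ ⟨V, hV⟩ (N.res h k a) = φ ⟨U, h hV⟩ a}
  zero_mem' := ⟨fun _ _ _ => (add_zero 0).symm, fun _ _ _ => (mul_zero _).symm,
    fun _ _ _ _ _ => rfl⟩
  add_mem' {φ φ'} h h' := ⟨fun U a b => by
      simp only [Pi.add_apply, h.1, h'.1]
      ring, fun U f a => by
      simp only [Pi.add_apply, h.2.1, h'.2.1]
      ring, fun U V hVU hV a => by
      simp only [Pi.add_apply, h.2.2 U V hVU, h'.2.2 U V hVU]⟩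
  smul_mem' r φ h := ⟨fun U a b => by
      simp only [Pi.smul_apply, smul_eq_mul, h.1]
      ring, fun U f a => by
      simp only [Pi.smul_apply, smul_eq_mul, h.2.1]
      ring, fun U V hVU hV a => by
      simp only [Pi.smul_apply, h.2.2 U V hVU]⟩

/-- The functionals on germs at `m` of functions of degree `k`. -/
abbrev Functional (N : GradedMfd.{u}) (m : N.base) (k : ℕ) : Type u := N.functionals m k

/-- The value of a functional on a function of degree `k`. -/
def Functional.ev {k : ℕ} (φ : N.Functional m k) {U : Opens N.base} (hm : m ∈ U) (a : N.sec U k) :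
    ℝ := φ.1 ⟨U, hm⟩ a

namespace Functional

variable {k : ℕ} (φ φ' : N.Functional m k)

theorem ext' {φ φ' : N.Functional m k} (h : ∀ U (hU : m ∈ U) a, φ.ev hU a = φ'.ev hU a) : φ = φ' :=
  Subtype.ext (funext fun U => funext fun a => h U.1 U.2 a)

theorem ev_add (hm : m ∈ U) (a b : N.sec U k) : φ.ev hm (a + b) = φ.ev hm a + φ.ev hm b :=
  φ.2.1 ⟨U, hm⟩ a b

theorem ev_smul (hm : m ∈ U) (f : Fun N.base U) (a : N.sec U k) :
    φ.ev hm (f • a) = f ⟨m, hm⟩ * φ.ev hm a := φ.2.2.1 ⟨U, hm⟩ f a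

theorem ev_res (h : V ≤ U) (hm : m ∈ V) (a : N.sec U k) : φ.ev hm (N.res h k a) = φ.ev (h hm) a :=
  φ.2.2.2 U V h hm a

theorem ev_zero (hm : m ∈ U) : φ.ev hm (0 : N.sec U k) = 0 := by
  have := φ.ev_add hm 0 0
  rw [add_zero] at this
  linarith

theorem ev_neg (hm : m ∈ U) (a : N.sec U k) : φ.ev hm (-a) = -φ.ev hm a := by
  have := φ.ev_add hm a (-a)
  rw [add_neg_cancel, ev_zero] at this
  linarith

theorem ev_sum (hm : m ∈ U) {ι : Type*} (s : Finset ι) (a : ι → N.sec U k) :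
    φ.ev hm (∑ i ∈ s, a i) = ∑ i ∈ s, φ.ev hm (a i) := by
  classical
  induction s using Finset.induction_on with
  | empty => exact φ.ev_zero hm
  | insert i s hi h => rw [Finset.sum_insert hi, Finset.sum_insert hi, ev_add, h]

theorem smul_ev (r : ℝ) (hm : m ∈ U) (a : N.sec U k) : (r • φ).ev hm a = r * φ.ev hm a := rfl

/-- Functionals agree if they agree on a spanning family over some neighbourhood and all smaller
ones. -/
theorem ext_of_span {φ φ' : N.Functional m k} (hm : m ∈ U) {ι : Type*} (x : ι → N.sec U k)
    (hx : ∀ (V : Opens N.base) (hV : V ≤ U) (a : N.sec V k),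
      a ∈ Submodule.span (Fun N.base V) (Set.range fun i => N.res hV k (x i)))
    (h : ∀ i, φ.ev hm (x i) = φ'.ev hm (x i)) : φ = φ' := by
  refine ext' fun V hV a => ?_
  have hVU : m ∈ V ⊓ U := ⟨hV, hm⟩
  rw [← φ.ev_res (inf_le_left : V ⊓ U ≤ V) hVU, ← φ'.ev_res (inf_le_left : V ⊓ U ≤ V) hVU]
  have h1 := hx (V ⊓ U) inf_le_right (N.res inf_le_left k a)
  generalize N.res (inf_le_left : V ⊓ U ≤ V) k a = a' at h1 ⊢
  induction h1 using Submodule.span_induction with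
  | mem y hy =>
    obtain ⟨i, rfl⟩ := hy
    beta_reduce
    rw [ev_res, ev_res, h]
  | zero => rw [ev_zero, ev_zero]
  | add y z _ _ h1 h2 => rw [ev_add, ev_add, h1, h2]
  | smul f y _ h1 => rw [ev_smul, ev_smul, h1]

/-- A functional of degree 1 is determined by its values on free generators. -/
theorem ext₁ (h : N.IsFreelyGenerated U ξ η) (hm : m ∈ U) {φ φ' : N.Functional m 1}
    (h1 : ∀ i, φ.ev hm (ξ i) = φ'.ev hm (ξ i)) : φ = φ' :=
  ext_of_span hm ξ (fun _ hV a => (h.restrict hV).mem_span₁ a) h1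

/-- A functional of degree 2 is determined by its values on free generators of degree 2 and on the
products of those of degree 1. -/
theorem ext₂ (h : N.IsFreelyGenerated U ξ η) (hm : m ∈ U) {ψ ψ' : N.Functional m 2}
    (h1 : ∀ j, ψ.ev hm (η j) = ψ'.ev hm (η j))
    (h2 : ∀ i k, ψ.ev hm (mul₁₁ (ξ i) (ξ k)) = ψ'.ev hm (mul₁₁ (ξ i) (ξ k))) : ψ = ψ' := by
  refine ext_of_span hm (Sum.elim η fun q : {q : Fin r₁ × Fin r₁ // q.1 < q.2} =>
    mul₁₁ (ξ q.1.1) (ξ q.1.2))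
    (fun V hV a => ?_) ?_
  · have := (h.restrict hV).mem_span₂ a
    convert this using 3
    funext x
    rcases x with j | q
    · rfl
    · exact res_mul₁₁ hV _ _
  · rintro (j | q)
    · exact h1 j
    · exact h2 q.1.1 q.1.2

end Functional

/-- A point over `m` of the double vector bundle of a manifold with a sheaf of graded algebras: two
functionals of degree 1 and a functional of degree 2 compatible with the product. The compatibility
expresses that a product `a b` corresponds to the function
`1/2 (a ∘ π₁ · b ∘ π₂ - b ∘ π₁ · a ∘ π₂)` on the double vector bundle. -/
@[ext]
structure DPt (N : GradedMfd.{u}) (m : N.base) where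
  φ₁ : N.Functional m 1
  φ₂ : N.Functional m 1
  ψ : N.Functional m 2
  mul : ∀ (U : Opens N.base) (hm : m ∈ U) (a b : N.sec U 1), ψ.ev hm (mul₁₁ a b) =
    1 / 2 * (φ₁.ev hm a * φ₂.ev hm b - φ₁.ev hm b * φ₂.ev hm a)

/-- A point is determined by its values on free generators. -/
theorem DPt.ext_of_free (h : N.IsFreelyGenerated U ξ η) (hm : m ∈ U) {P P' : N.DPt m}
    (h1 : ∀ i, P.φ₁.ev hm (ξ i) = P'.φ₁.ev hm (ξ i))
    (h2 : ∀ i, P.φ₂.ev hm (ξ i) = P'.φ₂.ev hm (ξ i))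
    (h3 : ∀ j, P.ψ.ev hm (η j) = P'.ψ.ev hm (η j)) : P = P' := by
  have e1 := Functional.ext₁ h hm h1
  have e2 := Functional.ext₁ h hm h2
  exact DPt.ext e1 e2 (Functional.ext₂ h hm h3 fun i k => by rw [P.mul, P'.mul, e1, e2])

/-- Free generators define coordinates: a point is given by arbitrary values on the generators. The
point is read off from the homomorphism of germs to the exterior algebra on `θ₀`, `θ₁` with
`ξ_i ↦ a_i θ₀ + b_i θ₁` and `η_j ↦ 2 c_j θ₀ θ₁`. -/
theorem DPt.exists_of_free (h : N.IsFreelyGenerated U ξ η) (hm : m ∈ U) (a b : Fin r₁ → ℝ)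
    (c : Fin r₂ → ℝ) : ∃ P : N.DPt m, (∀ i, P.φ₁.ev hm (ξ i) = a i) ∧
      (∀ i, P.φ₂.ev hm (ξ i) = b i) ∧ ∀ j, P.ψ.ev hm (η j) = c j := by
  let θ := modelθ 2 0
  have hθ := superCommute_model 2 0
  have hxy : ∀ x y z w : ℝ, (x • θ 0 + y • θ 1) * (z • θ 0 + w • θ 1) =
      (x * w - y * z) • (θ 0 * θ 1) := fun x y z w => by
    simp only [add_mul, mul_add, smul_mul_assoc, mul_smul_comm]
    rw [show θ 0 * θ 0 = 0 from hθ.sq 0, show θ 1 * θ 1 = 0 from hθ.sq 1,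
      show θ 1 * θ 0 = -(θ 0 * θ 1) from hθ.anti 1 0]
    simp only [smul_zero, smul_neg, zero_add, add_zero, smul_smul, sub_smul]
    rw [mul_comm z y, mul_comm w x]
    abel
  have hB : SuperCommute (fun i => a i • θ 0 + b i • θ 1) (fun j => (2 * c j) • (θ 0 * θ 1)) := by
    have h2 : ∀ i, Commute (θ 0 * θ 1) (θ i) := fun i => hθ.pair_comm 0 1 i
    refine ⟨fun i j => ?_, fun i => ?_, fun j i => ?_, fun j k => ?_⟩
    · rw [hxy, hxy, ← neg_smul]
      congr 1
      ring
    · rw [hxy, mul_comm, sub_self, zero_smul]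
    · exact ((h2 0).smul_right _ |>.add_right ((h2 1).smul_right _)).smul_left _
    · exact (((h2 0).mul_right (h2 1)).smul_right _).smul_left _
  obtain ⟨T, hT1, hT2, hT3, hT4⟩ := h.exists_germ_hom hm hB
  -- the coefficients of the monomials in the exterior algebra on `θ 0`, `θ 1`
  have hli := linearIndependent_model 2 0
  obtain ⟨G, hG⟩ := LinearMap.exists_extend hli.repr
  have hl : ∀ p q, G (mono θ (modelY 2 0) q) p = if q = p then 1 else 0 := fun p q => by
    have h1 := LinearMap.congr_fun hG ⟨_, Submodule.subset_span ⟨q, rfl⟩⟩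
    rw [hli.repr_eq_single q _ rfl] at h1
    exact (congrArg (· p) h1).trans Finsupp.single_apply
  have mk : ∀ k p, ∃ φ : N.Functional m k, ∀ V (hV : m ∈ V) a,
      φ.ev hV a = G (T V hV (DirectSum.of (N.sec V) k a)) p := fun k p =>
    ⟨⟨fun V a => G (T V.1 V.2 (DirectSum.of (N.sec V.1) k a)) p, fun U a b => by
        simp only [_root_.map_add, Finsupp.add_apply], fun U f a => by
        beta_reduce
        rw [← smul_of, hT1]
        simp only [_root_.map_smul, Finsupp.smul_apply, smul_eq_mul], fun U V hVU hV a => by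
        beta_reduce
        rw [← resHom_of, hT2]⟩, fun _ _ _ => rfl⟩
  have e0 : mono θ (modelY 2 0) ({0}, 0) = θ 0 := mono_single_left _ _ _
  have e1 : mono θ (modelY 2 0) ({1}, 0) = θ 1 := mono_single_left _ _ _
  have e2 : mono θ (modelY 2 0) ({0, 1}, 0) = θ 0 * θ 1 := mono_pair _ _ (by decide)
  have g0 := fun p => hl p ({0}, 0)
  have g1 := fun p => hl p ({1}, 0)
  have g2 := fun p => hl p ({0, 1}, 0)
  rw [e0] at g0
  rw [e1] at g1
  rw [e2] at g2
  have hdeg1 : ∀ x y, G (x • θ 0 + y • θ 1) ({0}, 0) = x ∧ G (x • θ 0 + y • θ 1) ({1}, 0) = y :=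
    fun x y => by
      simp [g0, g1]
  have hT : ∀ V (hV : m ∈ V) (s : N.sec V 1), ∃ x y : ℝ,
      T V hV (DirectSum.of (N.sec V) 1 s) = x • θ 0 + y • θ 1 := fun V hV s => by
    have hVU : m ∈ V ⊓ U := ⟨hV, hm⟩
    rw [← hT2 V (V ⊓ U) inf_le_left hVU, resHom_of]
    have h1 := (h.restrict (inf_le_right : V ⊓ U ≤ U)).mem_span₁ (N.res inf_le_left 1 s)
    generalize N.res (inf_le_left : V ⊓ U ≤ V) 1 s = s' at h1 ⊢
    induction h1 using Submodule.span_induction with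
    | mem x hx =>
      obtain ⟨i, rfl⟩ := hx
      refine ⟨a i, b i, ?_⟩
      rw [← resHom_of, hT2, hT3]
    | zero => exact ⟨0, 0, by simp⟩
    | add x y _ _ h1 h2 =>
      obtain ⟨p, q, h1⟩ := h1
      obtain ⟨p', q', h2⟩ := h2
      refine ⟨p + p', q + q', ?_⟩
      rw [_root_.map_add, _root_.map_add, h1, h2]
      module
    | smul f x _ h1 =>
      obtain ⟨p, q, h1⟩ := h1
      refine ⟨f ⟨m, hVU⟩ * p, f ⟨m, hVU⟩ * q, ?_⟩
      rw [← smul_of, hT1, h1, smul_add, smul_smul, smul_smul]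
  obtain ⟨φ₁, h1⟩ := mk 1 ({0}, 0)
  obtain ⟨φ₂, h2⟩ := mk 1 ({1}, 0)
  obtain ⟨ψ, h3⟩ := mk 2 ({0, 1}, 0)
  refine ⟨DPt.mk φ₁ φ₂ ((1 / 2 : ℝ) • ψ) fun V hV a b => ?_, fun i => ?_, fun i => ?_,
    fun j => ?_⟩
  · obtain ⟨x, y, hx⟩ := hT V hV a
    obtain ⟨z, w, hz⟩ := hT V hV b
    rw [Functional.smul_ev, h1, h1, h2, h2, h3, ← of_mul_of₁₁, _root_.map_mul, hx, hz, hxy]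
    simp only [(hdeg1 _ _).1, (hdeg1 _ _).2, _root_.map_smul, Finsupp.smul_apply, g2, smul_eq_mul]
    simp only [if_true]
    ring
  · rw [h1, hT3, (hdeg1 _ _).1]
  · rw [h2, hT3, (hdeg1 _ _).2]
  · rw [Functional.smul_ev, h3, hT4]
    simp only [_root_.map_smul, Finsupp.smul_apply, g2, smul_eq_mul, if_true]
    ring

end GradedMfd

namespace GradedMfd

variable {N N' N'' : GradedMfd.{u}} {m : N.base} {U V : Opens N.base}

/-! ### Total spaces and pushforward of points -/

/-- The total space of the dual of the bundle of functions of degree 1, as a set. -/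
abbrev TQ (N : GradedMfd.{u}) : Type u := Σ m : N.base, N.Functional m 1

/-- The total space of the double vector bundle of points, as a set. -/
abbrev TD (N : GradedMfd.{u}) : Type u := Σ m : N.base, N.DPt m

/-- The first projection, onto the dual of the bundle of functions of degree 1. -/
def TD.p₁ (P : N.TD) : N.TQ := ⟨P.1, P.2.φ₁⟩

/-- The second projection, onto the dual of the bundle of functions of degree 1. -/
def TD.p₂ (P : N.TD) : N.TQ := ⟨P.1, P.2.φ₂⟩

/-- The flip of a point: it exchanges the two functionals of degree 1 and changes the sign of the
functional of degree 2. -/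
noncomputable def DPt.inv (P : N.DPt m) : N.DPt m where
  φ₁ := P.φ₂
  φ₂ := P.φ₁
  ψ := (-1 : ℝ) • P.ψ
  mul U hm a b := by
    rw [Functional.smul_ev, P.mul]
    ring

/-- The flip as a map of the total space. -/
noncomputable def TD.inv (P : N.TD) : N.TD := ⟨P.1, P.2.inv⟩

theorem TD.inv_inv (P : N.TD) : P.inv.inv = P := by
  obtain ⟨m, P⟩ := P
  refine Sigma.ext rfl (heq_of_eq (DPt.ext rfl rfl ?_))
  refine Functional.ext' fun U hU a => ?_
  exact (neg_one_mul _).trans ((congrArg Neg.neg (neg_one_mul _)).trans (neg_neg (P.ψ.ev hU a)))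

theorem TQ.ext_ev {x x' : N.TQ} (h : x.1 = x'.1)
    (h' : ∀ (U : Opens N.base) (hx : x.1 ∈ U) (hx' : x'.1 ∈ U) (a : N.sec U 1),
      x.2.ev hx a = x'.2.ev hx' a) : x = x' := by
  obtain ⟨m, φ⟩ := x
  obtain ⟨m', φ'⟩ := x'
  obtain rfl : m = m' := h
  exact Sigma.ext rfl (heq_of_eq (Functional.ext' fun U hU a => h' U hU hU a))

theorem TQ.ev_congr {x x' : N.TQ} (h : x = x') (hx : x.1 ∈ U) (hx' : x'.1 ∈ U) (a : N.sec U 1) :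
    x.2.ev hx a = x'.2.ev hx' a := by
  subst h
  rfl

theorem TD.ψ_congr {P P' : N.TD} (h : P = P') (hx : P.1 ∈ U) (hx' : P'.1 ∈ U) (a : N.sec U 2) :
    P.2.ψ.ev hx a = P'.2.ψ.ev hx' a := by
  subst h
  rfl

theorem TD.ext_free {r₁ r₂ : ℕ} {ξ : Fin r₁ → N.sec U 1} {η : Fin r₂ → N.sec U 2}
    (hf : N.IsFreelyGenerated U ξ η) {P P' : N.TD} (h : P.1 = P'.1) (hP : P.1 ∈ U) (hP' : P'.1 ∈ U)
    (h1 : ∀ i, P.2.φ₁.ev hP (ξ i) = P'.2.φ₁.ev hP' (ξ i))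
    (h2 : ∀ i, P.2.φ₂.ev hP (ξ i) = P'.2.φ₂.ev hP' (ξ i))
    (h3 : ∀ j, P.2.ψ.ev hP (η j) = P'.2.ψ.ev hP' (η j)) : P = P' := by
  obtain ⟨m, P⟩ := P
  obtain ⟨m', P'⟩ := P'
  obtain rfl : m = m' := h
  exact Sigma.ext rfl (heq_of_eq (DPt.ext_of_free hf hP h1 h2 h3))

theorem TD.ext_ev {P P' : N.TD} (h : P.1 = P'.1) (h1 : P.p₁ = P'.p₁) (h2 : P.p₂ = P'.p₂)
    (h3 : ∀ (U : Opens N.base) (hx : P.1 ∈ U) (hx' : P'.1 ∈ U) (a : N.sec U 2),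
      P.2.ψ.ev hx a = P'.2.ψ.ev hx' a) : P = P' := by
  obtain ⟨m, P⟩ := P
  obtain ⟨m', P'⟩ := P'
  obtain rfl : m = m' := h
  exact Sigma.ext rfl (heq_of_eq (DPt.ext (eq_of_heq (Sigma.ext_iff.mp h1).2)
    (eq_of_heq (Sigma.ext_iff.mp h2).2) (Functional.ext' fun U hU a => h3 U hU hU a)))

theorem mem_preim {M M' : Mfd.{u}} {f : M → M'} {hf : SmoothMap f} {V : Opens M'} {x : M}
    (h : f x ∈ V) : x ∈ preim hf V := h

/-- Pushforward of functionals along a morphism, by pulling back functions. -/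
def Hom.push (F : Hom N N') {k : ℕ} (φ : N.Functional m k) : N'.Functional (F.base m) k :=
  ⟨fun V a => φ.ev (mem_preim (hf := F.smooth) V.2) (F.app V.1 k a),
    fun _ a b => (congrArg (φ.ev _) (_root_.map_add _ a b)).trans (φ.ev_add _ _ _),
    fun _ f a => (congrArg (φ.ev _) (F.app_smul _ k f a)).trans (φ.ev_smul _ _ _),
    fun _ _ h _ a => (congrArg (φ.ev _) (F.app_res h k a)).trans (φ.ev_res _ _ _)⟩

theorem Hom.push_ev (F : Hom N N') {k : ℕ} (φ : N.Functional m k) {V : Opens N'.base}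
    (hV : F.base m ∈ V) (a : N'.sec V k) :
    (F.push φ).ev hV a = φ.ev (mem_preim (hf := F.smooth) hV) (F.app V k a) := rfl

/-- Pushforward of points along a morphism. -/
def Hom.pushD (F : Hom N N') (P : N.DPt m) : N'.DPt (F.base m) where
  φ₁ := F.push P.φ₁
  φ₂ := F.push P.φ₂
  ψ := F.push P.ψ
  mul V hV a b := by
    rw [F.push_ev, show F.app V 2 (mul₁₁ a b) = mul₁₁ (F.app V 1 a) (F.app V 1 b) from
      F.app_mul V 1 1 a b, P.mul]
    rfl

/-- The map induced by a morphism on the duals of the bundles of functions of degree 1. -/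
def Hom.mapQ (F : Hom N N') (x : N.TQ) : N'.TQ := ⟨F.base x.1, F.push x.2⟩

/-- The map induced by a morphism on the double vector bundles of points. -/
def Hom.mapD (F : Hom N N') (P : N.TD) : N'.TD := ⟨F.base P.1, F.pushD P.2⟩

/-- Sections are equal if they are locally equal. -/
theorem eq_of_local {k : ℕ} {a b : N.sec U k} (h : ∀ m ∈ U, ∃ (V : Opens N.base) (hV : V ≤ U),
    m ∈ V ∧ N.res hV k a = N.res hV k b) : a = b := by
  choose V hV hm hab using h
  let W : N.base → Opens N.base := fun m => by
    classical exact if hm : m ∈ U then V m hm else ⊥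
  have hW : ∀ m (hm : m ∈ U), W m = V m hm := fun m hm => dif_pos hm
  have hWU : ∀ m, W m ≤ U := fun m => by
    by_cases hm : m ∈ U
    · rw [hW m hm]
      exact hV m hm
    · rw [show W m = ⊥ from dif_neg hm]
      exact bot_le
  have hU : (⨆ m, W m) = U := le_antisymm (iSup_le hWU) fun m hm' =>
    Opens.mem_iSup.mpr ⟨m, by rw [hW m hm']; exact hm m hm'⟩
  have hres : ∀ m, N.res (hWU m) k a = N.res (hWU m) k b := fun m => by
    by_cases hm : m ∈ U
    · have key : ∀ (W' : Opens N.base) (e : W' = V m hm) (h : W' ≤ U),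
          N.res h k a = N.res h k b := by
        rintro _ rfl h
        exact hab m hm
      exact key _ (hW m hm) _
    · have key : ∀ (W' : Opens N.base) (e : W' = ⊥) (h : W' ≤ U),
          N.res h k a = N.res h k b := by
        rintro _ rfl h
        -- over the empty set every section equals the glueing of the empty family
        obtain ⟨t, -, ht⟩ := N.sheaf (fun i : PEmpty => i.elim) k (fun i => i.elim)
          (fun i => i.elim)
        have e : (⨆ i : PEmpty.{u + 1}, (i.elim : Opens N.base)) = ⊥ := by simp
        have key2 : ∀ (O O' : Opens N.base) (_ : O' = O) (_ : ∀ s s' : N.sec O' k, s = s')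
            (s s' : N.sec O k), s = s' := by
          rintro O _ rfl h s s'
          exact h s s'
        exact key2 _ _ e (fun s s' => (ht s fun i => i.elim).trans (ht s' fun i => i.elim).symm) _ _
      exact key _ (dif_neg hm) _
  have key : ∀ (O : Opens N.base) (e : (⨆ m, W m) = O) (hO : ∀ m, W m ≤ O) (a b : N.sec O k),
      (∀ m, N.res (hO m) k a = N.res (hO m) k b) → a = b := by
    rintro _ rfl hO a b hab
    obtain ⟨t, -, ht⟩ := N.sheaf W k (fun m => N.res (hO m) k a) fun i j => by
      rw [N.res_res, N.res_res]
    exact (ht a fun _ => rfl).trans (ht b fun m => (hab m).symm).symm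
  exact key U hU hWU a b hres

/-- The homomorphism of algebras over an open set given by a morphism. -/
noncomputable def Hom.appHom (F : Hom N N') (V : Opens N'.base) :
    (⨁ k, N'.sec V k) →+* ⨁ k, N.sec (preim F.smooth V) k :=
  DirectSum.toSemiring (fun k => (DirectSum.of (N.sec (preim F.smooth V)) k).comp (F.app V k))
    (congrArg (DirectSum.of (N.sec (preim F.smooth V)) 0) (F.app_one V))
    fun {i j} a b => (congrArg (DirectSum.of (N.sec (preim F.smooth V)) (i + j))
      (F.app_mul V i j a b)).trans (DirectSum.of_mul_of _ _).symm

theorem Hom.appHom_of (F : Hom N N') (V : Opens N'.base) (k : ℕ) (a : N'.sec V k) :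
    F.appHom V (DirectSum.of (N'.sec V) k a) =
      DirectSum.of (N.sec (preim F.smooth V)) k (F.app V k a) :=
  DirectSum.toSemiring_of _ _ _ _ _

theorem Hom.appHom_smul (F : Hom N N') (V : Opens N'.base) (f : Fun N'.base V)
    (a : ⨁ k, N'.sec V k) : F.appHom V (f • a) =
      (Fun.pullback F.smooth (fun _ hx => hx) f : Fun N.base (preim F.smooth V)) •
        F.appHom V a := by
  induction a using DirectSum.induction_on with
  | zero => rw [smul_zero, _root_.map_zero, smul_zero]
  | of k a => rw [smul_of, Hom.appHom_of, Hom.appHom_of, F.app_smul, smul_of]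
  | add a b h1 h2 => rw [smul_add, _root_.map_add, h1, h2, _root_.map_add, smul_add]

section

variable {r₁ r₂ : ℕ} {ξ : Fin r₁ → N.sec U 1} {η : Fin r₂ → N.sec U 2}

/-- Functions of degree 1 are separated by the points. -/
theorem IsTwoManifold.eq_of_ev₁ (hN : IsTwoManifold N) {a b : N.sec U 1}
    (h : ∀ m (hm : m ∈ U) (P : N.DPt m), P.φ₁.ev hm a = P.φ₁.ev hm b) : a = b := by
  obtain ⟨r₁, r₂, hN⟩ := hN
  refine eq_of_local fun m hm => ?_
  obtain ⟨W, hmW, ξ, η, hf⟩ := hN m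
  refine ⟨U ⊓ W, inf_le_left, ⟨hm, hmW⟩, ?_⟩
  have hf' := hf.restrict (inf_le_right : U ⊓ W ≤ W)
  obtain ⟨f, hfa⟩ := (Submodule.mem_span_range_iff_exists_fun _).mp
    (hf'.mem_span₁ (N.res inf_le_left 1 a - N.res inf_le_left 1 b))
  have hf0 : ∀ i, f i = 0 := fun i => DFunLike.ext _ _ fun x => by
    obtain ⟨P, hP, -, -⟩ := DPt.exists_of_free hf' x.2 (Pi.single i 1) 0 0
    have h1 := congrArg (P.φ₁.ev x.2) hfa
    rw [Functional.ev_sum, sub_eq_add_neg, Functional.ev_add, Functional.ev_neg, Functional.ev_res,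
      Functional.ev_res, h, add_neg_cancel] at h1
    simp only [Functional.ev_smul, hP, Pi.single_apply, mul_ite, mul_one, mul_zero] at h1
    simpa using h1
  rw [← sub_eq_zero, ← hfa]
  simp [hf0]

/-- Functions of degree 2 are separated by the points. -/
theorem IsTwoManifold.eq_of_ev₂ (hN : IsTwoManifold N) {a b : N.sec U 2}
    (h : ∀ m (hm : m ∈ U) (P : N.DPt m), P.ψ.ev hm a = P.ψ.ev hm b) : a = b := by
  obtain ⟨r₁, r₂, hN⟩ := hN
  refine eq_of_local fun m hm => ?_
  obtain ⟨W, hmW, ξ, η, hf⟩ := hN m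
  refine ⟨U ⊓ W, inf_le_left, ⟨hm, hmW⟩, ?_⟩
  have hf' := hf.restrict (inf_le_right : U ⊓ W ≤ W)
  obtain ⟨f, hfa⟩ := (Submodule.mem_span_range_iff_exists_fun _).mp
    (hf'.mem_span₂ (N.res inf_le_left 2 a - N.res inf_le_left 2 b))
  have hP : ∀ (x : (U ⊓ W : Opens N.base)) (P : N.DPt x.1),
      ∑ j, f (Sum.inl j) x * P.ψ.ev x.2 (N.res inf_le_right 2 (η j)) +
        ∑ q : {q : Fin r₁ × Fin r₁ // q.1 < q.2}, f (Sum.inr q) x *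
          (1 / 2 * (P.φ₁.ev x.2 (N.res inf_le_right 1 (ξ q.1.1)) *
            P.φ₂.ev x.2 (N.res inf_le_right 1 (ξ q.1.2)) -
            P.φ₁.ev x.2 (N.res inf_le_right 1 (ξ q.1.2)) *
            P.φ₂.ev x.2 (N.res inf_le_right 1 (ξ q.1.1)))) = 0 := fun x P => by
    have h1 := congrArg (P.ψ.ev x.2) hfa
    rw [Functional.ev_sum, sub_eq_add_neg, Functional.ev_add, Functional.ev_neg, Functional.ev_res,
      Functional.ev_res, h, add_neg_cancel, Fintype.sum_sum_type] at h1
    simp only [Functional.ev_smul, Sum.elim_inl, Sum.elim_inr, P.mul] at h1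
    exact h1
  have hf0 : ∀ i, f i = 0 := fun i => DFunLike.ext _ _ fun x => by
    rcases i with j | ⟨⟨i, k⟩, hik⟩
    · obtain ⟨P, h1, h2, h3⟩ := DPt.exists_of_free hf' x.2 0 0 (Pi.single j 1)
      have h4 := hP x P
      simp only [h1, h2, h3, Pi.single_apply, mul_ite, mul_one, mul_zero, Pi.zero_apply] at h4
      simpa using h4
    · obtain ⟨P, h1, h2, h3⟩ := DPt.exists_of_free hf' x.2 (Pi.single i 1) (Pi.single k 1) 0
      have h4 := hP x P
      simp only [h1, h2, h3, mul_zero, Pi.zero_apply, Finset.sum_const_zero, zero_add] at h4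
      rw [Finset.sum_eq_single ⟨(i, k), hik⟩] at h4
      · have hki : k ≠ i := ne_of_gt hik
        have hik' : i ≠ k := ne_of_lt hik
        simp only [Pi.single_eq_same, Pi.single_eq_of_ne hki, Pi.single_eq_of_ne hik', mul_one,
          mul_zero, sub_zero] at h4
        change _ = (0 : ℝ)
        linarith
      · rintro ⟨⟨i', k'⟩, hik'⟩ - hne
        have h5 : (Pi.single i 1 : Fin r₁ → ℝ) i' * (Pi.single k 1 : Fin r₁ → ℝ) k' = 0 := by
          by_cases hi : i' = i
          · by_cases hk : k' = k
            · subst hi hk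
              exact absurd rfl hne
            · rw [Pi.single_eq_of_ne hk, mul_zero]
          · rw [Pi.single_eq_of_ne hi, zero_mul]
        have h6 : (Pi.single i 1 : Fin r₁ → ℝ) k' * (Pi.single k 1 : Fin r₁ → ℝ) i' = 0 := by
          by_cases hi : k' = i
          · by_cases hk : i' = k
            · subst hi hk
              exact absurd hik' (lt_asymm hik)
            · rw [Pi.single_eq_of_ne hk, mul_zero]
          · rw [Pi.single_eq_of_ne hi, zero_mul]
        simp only [h5, h6]
        ring
      · intro h
        exact absurd (Finset.mem_univ _) h
  rw [← sub_eq_zero, ← hfa]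
  simp [hf0]

end

/-- Over every point of the base there is a point, namely the one all of whose coordinates
vanish. -/
theorem IsTwoManifold.exists_point (hN : IsTwoManifold N) (m : N.base) : Nonempty (N.DPt m) := by
  obtain ⟨r₁, r₂, hN⟩ := hN
  obtain ⟨W, hmW, ξ, η, hf⟩ := hN m
  obtain ⟨P, -⟩ := DPt.exists_of_free hf hmW 0 0 0
  exact ⟨P⟩

/-- A morphism of `[2]`-manifolds is determined by its effect on points: these separate functions
of degree 1 and 2, which generate all functions. -/
theorem Hom.ext_of_mapD (hN : IsTwoManifold N) (hN' : IsTwoManifold N') {F G : Hom N N'}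
    (h : ∀ P, F.mapD P = G.mapD P) : F = G := by
  have hb : F.base = G.base := funext fun m => by
    obtain ⟨P⟩ := IsTwoManifold.exists_point hN m
    exact congrArg Sigma.fst (h ⟨m, P⟩)
  have h1 : ∀ (U : Opens N'.base) (s : N'.sec U 1) m (hF : F.base m ∈ U) (hG : G.base m ∈ U)
      (P : N.DPt m), P.φ₁.ev (mem_preim (hf := F.smooth) hF) (F.app U 1 s) =
        P.φ₁.ev (mem_preim (hf := G.smooth) hG) (G.app U 1 s) := fun U s m hF hG P =>
    TQ.ev_congr (congrArg TD.p₁ (h ⟨m, P⟩)) hF hG s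
  have h2 : ∀ (U : Opens N'.base) (s : N'.sec U 2) m (hF : F.base m ∈ U) (hG : G.base m ∈ U)
      (P : N.DPt m), P.ψ.ev (mem_preim (hf := F.smooth) hF) (F.app U 2 s) =
        P.ψ.ev (mem_preim (hf := G.smooth) hG) (G.app U 2 s) := fun U s m hF hG P =>
    TD.ψ_congr (h ⟨m, P⟩) hF hG s
  clear h
  obtain ⟨f, hf, app, hone, hmul, hsmul, hres⟩ := F
  obtain ⟨g, hg, app', hone', hmul', hsmul', hres'⟩ := G
  obtain rfl : f = g := hb
  let F : Hom N N' := ⟨f, hf, app, hone, hmul, hsmul, hres⟩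
  let G : Hom N N' := ⟨f, hg, app', hone', hmul', hsmul', hres'⟩
  refine Hom.ext rfl (heq_of_eq (funext fun U => funext fun k => AddMonoidHom.ext fun a => ?_))
  obtain ⟨r₁, r₂, hN'⟩ := hN'
  refine eq_of_local fun m hm => ?_
  obtain ⟨W, hmW, ξ, η, hfree⟩ := hN' (f m)
  refine ⟨preim hf (U ⊓ W), fun x hx => hx.1, ⟨hm, hmW⟩, ?_⟩
  have hfree' := hfree.restrict (inf_le_right : U ⊓ W ≤ W)
  have key := hfree'.hom_ext (T := F.appHom (U ⊓ W)) (T' := G.appHom (U ⊓ W))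
    (fun f => Fun.pullback F.smooth (fun _ hx => hx) f) (F.appHom_smul _) (G.appHom_smul _)
    (fun i => by
      rw [F.appHom_of, G.appHom_of]
      exact congrArg _ (IsTwoManifold.eq_of_ev₁ hN fun m hm P => h1 _ _ m hm hm P))
    (fun j => by
      rw [F.appHom_of, G.appHom_of]
      exact congrArg _ (IsTwoManifold.eq_of_ev₂ hN fun m hm P => h2 _ _ m hm hm P))
    (DirectSum.of (N'.sec (U ⊓ W)) k (N'.res inf_le_left k a))
  rw [F.appHom_of, G.appHom_of] at key
  have key2 := DirectSum.of_injective _ key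
  rw [F.app_res, G.app_res] at key2
  exact key2

end GradedMfd

namespace IDVB

variable {X Y : IDVB.{u}} {U : Opens X.M}

/-! ### An involutive double vector bundle as the space of points of its functions -/

/-- The section of `Q^*` corresponding to a function of degree 1. -/
noncomputable def dualOf (s : X.toGradedMfd.sec U 1) : X.DualSection U :=
  ((bijective_ofDual X U).2 s).choose

theorem ofDual_dualOf (s : X.toGradedMfd.sec U 1) : X.ofDual (dualOf s) = s :=
  ((bijective_ofDual X U).2 s).choose_spec

theorem dualOf_ofDual (σ : X.DualSection U) : dualOf (X.ofDual σ) = σ :=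
  (bijective_ofDual X U).1 (ofDual_dualOf _)

/-- The isotropic linear section corresponding to a function of degree 2. -/
noncomputable def isotropicOf (s : X.toGradedMfd.sec U 2) : X.IsotropicSection U :=
  ((bijective_ofIsotropic X U).2 s).choose

theorem ofIsotropic_isotropicOf (s : X.toGradedMfd.sec U 2) :
    X.ofIsotropic (isotropicOf s) = s :=
  ((bijective_ofIsotropic X U).2 s).choose_spec

theorem isotropicOf_ofIsotropic (χ : X.IsotropicSection U) : isotropicOf (X.ofIsotropic χ) = χ :=
  (bijective_ofIsotropic X U).1 (ofIsotropic_isotropicOf _)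

theorem secOfDual_dualOf (s : X.toGradedMfd.sec U 1) : secOfDual (dualOf s) = s.1 :=
  congrArg Subtype.val (ofDual_dualOf s)

theorem secOfIsotropic_isotropicOf (s : X.toGradedMfd.sec U 2) :
    secOfIsotropic (isotropicOf s) = s.1 :=
  congrArg Subtype.val (ofIsotropic_isotropicOf s)

theorem deg1_dualOf (s : X.toGradedMfd.sec U 1) (m : U) :
    (TwoAlg.deg1 wedge ((dualOf s).toFun m) : X.FibAlg m.1) = s.1 m :=
  congrFun (secOfDual_dualOf s) m

theorem deg2_isotropicOf (s : X.toGradedMfd.sec U 2) (m : U) :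
    (TwoAlg.deg2 wedge ((isotropicOf s).toFun m) : X.FibAlg m.1) = s.1 m :=
  congrFun (secOfIsotropic_isotropicOf s) m

theorem dualOf_add (s t : X.toGradedMfd.sec U 1) (m : U) :
    (dualOf (s + t)).toFun m = (dualOf s).toFun m + (dualOf t).toFun m := by
  apply deg1_injective
  rw [_root_.map_add, deg1_dualOf, deg1_dualOf, deg1_dualOf]
  rfl

theorem dualOf_smul (f : Fun X.M U) (s : X.toGradedMfd.sec U 1) (m : U) :
    (dualOf (f • s)).toFun m = f m • (dualOf s).toFun m := by
  apply deg1_injective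
  rw [_root_.map_smul, deg1_dualOf, deg1_dualOf]
  exact Sec.eval_smul m f s.1

theorem dualOf_res {V : Opens X.M} (h : V ≤ U) (s : X.toGradedMfd.sec U 1) (m : V) :
    (dualOf (X.toGradedMfd.res h 1 s)).toFun m = (dualOf s).toFun ⟨m.1, h m.2⟩ := by
  apply deg1_injective
  exact (deg1_dualOf _ _).trans (deg1_dualOf s ⟨m.1, h m.2⟩).symm

theorem isotropicOf_add (s t : X.toGradedMfd.sec U 2) (m : U) :
    (isotropicOf (s + t)).toFun m = (isotropicOf s).toFun m + (isotropicOf t).toFun m := by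
  apply deg2_injective
  rw [_root_.map_add, deg2_isotropicOf, deg2_isotropicOf, deg2_isotropicOf]
  rfl

theorem isotropicOf_smul (f : Fun X.M U) (s : X.toGradedMfd.sec U 2) (m : U) :
    (isotropicOf (f • s)).toFun m = f m • (isotropicOf s).toFun m := by
  apply deg2_injective
  rw [_root_.map_smul, deg2_isotropicOf, deg2_isotropicOf]
  exact Sec.eval_smul m f s.1

theorem isotropicOf_res {V : Opens X.M} (h : V ≤ U) (s : X.toGradedMfd.sec U 2) (m : V) :
    (isotropicOf (X.toGradedMfd.res h 2 s)).toFun m = (isotropicOf s).toFun ⟨m.1, h m.2⟩ := by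
  apply deg2_injective
  exact (deg2_isotropicOf _ _).trans (deg2_isotropicOf s ⟨m.1, h m.2⟩).symm

/-- The evaluation of functions of degree 1 at an element of `Q`. -/
noncomputable def evalQ {m : X.M} (x : X.q.Fib m) : X.toGradedMfd.Functional m 1 :=
  ⟨fun V s => (dualOf s).toFun ⟨m, V.2⟩ x,
    fun V a b => congrArg (fun v : Module.Dual ℝ (X.q.Fib m) => v x)
      (dualOf_add (X := X) a b ⟨m, V.2⟩),
    fun V f a => congrArg (fun v : Module.Dual ℝ (X.q.Fib m) => v x)
      (dualOf_smul (X := X) f a ⟨m, V.2⟩),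
    fun _ _ h hV a => congrArg (fun v : Module.Dual ℝ (X.q.Fib m) => v x) (dualOf_res h a ⟨m, hV⟩)⟩

/-- The evaluation of functions of degree 2 at an element of `D`. -/
noncomputable def evalD {m : X.M} (d : X.D) (h : X.toBase d = m) : X.toGradedMfd.Functional m 2 :=
  ⟨fun V s => isoEv ((isotropicOf s).toFun ⟨m, V.2⟩) d h,
    fun V a b => congrArg (fun v : X.isotropicFib m => isoEv v d h)
      (isotropicOf_add (X := X) a b ⟨m, V.2⟩),
    fun V f a => congrArg (fun v : X.isotropicFib m => isoEv v d h)
      (isotropicOf_smul (X := X) f a ⟨m, V.2⟩),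
    fun _ _ h' hV a =>
      congrArg (fun v : X.isotropicFib m => isoEv v d h) (isotropicOf_res h' a ⟨m, hV⟩)⟩

/-- The point of `ℳ(X)` defined by an element of `D`. -/
noncomputable def evalPt (d : X.D) : X.toGradedMfd.DPt (X.toBase d) where
  φ₁ := evalQ ⟨X.p₁.proj d, rfl⟩
  φ₂ := evalQ ⟨X.p₂.proj d, X.proj_p₂ d⟩
  ψ := evalD d rfl
  mul V hV a b := by
    have h : (isotropicOf (GradedMfd.mul₁₁ a b)).toFun ⟨X.toBase d, hV⟩ =
        wedge ((dualOf a).toFun ⟨X.toBase d, hV⟩) ((dualOf b).toFun ⟨X.toBase d, hV⟩) := by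
      apply deg2_injective
      rw [deg2_isotropicOf, ← TwoAlg.deg1_mul_deg1, deg1_dualOf, deg1_dualOf]
      rfl
    exact (congrArg (fun v => isoEv v d rfl) h).trans (isoEv_wedge _ _ d rfl)

/-- The map from `Q` to the dual of the bundle of functions of degree 1. -/
noncomputable def toTQ (x : X.Q) : X.toGradedMfd.TQ := ⟨X.q.proj x, evalQ ⟨x, rfl⟩⟩

/-- The map from `D` to the space of points of `ℳ(X)`. -/
noncomputable def toTD (d : X.D) : X.toGradedMfd.TD := ⟨X.toBase d, evalPt d⟩

theorem toTQ_ev {x : X.Q} (hx : (toTQ x).1 ∈ U) (s : X.toGradedMfd.sec U 1) :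
    (toTQ x).2.ev hx s = (dualOf s).ev x :=
  ((dualOf s).ev_eq ⟨_, hx⟩ ⟨x, rfl⟩).symm

theorem toTD_ev₁ {d : X.D} (hd : (toTD d).1 ∈ U) (s : X.toGradedMfd.sec U 1) :
    (toTD d).2.φ₁.ev hd s = (dualOf s).ev (X.p₁.proj d) :=
  ((dualOf s).ev_eq ⟨_, hd⟩ ⟨X.p₁.proj d, rfl⟩).symm

theorem toTD_ev₂ {d : X.D} (hd : (toTD d).1 ∈ U) (s : X.toGradedMfd.sec U 1) :
    (toTD d).2.φ₂.ev hd s = (dualOf s).ev (X.p₂.proj d) :=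
  ((dualOf s).ev_eq ⟨_, hd⟩ ⟨X.p₂.proj d, X.proj_p₂ d⟩).symm

theorem toTD_ev {d : X.D} (hd : (toTD d).1 ∈ U) (s : X.toGradedMfd.sec U 2) :
    (toTD d).2.ψ.ev hd s = (isotropicOf s).ev d :=
  ((isotropicOf s).ev_eq ⟨_, hd⟩ d rfl).symm

theorem p₁_toTD (d : X.D) : (toTD d).p₁ = toTQ (X.p₁.proj d) := rfl

theorem p₂_toTD (d : X.D) : (toTD d).p₂ = toTQ (X.p₂.proj d) :=
  GradedMfd.TQ.ext_ev (X.proj_p₂ d).symm fun _ hx hx' a =>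
    (toTD_ev₂ (d := d) hx a).trans (toTQ_ev hx' a).symm

theorem toTD_inv (d : X.D) : toTD (X.inv d) = (toTD d).inv := by
  refine GradedMfd.TD.ext_ev (X.toBase_inv d) ?_ ?_ fun V hx hx' a => ?_
  · rw [p₁_toTD, X.p₁_inv, ← p₂_toTD]
    rfl
  · rw [p₂_toTD, X.p₂_inv, ← p₁_toTD]
    rfl
  · have hx'' : (toTD d).1 ∈ V := hx'
    refine (toTD_ev hx a).trans (((isotropicOf a).ev_inv d hx').trans ?_)
    refine Eq.trans ?_ (GradedMfd.Functional.smul_ev (toTD d).2.ψ (-1) hx'' a).symm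
    rw [toTD_ev, neg_one_mul]

/-- The coordinates of an element of `D` with respect to a frame are the coordinates of its
image with respect to the corresponding free generators. -/
theorem injective_toTD : Function.Injective (toTD (X := X)) := fun d d' h => by
  obtain ⟨V, τ, χ, hV, hf⟩ := X.exists_frame (X.toBase d)
  have hd' : X.toBase d' = X.toBase d := (congrArg Sigma.fst h).symm
  have hV' : (toTD d').1 ∈ V := (congrArg (· ∈ V) hd').mpr hV
  have hV1 : (toTD d).1 ∈ V := hV
  refine hf.eq_of_coords hV rfl hd' (fun i => ?_) (fun i => ?_) fun j => ?_
  · have := GradedMfd.TQ.ev_congr (congrArg GradedMfd.TD.p₁ h) hV1 hV' (X.ofDual (τ i))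
    exact (congrArg (fun σ => σ.ev (X.p₁.proj d)) (dualOf_ofDual (τ i))).symm.trans
      ((toTD_ev₁ hV1 _).symm.trans (this.trans ((toTD_ev₁ hV' _).trans
      (congrArg (fun σ => σ.ev (X.p₁.proj d')) (dualOf_ofDual (τ i))))))
  · have := GradedMfd.TQ.ev_congr (congrArg GradedMfd.TD.p₂ h) hV1 hV' (X.ofDual (τ i))
    exact (congrArg (fun σ => σ.ev (X.p₂.proj d)) (dualOf_ofDual (τ i))).symm.trans
      ((toTD_ev₂ hV1 _).symm.trans (this.trans ((toTD_ev₂ hV' _).trans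
      (congrArg (fun σ => σ.ev (X.p₂.proj d')) (dualOf_ofDual (τ i))))))
  · have := GradedMfd.TD.ψ_congr h hV1 hV' (X.ofIsotropic (χ j))
    rwa [toTD_ev, toTD_ev, isotropicOf_ofIsotropic] at this

/-- The element of `D` with given frame coordinates is sent to the point whose coordinates with
respect to the corresponding free generators are the same. -/
theorem surjective_toTD : Function.Surjective (toTD (X := X)) := fun P => by
  obtain ⟨V, τ, χ, hV, hf⟩ := X.exists_frame P.1
  obtain ⟨h0, h1, h2, h3⟩ := hf.pt_spec hV (fun i => P.2.φ₁.ev hV (X.ofDual (τ i)))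
    (fun i => P.2.φ₂.ev hV (X.ofDual (τ i))) fun j => P.2.ψ.ev hV (X.ofIsotropic (χ j))
  have hV' : (toTD (hf.pt P.1 (fun i => P.2.φ₁.ev hV (X.ofDual (τ i)))
      (fun i => P.2.φ₂.ev hV (X.ofDual (τ i))) fun j => P.2.ψ.ev hV (X.ofIsotropic (χ j)))).1 ∈ V :=
    (congrArg (· ∈ V) h0).mpr hV
  refine ⟨_, GradedMfd.TD.ext_free hf.isFreelyGenerated h0 hV' hV (fun i => ?_) (fun i => ?_)
    fun j => ?_⟩
  · rw [toTD_ev₁, dualOf_ofDual]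
    exact h1 i
  · rw [toTD_ev₂, dualOf_ofDual]
    exact h2 i
  · rw [toTD_ev, isotropicOf_ofIsotropic]
    exact h3 j

theorem injective_toTQ : Function.Injective (toTQ (X := X)) := fun x x' h => by
  obtain ⟨V, τ, χ, hV, hf⟩ := X.exists_frame (X.q.proj x)
  have hx' : X.q.proj x' = X.q.proj x := (congrArg Sigma.fst h).symm
  have hV' : (toTQ x').1 ∈ V := (congrArg (· ∈ V) hx').mpr hV
  have hV1 : (toTQ x).1 ∈ V := hV
  refine hf.injective_dual hV rfl hx' fun i => ?_
  have := GradedMfd.TQ.ev_congr h hV1 hV' (X.ofDual (τ i))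
  rwa [toTQ_ev, toTQ_ev, dualOf_ofDual] at this

theorem surjective_toTQ : Function.Surjective (toTQ (X := X)) := fun φ => by
  obtain ⟨V, τ, χ, hV, hf⟩ := X.exists_frame φ.1
  obtain ⟨P, hP, -⟩ := GradedMfd.DPt.exists_of_free hf.isFreelyGenerated hV
    (fun i => φ.2.ev hV (X.ofDual (τ i))) 0 0
  obtain ⟨d, hd⟩ := surjective_toTD (X := X) ⟨φ.1, P⟩
  refine ⟨X.p₁.proj d, ?_⟩
  rw [← p₁_toTD, hd]
  exact Sigma.ext rfl (heq_of_eq (GradedMfd.Functional.ext₁ hf.isFreelyGenerated hV hP))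

/-- The identification of `Q` with the dual of the bundle of functions of degree 1. -/
noncomputable def equivTQ : X.Q ≃ X.toGradedMfd.TQ :=
  Equiv.ofBijective toTQ ⟨injective_toTQ, surjective_toTQ⟩

/-- The identification of `D` with the space of points of `ℳ(X)`. -/
noncomputable def equivTD : X.D ≃ X.toGradedMfd.TD :=
  Equiv.ofBijective toTD ⟨injective_toTD, surjective_toTD⟩

theorem toTQ_symm (φ : X.toGradedMfd.TQ) : toTQ (equivTQ.symm φ) = φ := equivTQ.apply_symm_apply φ

theorem toTD_symm (P : X.toGradedMfd.TD) : toTD (equivTD.symm P) = P := equivTD.apply_symm_apply P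

/-! ### The functor of functions is faithful -/

theorem Hom.ev_pullDual (f : Hom X Y) {V : Opens Y.M} (σ : Y.DualSection V) {x : X.Q}
    (hx : f.ω₀ (X.q.proj x) ∈ V) : (f.pullDual σ).ev x = σ.ev (f.ωQ x) := by
  have hx' : X.q.proj x ∈ preim f.morphismQ.smooth_base V := hx
  refine ((f.pullDual σ).ev_eq ⟨_, hx'⟩ ⟨x, rfl⟩).trans ?_
  exact (σ.ev_eq ⟨_, hx⟩ (f.morphismQ.fibMap _ ⟨x, rfl⟩)).symm

theorem Hom.toBase_Ω (f : Hom X Y) (d : X.D) : Y.toBase (f.Ω d) = f.ω₀ (X.toBase d) :=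
  (congrArg Y.q.proj (f.morphism₁.comm d)).trans (f.morphismQ.comm _)

theorem Hom.ev_pullIsotropic (f : Hom X Y) {V : Opens Y.M} (χ : Y.IsotropicSection V) {d : X.D}
    (hd : f.ω₀ (X.toBase d) ∈ V) : (f.pullIsotropic χ).ev d = χ.ev (f.Ω d) := by
  have hd' : X.toBase d ∈ preim f.morphismQ.smooth_base V := hd
  refine ((f.pullIsotropic χ).ev_eq ⟨_, hd'⟩ d rfl).trans ?_
  refine Eq.trans ?_ (χ.ev_eq ⟨_, hd⟩ (f.Ω d) (f.toBase_Ω d)).symm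
  exact (isoEv_eq _ (f.morphismQ.fibMap _ ⟨X.p₁.proj d, rfl⟩) (f.dFib _ ⟨d, rfl⟩) _).symm

theorem Hom.app_ofDual (f : Hom X Y) {V : Opens Y.M} (σ : Y.DualSection V) :
    f.toGradedMfd.app V 1 (Y.ofDual σ) = X.ofDual (f.pullDual σ) :=
  Subtype.ext (funext fun _ => TwoAlg.map_deg1 _ _ _ _)

theorem Hom.app_ofIsotropic (f : Hom X Y) {V : Opens Y.M} (χ : Y.IsotropicSection V) :
    f.toGradedMfd.app V 2 (Y.ofIsotropic χ) = X.ofIsotropic (f.pullIsotropic χ) :=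
  Subtype.ext (funext fun _ => TwoAlg.map_deg2 _ _ _ _)

/-- Naturality of `toTQ`. -/
theorem Hom.mapQ_toTQ (f : Hom X Y) (x : X.Q) : f.toGradedMfd.mapQ (toTQ x) = toTQ (f.ωQ x) := by
  refine GradedMfd.TQ.ext_ev (f.morphismQ.comm x).symm fun V hx hx' a => ?_
  have hx1 : (toTQ x).1 ∈ preim f.toGradedMfd.smooth V := hx
  refine (toTQ_ev hx1 (f.toGradedMfd.app V 1 a)).trans ?_
  rw [toTQ_ev, ← f.ev_pullDual (dualOf a) hx]
  have h : f.toGradedMfd.app V 1 a = X.ofDual (f.pullDual (dualOf a)) := by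
    rw [← f.app_ofDual, ofDual_dualOf]
  exact congrArg (fun σ => DualSection.ev σ x)
    ((congrArg dualOf h).trans (dualOf_ofDual (f.pullDual (dualOf a))))

/-- Naturality of `toTD`. -/
theorem Hom.mapD_toTD (f : Hom X Y) (d : X.D) : f.toGradedMfd.mapD (toTD d) = toTD (f.Ω d) := by
  refine GradedMfd.TD.ext_ev (f.toBase_Ω d).symm ?_ ?_ fun V hx hx' a => ?_
  · rw [p₁_toTD, f.morphism₁.comm, ← f.mapQ_toTQ]
    rfl
  · rw [p₂_toTD, f.morphism₂.comm, ← f.mapQ_toTQ, ← p₂_toTD]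
    rfl
  · have hx1 : (toTD d).1 ∈ preim f.toGradedMfd.smooth V := hx
    refine (toTD_ev hx1 (f.toGradedMfd.app V 2 a)).trans ?_
    rw [toTD_ev, ← f.ev_pullIsotropic (isotropicOf a) hx]
    have h : f.toGradedMfd.app V 2 a = X.ofIsotropic (f.pullIsotropic (isotropicOf a)) := by
      rw [← f.app_ofIsotropic, ofIsotropic_isotropicOf]
    exact congrArg (fun χ => IsotropicSection.ev χ d)
      ((congrArg isotropicOf h).trans (isotropicOf_ofIsotropic (f.pullIsotropic (isotropicOf a))))

/-- The maps of `Q` and `M` are recovered from the map of `D` on the zero sections. -/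
theorem Hom.ext_of_Ω {f g : Hom X Y} (h : f.Ω = g.Ω) : f = g := by
  have h1 : f.ωQ = g.ωQ := funext fun x => by
    rw [← X.p₁.proj_zero x, ← f.morphism₁.comm, h, g.morphism₁.comm]
  have h2 : f.ω₀ = g.ω₀ := funext fun m => by
    rw [← X.q.proj_zero m, ← f.morphismQ.comm, h1, g.morphismQ.comm]
  exact Hom.ext h h1 h2

/-- The functor `ℳ` is faithful. -/
theorem Hom.toGradedMfd_injective : Function.Injective (Hom.toGradedMfd (X := X) (Y := Y)) :=
  fun f g h => Hom.ext_of_Ω (funext fun d => injective_toTD (by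
    rw [← f.mapD_toTD, h, g.mapD_toTD]))

end IDVB

/-! ### The functor of functions is full -/

/-- A map whose compositions with a separating family of linear functionals are linear is
linear. -/
theorem isLinearMap_of_separating {E F ι : Type*} [AddCommGroup E] [Module ℝ E] [AddCommGroup F]
    [Module ℝ F] {g : E → F} {t : ι → F → ℝ} (ht : ∀ i, IsLinearMap ℝ (t i))
    (hsep : ∀ y y', (∀ i, t i y = t i y') → y = y')
    (h : ∀ i, IsLinearMap ℝ (fun x => t i (g x))) : IsLinearMap ℝ g where
  map_add x y := hsep _ _ fun i => ((h i).map_add x y).trans ((ht i).map_add _ _).symm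
  map_smul r x := hsep _ _ fun i => ((h i).map_smul r x).trans ((ht i).map_smul r _).symm

namespace IDVB

variable {X Y : IDVB.{u}}

theorem DualSection.linear_ev_p₂ {U : Opens X.M} (σ : X.DualSection U) {x : X.Q}
    (hx : X.q.proj x ∈ U) : IsLinearMap ℝ (fun d : X.p₁.Fib x => σ.ev (X.p₂.proj d.1)) := by
  have h : (fun d : X.p₁.Fib x => σ.ev (X.p₂.proj d.1)) =
      fun d => (σ.toFun ⟨_, hx⟩ ∘ₗ snd (⟨x, rfl⟩ : X.q.Fib (X.q.proj x))) d :=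
    funext fun d => σ.ev_eq ⟨_, hx⟩ (snd (⟨x, rfl⟩ : X.q.Fib (X.q.proj x)) d)
  rw [h]
  exact LinearMap.isLinear _

section Full

variable (F : GradedMfd.Hom X.toGradedMfd Y.toGradedMfd)

/-- The map `Q → Q` induced by a morphism of the algebras of functions, through the
identification `equivTQ` with functionals. -/
noncomputable def realizeQ (x : X.Q) : Y.Q := equivTQ.symm (F.mapQ (toTQ x))

/-- The map `D → D` induced by a morphism of the algebras of functions, through the
identification `equivTD` with points. -/
noncomputable def realizeD (d : X.D) : Y.D := equivTD.symm (F.mapD (toTD d))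

theorem toTQ_realizeQ (x : X.Q) : toTQ (realizeQ F x) = F.mapQ (toTQ x) := toTQ_symm _

theorem toTD_realizeD (d : X.D) : toTD (realizeD F d) = F.mapD (toTD d) := toTD_symm _

theorem proj_realizeQ (x : X.Q) : Y.q.proj (realizeQ F x) = F.base (X.q.proj x) :=
  congrArg Sigma.fst (toTQ_realizeQ F x)

theorem toBase_realizeD (d : X.D) : Y.toBase (realizeD F d) = F.base (X.toBase d) :=
  congrArg Sigma.fst (toTD_realizeD F d)

theorem p₁_realizeD (d : X.D) : Y.p₁.proj (realizeD F d) = realizeQ F (X.p₁.proj d) :=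
  injective_toTQ (by
    rw [toTQ_realizeQ, ← p₁_toTD, toTD_realizeD]
    rfl)

theorem realizeD_inv (d : X.D) : realizeD F (X.inv d) = Y.inv (realizeD F d) :=
  injective_toTD (by
    rw [toTD_inv, toTD_realizeD, toTD_realizeD, toTD_inv]
    rfl)

theorem p₂_realizeD (d : X.D) : Y.p₂.proj (realizeD F d) = realizeQ F (X.p₂.proj d) := by
  rw [← Y.p₁_inv, ← realizeD_inv, p₁_realizeD, X.p₁_inv]

theorem ev_realizeQ {V : Opens Y.M} (σ : Y.DualSection V) {x : X.Q}
    (hx : F.base (X.q.proj x) ∈ V) :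
    σ.ev (realizeQ F x) = (dualOf (F.app V 1 (Y.ofDual σ))).ev x := by
  have h1 : (toTQ (realizeQ F x)).1 ∈ V := (congrArg (· ∈ V) (proj_realizeQ F x)).mpr hx
  have h2 : (toTQ x).1 ∈ preim F.smooth V := hx
  have h3 := toTQ_ev h1 (Y.ofDual σ)
  rw [dualOf_ofDual] at h3
  rw [← h3, ← toTQ_ev h2]
  exact GradedMfd.TQ.ev_congr (toTQ_realizeQ F x) h1 hx _

theorem ev_realizeD {V : Opens Y.M} (χ : Y.IsotropicSection V) {d : X.D}
    (hd : F.base (X.toBase d) ∈ V) :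
    χ.ev (realizeD F d) = (isotropicOf (F.app V 2 (Y.ofIsotropic χ))).ev d := by
  have h1 : (toTD (realizeD F d)).1 ∈ V := (congrArg (· ∈ V) (toBase_realizeD F d)).mpr hd
  have h2 : (toTD d).1 ∈ preim F.smooth V := hd
  have h3 := toTD_ev h1 (Y.ofIsotropic χ)
  rw [isotropicOf_ofIsotropic] at h3
  rw [← h3, ← toTD_ev h2]
  exact GradedMfd.TD.ψ_congr (toTD_realizeD F d) h1 hd _

theorem smooth_ev_realizeQ {V : Opens Y.M} (σ : Y.DualSection V) {x : X.Q}
    (hx : F.base (X.q.proj x) ∈ V) :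
    ContMDiffAt (𝓡 X.Q.dim) 𝓘(ℝ, ℝ) ∞ (fun x => σ.ev (realizeQ F x)) x := by
  have hx' : X.q.proj x ∈ preim F.smooth V := hx
  have ho : IsOpen (X.q.proj ⁻¹' (preim F.smooth V : Set X.M)) :=
    (preim X.q.smooth_proj (preim F.smooth V)).2
  refine (((dualOf (F.app V 1 (Y.ofDual σ))).smooth_ev x hx').contMDiffAt
    (ho.mem_nhds hx')).congr_of_eventuallyEq ?_
  filter_upwards [ho.mem_nhds hx'] with y hy using ev_realizeQ F σ hy

theorem smooth_realizeQ : SmoothMap (realizeQ F) := fun x => by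
  obtain ⟨V, τ, χ, hV, hf⟩ := Y.exists_frame (F.base (X.q.proj x))
  refine hf.smoothAt_Q ((congrArg (· ∈ V) (proj_realizeQ F x)).mpr hV) ?_
    fun i => smooth_ev_realizeQ F (τ i) hV
  rw [show (fun x => Y.q.proj (realizeQ F x)) = fun x => F.base (X.q.proj x) from
    funext fun x => proj_realizeQ F x]
  exact (F.smooth.comp X.q.smooth_proj) x

/-- In the coordinates of a frame of `Y`, the map is given by functions on `X`. -/
theorem smooth_realizeD : SmoothMap (realizeD F) := fun d => by
  obtain ⟨V, τ, χ, hV, hf⟩ := Y.exists_frame (F.base (X.toBase d))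
  refine hf.smoothAt_D ((congrArg (· ∈ V) (toBase_realizeD F d)).mpr hV) ?_ (fun i => ?_)
    (fun i => ?_) fun j => ?_
  · rw [show (fun x => Y.toBase (realizeD F x)) = fun x => F.base (X.toBase x) from
      funext fun x => toBase_realizeD F x]
    exact (F.smooth.comp X.smooth_toBase) d
  · simp only [p₁_realizeD]
    exact (smooth_ev_realizeQ F (τ i) (x := X.p₁.proj d) hV).comp d (X.p₁.smooth_proj d)
  · simp only [p₂_realizeD]
    exact (smooth_ev_realizeQ F (τ i) (x := X.p₂.proj d)
      (by rw [X.proj_p₂]; exact hV)).comp d (X.p₂.smooth_proj d)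
  · have hx' : X.toBase d ∈ preim F.smooth V := hV
    have ho : IsOpen (X.toBase ⁻¹' (preim F.smooth V : Set X.M)) :=
      (preim X.smooth_toBase (preim F.smooth V)).2
    refine (((isotropicOf (F.app V 2 (Y.ofIsotropic (χ j)))).smooth_ev d hx').contMDiffAt
      (ho.mem_nhds hx')).congr_of_eventuallyEq ?_
    filter_upwards [ho.mem_nhds hx'] with y hy using ev_realizeD F (χ j) hy

theorem realizeQ_morphism : VBundle.IsMorphism X.q Y.q (realizeQ F) F.base where
  smooth := smooth_realizeQ F
  smooth_base := F.smooth
  comm := proj_realizeQ F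
  linear m := by
    obtain ⟨V, τ, χ, hV, hf⟩ := Y.exists_frame (F.base m)
    have hm : m ∈ preim F.smooth V := hV
    have key : ∀ i (x : X.q.Fib m), (τ i).ev (realizeQ F x.1) =
        (dualOf (F.app V 1 (Y.ofDual (τ i)))).ev x.1 := fun i x =>
      ev_realizeQ F (τ i) (by rw [x.2]; exact hV)
    refine isLinearMap_of_separating (t := fun i (y : Y.q.Fib (F.base m)) => (τ i).ev y.1)
      (fun i => (τ i).linear_ev (F.base m) hV)
      (fun y y' h => Subtype.ext (hf.injective_dual hV y.2 y'.2 h)) fun i => ?_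
    have h := (dualOf (F.app V 1 (Y.ofDual (τ i)))).linear_ev m hm
    rwa [← funext (key i)] at h

theorem realizeD_morphism₁ : VBundle.IsMorphism X.p₁ Y.p₁ (realizeD F) (realizeQ F) where
  smooth := smooth_realizeD F
  smooth_base := smooth_realizeQ F
  comm := p₁_realizeD F
  linear x := by
    obtain ⟨V, τ, χ, hV, hf⟩ := Y.exists_frame (F.base (X.q.proj x))
    have hx : X.q.proj x ∈ preim F.smooth V := hV
    have hx' : Y.q.proj (realizeQ F x) ∈ V := by rw [proj_realizeQ]; exact hV
    have hb : ∀ d : Y.p₁.Fib (realizeQ F x), Y.toBase d.1 = F.base (X.q.proj x) := fun d => by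
      rw [toBase, d.2, proj_realizeQ]
    have key₂ : ∀ i (d : X.p₁.Fib x), (τ i).ev (Y.p₂.proj (realizeD F d.1)) =
        (dualOf (F.app V 1 (Y.ofDual (τ i)))).ev (X.p₂.proj d.1) := fun i d => by
      rw [p₂_realizeD]
      exact ev_realizeQ F (τ i) (by rw [X.proj_p₂, toBase, d.2]; exact hV)
    have key : ∀ j (d : X.p₁.Fib x), (χ j).ev (realizeD F d.1) =
        (isotropicOf (F.app V 2 (Y.ofIsotropic (χ j)))).ev d.1 := fun j d =>
      ev_realizeD F (χ j) (by rw [toBase, d.2]; exact hV)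
    refine isLinearMap_of_separating
      (t := Sum.elim (fun i (d : Y.p₁.Fib (realizeQ F x)) => (τ i).ev (Y.p₂.proj d.1))
        fun j (d : Y.p₁.Fib (realizeQ F x)) => (χ j).ev d.1)
      (Sum.rec (fun i => (τ i).linear_ev_p₂ hx')
        fun j => (χ j).doublyLinear_ev.isLinear₁ (realizeQ F x) hx')
      (fun d d' h => Subtype.ext (hf.eq_of_coords hV (hb d) (hb d') (fun i => by rw [d.2, d'.2])
        (fun i => h (Sum.inl i)) fun j => h (Sum.inr j)))
      (Sum.rec (fun i => ?_) fun j => ?_)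
    · have h := (dualOf (F.app V 1 (Y.ofDual (τ i)))).linear_ev_p₂ hx
      rwa [← funext (key₂ i)] at h
    · have h := (isotropicOf (F.app V 2 (Y.ofIsotropic (χ j)))).doublyLinear_ev.isLinear₁ x hx
      rwa [← funext (key j)] at h

/-- The first structure is the conjugate of the second one by the involution. -/
theorem realizeD_morphism₂ : VBundle.IsMorphism X.p₂ Y.p₂ (realizeD F) (realizeQ F) := by
  have h := Y.inv_morphism₁.comp ((realizeD_morphism₁ F).comp X.inv_morphism₂)
  rw [show (fun d => Y.inv (realizeD F (X.inv d))) = realizeD F from funext fun d => by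
    rw [realizeD_inv, Y.inv_inv]] at h
  exact h

/-- The morphism of involutive double vector bundles defined by a morphism of the algebras of
functions. -/
noncomputable def realize : Hom X Y where
  Ω := realizeD F
  ωQ := realizeQ F
  ω₀ := F.base
  morphism₁ := realizeD_morphism₁ F
  morphism₂ := realizeD_morphism₂ F
  morphismQ := realizeQ_morphism F
  comm_inv := realizeD_inv F

/-- The functor `ℳ` is full. -/
theorem toGradedMfd_realize : (realize F).toGradedMfd = F :=
  GradedMfd.Hom.ext_of_mapD (isTwoManifold X) (isTwoManifold Y) fun P => by
    obtain ⟨d, rfl⟩ := surjective_toTD P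
    rw [Hom.mapD_toTD]
    exact toTD_realizeD F d

end Full

end IDVB

/-! ### Manifolds glued from fibrewise coordinates -/

/-- The splitting of a vector of length `n + k`. -/
noncomputable def splitCoords (n k : ℕ) : EuclideanSpace ℝ (Fin (n + k)) ≃L[ℝ]
    EuclideanSpace ℝ (Fin n) × EuclideanSpace ℝ (Fin k) :=
  EuclideanSpace.finAddEquivProd

theorem smooth_splitCoords (n k : ℕ) :
    ContMDiff (𝓡 (n + k)) ((𝓡 n).prod (𝓡 k)) ∞ (splitCoords n k) := by
  rw [← modelWithCornersSelf_prod, chartedSpaceSelf_prod]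
  exact (splitCoords n k).contDiff.contMDiff

theorem smooth_splitCoords_symm (n k : ℕ) :
    ContMDiff ((𝓡 n).prod (𝓡 k)) (𝓡 (n + k)) ∞ (splitCoords n k).symm := by
  rw [← modelWithCornersSelf_prod, chartedSpaceSelf_prod]
  exact (splitCoords n k).symm.contDiff.contMDiff

/-- The chart of a manifold around `c`. -/
noncomputable abbrev Mfd.chart (M : Mfd.{u}) (c : M) :
    OpenPartialHomeomorph M (EuclideanSpace ℝ (Fin M.dim)) := chartAt _ c

/-- Fibrewise coordinates for a map `proj : P → M` from a set to a manifold: around every point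
`c ∈ M` a bijection `p ↦ (proj p, Θ c p)` from the part of `P` over `U c` to `U c × ℝ^k`, with
inverse `Ψ c`, such that the changes of coordinates are smooth. -/
structure FibreCharts (M : Mfd.{u}) (P : Type u) (k : ℕ) where
  proj : P → M
  U : M → Opens M
  mem_U : ∀ c, c ∈ U c
  Θ : M → P → EuclideanSpace ℝ (Fin k)
  Ψ : M → M × EuclideanSpace ℝ (Fin k) → P
  proj_Ψ : ∀ c, ∀ b ∈ U c, ∀ v, proj (Ψ c (b, v)) = b
  Θ_Ψ : ∀ c, ∀ b ∈ U c, ∀ v, Θ c (Ψ c (b, v)) = v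
  Ψ_Θ : ∀ c p, proj p ∈ U c → Ψ c (proj p, Θ c p) = p
  smooth_change : ∀ c c', ContMDiffOn ((𝓡 M.dim).prod (𝓡 k)) (𝓡 k) ∞ (fun p => Θ c' (Ψ c p))
    (((U c : Set M) ∩ U c') ×ˢ Set.univ)

namespace FibreCharts

variable {M : Mfd.{u}} {P : Type u} {k : ℕ} (C : FibreCharts M P k)

/-- The chart around the fibre over `c`: a chart of the base followed by the fibre coordinate. -/
noncomputable def chart (c : M) : PartialEquiv P (EuclideanSpace ℝ (Fin (M.dim + k))) where
  toFun p := (splitCoords M.dim k).symm (M.chart c (C.proj p), C.Θ c p)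
  invFun v := C.Ψ c ((M.chart c).symm (splitCoords M.dim k v).1, (splitCoords M.dim k v).2)
  source := {p | C.proj p ∈ C.U c ∧ C.proj p ∈ (M.chart c).source}
  target := {v | (splitCoords M.dim k v).1 ∈ (M.chart c).target ∧
    (M.chart c).symm (splitCoords M.dim k v).1 ∈ C.U c}
  map_source' p hp := by
    simp only [Set.mem_ofPred_eq, ContinuousLinearEquiv.apply_symm_apply]
    refine ⟨(M.chart c).map_source hp.2, ?_⟩
    rw [(M.chart c).left_inv hp.2]
    exact hp.1
  map_target' v hv := by
    simp only [Set.mem_ofPred_eq]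
    rw [C.proj_Ψ c _ hv.2]
    exact ⟨hv.2, (M.chart c).map_target hv.1⟩
  left_inv' p hp := by
    simp only [ContinuousLinearEquiv.apply_symm_apply]
    rw [(M.chart c).left_inv hp.2]
    exact C.Ψ_Θ c p hp.1
  right_inv' v hv := by
    rw [C.proj_Ψ c _ hv.2, C.Θ_Ψ c _ hv.2, (M.chart c).right_inv hv.1]
    exact (splitCoords M.dim k).symm_apply_apply v

theorem transition_source (c c' : M) : ((C.chart c).symm.trans (C.chart c')).source =
    splitCoords M.dim k ⁻¹' (Prod.fst ⁻¹' ((M.chart c).target ∩ (M.chart c).symm ⁻¹'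
      ((C.U c : Set M) ∩ ((C.U c' : Set M) ∩ (M.chart c').source)))) := by
  ext v
  simp only [PartialEquiv.trans_source, PartialEquiv.symm_source, Set.mem_inter_iff,
    Set.mem_preimage]
  constructor
  · rintro ⟨h1, h2, h3⟩
    change C.proj (C.Ψ c _) ∈ _ at h2
    change C.proj (C.Ψ c _) ∈ _ at h3
    rw [C.proj_Ψ c _ h1.2] at h2 h3
    exact ⟨h1.1, h1.2, h2, h3⟩
  · rintro ⟨h1, h2, h3, h4⟩
    refine ⟨⟨h1, h2⟩, ?_, ?_⟩
    · change C.proj (C.Ψ c _) ∈ _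
      rwa [C.proj_Ψ c _ h2]
    · change C.proj (C.Ψ c _) ∈ _
      rwa [C.proj_Ψ c _ h2]

theorem isOpen_transition_source (c c' : M) :
    IsOpen ((C.chart c).symm.trans (C.chart c')).source := by
  rw [transition_source]
  refine (IsOpen.preimage continuous_fst ?_).preimage (splitCoords M.dim k).continuous
  exact (M.chart c).isOpen_inter_preimage_symm
    ((C.U c).2.inter ((C.U c').2.inter (M.chart c').open_source))

theorem smooth_transition (c c' : M) :
    ContMDiffOn (𝓡 (M.dim + k)) (𝓡 (M.dim + k)) ∞ ((C.chart c).symm.trans (C.chart c'))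
      ((C.chart c).symm.trans (C.chart c')).source := by
  rw [transition_source]
  intro v hv
  obtain ⟨h1, h2, h3, h4⟩ := hv
  have hb : ContMDiffAt (𝓡 (M.dim + k)) (𝓡 M.dim) ∞
      (fun v => (M.chart c).symm (splitCoords M.dim k v).1) v :=
    (((contMDiffOn_chart_symm (I := 𝓡 M.dim) (n := ∞) (x := c)).contMDiffAt
      ((M.chart c).open_target.mem_nhds h1)).comp v (contMDiff_fst.comp (smooth_splitCoords _ _) v))
  have hbv := hb.prodMk (contMDiff_snd.comp (smooth_splitCoords _ _) v)
  have hΘ := ((C.smooth_change c c').contMDiffAt ((((C.U c).2.inter (C.U c').2).prod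
    isOpen_univ).mem_nhds (show ((M.chart c).symm (splitCoords M.dim k v).1,
      (splitCoords M.dim k v).2) ∈ _ from
      ⟨⟨h2, h3⟩, Set.mem_univ _⟩))).comp v hbv
  have hφ := ((contMDiffOn_chart (I := 𝓡 M.dim) (n := ∞) (x := c')).contMDiffAt
      ((M.chart c').open_source.mem_nhds h4)).comp v hb
  have key := (smooth_splitCoords_symm _ _ _).comp v (hφ.prodMk hΘ)
  refine (key.congr_of_eventuallyEq ?_).contMDiffWithinAt
  filter_upwards [(C.isOpen_transition_source c c').mem_nhds (by
    rw [transition_source]; exact ⟨h1, h2, h3, h4⟩)] with w hw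
  rw [transition_source] at hw
  change (splitCoords M.dim k).symm (M.chart c' (C.proj (C.Ψ c _)), _) =
    (splitCoords M.dim k).symm _
  rw [C.proj_Ψ c _ hw.2.1]
  rfl

/-- The total space: the set `P`, as a type synonym which carries the topology and the charts
defined by `C`. -/
@[nolint unusedArguments]
def Carrier (_ : FibreCharts M P k) : Type u := P

/-- The charts of the total space. -/
noncomputable def core : ChartedSpaceCore (EuclideanSpace ℝ (Fin (M.dim + k))) C.Carrier where
  atlas := Set.range C.chart
  chartAt p := C.chart (C.proj p)
  mem_chart_source p := ⟨C.mem_U _, mem_chart_source _ _⟩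
  chart_mem_atlas p := ⟨_, rfl⟩
  open_source := by
    rintro _ _ ⟨c, rfl⟩ ⟨c', rfl⟩
    exact C.isOpen_transition_source c c'
  continuousOn_toFun := by
    rintro _ _ ⟨c, rfl⟩ ⟨c', rfl⟩
    exact (C.smooth_transition c c').continuousOn

noncomputable instance : TopologicalSpace C.Carrier := C.core.toTopologicalSpace

noncomputable instance : ChartedSpace (EuclideanSpace ℝ (Fin (M.dim + k))) C.Carrier :=
  C.core.toChartedSpace

/-- The chart around the fibre over `c`, as a local homeomorphism. -/
noncomputable def homeo (c : M) :
    OpenPartialHomeomorph C.Carrier (EuclideanSpace ℝ (Fin (M.dim + k))) :=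
  C.core.openPartialHomeomorph (C.chart c) ⟨c, rfl⟩

theorem homeo_mem_atlas (c : M) :
    C.homeo c ∈ atlas (EuclideanSpace ℝ (Fin (M.dim + k))) C.Carrier := by
  change C.homeo c ∈ ⋃ (e : PartialEquiv C.Carrier (EuclideanSpace ℝ (Fin (M.dim + k))))
    (he : e ∈ C.core.atlas), {C.core.openPartialHomeomorph e he}
  simp only [Set.mem_iUnion]
  exact ⟨C.chart c, ⟨c, rfl⟩, rfl⟩

theorem exists_of_mem_atlas
    {e : OpenPartialHomeomorph C.Carrier (EuclideanSpace ℝ (Fin (M.dim + k)))}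
    (he : e ∈ atlas (EuclideanSpace ℝ (Fin (M.dim + k))) C.Carrier) : ∃ c, e = C.homeo c := by
  change e ∈ ⋃ (e : PartialEquiv C.Carrier (EuclideanSpace ℝ (Fin (M.dim + k))))
    (he : e ∈ C.core.atlas), {C.core.openPartialHomeomorph e he} at he
  simp only [Set.mem_iUnion] at he
  obtain ⟨_, ⟨c, rfl⟩, rfl⟩ := he
  exact ⟨c, rfl⟩

instance : IsManifold (𝓡 (M.dim + k)) ∞ C.Carrier := by
  refine isManifold_of_contDiffOn _ _ _ fun e e' he he' => ?_
  obtain ⟨c, rfl⟩ := C.exists_of_mem_atlas he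
  obtain ⟨c', rfl⟩ := C.exists_of_mem_atlas he'
  have h := (C.smooth_transition c c').contDiffOn
  refine h.congr_mono (fun _ _ => rfl) ?_
  rintro v ⟨hv, -⟩
  exact hv

theorem smoothOn_homeo (c : M) : ContMDiffOn (𝓡 (M.dim + k)) (𝓡 (M.dim + k)) ∞ (C.homeo c)
    (C.homeo c).source :=
  contMDiffOn_of_mem_maximalAtlas
    (IsManifold.subset_maximalAtlas (C.homeo_mem_atlas c))

theorem smoothOn_homeo_symm (c : M) : ContMDiffOn (𝓡 (M.dim + k)) (𝓡 (M.dim + k)) ∞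
    (C.homeo c).symm (C.homeo c).target :=
  contMDiffOn_symm_of_mem_maximalAtlas
    (IsManifold.subset_maximalAtlas (C.homeo_mem_atlas c))

theorem mem_source {c : M} {p : C.Carrier} (h : C.proj p ∈ C.U c)
    (h' : C.proj p ∈ (M.chart c).source) : p ∈ (C.homeo c).source := ⟨h, h'⟩

theorem smoothAt_homeo_split (c : M) {p : C.Carrier} (h : p ∈ (C.homeo c).source) :
    ContMDiffAt (𝓡 (M.dim + k)) ((𝓡 M.dim).prod (𝓡 k)) ∞
      (fun p : C.Carrier => (M.chart c (C.proj p), C.Θ c p)) p := by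
  have h1 := (smooth_splitCoords _ _ _).comp p
    ((C.smoothOn_homeo c).contMDiffAt ((C.homeo c).open_source.mem_nhds h))
  refine h1.congr_of_eventuallyEq (Filter.Eventually.of_forall fun q => ?_)
  exact ((splitCoords M.dim k).apply_symm_apply (M.chart c (C.proj q), C.Θ c q)).symm

theorem smooth_proj : ContMDiff (𝓡 (M.dim + k)) (𝓡 M.dim) ∞ (fun p : C.Carrier => C.proj p) :=
  fun p => by
  have hp : p ∈ (C.homeo (C.proj p)).source := C.mem_source (C.mem_U _) (mem_chart_source _ _)
  have h1 := contMDiff_fst.contMDiffAt.comp p (C.smoothAt_homeo_split (C.proj p) hp)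
  have h2 := ((contMDiffOn_chart_symm (I := 𝓡 M.dim) (n := ∞) (x := C.proj p)).contMDiffAt
      ((M.chart (C.proj p)).open_target.mem_nhds ((M.chart (C.proj p)).map_source hp.2))).comp p h1
  refine h2.congr_of_eventuallyEq ?_
  filter_upwards [(C.homeo (C.proj p)).open_source.mem_nhds hp] with q hq
  exact ((M.chart (C.proj p)).left_inv hq.2).symm

instance : T2Space C.Carrier := by
  refine ⟨fun p q hpq => ?_⟩
  by_cases h : C.proj p = C.proj q
  · have hp : p ∈ (C.homeo (C.proj p)).source := C.mem_source (C.mem_U _) (mem_chart_source _ _)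
    have hq : q ∈ (C.homeo (C.proj p)).source :=
      C.mem_source (h ▸ C.mem_U _) (h ▸ mem_chart_source _ _)
    obtain ⟨V, W, hV, hW, h1, h2, h3⟩ :=
      t2_separation fun e => hpq ((C.homeo (C.proj p)).injOn hp hq e)
    refine ⟨_, _, (C.homeo (C.proj p)).isOpen_inter_preimage hV,
      (C.homeo (C.proj p)).isOpen_inter_preimage hW, ⟨hp, h1⟩, ⟨hq, h2⟩, ?_⟩
    exact (h3.preimage _).mono Set.inter_subset_right Set.inter_subset_right
  · obtain ⟨V, W, hV, hW, h1, h2, h3⟩ := t2_separation h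
    exact ⟨_, _, hV.preimage C.smooth_proj.continuous, hW.preimage C.smooth_proj.continuous, h1, h2,
      h3.preimage _⟩

instance : SecondCountableTopology C.Carrier := by
  obtain ⟨s, hs, hcov⟩ := countable_cover_nhds (α := M)
    (f := fun c => (C.U c : Set M) ∩ (M.chart c).source) fun c =>
      ((C.U c).2.inter (M.chart c).open_source).mem_nhds ⟨C.mem_U c, mem_chart_source _ _⟩
  have := hs.to_subtype
  have h : ∀ c : s, SecondCountableTopology (C.homeo c.1).source := fun c =>
    (C.homeo c.1).secondCountableTopology_source
  refine TopologicalSpace.secondCountableTopology_of_countable_cover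
    (U := fun c : s => (C.homeo c.1).source) (fun c => (C.homeo c.1).open_source) ?_
  refine Set.eq_univ_of_forall fun p => ?_
  obtain ⟨c, hc, hp⟩ := Set.mem_iUnion₂.mp (hcov.symm ▸ Set.mem_univ (C.proj p))
  exact Set.mem_iUnion.mpr ⟨⟨c, hc⟩, hp.1, hp.2⟩

/-- The total space as a manifold. -/
noncomputable def toMfd : Mfd.{u} where
  carrier := C.Carrier
  dim := M.dim + k

theorem smoothAt_Θ_self {c : M} {p : C.Carrier} (h : C.proj p ∈ C.U c)
    (h' : C.proj p ∈ (M.chart c).source) :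
    ContMDiffAt (𝓡 (M.dim + k)) (𝓡 k) ∞ (fun p : C.Carrier => C.Θ c p) p :=
  contMDiff_snd.contMDiffAt.comp (p : C.Carrier)
    (C.smoothAt_homeo_split c (C.mem_source h h'))

theorem smoothOn_Θ (c : M) :
    ContMDiffOn (𝓡 C.toMfd.dim) (𝓡 k) ∞ (fun p : C.toMfd => C.Θ c p)
      (C.proj ⁻¹' C.U c) := by
  change ContMDiffOn (M := C.Carrier) (𝓡 (M.dim + k)) (𝓡 k) ∞ (C.Θ c) (C.proj ⁻¹' C.U c)
  intro p hp
  have h1 := C.smoothAt_Θ_self (C.mem_U (C.proj p)) (mem_chart_source _ _)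
  have h2 := (C.smooth_proj p).prodMk h1
  have h3 := ((C.smooth_change (C.proj p) c).contMDiffAt ((((C.U _).2.inter (C.U c).2).prod
    isOpen_univ).mem_nhds (show (C.proj p, C.Θ (C.proj p) p) ∈ _ from
      ⟨⟨C.mem_U _, hp⟩, Set.mem_univ _⟩))).comp (p : C.Carrier) h2
  refine (h3.congr_of_eventuallyEq ?_).contMDiffWithinAt
  filter_upwards [((C.U (C.proj p)).2.preimage C.smooth_proj.continuous).mem_nhds
    (C.mem_U (C.proj p))] with q hq
  exact congrArg (C.Θ c) (C.Ψ_Θ _ q hq).symm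

theorem smoothOn_Ψ (c : M) : ContMDiffOn (M' := C.toMfd) ((𝓡 M.dim).prod (𝓡 k))
    (𝓡 C.toMfd.dim) ∞ (C.Ψ c) ((C.U c : Set M) ×ˢ Set.univ) := by
  rintro ⟨b, v⟩ ⟨hb, -⟩
  have hΘ := (C.smooth_change c b).contMDiffAt ((((C.U c).2.inter (C.U b).2).prod
    isOpen_univ).mem_nhds (show (b, v) ∈ _ from ⟨⟨hb, C.mem_U b⟩, Set.mem_univ _⟩))
  have hφ := ((contMDiffOn_chart (I := 𝓡 M.dim) (n := ∞) (x := b)).contMDiffAt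
      ((M.chart b).open_source.mem_nhds (mem_chart_source _ _))).comp (b, v)
      (contMDiff_fst (I := 𝓡 M.dim) (J := 𝓡 k) (n := ∞)).contMDiffAt
  have h1 := (smooth_splitCoords_symm _ _ _).comp (b, v) (hφ.prodMk hΘ)
  have key : ∀ b' ∈ (C.U c : Set M) ∩ ((C.U b : Set M) ∩ (M.chart b).source), ∀ v',
      (C.Ψ c (b', v') : C.Carrier) ∈ (C.homeo b).source ∧
      (splitCoords M.dim k).symm (M.chart b b', C.Θ b (C.Ψ c (b', v'))) =
        C.homeo b (C.Ψ c (b', v')) := by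
    rintro b' ⟨h1, h2, h3⟩ v'
    have h0 := C.proj_Ψ c b' h1 v'
    refine ⟨C.mem_source (h0.symm ▸ h2) (h0.symm ▸ h3), ?_⟩
    change _ = (splitCoords M.dim k).symm (M.chart b (C.proj (C.Ψ c (b', v'))), _)
    rw [h0]
  have hbb : b ∈ (C.U c : Set M) ∩ ((C.U b : Set M) ∩ (M.chart b).source) :=
    ⟨hb, C.mem_U b, mem_chart_source _ _⟩
  have h2 := ((C.smoothOn_homeo_symm b).contMDiffAt ((C.homeo b).open_target.mem_nhds (by
    change (splitCoords M.dim k).symm (M.chart b b, C.Θ b (C.Ψ c (b, v))) ∈ _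
    rw [(key b hbb v).2]
    exact (C.homeo b).map_source (key b hbb v).1))).comp (b, v) h1
  refine (h2.congr_of_eventuallyEq ?_).contMDiffWithinAt
  filter_upwards [(((C.U c).2.inter ((C.U b).2.inter (M.chart b).open_source)).prod
    isOpen_univ).mem_nhds (show (b, v) ∈ _ from ⟨hbb, Set.mem_univ _⟩)] with q hq
  change _ = (C.homeo b).symm
    ((splitCoords M.dim k).symm (M.chart b q.1, C.Θ b (C.Ψ c (q.1, q.2))))
  rw [(key q.1 hq.1 q.2).2, (C.homeo b).left_inv (key q.1 hq.1 q.2).1]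

/-- A map to the total space is smooth if its coordinates are. -/
theorem smoothAt_of_coords {H E : Type*} [NormedAddCommGroup E] [NormedSpace ℝ E]
    [TopologicalSpace H] {I : ModelWithCorners ℝ E H} {Z : Type*} [TopologicalSpace Z]
    [ChartedSpace H Z] {F : Z → C.toMfd} {z : Z} (c : M) (hz : C.proj (F z) ∈ C.U c)
    (h1 : ContMDiffAt I (𝓡 M.dim) ∞ (fun z => C.proj (F z)) z)
    (h2 : ContMDiffAt I (𝓡 k) ∞ (fun z => C.Θ c (F z)) z) :
    ContMDiffAt I (𝓡 C.toMfd.dim) ∞ F z := by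
  have h3 := ((C.smoothOn_Ψ c).contMDiffAt (((C.U c).2.prod isOpen_univ).mem_nhds
    (show (C.proj (F z), C.Θ c (F z)) ∈ _ from ⟨hz, Set.mem_univ _⟩))).comp z (h1.prodMk h2)
  refine h3.congr_of_eventuallyEq ?_
  filter_upwards [h1.continuousAt.preimage_mem_nhds ((C.U c).2.mem_nhds hz)] with y hy
  exact (C.Ψ_Θ c (F y) hy).symm

/-- The vector bundle with given fibrewise linear coordinates. -/
noncomputable def toVBundle [∀ b, AddCommGroup {p : C.toMfd // C.proj p = b}]
    [∀ b, Module ℝ {p : C.toMfd // C.proj p = b}]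
    (h : ∀ c, ∀ b ∈ C.U c, IsLinearMap ℝ (fun x : {p : C.toMfd // C.proj p = b} => C.Θ c x.1)) :
    VBundle C.toMfd M where
  proj := C.proj
  smooth_proj := C.smooth_proj
  rank := k
  locally_trivial c := ⟨C.U c, C.mem_U c, C.Θ c, C.Ψ c, C.smoothOn_Θ c, C.smoothOn_Ψ c,
    fun b hb v => ⟨C.proj_Ψ c b hb v, C.Θ_Ψ c b hb v⟩, C.Ψ_Θ c, h c⟩

end FibreCharts

/-! ### Evaluation of sections on functionals at varying points -/

/-- The extension by zero of a smooth function on an open set. -/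
noncomputable def Fun.extend {M : Mfd.{u}} {U : Opens M} (f : Fun M U) (x : M) : ℝ := by
  classical exact if h : x ∈ U then f ⟨x, h⟩ else 0

theorem Fun.extend_eq {M : Mfd.{u}} {U : Opens M} (f : Fun M U) {x : M} (h : x ∈ U) :
    f.extend x = f ⟨x, h⟩ := dif_pos h

theorem Fun.smoothAt_extend {M : Mfd.{u}} {U : Opens M} (f : Fun M U) {x : M} (h : x ∈ U) :
    ContMDiffAt (𝓡 M.dim) 𝓘(ℝ, ℝ) ∞ f.extend x :=
  (smoothOn_of_smoothFun f.2 fun y => f.extend_eq y.2).contMDiffAt (U.2.mem_nhds h)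

namespace GradedMfd

variable {N : GradedMfd.{u}} {U V : Opens N.base} {k : ℕ} {m : N.base} {r₁ r₂ : ℕ}

/-- The evaluation of a section on a functional, extended by zero. -/
noncomputable def evAt (a : N.sec U k) (x : Σ m, N.Functional m k) : ℝ := by
  classical exact if h : x.1 ∈ U then x.2.ev h a else 0

theorem evAt_eq (a : N.sec U k) {x : Σ m, N.Functional m k} (h : x.1 ∈ U) :
    evAt a x = x.2.ev h a := dif_pos h

theorem evAt_eq_zero (a : N.sec U k) {x : Σ m, N.Functional m k} (h : x.1 ∉ U) :
    evAt a x = 0 := dif_neg h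

theorem evAt_mk (a : N.sec U k) {m : N.base} (φ : N.Functional m k) (h : m ∈ U) :
    evAt a ⟨m, φ⟩ = φ.ev h a := dif_pos h

theorem evAt_add (a : N.sec U k) {m : N.base} (φ φ' : N.Functional m k) :
    evAt a ⟨m, φ + φ'⟩ = evAt a ⟨m, φ⟩ + evAt a ⟨m, φ'⟩ := by
  by_cases h : m ∈ U
  · rw [evAt_mk a _ h, evAt_mk a _ h, evAt_mk a _ h]
    rfl
  · have h0 : ∀ φ : N.Functional m k, evAt a ⟨m, φ⟩ = 0 := fun φ => evAt_eq_zero a h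
    rw [h0, h0, h0, add_zero]

theorem evAt_smul (a : N.sec U k) {m : N.base} (r : ℝ) (φ : N.Functional m k) :
    evAt a ⟨m, r • φ⟩ = r * evAt a ⟨m, φ⟩ := by
  by_cases h : m ∈ U
  · rw [evAt_mk a _ h, evAt_mk a _ h]
    rfl
  · have h0 : ∀ φ : N.Functional m k, evAt a ⟨m, φ⟩ = 0 := fun φ => evAt_eq_zero a h
    rw [h0, h0, mul_zero]

theorem ext_evAt {x x' : Σ m, N.Functional m k} (h : x.1 = x'.1)
    (h' : ∀ (U : Opens N.base) (a : N.sec U k), evAt a x = evAt a x') : x = x' := by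
  obtain ⟨m, φ⟩ := x
  obtain ⟨m', φ'⟩ := x'
  obtain rfl : m = m' := h
  refine Sigma.ext rfl (heq_of_eq (Functional.ext' fun U hU a => ?_))
  rw [← evAt_mk a φ hU, ← evAt_mk a φ' hU]
  exact h' U a

section Smooth

variable {H E : Type*} [NormedAddCommGroup E] [NormedSpace ℝ E] [TopologicalSpace H]
  {I : ModelWithCorners ℝ E H} {Z : Type*} [TopologicalSpace Z] [ChartedSpace H Z] {z : Z}

/-- If the base point and the values of a family of functionals on local generators of the sections
depend smoothly on a parameter, then so do the values on all sections. -/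
theorem smoothAt_evAt {ι : Type*} [Fintype ι] (x : ι → N.sec U k)
    (hx : ∀ (V : Opens N.base) (hV : V ≤ U) (a : N.sec V k),
      a ∈ Submodule.span (Fun N.base V) (Set.range fun i => N.res hV k (x i)))
    {F : Z → Σ m, N.Functional m k} (hz : (F z).1 ∈ U)
    (h0 : ContMDiffAt I (𝓡 N.base.dim) ∞ (fun z => (F z).1) z)
    (h : ∀ i, ContMDiffAt I 𝓘(ℝ, ℝ) ∞ (fun z => evAt (x i) (F z)) z) (a : N.sec V k)
    (hV : (F z).1 ∈ V) : ContMDiffAt I 𝓘(ℝ, ℝ) ∞ (fun z => evAt a (F z)) z := by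
  obtain ⟨f, hf⟩ := (Submodule.mem_span_range_iff_exists_fun _).mp
    (hx (V ⊓ U) inf_le_right (N.res inf_le_left k a))
  have hW : (F z).1 ∈ V ⊓ U := ⟨hV, hz⟩
  have key : ∀ y, (F y).1 ∈ V ⊓ U →
      evAt a (F y) = ∑ i, (f i).extend (F y).1 * evAt (x i) (F y) := fun y hy => by
    have h1 := congrArg ((F y).2.ev hy) hf
    rw [Functional.ev_sum, Functional.ev_res] at h1
    rw [evAt_eq a hy.1, ← h1]
    refine Finset.sum_congr rfl fun i _ => ?_
    rw [Functional.ev_smul, Functional.ev_res, evAt_eq (x i) hy.2, Fun.extend_eq _ hy]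
  have h1 : ContMDiffAt I 𝓘(ℝ, ℝ) ∞
      (fun y => ∑ i, (f i).extend (F y).1 * evAt (x i) (F y)) z :=
    ContMDiffAt.sum fun i _ => by
      have h2 : ContMDiffAt I 𝓘(ℝ, ℝ) ∞ (fun y => (f i).extend (F y).1) z :=
        ((f i).smoothAt_extend hW).comp z h0
      exact h2.mul (h i)
  refine h1.congr_of_eventuallyEq ?_
  filter_upwards [h0.continuousAt.preimage_mem_nhds ((V ⊓ U).2.mem_nhds hW)] with y hy
  exact key y hy

variable {ξ : Fin r₁ → N.sec U 1} {η : Fin r₂ → N.sec U 2}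

theorem IsFreelyGenerated.smoothAt_evAt₁ (hf : N.IsFreelyGenerated U ξ η)
    {F : Z → N.TQ} (hz : (F z).1 ∈ U)
    (h0 : ContMDiffAt I (𝓡 N.base.dim) ∞ (fun z => (F z).1) z)
    (h : ∀ i, ContMDiffAt I 𝓘(ℝ, ℝ) ∞ (fun z => evAt (ξ i) (F z)) z) (a : N.sec V 1)
    (hV : (F z).1 ∈ V) : ContMDiffAt I 𝓘(ℝ, ℝ) ∞ (fun z => evAt a (F z)) z :=
  smoothAt_evAt ξ (fun _ hV a => (hf.restrict hV).mem_span₁ a) hz h0 h a hV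

/-- Smoothness in the free generators suffices, since the value of `ψ` on a product of two
generators of degree 1 is a polynomial in the values of `φ₁` and `φ₂` on them. -/
theorem IsFreelyGenerated.smoothAt_evAt₂ (hf : N.IsFreelyGenerated U ξ η)
    {F : Z → N.TD} (hz : (F z).1 ∈ U)
    (h0 : ContMDiffAt I (𝓡 N.base.dim) ∞ (fun z => (F z).1) z)
    (h1 : ∀ i, ContMDiffAt I 𝓘(ℝ, ℝ) ∞ (fun z => evAt (ξ i) (F z).p₁) z)
    (h2 : ∀ i, ContMDiffAt I 𝓘(ℝ, ℝ) ∞ (fun z => evAt (ξ i) (F z).p₂) z)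
    (h3 : ∀ j, ContMDiffAt I 𝓘(ℝ, ℝ) ∞ (fun z => evAt (η j) ⟨(F z).1, (F z).2.ψ⟩) z)
    (a : N.sec V 2) (hV : (F z).1 ∈ V) :
    ContMDiffAt I 𝓘(ℝ, ℝ) ∞ (fun z => evAt a ⟨(F z).1, (F z).2.ψ⟩) z := by
  refine smoothAt_evAt (F := fun z => (⟨(F z).1, (F z).2.ψ⟩ : Σ m, N.Functional m 2))
    (Sum.elim η fun q : {q : Fin r₁ × Fin r₁ // q.1 < q.2} => mul₁₁ (ξ q.1.1) (ξ q.1.2))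
    (fun V hV a => ?_) hz h0 ?_ a hV
  · have := (hf.restrict hV).mem_span₂ a
    convert this using 3
    funext x
    rcases x with j | q
    · rfl
    · exact res_mul₁₁ hV _ _
  · rintro (j | q)
    · exact h3 j
    · have key : ContMDiffAt I 𝓘(ℝ, ℝ) ∞ (fun z => 1 / 2 *
          (evAt (ξ q.1.1) (F z).p₁ * evAt (ξ q.1.2) (F z).p₂ -
            evAt (ξ q.1.2) (F z).p₁ * evAt (ξ q.1.1) (F z).p₂)) z :=
        contMDiffAt_const.mul (((h1 _).mul (h2 _)).sub ((h1 _).mul (h2 _)))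
      refine key.congr_of_eventuallyEq ?_
      filter_upwards [h0.continuousAt.preimage_mem_nhds (U.2.mem_nhds hz)] with y hy
      have hy1 : (F y).p₁.1 ∈ U := hy
      have hy2 : (F y).p₂.1 ∈ U := hy
      rw [evAt_eq _ hy1, evAt_eq _ hy1, evAt_eq _ hy2, evAt_eq _ hy2]
      exact (evAt_mk _ _ hy).trans ((F y).2.mul U hy _ _)

end Smooth

/-! ### Germs of linear maps and glueing -/

/-- A family of maps, for every open neighbourhood `V` of `m`, from the sections of degree `k` over
`V` to a vector space, which is compatible with restrictions and linear over the evaluation of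
functions at `m`. -/
structure IsGermMap {B : Type*} [AddCommGroup B] [Module ℝ B]
    (A : ∀ V : Opens N.base, m ∈ V → N.sec V k → B) : Prop where
  add : ∀ V hV a b, A V hV (a + b) = A V hV a + A V hV b
  smul : ∀ V hV (f : Fun N.base V) a, A V hV (f • a) = f ⟨m, hV⟩ • A V hV a
  res : ∀ V W (h : W ≤ V) hW a, A W hW (N.res h k a) = A V (h hW) a

theorem IsGermMap.zero {B : Type*} [AddCommGroup B] [Module ℝ B]
    {A : ∀ V : Opens N.base, m ∈ V → N.sec V k → B} (h : IsGermMap A) {V} (hV) : A V hV 0 = 0 := by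
  have := h.add V hV 0 0
  rwa [add_zero, left_eq_add] at this

/-- Germ maps which agree on local generators agree. -/
theorem IsGermMap.ext_of_span {B : Type*} [AddCommGroup B] [Module ℝ B]
    {A A' : ∀ V : Opens N.base, m ∈ V → N.sec V k → B} (hA : IsGermMap A) (hA' : IsGermMap A')
    (hm : m ∈ U) {ι : Type*} (x : ι → N.sec U k)
    (hx : ∀ (V : Opens N.base) (hV : V ≤ U) (a : N.sec V k),
      a ∈ Submodule.span (Fun N.base V) (Set.range fun i => N.res hV k (x i)))
    (h : ∀ i, A U hm (x i) = A' U hm (x i)) (hV : m ∈ V) (a : N.sec V k) :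
    A V hV a = A' V hV a := by
  have hVU : m ∈ V ⊓ U := ⟨hV, hm⟩
  rw [← hA.res V _ (inf_le_left : V ⊓ U ≤ V) hVU, ← hA'.res V _ (inf_le_left : V ⊓ U ≤ V) hVU]
  have h1 := hx (V ⊓ U) inf_le_right (N.res inf_le_left k a)
  generalize N.res (inf_le_left : V ⊓ U ≤ V) k a = a' at h1 ⊢
  induction h1 using Submodule.span_induction with
  | mem y hy =>
    obtain ⟨i, rfl⟩ := hy
    beta_reduce
    rw [hA.res, hA'.res, h]
  | zero => rw [hA.zero, hA'.zero]
  | add y z _ _ h1 h2 => rw [hA.add, hA'.add, h1, h2]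
  | smul f y _ h1 => rw [hA.smul, hA'.smul, h1]

/-- Sections over an open cover of `U` indexed by the points which agree on the overlaps come
from a section over `U`. -/
theorem exists_glue {W : N.base → Opens N.base} (hW : ∀ m, W m ≤ U) (hm : ∀ m ∈ U, m ∈ W m)
    (s : ∀ i, N.sec (W i) k) (hs : ∀ i j, N.res (inf_le_left : W i ⊓ W j ≤ W i) k (s i) =
      N.res (inf_le_right : W i ⊓ W j ≤ W j) k (s j)) :
    ∃ t : N.sec U k, ∀ i, N.res (hW i) k t = s i := by
  obtain rfl : U = ⨆ i, W i :=
    le_antisymm (fun m h => Opens.mem_iSup.mpr ⟨m, hm m h⟩) (iSup_le hW)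
  exact (N.sheaf W k s hs).exists

/-- A morphism of sheaves which is locally bijective is bijective. -/
theorem bijective_of_local {N' : GradedMfd.{u}} (e : Hom N N') (k : ℕ)
    (h : ∀ m : N'.base, ∃ U : Opens N'.base, m ∈ U ∧ ∀ V ≤ U, Function.Bijective (e.app V k))
    (U : Opens N'.base) : Function.Bijective (e.app U k) := by
  choose O hO hb using h
  have inj : ∀ V, Function.Injective (e.app V k) := fun V a b hab => by
    refine eq_of_local fun m hm => ⟨V ⊓ O m, inf_le_left, ⟨hm, hO m⟩, ?_⟩
    refine (hb m (V ⊓ O m) inf_le_right).1 ?_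
    rw [e.app_res, e.app_res, hab]
  refine ⟨inj U, fun b => ?_⟩
  choose s hs using fun m => (hb m (U ⊓ O m) inf_le_right).2
    (N.res (show preim e.smooth (U ⊓ O m) ≤ preim e.smooth U from fun x hx => hx.1) k b)
  obtain ⟨t, ht⟩ := exists_glue (W := fun m => U ⊓ O m) (U := U) (fun m => inf_le_left)
    (fun m hm => ⟨hm, hO m⟩) s fun i j => by
      refine inj _ ?_
      rw [e.app_res, e.app_res, hs, hs, N.res_res, N.res_res]
  refine ⟨t, eq_of_local fun x hx => ?_⟩
  refine ⟨preim e.smooth (U ⊓ O (e.base x)), fun y hy => hy.1, ⟨hx, hO _⟩, ?_⟩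
  rw [← hs, ← ht, e.app_res]

/-- A morphism which maps free generators to free generators and is bijective on smooth functions
is bijective in every degree. -/
theorem bijective_app_of_free {N' : GradedMfd.{u}} (e : Hom N N') {U : Opens N'.base}
    {ξ : Fin r₁ → N'.sec U 1} {η : Fin r₂ → N'.sec U 2} (hf : N'.IsFreelyGenerated U ξ η)
    (hf' : N.IsFreelyGenerated (preim e.smooth U) (fun i => e.app U 1 (ξ i))
      (fun j => e.app U 2 (η j)))
    (hb : Function.Bijective (fun f : Fun N'.base U =>
      (Fun.pullback e.smooth (fun _ hx => hx) f : Fun N.base (preim e.smooth U)))) (k : ℕ) :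
    Function.Bijective (e.app U k) := by
  have hmono : ∀ p, e.appHom U (mono (fun i => DirectSum.of (N'.sec U) 1 (ξ i))
      (fun j => DirectSum.of (N'.sec U) 2 (η j)) p) =
      mono (fun i => DirectSum.of (N.sec (preim e.smooth U)) 1 (e.app U 1 (ξ i)))
        (fun j => DirectSum.of (N.sec (preim e.smooth U)) 2 (e.app U 2 (η j))) p := fun p => by
    rw [map_mono]
    simp only [e.appHom_of]
  constructor
  · refine (injective_iff_map_eq_zero _).mpr fun a ha => ?_
    obtain ⟨l, hl⟩ := Finsupp.mem_span_range_iff_exists_finsupp.mp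
      (hf.span_eq_top ▸ Submodule.mem_top : DirectSum.of (N'.sec U) k a ∈ _)
    have h1 : ∑ p ∈ l.support, (Fun.pullback e.smooth (fun _ hx => hx) (l p) :
        Fun N.base (preim e.smooth U)) •
        mono (fun i => DirectSum.of (N.sec (preim e.smooth U)) 1 (e.app U 1 (ξ i)))
          (fun j => DirectSum.of (N.sec (preim e.smooth U)) 2 (e.app U 2 (η j))) p = 0 := by
      have h2 := congrArg (e.appHom U) hl
      rw [e.appHom_of, ha, _root_.map_zero, Finsupp.sum, _root_.map_sum] at h2
      rw [← h2]
      exact Finset.sum_congr rfl fun p _ => by rw [e.appHom_smul, hmono]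
    have h3 := linearIndependent_iff'.mp hf'.linearIndependent _ _ h1
    have h4 : l = 0 := Finsupp.ext fun p => by
      by_cases hp : p ∈ l.support
      · exact hb.1 (h3 p hp)
      · exact Finsupp.notMem_support_iff.mp hp
    rw [h4, Finsupp.sum_zero_index] at hl
    exact DirectSum.of_injective k (hl.symm.trans (_root_.map_zero _).symm)
  · have key : ∀ b : ⨁ k, N.sec (preim e.smooth U) k, ∃ a, e.appHom U a = b := fun b => by
      have hb' : b ∈ Submodule.span _ _ := hf'.span_eq_top ▸ Submodule.mem_top (x := b)
      induction hb' using Submodule.span_induction with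
      | mem y hy =>
        obtain ⟨p, rfl⟩ := hy
        exact ⟨_, hmono p⟩
      | zero => exact ⟨0, _root_.map_zero _⟩
      | add y z _ _ h1 h2 =>
        obtain ⟨a, rfl⟩ := h1
        obtain ⟨a', rfl⟩ := h2
        exact ⟨a + a', _root_.map_add _ _ _⟩
      | smul g y _ h1 =>
        obtain ⟨a, rfl⟩ := h1
        obtain ⟨f, rfl⟩ := hb.2 g
        exact ⟨f • a, e.appHom_smul U f a⟩
    have hcomp : ∀ a : ⨁ k, N'.sec U k, e.appHom U a k = e.app U k (a k) := fun a => by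
      classical
      induction a using DirectSum.induction_on with
      | zero => rw [_root_.map_zero, DirectSum.zero_apply, DirectSum.zero_apply, _root_.map_zero]
      | of l a =>
        rw [e.appHom_of]
        by_cases hlk : l = k
        · subst hlk
          rw [DirectSum.of_eq_same, DirectSum.of_eq_same]
        · rw [DirectSum.of_eq_of_ne _ _ _ (Ne.symm hlk), DirectSum.of_eq_of_ne _ _ _ (Ne.symm hlk),
            _root_.map_zero]
      | add a b h1 h2 =>
        rw [_root_.map_add, DirectSum.add_apply, DirectSum.add_apply, h1, h2, _root_.map_add]
    intro b
    obtain ⟨a, ha⟩ := key (DirectSum.of _ k b)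
    refine ⟨a k, ?_⟩
    rw [← hcomp, ha, DirectSum.of_eq_same]

end GradedMfd

/-! ### The total spaces attached to a `[2]`-manifold as manifolds -/

theorem smoothAt_toLp {H E Z : Type*} [NormedAddCommGroup E] [NormedSpace ℝ E] [TopologicalSpace H]
    {I : ModelWithCorners ℝ E H} [TopologicalSpace Z] [ChartedSpace H Z] {z : Z} {r : ℕ}
    {f : Fin r → Z → ℝ} (hf : ∀ i, ContMDiffAt I 𝓘(ℝ, ℝ) ∞ (f i) z) :
    ContMDiffAt I (𝓡 r) ∞ (fun z => WithLp.toLp 2 fun i => f i z) z :=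
  PiLp.contDiff_toLp.contMDiff.contMDiffAt.comp z (contMDiffAt_pi_space.mpr hf)

theorem smooth_coord {r : ℕ} (i : Fin r) :
    ContMDiff (𝓡 r) 𝓘(ℝ, ℝ) ∞ (fun v : EuclideanSpace ℝ (Fin r) => v i) :=
  (EuclideanSpace.proj (𝕜 := ℝ) i).contDiff.contMDiff

namespace GradedMfd

variable {N : GradedMfd.{u}}

/-- A choice of free generators around every point. -/
structure LocalGenerators (N : GradedMfd.{u}) where
  r₁ : ℕ
  r₂ : ℕ
  U : N.base → Opens N.base
  mem_U : ∀ c, c ∈ U c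
  ξ : ∀ c, Fin r₁ → N.sec (U c) 1
  η : ∀ c, Fin r₂ → N.sec (U c) 2
  free : ∀ c, N.IsFreelyGenerated (U c) (ξ c) (η c)

theorem IsTwoManifold.exists_localGenerators (hN : IsTwoManifold N) :
    Nonempty N.LocalGenerators := by
  obtain ⟨r₁, r₂, h⟩ := hN
  choose U hU ξ η hf using h
  exact ⟨⟨r₁, r₂, U, hU, ξ, η, hf⟩⟩

theorem TQ.ext_evAt_free {U : Opens N.base} {r₁ r₂ : ℕ} {ξ : Fin r₁ → N.sec U 1}
    {η : Fin r₂ → N.sec U 2} (hf : N.IsFreelyGenerated U ξ η) {x x' : N.TQ} (h : x.1 = x'.1)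
    (hU : x.1 ∈ U) (h' : ∀ i, evAt (ξ i) x = evAt (ξ i) x') : x = x' := by
  obtain ⟨m, φ⟩ := x
  obtain ⟨m', φ'⟩ := x'
  obtain rfl : m = m' := h
  refine Sigma.ext rfl (heq_of_eq (Functional.ext₁ hf hU fun i => ?_))
  rw [← evAt_mk _ φ hU, ← evAt_mk _ φ' hU]
  exact h' i

theorem TD.ext_evAt_free {U : Opens N.base} {r₁ r₂ : ℕ} {ξ : Fin r₁ → N.sec U 1}
    {η : Fin r₂ → N.sec U 2} (hf : N.IsFreelyGenerated U ξ η) {P P' : N.TD} (h : P.1 = P'.1)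
    (hU : P.1 ∈ U) (h1 : ∀ i, evAt (ξ i) P.p₁ = evAt (ξ i) P'.p₁)
    (h2 : ∀ i, evAt (ξ i) P.p₂ = evAt (ξ i) P'.p₂)
    (h3 : ∀ j, evAt (η j) ⟨P.1, P.2.ψ⟩ = evAt (η j) ⟨P'.1, P'.2.ψ⟩) : P = P' := by
  obtain ⟨m, P⟩ := P
  obtain ⟨m', P'⟩ := P'
  obtain rfl : m = m' := h
  have hU' : m ∈ U := hU
  refine Sigma.ext rfl (heq_of_eq (DPt.ext_of_free hf hU' (fun i => ?_) (fun i => ?_) fun j => ?_))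
  · exact (evAt_mk _ _ hU').symm.trans ((h1 i).trans (evAt_mk _ _ hU'))
  · exact (evAt_mk _ _ hU').symm.trans ((h2 i).trans (evAt_mk _ _ hU'))
  · exact (evAt_mk _ _ hU').symm.trans ((h3 j).trans (evAt_mk _ _ hU'))

namespace LocalGenerators

variable (S : N.LocalGenerators)

/-- The functional over `b` with given values on the generators around `c`; it is zero for `b`
outside the domain of these. -/
noncomputable def qPoint (c b : N.base) (v : Fin S.r₁ → ℝ) : N.TQ := by
  classical exact
  if h : b ∈ S.U c then ⟨b, (DPt.exists_of_free (S.free c) h v 0 0).choose.φ₁⟩ else ⟨b, 0⟩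

theorem qPoint_fst (c b : N.base) (v : Fin S.r₁ → ℝ) : (S.qPoint c b v).1 = b := by
  unfold qPoint
  split_ifs <;> rfl

theorem evAt_qPoint (c : N.base) {b : N.base} (h : b ∈ S.U c) (v : Fin S.r₁ → ℝ) (i : Fin S.r₁) :
    evAt (S.ξ c i) (S.qPoint c b v) = v i := by
  have e : S.qPoint c b v = ⟨b, (DPt.exists_of_free (S.free c) h v 0 0).choose.φ₁⟩ := dif_pos h
  rw [e, evAt_mk _ _ h]
  exact (DPt.exists_of_free (S.free c) h v 0 0).choose_spec.1 i

/-- Fibrewise coordinates on the dual of the bundle of functions of degree 1. -/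
noncomputable def qCharts : FibreCharts N.base N.TQ S.r₁ where
  proj x := x.1
  U := S.U
  mem_U := S.mem_U
  Θ c x := WithLp.toLp 2 fun i => evAt (S.ξ c i) x
  Ψ c p := S.qPoint c p.1 p.2
  proj_Ψ c b _ v := S.qPoint_fst c b v
  Θ_Ψ c b hb v := PiLp.ext fun i => S.evAt_qPoint c hb v i
  Ψ_Θ c x hx := TQ.ext_evAt_free (S.free c) (S.qPoint_fst c _ _)
    ((congrArg (· ∈ S.U c) (S.qPoint_fst c _ _)).mpr hx) fun i => S.evAt_qPoint c hx _ i
  smooth_change c c' := by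
    rintro ⟨b, v⟩ ⟨⟨hc, hc'⟩, -⟩
    have h0 : (fun p : N.base × EuclideanSpace ℝ (Fin S.r₁) => (S.qPoint c p.1 p.2).1) = Prod.fst :=
      funext fun p => S.qPoint_fst c _ _
    refine (smoothAt_toLp fun i => ?_).contMDiffWithinAt
    refine (S.free c).smoothAt_evAt₁ (F := fun p : N.base × EuclideanSpace ℝ (Fin S.r₁) =>
      S.qPoint c p.1 p.2) ((congrArg (· ∈ S.U c) (S.qPoint_fst c b v)).mpr hc) ?_ (fun j => ?_) _
      ((congrArg (· ∈ S.U c') (S.qPoint_fst c b v)).mpr hc')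
    · rw [h0]
      exact contMDiff_fst.contMDiffAt
    · refine ((smooth_coord j).comp contMDiff_snd).contMDiffAt.congr_of_eventuallyEq ?_
      filter_upwards [((S.U c).2.prod isOpen_univ).mem_nhds (show (b, v) ∈ _ from
        ⟨hc, Set.mem_univ _⟩)] with p hp
      exact S.evAt_qPoint c hp.1 _ j

/-- The dual of the bundle of functions of degree 1, as a manifold. -/
noncomputable def Q : Mfd.{u} := S.qCharts.toMfd

/-- The projection to the base. -/
def bQ (x : S.Q) : N.base := (show N.TQ from x).1

/-- A function of degree 1 as a function on `Q`, extended by zero outside its domain. -/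
noncomputable def fQ {V : Opens N.base} (a : N.sec V 1) (x : S.Q) : ℝ := evAt a (show N.TQ from x)

theorem smooth_bQ : SmoothMap S.bQ := S.qCharts.smooth_proj

theorem smoothAt_fQ {V : Opens N.base} (a : N.sec V 1) {x : S.Q} (h : S.bQ x ∈ V) :
    ContMDiffAt (𝓡 S.Q.dim) 𝓘(ℝ, ℝ) ∞ (S.fQ a) x := by
  refine (S.free (S.bQ x)).smoothAt_evAt₁ (F := fun x : S.Q => (show N.TQ from x))
    (S.mem_U (S.bQ x)) (S.smooth_bQ x) (fun i => ?_) a h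
  have h1 : ContMDiffAt (𝓡 S.Q.dim) (𝓡 S.r₁) ∞ (fun y : S.Q => S.qCharts.Θ (S.bQ x) y) x :=
    ContMDiffOn.contMDiffAt (S.qCharts.smoothOn_Θ (S.bQ x))
      (((S.U (S.bQ x)).2.preimage S.smooth_bQ.continuous).mem_nhds (S.mem_U (S.bQ x)))
  exact (smooth_coord i _).comp x h1

theorem Q_ext {x x' : S.Q} (h : S.bQ x = S.bQ x')
    (h' : ∀ (U : Opens N.base) (a : N.sec U 1), S.fQ a x = S.fQ a x') : x = x' := ext_evAt h h'

section

variable {H E : Type*} [NormedAddCommGroup E] [NormedSpace ℝ E] [TopologicalSpace H]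
  {I : ModelWithCorners ℝ E H} {Z : Type*} [TopologicalSpace Z] [ChartedSpace H Z] {z : Z}

/-- A map to `Q` is smooth if its base point and the functions of degree 1 along it are. -/
theorem smoothAt_Q {F : Z → S.Q} (h0 : ContMDiffAt I (𝓡 N.base.dim) ∞ (fun z => S.bQ (F z)) z)
    (h : ∀ (V : Opens N.base) (a : N.sec V 1), S.bQ (F z) ∈ V →
      ContMDiffAt I 𝓘(ℝ, ℝ) ∞ (fun z => S.fQ a (F z)) z) : ContMDiffAt I (𝓡 S.Q.dim) ∞ F z :=
  S.qCharts.smoothAt_of_coords (S.bQ (F z)) (S.mem_U _) h0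
    (smoothAt_toLp fun i => h _ (S.ξ (S.bQ (F z)) i) (S.mem_U _))

end

/-- The point `(φ₁, φ₂, ψ)` where `φ₁` is the given functional `y` and `φ₂`, `ψ` have given values
on the generators around `c`. Outside the domain of these it is `(y, 0, 0)`, so that it lies over
`y` in all cases. -/
noncomputable def dPoint (c : N.base) (y : N.TQ) (v : Fin S.r₁ → ℝ) (w : Fin S.r₂ → ℝ) : N.TD := by
  classical exact
  if h : y.1 ∈ S.U c then
    ⟨y.1, (DPt.exists_of_free (S.free c) h (fun i => y.2.ev h (S.ξ c i)) v w).choose⟩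
  else ⟨y.1, DPt.mk y.2 0 0 fun U hm a b => by
    have h0 : ∀ (k : ℕ) (a : N.sec U k), (0 : N.Functional y.1 k).ev hm a = 0 := fun _ _ => rfl
    rw [h0, h0, h0, mul_zero, mul_zero, sub_zero, mul_zero]⟩

theorem p₁_dPoint (c : N.base) (y : N.TQ) (v : Fin S.r₁ → ℝ) (w : Fin S.r₂ → ℝ) :
    (S.dPoint c y v w).p₁ = y := by
  unfold dPoint
  split_ifs with h
  · exact Sigma.ext rfl (heq_of_eq (Functional.ext₁ (S.free c) h
      (DPt.exists_of_free (S.free c) h (fun i => y.2.ev h (S.ξ c i)) v w).choose_spec.1))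
  · rfl

theorem dPoint_fst (c : N.base) (y : N.TQ) (v : Fin S.r₁ → ℝ) (w : Fin S.r₂ → ℝ) :
    (S.dPoint c y v w).1 = y.1 := congrArg Sigma.fst (S.p₁_dPoint c y v w)

theorem evAt_dPoint₂ (c : N.base) {y : N.TQ} (h : y.1 ∈ S.U c) (v : Fin S.r₁ → ℝ)
    (w : Fin S.r₂ → ℝ) (i : Fin S.r₁) : evAt (S.ξ c i) (S.dPoint c y v w).p₂ = v i := by
  have e : S.dPoint c y v w =
    ⟨y.1, (DPt.exists_of_free (S.free c) h (fun i => y.2.ev h (S.ξ c i)) v w).choose⟩ := dif_pos h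
  rw [e]
  exact (evAt_mk _ _ h).trans
    ((DPt.exists_of_free (S.free c) h (fun i => y.2.ev h (S.ξ c i)) v w).choose_spec.2.1 i)

theorem evAt_dPoint (c : N.base) {y : N.TQ} (h : y.1 ∈ S.U c) (v : Fin S.r₁ → ℝ)
    (w : Fin S.r₂ → ℝ) (j : Fin S.r₂) :
    evAt (S.η c j) ⟨(S.dPoint c y v w).1, (S.dPoint c y v w).2.ψ⟩ = w j := by
  have e : S.dPoint c y v w =
    ⟨y.1, (DPt.exists_of_free (S.free c) h (fun i => y.2.ev h (S.ξ c i)) v w).choose⟩ := dif_pos h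
  rw [e]
  exact (evAt_mk _ _ h).trans
    ((DPt.exists_of_free (S.free c) h (fun i => y.2.ev h (S.ξ c i)) v w).choose_spec.2.2 j)

/-- Fibrewise coordinates for the first projection of the space of points: the values of `φ₂` and
`ψ` on free generators. -/
noncomputable def dCharts : FibreCharts S.Q N.TD (S.r₁ + S.r₂) where
  proj P := P.p₁
  U x := preim S.smooth_bQ (S.U (S.bQ x))
  mem_U x := S.mem_U (S.bQ x)
  Θ x P := (splitCoords S.r₁ S.r₂).symm (WithLp.toLp 2 fun i => evAt (S.ξ (S.bQ x) i) P.p₂,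
    WithLp.toLp 2 fun j => evAt (S.η (S.bQ x) j) ⟨P.1, P.2.ψ⟩)
  Ψ x p := S.dPoint (S.bQ x) p.1 (splitCoords S.r₁ S.r₂ p.2).1 (splitCoords S.r₁ S.r₂ p.2).2
  proj_Ψ x y _ v := S.p₁_dPoint _ _ _ _
  Θ_Ψ x y hy v := by
    rw [ContinuousLinearEquiv.symm_apply_eq]
    exact Prod.ext (PiLp.ext fun i => S.evAt_dPoint₂ _ hy _ _ i)
      (PiLp.ext fun j => S.evAt_dPoint _ hy _ _ j)
  Ψ_Θ x P hP := by
    have hP' : P.p₁.1 ∈ S.U (S.bQ x) := hP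
    beta_reduce
    rw [ContinuousLinearEquiv.apply_symm_apply]
    refine TD.ext_evAt_free (S.free (S.bQ x)) (S.dPoint_fst _ _ _ _) ?_ (fun i => ?_) (fun i => ?_)
      fun j => ?_
    · rw [S.dPoint_fst]
      exact hP
    · exact congrArg _ (S.p₁_dPoint _ _ _ _)
    · exact S.evAt_dPoint₂ _ hP' _ _ i
    · exact S.evAt_dPoint _ hP' _ _ j
  smooth_change x x' := by
    rintro ⟨y, v⟩ ⟨⟨hc, hc'⟩, -⟩
    have hc1 : S.bQ y ∈ S.U (S.bQ x) := hc
    have hc1' : S.bQ y ∈ S.U (S.bQ x') := hc'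
    let F : S.Q × EuclideanSpace ℝ (Fin (S.r₁ + S.r₂)) → N.TD := fun p =>
      S.dPoint (S.bQ x) p.1 (splitCoords S.r₁ S.r₂ p.2).1 (splitCoords S.r₁ S.r₂ p.2).2
    have h0 : ContMDiff ((𝓡 S.Q.dim).prod (𝓡 (S.r₁ + S.r₂))) (𝓡 N.base.dim) ∞
        (fun p => (F p).1) := by
      rw [show (fun p => (F p).1) = fun p => S.bQ p.1 from funext fun p => S.dPoint_fst _ _ _ _]
      exact S.smooth_bQ.comp contMDiff_fst
    have hF : (F (y, v)).1 ∈ S.U (S.bQ x) := (congrArg (· ∈ S.U (S.bQ x))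
      (S.dPoint_fst _ _ _ _)).mpr hc1
    have hF' : (F (y, v)).1 ∈ S.U (S.bQ x') := (congrArg (· ∈ S.U (S.bQ x'))
      (S.dPoint_fst _ _ _ _)).mpr hc1'
    have hnhds := ((preim S.smooth_bQ (S.U (S.bQ x))).2.prod
        (isOpen_univ (X := EuclideanSpace ℝ (Fin (S.r₁ + S.r₂))))).mem_nhds
        (show (y, v) ∈ _ from ⟨hc, Set.mem_univ _⟩)
    have h1 : ∀ i, ContMDiffAt ((𝓡 S.Q.dim).prod (𝓡 (S.r₁ + S.r₂))) 𝓘(ℝ, ℝ) ∞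
        (fun p => evAt (S.ξ (S.bQ x) i) (F p).p₁) (y, v) := fun i => by
      have hfst : ContMDiffAt ((𝓡 S.Q.dim).prod (𝓡 (S.r₁ + S.r₂))) (𝓡 S.Q.dim) ∞
        (fun p : S.Q × EuclideanSpace ℝ (Fin (S.r₁ + S.r₂)) => p.1) (y, v) := contMDiffAt_fst
      have h4 := (S.smoothAt_fQ (S.ξ (S.bQ x) i) (x := y) hc1).comp (y, v) hfst
      exact h4.congr_of_eventuallyEq (Filter.Eventually.of_forall fun p =>
        congrArg (evAt (S.ξ (S.bQ x) i)) (S.p₁_dPoint _ _ _ _))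
    have hs : ContMDiff ((𝓡 S.Q.dim).prod (𝓡 (S.r₁ + S.r₂))) ((𝓡 S.r₁).prod (𝓡 S.r₂)) ∞
        (fun p : S.Q × EuclideanSpace ℝ (Fin (S.r₁ + S.r₂)) => splitCoords S.r₁ S.r₂ p.2) :=
      (smooth_splitCoords _ _).comp contMDiff_snd
    have h2 : ∀ i, ContMDiffAt ((𝓡 S.Q.dim).prod (𝓡 (S.r₁ + S.r₂))) 𝓘(ℝ, ℝ) ∞
        (fun p => evAt (S.ξ (S.bQ x) i) (F p).p₂) (y, v) := fun i => by
      refine ((smooth_coord i).comp (contMDiff_fst.comp hs)).contMDiffAt.congr_of_eventuallyEq ?_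
      filter_upwards [hnhds] with p hp
      exact S.evAt_dPoint₂ _ hp.1 _ _ i
    have h3 : ∀ j, ContMDiffAt ((𝓡 S.Q.dim).prod (𝓡 (S.r₁ + S.r₂))) 𝓘(ℝ, ℝ) ∞
        (fun p => evAt (S.η (S.bQ x) j) ⟨(F p).1, (F p).2.ψ⟩) (y, v) := fun j => by
      refine ((smooth_coord j).comp (contMDiff_snd.comp hs)).contMDiffAt.congr_of_eventuallyEq ?_
      filter_upwards [hnhds] with p hp
      exact S.evAt_dPoint _ hp.1 _ _ j
    refine ((smooth_splitCoords_symm S.r₁ S.r₂ _).comp (y, v) ((smoothAt_toLp fun i => ?_).prodMk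
      (smoothAt_toLp fun j => ?_))).contMDiffWithinAt
    · exact (S.free (S.bQ x)).smoothAt_evAt₁ (F := fun p => (F p).p₂) hF (h0 _) h2 _ hF'
    · exact (S.free (S.bQ x)).smoothAt_evAt₂ (F := F) hF (h0 _) h1 h2 h3 _ hF'

/-- The space of points, as a manifold fibred over `Q` by the first projection. -/
noncomputable def D : Mfd.{u} := S.dCharts.toMfd

/-- The first projection. -/
def πD (P : S.D) : S.Q := (show N.TD from P).p₁

/-- The flip `(φ₁, φ₂, ψ) ↦ (φ₂, φ₁, -ψ)`; the second projection to `Q` is `πD ∘ invD`. -/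
noncomputable def invD (P : S.D) : S.D := (show N.TD from P).inv

/-- A function of degree 2 as a function on the space of points, extended by zero outside its
domain. -/
noncomputable def fD {V : Opens N.base} (a : N.sec V 2) (P : S.D) : ℝ :=
  evAt a ⟨(show N.TD from P).1, (show N.TD from P).2.ψ⟩

theorem invD_invD (P : S.D) : S.invD (S.invD P) = P := TD.inv_inv _

theorem bQ_πD_invD (P : S.D) : S.bQ (S.πD (S.invD P)) = S.bQ (S.πD P) := rfl

theorem fD_invD {V : Opens N.base} (a : N.sec V 2) (P : S.D) :
    S.fD a (S.invD P) = -S.fD a P :=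
  (evAt_smul a (-1) (show N.TD from P).2.ψ).trans (neg_one_mul _)

theorem smooth_πD : SmoothMap S.πD := S.dCharts.smooth_proj

theorem D_ext {P P' : S.D} (h1 : S.πD P = S.πD P') (h2 : S.πD (S.invD P) = S.πD (S.invD P'))
    (h3 : ∀ (U : Opens N.base) (a : N.sec U 2), S.fD a P = S.fD a P') : P = P' :=
  TD.ext_ev (P := P) (P' := P') (congrArg S.bQ h1) h1 h2 fun U hx hx' a => by
    have h := h3 U a
    exact (evAt_mk a _ hx).symm.trans (h.trans (evAt_mk a _ hx'))

theorem smoothAt_splitCoords_Θ (P : S.D) : ContMDiffAt (𝓡 S.D.dim) ((𝓡 S.r₁).prod (𝓡 S.r₂)) ∞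
    (fun P' : S.D => ((WithLp.toLp 2 fun i => S.fQ (S.ξ (S.bQ (S.πD P)) i) (S.πD (S.invD P')) :
      EuclideanSpace ℝ (Fin S.r₁)), (WithLp.toLp 2 fun j => S.fD (S.η (S.bQ (S.πD P)) j) P' :
      EuclideanSpace ℝ (Fin S.r₂)))) P := by
  have h1 : ContMDiffAt (𝓡 S.D.dim) (𝓡 (S.r₁ + S.r₂)) ∞
      (fun P' : S.D => S.dCharts.Θ (S.πD P) P') P :=
    ContMDiffOn.contMDiffAt (S.dCharts.smoothOn_Θ (S.πD P))
      (((S.dCharts.U (S.πD P)).2.preimage S.smooth_πD.continuous).mem_nhds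
        (S.dCharts.mem_U (S.πD P)))
  refine ((smooth_splitCoords S.r₁ S.r₂ _).comp P h1).congr_of_eventuallyEq
    (Filter.Eventually.of_forall fun P' => ?_)
  exact ((splitCoords S.r₁ S.r₂).apply_symm_apply _).symm

theorem smoothAt_fQ_πD {V : Opens N.base} (a : N.sec V 1) {P : S.D} (h : S.bQ (S.πD P) ∈ V) :
    ContMDiffAt (𝓡 S.D.dim) 𝓘(ℝ, ℝ) ∞ (fun P => S.fQ a (S.πD P)) P :=
  (S.smoothAt_fQ a h).comp P (S.smooth_πD P)

theorem smoothAt_fQ_πD_invD {V : Opens N.base} (a : N.sec V 1) {P : S.D} (h : S.bQ (S.πD P) ∈ V) :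
    ContMDiffAt (𝓡 S.D.dim) 𝓘(ℝ, ℝ) ∞ (fun P => S.fQ a (S.πD (S.invD P))) P :=
  (S.free (S.bQ (S.πD P))).smoothAt_evAt₁ (F := fun P : S.D => (show N.TD from P).p₂)
    (S.mem_U (S.bQ (S.πD P))) ((S.smooth_bQ.comp S.smooth_πD) P)
    (fun i => (smooth_coord i _).comp P (contMDiffAt_fst.comp P (S.smoothAt_splitCoords_Θ P))) a h

theorem smoothAt_fD {V : Opens N.base} (a : N.sec V 2) {P : S.D} (h : S.bQ (S.πD P) ∈ V) :
    ContMDiffAt (𝓡 S.D.dim) 𝓘(ℝ, ℝ) ∞ (fun P => S.fD a P) P :=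
  (S.free (S.bQ (S.πD P))).smoothAt_evAt₂ (F := fun P : S.D => (show N.TD from P))
    (S.mem_U (S.bQ (S.πD P))) ((S.smooth_bQ.comp S.smooth_πD) P)
    (fun _ => S.smoothAt_fQ_πD _ (S.mem_U (S.bQ (S.πD P))))
    (fun _ => S.smoothAt_fQ_πD_invD _ (S.mem_U (S.bQ (S.πD P))))
    (fun j => (smooth_coord j _).comp P (contMDiffAt_snd.comp P (S.smoothAt_splitCoords_Θ P))) a h

/-- A map to `D` is smooth if its base point and the functions of degree 1 and 2 along it are. -/
theorem smoothAt_D {H E : Type*} [NormedAddCommGroup E] [NormedSpace ℝ E] [TopologicalSpace H]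
    {I : ModelWithCorners ℝ E H} {Z : Type*} [TopologicalSpace Z] [ChartedSpace H Z] {z : Z}
    {F : Z → S.D} (h0 : ContMDiffAt I (𝓡 N.base.dim) ∞ (fun z => S.bQ (S.πD (F z))) z)
    (h1 : ∀ (V : Opens N.base) (a : N.sec V 1), S.bQ (S.πD (F z)) ∈ V →
      ContMDiffAt I 𝓘(ℝ, ℝ) ∞ (fun z => S.fQ a (S.πD (F z))) z)
    (h2 : ∀ (V : Opens N.base) (a : N.sec V 1), S.bQ (S.πD (F z)) ∈ V →
      ContMDiffAt I 𝓘(ℝ, ℝ) ∞ (fun z => S.fQ a (S.πD (S.invD (F z)))) z)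
    (h3 : ∀ (V : Opens N.base) (a : N.sec V 2), S.bQ (S.πD (F z)) ∈ V →
      ContMDiffAt I 𝓘(ℝ, ℝ) ∞ (fun z => S.fD a (F z)) z) : ContMDiffAt I (𝓡 S.D.dim) ∞ F z :=
  S.dCharts.smoothAt_of_coords (S.πD (F z)) (S.dCharts.mem_U _) (S.smoothAt_Q h0 h1)
    ((smooth_splitCoords_symm S.r₁ S.r₂ _).comp z
      ((smoothAt_toLp fun i => h2 _ (S.ξ (S.bQ (S.πD (F z))) i) (S.mem_U _)).prodMk
        (smoothAt_toLp fun j => h3 _ (S.η (S.bQ (S.πD (F z))) j) (S.mem_U _))))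

theorem smooth_invD : SmoothMap S.invD := fun P => by
  refine S.smoothAt_D ((S.smooth_bQ.comp S.smooth_πD) P)
    (fun V a h => S.smoothAt_fQ_πD_invD a h) (fun V a h => ?_) fun V a h => ?_
  · simp only [S.invD_invD]
    exact S.smoothAt_fQ_πD a h
  · simp only [S.fD_invD]
    exact (S.smoothAt_fD a (P := P) h).neg

theorem fD_mul₁₁ {V : Opens N.base} (a b : N.sec V 1) {P : S.D} (h : S.bQ (S.πD P) ∈ V) :
    S.fD (mul₁₁ a b) P = 1 / 2 * (S.fQ a (S.πD P) * S.fQ b (S.πD (S.invD P)) -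
      S.fQ b (S.πD P) * S.fQ a (S.πD (S.invD P))) := by
  have h1 : (show N.TD from P).p₁.1 ∈ V := h
  have h2 : (show N.TD from P).p₂.1 ∈ V := h
  refine (evAt_mk _ _ h1).trans (((show N.TD from P).2.mul V h1 a b).trans ?_)
  exact congrArg (1 / 2 * ·) (congrArg₂ (· - ·)
    (congrArg₂ (· * ·) (evAt_eq a h1).symm (evAt_eq b h2).symm)
    (congrArg₂ (· * ·) (evAt_eq b h1).symm (evAt_eq a h2).symm))

/-- Free generators over any open set, not only the chosen ones, are coordinates on `D`. -/
theorem exists_D_of_free {U : Opens N.base} {r₁ r₂ : ℕ} {ξ : Fin r₁ → N.sec U 1}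
    {η : Fin r₂ → N.sec U 2} (hf : N.IsFreelyGenerated U ξ η) {m : N.base} (hm : m ∈ U)
    (a b : Fin r₁ → ℝ) (c : Fin r₂ → ℝ) : ∃! P : S.D, S.bQ (S.πD P) = m ∧
      (∀ i, S.fQ (ξ i) (S.πD P) = a i) ∧ (∀ i, S.fQ (ξ i) (S.πD (S.invD P)) = b i) ∧
      ∀ j, S.fD (η j) P = c j := by
  obtain ⟨P, h1, h2, h3⟩ := DPt.exists_of_free hf hm a b c
  refine ⟨(⟨m, P⟩ : N.TD), ⟨rfl, fun i => (evAt_mk _ _ hm).trans (h1 i),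
    fun i => (evAt_mk _ _ hm).trans (h2 i), fun j => (evAt_mk _ _ hm).trans (h3 j)⟩, ?_⟩
  rintro (P' : N.TD) ⟨h0', h1', h2', h3'⟩
  have hP' : P'.1 ∈ U := (congrArg (· ∈ U) h0').mpr hm
  refine TD.ext_evAt_free hf h0' hP' (fun i => ?_) (fun i => ?_) fun j => ?_
  · exact (h1' i).trans ((evAt_mk _ _ hm).trans (h1 i)).symm
  · exact (h2' i).trans ((evAt_mk _ _ hm).trans (h2 i)).symm
  · exact (h3' j).trans ((evAt_mk _ _ hm).trans (h3 j)).symm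

end LocalGenerators

end GradedMfd

/-! ### The vector bundle structures on the space of points -/

/-- A map is linear for a vector space structure transported along a bijection if the composite
with the bijection is. -/
theorem isLinearMap_transport {α β F : Type*} [AddCommGroup α] [Module ℝ α] [AddCommGroup F]
    [Module ℝ F] (e : α ≃ β) {g : β → F} (h : IsLinearMap ℝ (fun a => g (e a))) :
    letI := e.symm.addCommGroup
    letI := e.symm.module ℝ
    IsLinearMap ℝ g := by
  let _ := e.symm.addCommGroup
  let _ := e.symm.module ℝ
  have h1 := ((h.mk' _) ∘ₗ (e.symm.linearEquiv ℝ).toLinearMap).isLinear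
  have h2 : g = ((h.mk' _) ∘ₗ (e.symm.linearEquiv ℝ).toLinearMap) :=
    funext fun b => congrArg g (e.apply_symm_apply b).symm
  rw [h2]
  exact h1

namespace VBundle

variable {E B : Mfd.{u}} (π : VBundle E B)

section Conj

variable {σ : E → E} (hσ : ∀ e, σ (σ e) = e)

/-- The involution identifies the fibres of `π ∘ σ` with those of `π`. -/
def flipFib (b : B) : {e : E // π.proj (σ e) = b} ≃ π.Fib b where
  toFun e := ⟨σ e.1, e.2⟩
  invFun e := ⟨σ e.1, by rw [hσ]; exact e.2⟩
  left_inv e := Subtype.ext (hσ e.1)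
  right_inv e := Subtype.ext (hσ e.1)

/-- The vector bundle structure conjugate to a given one under an involution of the total space. -/
noncomputable def conj (hs : SmoothMap σ) : VBundle E B :=
  letI := fun b => (π.flipFib hσ b).addCommGroup
  letI := fun b => (π.flipFib hσ b).module ℝ
  { proj := fun e => π.proj (σ e)
    smooth_proj := π.smooth_proj.comp hs
    rank := π.rank
    locally_trivial := fun b => by
      obtain ⟨T, hT⟩ := π.exists_localTriv b
      refine ⟨T.U, hT, fun e => T.Θ (σ e), fun p => σ (T.Ψ p), ?_, hs.comp_contMDiffOn T.smooth_Ψ,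
        fun b hb v => ?_, fun e he => ?_, fun b hb => ?_⟩
      · exact T.smooth_Θ.comp hs.contMDiffOn fun e he => he
      · exact ⟨(congrArg π.proj (hσ _)).trans (T.proj_Ψ b hb v),
          (congrArg T.Θ (hσ _)).trans (T.Θ_Ψ b hb v)⟩
      · exact (congrArg σ (T.Ψ_Θ _ he)).trans (hσ e)
      · exact ((T.linear b hb).mk' _ ∘ₗ ((π.flipFib hσ b).linearEquiv ℝ).toLinearMap).isLinear }

variable (hs : SmoothMap σ)

theorem conj_morphism : IsMorphism π (π.conj hσ hs) σ id where
  smooth := hs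
  smooth_base := contMDiff_id
  comm e := congrArg π.proj (hσ e)
  linear b := by
    let := (π.flipFib hσ b).addCommGroup
    let := (π.flipFib hσ b).module ℝ
    exact ((π.flipFib hσ b).linearEquiv ℝ).symm.toLinearMap.isLinear

theorem morphism_conj : IsMorphism (π.conj hσ hs) π σ id where
  smooth := hs
  smooth_base := contMDiff_id
  comm e := rfl
  linear b := by
    let := (π.flipFib hσ b).addCommGroup
    let := (π.flipFib hσ b).module ℝ
    exact ((π.flipFib hσ b).linearEquiv ℝ).toLinearMap.isLinear

end Conj

section Apply

variable {g : E → ℝ} (hg : ∀ b, IsLinearMap ℝ (fun x : π.Fib b => g x.1))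
include hg

theorem apply_add {e e' : E} (h : π.proj e = π.proj e') : g (π.add e e' h) = g e + g e' :=
  (hg (π.proj e)).map_add ⟨e, rfl⟩ ⟨e', h.symm⟩

theorem apply_smul (r : ℝ) (e : E) : g (π.smul r e) = r * g e :=
  (hg (π.proj e)).map_smul r ⟨e, rfl⟩

theorem apply_zero (b : B) : g (π.zero b) = 0 := (hg b).map_zero

end Apply

end VBundle

namespace GradedMfd

variable {N : GradedMfd.{u}}

namespace LocalGenerators

variable (S : N.LocalGenerators)

/-- The fibre of `Q` over `b` is the vector space of functionals of degree 1 at `b`. -/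
noncomputable def fibQ (b : N.base) :
    N.Functional b 1 ≃ {p : S.qCharts.toMfd // S.qCharts.proj p = b} :=
  Equiv.ofBijective (fun φ => ⟨(⟨b, φ⟩ : N.TQ), rfl⟩) ⟨fun φ φ' h =>
    eq_of_heq (Sigma.ext_iff.mp (congrArg Subtype.val h)).2, fun p => by
      obtain ⟨⟨b, φ⟩, rfl⟩ := p
      exact ⟨φ, rfl⟩⟩

/-- The vector bundle `Q`: the dual of the bundle of functions of degree 1. -/
noncomputable def q : VBundle S.Q N.base :=
  letI := fun b => (S.fibQ b).symm.addCommGroup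
  letI := fun b => (S.fibQ b).symm.module ℝ
  S.qCharts.toVBundle fun _ b _ => isLinearMap_transport (S.fibQ b) <|
    ⟨fun _ _ => PiLp.ext fun _ => evAt_add _ _ _, fun _ _ => PiLp.ext fun _ => evAt_smul _ _ _⟩

theorem linear_fQ {V : Opens N.base} (a : N.sec V 1) (b : N.base) :
    IsLinearMap ℝ (fun x : S.q.Fib b => S.fQ a x.1) :=
  isLinearMap_transport (S.fibQ b) (g := fun x => evAt a (show N.TQ from x.1))
    ⟨fun _ _ => evAt_add _ _ _, fun _ _ => evAt_smul _ _ _⟩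

/-- The points `(φ₁, φ₂, ψ)` with `φ₁ = x`, as pairs `(φ₂, ψ)`. For fixed `φ₁` the condition on
`ψ` is linear in `(φ₂, ψ)`. -/
def pairs (x : S.Q) : Submodule ℝ (N.Functional (S.bQ x) 1 × N.Functional (S.bQ x) 2) where
  carrier := {z | ∀ (U : Opens N.base) (hm : S.bQ x ∈ U) (a b : N.sec U 1),
    z.2.ev hm (mul₁₁ a b) = 1 / 2 * ((show N.TQ from x).2.ev hm a * z.1.ev hm b -
      (show N.TQ from x).2.ev hm b * z.1.ev hm a)}
  zero_mem' U hm a b := by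
    change (0 : ℝ) = 1 / 2 * (_ * 0 - _ * 0)
    ring
  add_mem' {z z'} h h' U hm a b := by
    have h1 := h U hm a b
    have h2 := h' U hm a b
    change z.2.ev hm _ + z'.2.ev hm _ =
      1 / 2 * (_ * (z.1.ev hm b + z'.1.ev hm b) - _ * (z.1.ev hm a + z'.1.ev hm a))
    rw [h1, h2]
    ring
  smul_mem' r z h U hm a b := by
    have h1 := h U hm a b
    change r * z.2.ev hm _ = 1 / 2 * (_ * (r * z.1.ev hm b) - _ * (r * z.1.ev hm a))
    rw [h1]
    ring

/-- The fibre of the first projection of `D` over `x` is the vector space `pairs x`. -/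
noncomputable def fibD (x : S.Q) :
    S.pairs x ≃ {P : S.dCharts.toMfd // S.dCharts.proj P = x} :=
  Equiv.ofBijective
    (fun z => ⟨(⟨S.bQ x, ⟨(show N.TQ from x).2, z.1.1, z.1.2, z.2⟩⟩ : N.TD), rfl⟩)
    ⟨fun z z' h => by
      have h1 := eq_of_heq (Sigma.ext_iff.mp (congrArg Subtype.val h)).2
      exact Subtype.ext (Prod.ext (congrArg DPt.φ₂ h1) (congrArg DPt.ψ h1)), fun P => by
      obtain ⟨⟨m, ⟨φ₁, φ₂, ψ, h⟩⟩, rfl⟩ := P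
      exact ⟨⟨(φ₂, ψ), h⟩, rfl⟩⟩

/-- The first vector bundle structure on `D`: addition of `φ₂` and `ψ` for fixed `φ₁`. -/
noncomputable def p₁ : VBundle S.D S.Q :=
  letI := fun x => (S.fibD x).symm.addCommGroup
  letI := fun x => (S.fibD x).symm.module ℝ
  S.dCharts.toVBundle fun c x _ => isLinearMap_transport (S.fibD x) <| by
    have h : IsLinearMap ℝ (fun z : S.pairs x =>
        ((WithLp.toLp 2 fun i => evAt (S.ξ (S.bQ c) i) ⟨S.bQ x, z.1.1⟩ :
          EuclideanSpace ℝ (Fin S.r₁)), (WithLp.toLp 2 fun j =>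
          evAt (S.η (S.bQ c) j) ⟨S.bQ x, z.1.2⟩ : EuclideanSpace ℝ (Fin S.r₂)))) :=
      ⟨fun _ _ => Prod.ext (PiLp.ext fun _ => evAt_add _ _ _) (PiLp.ext fun _ => evAt_add _ _ _),
        fun _ _ => Prod.ext (PiLp.ext fun _ => evAt_smul _ _ _)
          (PiLp.ext fun _ => evAt_smul _ _ _)⟩
    exact ((splitCoords S.r₁ S.r₂).symm.toLinearMap ∘ₗ h.mk' _).isLinear

theorem linear_fQ_πD_invD {V : Opens N.base} (a : N.sec V 1) (x : S.Q) :
    IsLinearMap ℝ (fun P : S.p₁.Fib x => S.fQ a (S.πD (S.invD P.1))) :=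
  isLinearMap_transport (S.fibD x) (g := fun P => evAt a (show N.TD from P.1).p₂)
    ⟨fun z z' => evAt_add a z.1.1 z'.1.1, fun r z => evAt_smul a r z.1.1⟩

theorem linear_fD {V : Opens N.base} (a : N.sec V 2) (x : S.Q) :
    IsLinearMap ℝ (fun P : S.p₁.Fib x => S.fD a P.1) :=
  isLinearMap_transport (S.fibD x)
    (g := fun P => evAt a ⟨(show N.TD from P.1).1, (show N.TD from P.1).2.ψ⟩)
    ⟨fun z z' => evAt_add a z.1.2 z'.1.2, fun r z => evAt_smul a r z.1.2⟩

/-- The second vector bundle structure on `D`, defined as the conjugate of the first one under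
the flip, so that the flip exchanges the two. -/
noncomputable def p₂ : VBundle S.D S.Q := S.p₁.conj S.invD_invD S.smooth_invD

/-! ### Values of functions on sums and multiples -/

section

variable {V : Opens N.base}

theorem fQ_zero (a : N.sec V 1) (m : N.base) : S.fQ a (S.q.zero m) = 0 :=
  S.q.apply_zero (S.linear_fQ a) m

theorem πD_add₁ {P P' : S.D} (h : S.p₁.proj P = S.p₁.proj P') :
    S.πD (S.p₁.add P P' h) = S.πD P := S.p₁.proj_add P P' h

theorem πD_smul₁ (r : ℝ) (P : S.D) : S.πD (S.p₁.smul r P) = S.πD P := S.p₁.proj_smul r P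

theorem fQ_add₁ (a : N.sec V 1) {P P' : S.D} (h : S.p₁.proj P = S.p₁.proj P') :
    S.fQ a (S.πD (S.invD (S.p₁.add P P' h))) =
      S.fQ a (S.πD (S.invD P)) + S.fQ a (S.πD (S.invD P')) :=
  S.p₁.apply_add (g := fun P => S.fQ a (S.πD (S.invD P))) (S.linear_fQ_πD_invD a) h

theorem fQ_smul₁ (a : N.sec V 1) (r : ℝ) (P : S.D) :
    S.fQ a (S.πD (S.invD (S.p₁.smul r P))) = r * S.fQ a (S.πD (S.invD P)) :=
  S.p₁.apply_smul (g := fun P => S.fQ a (S.πD (S.invD P))) (S.linear_fQ_πD_invD a) r P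

theorem fD_add₁ (a : N.sec V 2) {P P' : S.D} (h : S.p₁.proj P = S.p₁.proj P') :
    S.fD a (S.p₁.add P P' h) = S.fD a P + S.fD a P' :=
  S.p₁.apply_add (S.linear_fD a) h

theorem fD_smul₁ (a : N.sec V 2) (r : ℝ) (P : S.D) : S.fD a (S.p₁.smul r P) = r * S.fD a P :=
  S.p₁.apply_smul (S.linear_fD a) r P

theorem invD_add₂ {P P' : S.D} (h : S.p₂.proj P = S.p₂.proj P')
    (h' : S.p₁.proj (S.invD P) = S.p₁.proj (S.invD P')) :
    S.invD (S.p₂.add P P' h) = S.p₁.add (S.invD P) (S.invD P') h' :=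
  (VBundle.morphism_conj S.p₁ S.invD_invD S.smooth_invD).map_add P P' h

theorem invD_smul₂ (r : ℝ) (P : S.D) : S.invD (S.p₂.smul r P) = S.p₁.smul r (S.invD P) :=
  (VBundle.morphism_conj S.p₁ S.invD_invD S.smooth_invD).map_smul r P

theorem fD_add₂ (a : N.sec V 2) {P P' : S.D} (h : S.p₂.proj P = S.p₂.proj P') :
    S.fD a (S.p₂.add P P' h) = S.fD a P + S.fD a P' := by
  have h' : S.p₁.proj (S.invD P) = S.p₁.proj (S.invD P') := h
  have h1 := S.fD_invD a (S.p₂.add P P' h)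
  rw [S.invD_add₂ h h', S.fD_add₁ a, S.fD_invD, S.fD_invD] at h1
  linarith

theorem fD_smul₂ (a : N.sec V 2) (r : ℝ) (P : S.D) : S.fD a (S.p₂.smul r P) = r * S.fD a P := by
  have h1 := S.fD_invD a (S.p₂.smul r P)
  rw [S.invD_smul₂, S.fD_smul₁, S.fD_invD] at h1
  linarith

theorem fQ_πD_add₂ (a : N.sec V 1) {P P' : S.D} (h : S.p₂.proj P = S.p₂.proj P') :
    S.fQ a (S.πD (S.p₂.add P P' h)) = S.fQ a (S.πD P) + S.fQ a (S.πD P') := by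
  have h1 := S.fQ_add₁ a (P := S.invD P) (P' := S.invD P') h
  rwa [← S.invD_add₂ h h, S.invD_invD, S.invD_invD, S.invD_invD] at h1

theorem fQ_πD_smul₂ (a : N.sec V 1) (r : ℝ) (P : S.D) :
    S.fQ a (S.πD (S.p₂.smul r P)) = r * S.fQ a (S.πD P) := by
  have h1 := S.fQ_smul₁ a r (S.invD P)
  rwa [← S.invD_smul₂, S.invD_invD, S.invD_invD] at h1

theorem πD_invD_add₂ {P P' : S.D} (h : S.p₂.proj P = S.p₂.proj P') :
    S.πD (S.invD (S.p₂.add P P' h)) = S.πD (S.invD P) := S.p₂.proj_add P P' h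

theorem πD_invD_smul₂ (r : ℝ) (P : S.D) :
    S.πD (S.invD (S.p₂.smul r P)) = S.πD (S.invD P) := S.p₂.proj_smul r P

end

theorem bQ_add₂ {P P' : S.D} (h : S.p₂.proj P = S.p₂.proj P') :
    S.bQ (S.πD (S.p₂.add P P' h)) = S.bQ (S.πD P) := by
  rw [← S.bQ_πD_invD, S.πD_invD_add₂, S.bQ_πD_invD]

theorem bQ_smul₂ (r : ℝ) (P : S.D) :
    S.bQ (S.πD (S.p₂.smul r P)) = S.bQ (S.πD P) := by
  rw [← S.bQ_πD_invD, S.πD_invD_smul₂, S.bQ_πD_invD]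

/-- Equality in `D` can be tested on functions. -/
theorem D_ext' {P P' : S.D} (h : S.bQ (S.πD P) = S.bQ (S.πD P'))
    (h1 : ∀ (U : Opens N.base) (a : N.sec U 1), S.fQ a (S.πD P) = S.fQ a (S.πD P'))
    (h2 : ∀ (U : Opens N.base) (a : N.sec U 1),
      S.fQ a (S.πD (S.invD P)) = S.fQ a (S.πD (S.invD P')))
    (h3 : ∀ (U : Opens N.base) (a : N.sec U 2), S.fD a P = S.fD a P') : P = P' :=
  S.D_ext (S.Q_ext h h1) (S.Q_ext h h2) h3

theorem πD_morphism : VBundle.IsMorphism S.p₂ S.q S.πD S.bQ where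
  smooth := S.smooth_πD
  smooth_base := S.smooth_bQ
  comm P := rfl
  linear x := by
    refine isLinearMap_of_separating (ι := Σ V : Opens N.base, N.sec V 1)
      (t := fun a (y : S.q.Fib (S.bQ x)) => S.fQ a.2 y.1) (fun a => S.linear_fQ a.2 _)
      (fun y y' h => Subtype.ext (S.Q_ext (y.2.trans y'.2.symm) fun U a => h ⟨U, a⟩)) fun a => ?_
    constructor
    · intro P P'
      have h := S.fQ_πD_add₂ a.2 (P.2.trans P'.2.symm)
      rwa [VBundle.add_coe] at h
    · intro r P
      have h := S.fQ_πD_smul₂ a.2 r P.1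
      rwa [VBundle.smul_coe] at h

/-- The involutive double vector bundle of points. Its laws are equalities in `D`, which are
checked on functions. -/
noncomputable def toIDVB : IDVB.{u} where
  M := N.base
  Q := S.Q
  D := S.D
  q := S.q
  dvb :=
    { πA := S.p₁
      πB := S.p₂
      πB_morphism :=
        S.πD_morphism.comp (VBundle.conj_morphism S.p₁ S.invD_invD S.smooth_invD)
      πA_morphism := S.πD_morphism
      add_add := fun d₁ d₂ d₃ d₄ h₁₂ h₃₄ h₁₃ h₂₄ hB hA => by
        refine S.D_ext' ?_ (fun U a => ?_) (fun U a => ?_) fun U a => ?_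
        · rw [S.bQ_add₂, S.πD_add₁, S.πD_add₁, S.bQ_add₂]
        · rw [S.fQ_πD_add₂, S.πD_add₁, S.πD_add₁, S.πD_add₁, S.fQ_πD_add₂]
        · rw [S.πD_invD_add₂, S.fQ_add₁, S.fQ_add₁, S.πD_invD_add₂, S.πD_invD_add₂]
        · rw [S.fD_add₂, S.fD_add₁, S.fD_add₁, S.fD_add₁, S.fD_add₂, S.fD_add₂]
          ring
      smulA_addB := fun r d₁ d₂ h h' => by
        refine S.D_ext' ?_ (fun U a => ?_) (fun U a => ?_) fun U a => ?_
        · rw [S.πD_smul₁, S.bQ_add₂, S.bQ_add₂, S.πD_smul₁]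
        · rw [S.πD_smul₁, S.fQ_πD_add₂, S.fQ_πD_add₂, S.πD_smul₁, S.πD_smul₁]
        · rw [S.fQ_smul₁, S.πD_invD_add₂, S.πD_invD_add₂, S.fQ_smul₁]
        · rw [S.fD_smul₁, S.fD_add₂, S.fD_add₂, S.fD_smul₁, S.fD_smul₁]
          ring
      smulB_addA := fun r d₁ d₂ h h' => by
        refine S.D_ext' ?_ (fun U a => ?_) (fun U a => ?_) fun U a => ?_
        · rw [S.bQ_smul₂, S.πD_add₁, S.πD_add₁, S.bQ_smul₂]
        · rw [S.fQ_πD_smul₂, S.πD_add₁, S.πD_add₁, S.fQ_πD_smul₂]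
        · rw [S.πD_invD_smul₂, S.fQ_add₁, S.fQ_add₁, S.πD_invD_smul₂, S.πD_invD_smul₂]
        · rw [S.fD_smul₂, S.fD_add₁, S.fD_add₁, S.fD_smul₂, S.fD_smul₂]
          ring
      smul_smul := fun r s d => by
        refine S.D_ext' ?_ (fun U a => ?_) (fun U a => ?_) fun U a => ?_
        · rw [S.bQ_smul₂, S.πD_smul₁, S.πD_smul₁, S.bQ_smul₂]
        · rw [S.fQ_πD_smul₂, S.πD_smul₁, S.πD_smul₁, S.fQ_πD_smul₂]
        · rw [S.πD_invD_smul₂, S.fQ_smul₁, S.fQ_smul₁, S.πD_invD_smul₂]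
        · rw [S.fD_smul₂, S.fD_smul₁, S.fD_smul₁, S.fD_smul₂]
          ring }
  inv := S.invD
  inv_inv := S.invD_invD
  inv_morphism₁ := VBundle.conj_morphism S.p₁ S.invD_invD S.smooth_invD
  inv_morphism₂ := VBundle.morphism_conj S.p₁ S.invD_invD S.smooth_invD
  inv_core m c h1 h2 := by
    have h1' : S.πD c = S.q.zero m := h1
    have h2' : S.πD (S.invD c) = S.q.zero m := h2
    refine S.D_ext' ?_ (fun U a => ?_) (fun U a => ?_) fun U a => ?_
    · rw [h2', S.πD_smul₁, h1']
    · rw [h2', S.πD_smul₁, h1']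
    · rw [S.invD_invD, S.fQ_smul₁, h1', h2', S.fQ_zero, mul_zero]
    · rw [S.fD_invD, S.fD_smul₁, neg_one_mul]

end LocalGenerators

end GradedMfd

/-! ### Functions as sections on the double vector bundle of points -/

namespace GradedMfd

variable {N : GradedMfd.{u}} {U V : Opens N.base} {m : N.base} {k : ℕ}

theorem evAt_sec_add (a b : N.sec U k) {x : Σ m, N.Functional m k} (h : x.1 ∈ U) :
    evAt (a + b) x = evAt a x + evAt b x := by
  rw [evAt_eq _ h, evAt_eq _ h, evAt_eq _ h, Functional.ev_add]

theorem evAt_sec_smul (f : Fun N.base U) (a : N.sec U k) {x : Σ m, N.Functional m k}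
    (h : x.1 ∈ U) : evAt (f • a) x = f ⟨x.1, h⟩ * evAt a x := by
  rw [evAt_eq _ h, evAt_eq _ h, Functional.ev_smul]

theorem evAt_sec_res (h : V ≤ U) (a : N.sec U k) {x : Σ m, N.Functional m k} (hx : x.1 ∈ V) :
    evAt (N.res h k a) x = evAt a x := by
  rw [evAt_eq _ hx, evAt_eq _ (h hx), Functional.ev_res]

section

variable {r₁ r₂ : ℕ} {ξ : Fin r₁ → N.sec U 1} {η : Fin r₂ → N.sec U 2} {B : Type*}
  [AddCommGroup B] [Module ℝ B]

/-- Germ maps in degree 1 which agree on free generators agree. -/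
theorem IsFreelyGenerated.germMap_ext₁ (hf : N.IsFreelyGenerated U ξ η) (hm : m ∈ U)
    {A A' : ∀ V : Opens N.base, m ∈ V → N.sec V 1 → B} (hA : IsGermMap A) (hA' : IsGermMap A')
    (h : ∀ i, A U hm (ξ i) = A' U hm (ξ i)) (hV : m ∈ V) (a : N.sec V 1) : A V hV a = A' V hV a :=
  hA.ext_of_span hA' hm ξ (fun _ hV a => (hf.restrict hV).mem_span₁ a) h hV a

/-- Germ maps in degree 2 which agree on the free generators of degree 2 and on the products of
those of degree 1 agree. -/
theorem IsFreelyGenerated.germMap_ext₂ (hf : N.IsFreelyGenerated U ξ η) (hm : m ∈ U)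
    {A A' : ∀ V : Opens N.base, m ∈ V → N.sec V 2 → B} (hA : IsGermMap A) (hA' : IsGermMap A')
    (h : ∀ j, A U hm (η j) = A' U hm (η j))
    (h' : ∀ i k, A U hm (mul₁₁ (ξ i) (ξ k)) = A' U hm (mul₁₁ (ξ i) (ξ k)))
    (hV : m ∈ V) (a : N.sec V 2) : A V hV a = A' V hV a := by
  refine hA.ext_of_span hA' hm (Sum.elim η fun q : {q : Fin r₁ × Fin r₁ // q.1 < q.2} =>
    mul₁₁ (ξ q.1.1) (ξ q.1.2)) (fun V hV a => ?_) ?_ hV a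
  · have := (hf.restrict hV).mem_span₂ a
    convert this using 3
    funext x
    rcases x with j | q
    · rfl
    · exact res_mul₁₁ hV _ _
  · rintro (j | q)
    · exact h j
    · exact h' q.1.1 q.1.2

end

namespace LocalGenerators

variable (S : N.LocalGenerators)

/-- A function of degree 1 as a section of `Q^*`. -/
noncomputable def secQ (a : N.sec U 1) : S.toIDVB.DualSection U :=
  .ofFun (X := S.toIDVB) U (S.fQ a) (fun _ hx => (S.smoothAt_fQ a hx).contMDiffWithinAt)
    fun m _ => S.linear_fQ a m

/-- A function of degree 2 as an isotropic linear section. -/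
noncomputable def secD (a : N.sec U 2) : S.toIDVB.IsotropicSection U :=
  .ofFun (X := S.toIDVB) U (S.fD a) (fun _ hx => (S.smoothAt_fD a hx).contMDiffWithinAt)
    ⟨fun _ _ h _ => S.fD_add₁ a h, fun r P _ => S.fD_smul₁ a r P, fun _ _ h _ => S.fD_add₂ a h,
      fun r P _ => S.fD_smul₂ a r P⟩ fun P _ => S.fD_invD a P

theorem ev_secQ (a : N.sec U 1) {x : S.Q} (hx : S.bQ x ∈ U) : (S.secQ a).ev x = S.fQ a x :=
  IDVB.DualSection.ev_ofFun (X := S.toIDVB) hx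

theorem ev_secD (a : N.sec U 2) {P : S.D} (hP : S.bQ (S.πD P) ∈ U) :
    (S.secD a).ev P = S.fD a P :=
  IDVB.IsotropicSection.ev_ofFun (X := S.toIDVB) hP

theorem secQ_apply (a : N.sec U 1) (hm : m ∈ U) (x : S.q.Fib m) :
    (S.secQ a).toFun ⟨m, hm⟩ x = S.fQ a x.1 :=
  ((S.secQ a).ev_eq ⟨m, hm⟩ x).symm.trans (S.ev_secQ a ((congrArg (· ∈ U) x.2).mpr hm))

theorem isoEv_secD (a : N.sec U 2) (hm : m ∈ U) (P : S.D) (hP : S.bQ (S.πD P) = m) :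
    IDVB.isoEv (X := S.toIDVB) ((S.secD a).toFun ⟨m, hm⟩) P hP = S.fD a P :=
  ((S.secD a).ev_eq ⟨m, hm⟩ P hP).symm.trans (S.ev_secD a ((congrArg (· ∈ U) hP).mpr hm))

theorem fQ_smul_sec (f : Fun N.base U) (a : N.sec U 1) {x : S.Q} (hx : S.bQ x = m) (hm : m ∈ U) :
    S.fQ (f • a) x = f ⟨m, hm⟩ * S.fQ a x := by
  subst hx
  exact evAt_sec_smul f a hm

theorem fD_smul_sec (f : Fun N.base U) (a : N.sec U 2) {P : S.D} (hP : S.bQ (S.πD P) = m)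
    (hm : m ∈ U) : S.fD (f • a) P = f ⟨m, hm⟩ * S.fD a P := by
  subst hP
  exact evAt_sec_smul f a hm

theorem isGermMap_secQ (m : S.toIDVB.M) :
    IsGermMap (N := N) (m := m) (B := Module.Dual ℝ (S.toIDVB.q.Fib m))
      (fun V hV (a : N.sec V 1) => (S.secQ a).toFun ⟨m, hV⟩) where
  add V hV a b := LinearMap.ext fun x => by
    refine (S.secQ_apply _ hV x).trans ?_
    refine Eq.trans ?_ (congrArg₂ (· + ·) (S.secQ_apply a hV x) (S.secQ_apply b hV x)).symm
    exact evAt_sec_add _ _ ((congrArg (· ∈ V) x.2).mpr hV)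
  smul V hV f a := LinearMap.ext fun x => by
    refine (S.secQ_apply _ hV _).trans ?_
    refine Eq.trans ?_ (congrArg (f ⟨_, hV⟩ * ·) (S.secQ_apply a hV x)).symm
    exact S.fQ_smul_sec f a x.2 hV
  res V W h hW a := LinearMap.ext fun x => by
    refine (S.secQ_apply _ hW x).trans (Eq.trans ?_ (S.secQ_apply a (h hW) x).symm)
    exact evAt_sec_res _ _ ((congrArg (· ∈ W) x.2).mpr hW)

theorem isGermMap_secD (m : S.toIDVB.M) :
    IsGermMap (N := N) (m := m) (B := S.toIDVB.isotropicFib m)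
      (fun V hV (a : N.sec V 2) => (S.secD a).toFun ⟨m, hV⟩) where
  add V hV a b := IDVB.isoEv_ext fun P hP => by
    refine (S.isoEv_secD _ hV P hP).trans ?_
    refine Eq.trans ?_ (congrArg₂ (· + ·) (S.isoEv_secD a hV P hP) (S.isoEv_secD b hV P hP)).symm
    exact evAt_sec_add _ _ ((congrArg (· ∈ V) hP).mpr hV)
  smul V hV f a := IDVB.isoEv_ext fun P hP => by
    refine (S.isoEv_secD _ hV P hP).trans ?_
    refine Eq.trans ?_ (congrArg (f ⟨_, hV⟩ * ·) (S.isoEv_secD a hV P hP)).symm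
    exact S.fD_smul_sec f a hP hV
  res V W h hW a := IDVB.isoEv_ext fun P hP => by
    refine (S.isoEv_secD _ hW P hP).trans (Eq.trans ?_ (S.isoEv_secD a (h hW) P hP).symm)
    exact evAt_sec_res _ _ ((congrArg (· ∈ W) hP).mpr hW)

theorem secD_mul₁₁ (a b : N.sec U 1) (hm : m ∈ U) :
    (S.secD (mul₁₁ a b)).toFun ⟨m, hm⟩ =
      IDVB.wedge ((S.secQ a).toFun ⟨m, hm⟩) ((S.secQ b).toFun ⟨m, hm⟩) :=
  IDVB.isoEv_ext fun P hP => by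
    refine (S.isoEv_secD _ hm P hP).trans ((S.fD_mul₁₁ a b ((congrArg (· ∈ U) hP).mpr hm)).trans ?_)
    refine Eq.trans ?_ (IDVB.isoEv_wedge _ _ P hP).symm
    have h : ∀ c : N.sec U 1, S.fQ c (S.πD P) = (S.secQ c).toFun ⟨m, hm⟩ ⟨S.πD P, hP⟩ ∧
        S.fQ c (S.πD (S.invD P)) = (S.secQ c).toFun ⟨m, hm⟩ ⟨S.πD (S.invD P), hP⟩ :=
      fun c => ⟨(S.secQ_apply c hm ⟨S.πD P, hP⟩).symm,
        (S.secQ_apply c hm ⟨S.πD (S.invD P), hP⟩).symm⟩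
    exact congrArg (1 / 2 * ·) (congrArg₂ (· - ·) (congrArg₂ (· * ·) (h a).1 (h b).2)
      (congrArg₂ (· * ·) (h b).1 (h a).2))

/-- Free generators of the functions on `N` are frames of the double vector bundle of points. -/
theorem isFrame_sec {r₁ r₂ : ℕ} {ξ : Fin r₁ → N.sec U 1} {η : Fin r₂ → N.sec U 2}
    (hf : N.IsFreelyGenerated U ξ η) :
    IDVB.IsFrame (fun i => S.secQ (ξ i)) (fun j => S.secD (η j)) := fun m hm a b c => by
  obtain ⟨P, ⟨h0, h1, h2, h3⟩, hu⟩ := exists_D_of_free S hf hm a b c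
  have hP : S.bQ (S.πD P) ∈ U := h0.symm ▸ hm
  refine ⟨P, ⟨h0, fun i => (S.ev_secQ _ hP).trans (h1 i), fun i => ?_, fun j => ?_⟩, ?_⟩
  · exact (S.ev_secQ _ (x := S.πD (S.invD P)) hP).trans (h2 i)
  · exact (S.ev_secD _ hP).trans (h3 j)
  · rintro P' ⟨h0', h1', h2', h3'⟩
    have hP' : S.bQ (S.πD P') ∈ U := (congrArg (· ∈ U) h0').mpr hm
    refine hu P' ⟨h0', fun i => ?_, fun i => ?_, fun j => ?_⟩
    · exact (S.ev_secQ _ hP').symm.trans (h1' i)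
    · exact (S.ev_secQ _ (x := S.πD (S.invD P')) hP').symm.trans (h2' i)
    · exact (S.ev_secD _ hP').symm.trans (h3' j)

end LocalGenerators

end GradedMfd

/-! ### Morphisms of graded manifolds given by sections -/

namespace IDVB

variable {X : IDVB.{u}} {U : Opens X.M} {r₁ r₂ k : ℕ}

/-- Being homogeneous of degree `k` is a local property. -/
theorem mem_graded_of_local {s : X.Sec U} (h : ∀ m ∈ U, ∃ (V : Opens X.M) (hV : V ≤ U), m ∈ V ∧
    Sec.res hV s ∈ X.graded V k) : s ∈ X.graded U k := fun m hm => by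
  obtain ⟨V, hV, hmV, hs⟩ := h m hm
  obtain ⟨W, hW, hmW, hs'⟩ := hs m hmV
  exact ⟨W, hW.trans hV, hmW, hs'⟩

theorem mono_mem_graded (τ : Fin r₁ → X.DualSection U) (χ : Fin r₂ → X.IsotropicSection U)
    (p : Finset (Fin r₁) × (Fin r₂ → ℕ)) :
    mono (fun i => secOfDual (τ i)) (fun j => secOfIsotropic (χ j)) p ∈
      X.graded U (monoDeg p) := by
  obtain ⟨x, hx⟩ := exists_of_mono (A := fun k => X.graded U k) (fun i => X.ofDual (τ i))
    (fun j => X.ofIsotropic (χ j)) p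
  have h1 := coe_monomial τ χ p
  have h2 : X.toGradedMfd.monomial (fun i => X.ofDual (τ i)) (fun j => X.ofIsotropic (χ j)) p =
    DirectSum.of (fun k => X.graded U k) _ x := hx
  rw [h2] at h1
  rw [← h1, DirectSum.coeAlgHom_of]
  exact x.2

end IDVB

/-- A smooth map `base : Y.M → N.base`, and sections of `Q^*` and isotropic linear sections of `Y`
for the functions of degree 1 and 2 on `N`, compatible with the operations, the restrictions and
the product of functions of degree 1. -/
structure SectionMap (Y : IDVB.{u}) (N : GradedMfd.{u}) where
  base : Y.M → N.base
  smooth : SmoothMap base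
  dual : ∀ V : Opens N.base, N.sec V 1 → Y.DualSection (preim smooth V)
  isotropic : ∀ V : Opens N.base, N.sec V 2 → Y.IsotropicSection (preim smooth V)
  isGermMap_dual : ∀ m : Y.M, GradedMfd.IsGermMap (N := N) (m := base m)
    (B := Module.Dual ℝ (Y.q.Fib m)) (fun V hV a => (dual V a).toFun ⟨m, hV⟩)
  isGermMap_isotropic : ∀ m : Y.M, GradedMfd.IsGermMap (N := N) (m := base m)
    (B := Y.isotropicFib m) (fun V hV a => (isotropic V a).toFun ⟨m, hV⟩)
  isotropic_mul : ∀ (V : Opens N.base) (a b : N.sec V 1) (m : Y.M) (hm : base m ∈ V),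
    (isotropic V (GradedMfd.mul₁₁ a b)).toFun ⟨m, hm⟩ =
      IDVB.wedge ((dual V a).toFun ⟨m, hm⟩) ((dual V b).toFun ⟨m, hm⟩)

namespace SectionMap

open GradedMfd

variable {Y : IDVB.{u}} {N : GradedMfd.{u}} (hN : IsTwoManifold N) (S : SectionMap Y N)
  {U V : Opens N.base} {k : ℕ}

include hN in
/-- Free generators at `base m` determine a homomorphism with the prescribed values on them; it has
the prescribed values on all functions of degree 1 and 2, because both sides are germ maps. -/
theorem exists_fibHom (m : Y.M) :
    ∃ T : ∀ V : Opens N.base, S.base m ∈ V → (⨁ k, N.sec V k) →+* Y.FibAlg m,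
      (∀ V hV (f : Fun N.base V) a, T V hV (f • a) = f ⟨S.base m, hV⟩ • T V hV a) ∧
      (∀ (V W : Opens N.base) (hWV : W ≤ V) (hW : S.base m ∈ W) a,
        T W hW (N.resHom hWV a) = T V (hWV hW) a) ∧
      (∀ V (hV : S.base m ∈ V) (a : N.sec V 1), T V hV (DirectSum.of (N.sec V) 1 a) =
        TwoAlg.deg1 IDVB.wedge ((S.dual V a).toFun ⟨m, hV⟩)) ∧
      ∀ V (hV : S.base m ∈ V) (a : N.sec V 2), T V hV (DirectSum.of (N.sec V) 2 a) =
        TwoAlg.deg2 IDVB.wedge ((S.isotropic V a).toFun ⟨m, hV⟩) := by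
  obtain ⟨r₁, r₂, hN⟩ := hN
  obtain ⟨U, hU, ξ, η, hf⟩ := hN (S.base m)
  obtain ⟨T, h1, h2, h3, h4⟩ := hf.exists_germ_hom hU
    (IDVB.superCommute_fib m (fun i => (S.dual U (ξ i)).toFun ⟨m, hU⟩)
      (fun j => (S.isotropic U (η j)).toFun ⟨m, hU⟩))
  have hT : ∀ k, IsGermMap (N := N) (m := S.base m) (k := k) (B := Y.FibAlg m)
      (fun V hV a => T V hV (DirectSum.of (N.sec V) k a)) := fun k =>
    { add := fun V hV a b => by rw [_root_.map_add, _root_.map_add]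
      smul := fun V hV f a => by rw [← smul_of, h1]
      res := fun V W h hW a => by rw [← resHom_of, h2] }
  have hQ : ∀ V (hV : S.base m ∈ V) (a : N.sec V 1), T V hV (DirectSum.of (N.sec V) 1 a) =
      TwoAlg.deg1 IDVB.wedge ((S.dual V a).toFun ⟨m, hV⟩) := fun V hV a => by
    have h5 := S.isGermMap_dual m
    refine hf.germMap_ext₁ hU (hT 1) (A' := fun V hV a =>
      TwoAlg.deg1 IDVB.wedge ((S.dual V a).toFun ⟨m, hV⟩)) ?_ h3 hV a
    exact ⟨fun V hV a b => (congrArg _ (h5.add V hV a b)).trans (LinearMap.map_add _ _ _),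
      fun V hV f a => (congrArg _ (h5.smul V hV f a)).trans (LinearMap.map_smul _ _ _),
      fun V W h hW a => congrArg _ (h5.res V W h hW a)⟩
  refine ⟨T, h1, h2, hQ, fun V hV a => ?_⟩
  have h5 := S.isGermMap_isotropic m
  refine hf.germMap_ext₂ hU (hT 2) (A' := fun V hV a =>
      TwoAlg.deg2 IDVB.wedge ((S.isotropic V a).toFun ⟨m, hV⟩)) ?_ h4 (fun i k => ?_) hV a
  · exact ⟨fun V hV a b => (congrArg _ (h5.add V hV a b)).trans (LinearMap.map_add _ _ _),
      fun V hV f a => (congrArg _ (h5.smul V hV f a)).trans (LinearMap.map_smul _ _ _),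
      fun V W h hW a => congrArg _ (h5.res V W h hW a)⟩
  · rw [← of_mul_of₁₁, _root_.map_mul, hQ, hQ, TwoAlg.deg1_mul_deg1, S.isotropic_mul]

/-- The homomorphism from germs of functions at `base m` to the fibre over `m` of the bundle of
algebras. -/
noncomputable def fibHom (m : Y.M) (V : Opens N.base) (hV : S.base m ∈ V) :
    (⨁ k, N.sec V k) →+* Y.FibAlg m := (S.exists_fibHom hN m).choose V hV

theorem fibHom_res (m : Y.M) (h : V ≤ U) (hV : S.base m ∈ V) (a : N.sec U k) :
    S.fibHom hN m V hV (DirectSum.of (N.sec V) k (N.res h k a)) =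
      S.fibHom hN m U (h hV) (DirectSum.of (N.sec U) k a) := by
  rw [← resHom_of]
  exact (S.exists_fibHom hN m).choose_spec.2.1 U V h hV _

/-- The homomorphism from functions on `N` to sections of the bundle of algebras of `Y` which is
`fibHom` in every fibre. -/
noncomputable def secHom (V : Opens N.base) : (⨁ k, N.sec V k) →+* Y.Sec (preim S.smooth V) :=
  RingHom.pi (fun m : preim S.smooth V => S.fibHom hN m.1 V m.2)

theorem secHom_smul (f : Fun N.base V) (a : ⨁ k, N.sec V k) :
    S.secHom hN V (f • a) =
      (Fun.pullback S.smooth (fun _ hx => hx) f : Fun Y.M (preim S.smooth V)) •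
        S.secHom hN V a :=
  IDVB.Sec.ext_eval fun m => ((S.exists_fibHom hN m.1).choose_spec.1 V m.2 f a).trans
    (IDVB.Sec.eval_smul m (Fun.pullback S.smooth (fun _ hx => hx) f) (S.secHom hN V a)).symm

theorem secHom_of₁ (a : N.sec V 1) :
    S.secHom hN V (DirectSum.of (N.sec V) 1 a) = IDVB.secOfDual (S.dual V a) :=
  funext fun m => (S.exists_fibHom hN m.1).choose_spec.2.2.1 V m.2 a

theorem secHom_of₂ (a : N.sec V 2) :
    S.secHom hN V (DirectSum.of (N.sec V) 2 a) = IDVB.secOfIsotropic (S.isotropic V a) :=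
  funext fun m => (S.exists_fibHom hN m.1).choose_spec.2.2.2 V m.2 a

/-- A function is a combination of monomials in the free generators, which are sent to monomials in
sections. -/
theorem secHom_mem_of_free {r₁ r₂ : ℕ} {ξ : Fin r₁ → N.sec V 1} {η : Fin r₂ → N.sec V 2}
    (hf : N.IsFreelyGenerated V ξ η) (a : N.sec V k) :
    S.secHom hN V (DirectSum.of (N.sec V) k a) ∈ Y.graded (preim S.smooth V) k := by
  refine hf.mem_span_component a
    { carrier := {a | S.secHom hN V (DirectSum.of (N.sec V) k a) ∈ Y.graded (preim S.smooth V) k}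
      zero_mem' := by
        change S.secHom hN V (DirectSum.of (N.sec V) k 0) ∈ Y.graded (preim S.smooth V) k
        rw [_root_.map_zero, _root_.map_zero]
        exact Submodule.zero_mem _
      add_mem' := fun {a b} ha hb => by
        change S.secHom hN V (DirectSum.of (N.sec V) k (a + b)) ∈ Y.graded (preim S.smooth V) k
        rw [_root_.map_add, _root_.map_add]
        exact Submodule.add_mem _ ha hb
      smul_mem' := fun f a ha => by
        change S.secHom hN V (DirectSum.of (N.sec V) k (f • a)) ∈ Y.graded (preim S.smooth V) k
        rw [← smul_of, secHom_smul]
        exact Submodule.smul_mem _ _ ha } fun p hp x hx => ?_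
  subst hp
  change S.secHom hN V (DirectSum.of (N.sec V) _ x) ∈ Y.graded (preim S.smooth V) _
  rw [← hx, map_mono]
  simp only [secHom_of₁, secHom_of₂]
  exact IDVB.mono_mem_graded _ _ _

/-- The homomorphism takes functions of degree `k` to functions of degree `k`. -/
theorem secHom_mem (a : N.sec V k) :
    S.secHom hN V (DirectSum.of (N.sec V) k a) ∈ Y.graded (preim S.smooth V) k := by
  obtain ⟨r₁, r₂, hN'⟩ := id hN
  refine IDVB.mem_graded_of_local fun m hm => ?_
  obtain ⟨U, hU, ξ, η, hf⟩ := hN' (S.base m)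
  refine ⟨preim S.smooth (V ⊓ U), fun x hx => hx.1, ⟨hm, hU⟩, ?_⟩
  have h := S.secHom_mem_of_free hN (hf.restrict (inf_le_right : V ⊓ U ≤ _))
    (N.res (inf_le_left : V ⊓ U ≤ V) k a)
  have h' : IDVB.Sec.res (show preim S.smooth (V ⊓ U) ≤ preim S.smooth V from fun x hx => hx.1)
      (S.secHom hN V (DirectSum.of (N.sec V) k a)) = S.secHom hN (V ⊓ U)
      (DirectSum.of _ k (N.res (inf_le_left : V ⊓ U ≤ V) k a)) :=
    funext fun x => (S.fibHom_res hN x.1 (inf_le_left : V ⊓ U ≤ V) x.2 a).symm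
  rw [h']
  exact h

/-- The morphism with the given representations of functions of degree 1 and 2. -/
noncomputable def toHom : Hom Y.toGradedMfd N where
  base := S.base
  smooth := S.smooth
  app V k :=
    { toFun := fun a => ⟨S.secHom hN V (DirectSum.of (N.sec V) k a), S.secHom_mem hN a⟩
      map_zero' := Subtype.ext (by
        change S.secHom hN V (DirectSum.of (N.sec V) k 0) = 0
        rw [_root_.map_zero, _root_.map_zero])
      map_add' := fun a b => Subtype.ext (by
        change S.secHom hN V (DirectSum.of (N.sec V) k (a + b)) =
          S.secHom hN V (DirectSum.of (N.sec V) k a) + S.secHom hN V (DirectSum.of (N.sec V) k b)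
        rw [_root_.map_add, _root_.map_add]) }
  app_one V := Subtype.ext (S.secHom hN V).map_one
  app_mul V i j a b := Subtype.ext (by
    refine Eq.trans ?_ ((S.secHom hN V).map_mul (DirectSum.of (N.sec V) i a)
      (DirectSum.of (N.sec V) j b))
    rw [DirectSum.of_mul_of]
    rfl)
  app_smul V k f a := Subtype.ext (by
    refine Eq.trans ?_ (S.secHom_smul hN f (DirectSum.of (N.sec V) k a))
    rw [smul_of]
    rfl)
  app_res h k a := Subtype.ext (funext fun x => S.fibHom_res hN x.1 h x.2 a)

theorem toHom_app₁ (a : N.sec V 1) :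
    (S.toHom hN).app V 1 a = Y.ofDual (S.dual V a) := Subtype.ext (S.secHom_of₁ hN a)

theorem toHom_app₂ (a : N.sec V 2) :
    (S.toHom hN).app V 2 a = Y.ofIsotropic (S.isotropic V a) := Subtype.ext (S.secHom_of₂ hN a)

end SectionMap

namespace GradedMfd

/-- A morphism over the identity is an isomorphism if it is bijective on functions. The bases of
`A` and `B` are only assumed to be propositionally equal. -/
theorem Hom.exists_inverse {A B : GradedMfd.{u}} (e : A ⟶ B) (h : A.base = B.base)
    (he : ∀ x : A.base, e.base x = cast (congrArg Mfd.carrier h) x)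
    (hb : ∀ V k, Function.Bijective (e.app V k)) : IsIso e := by
  obtain ⟨M, secA⟩ := A
  obtain ⟨M', secB⟩ := B
  obtain ⟨f, hf, app, app_one, app_mul, app_smul, app_res⟩ := e
  dsimp only at h
  subst h
  obtain rfl : f = id := funext he
  let E : ∀ V k, secB V k ≃+ secA V k := fun V k => AddEquiv.ofBijective (app V k) (hb V k)
  refine ⟨⟨⟨id, hf, fun V k => (E V k).symm.toAddMonoidHom, fun V => ?_, fun V i j a b => ?_,
    fun V k f a => ?_, fun h k a => ?_⟩, ?_, ?_⟩⟩
  · exact (E V 0).symm_apply_eq.mpr (app_one V).symm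
  · refine (E V _).symm_apply_eq.mpr (Eq.trans ?_ (app_mul V i j _ _).symm)
    exact (congrArg₂ GradedMonoid.GMul.mul ((E V i).apply_symm_apply a)
      ((E V j).apply_symm_apply b)).symm
  · refine (E V _).symm_apply_eq.mpr (Eq.trans ?_ (app_smul V k f _).symm)
    exact (congrArg (f • ·) ((E V k).apply_symm_apply a)).symm
  · refine (E _ _).symm_apply_eq.mpr (Eq.trans ?_ (app_res h k _).symm)
    exact (congrArg _ ((E _ k).apply_symm_apply a)).symm
  · exact GradedMfd.Hom.ext rfl (heq_of_eq (funext fun V => funext fun k =>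
      AddMonoidHom.ext fun a => (E V k).apply_symm_apply a))
  · exact GradedMfd.Hom.ext rfl (heq_of_eq (funext fun V => funext fun k =>
      AddMonoidHom.ext fun a => (E V k).symm_apply_apply a))

namespace LocalGenerators

variable {N : GradedMfd.{u}} (hN : IsTwoManifold N) (S : N.LocalGenerators)

/-- Functions as sections on the double vector bundle of points. -/
noncomputable def sectionMap : SectionMap S.toIDVB N where
  base := id
  smooth := contMDiff_id
  dual _ a := S.secQ a
  isotropic _ a := S.secD a
  isGermMap_dual := S.isGermMap_secQ
  isGermMap_isotropic := S.isGermMap_secD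
  isotropic_mul _ a b _ hm := S.secD_mul₁₁ a b hm

/-- The functions on the double vector bundle of points of `N` are the functions on `N`: the
canonical morphism takes free generators to the free generators defined by a frame, hence it is
locally bijective. -/
theorem isIso_toHom : IsIso (C := GradedMfd.{u}) (S.sectionMap.toHom hN) := by
  refine Hom.exists_inverse _ rfl (fun _ => rfl) fun V k => ?_
  refine bijective_of_local (S.sectionMap.toHom hN) k
    (fun m => ⟨S.U m, S.mem_U m, fun W hW => ?_⟩) V
  have hf := (S.free m).restrict hW
  refine bijective_app_of_free (S.sectionMap.toHom hN) hf ?_ Function.bijective_id k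
  have h : S.toIDVB.toGradedMfd.IsFreelyGenerated (preim (S.sectionMap.toHom hN).smooth W)
      (fun i => S.toIDVB.ofDual (S.sectionMap.dual W (N.res hW 1 (S.ξ m i))))
      (fun j => S.toIDVB.ofIsotropic (S.sectionMap.isotropic W (N.res hW 2 (S.η m j)))) :=
    (S.isFrame_sec hf).isFreelyGenerated
  exact (congrArg₂ (fun a b => GradedMfd.IsFreelyGenerated _ _ a b)
    (funext fun _ => (S.sectionMap.toHom_app₁ hN _).symm)
    (funext fun _ => (S.sectionMap.toHom_app₂ hN _).symm)).mp h

end LocalGenerators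

end GradedMfd

/-! ### Free generators as charts, and the equivalence -/

namespace IDVB

variable {X : IDVB.{u}} {N : GradedMfd.{u}}

theorem bijective_mapD {A B : GradedMfd.{u}} (e : A ≅ B) :
    Function.Bijective (GradedMfd.Hom.mapD e.hom) :=
  Function.bijective_iff_has_inverse.mpr ⟨GradedMfd.Hom.mapD e.inv,
    fun P => congrArg (fun F : GradedMfd.Hom A A => F.mapD P) e.hom_inv_id,
    fun P => congrArg (fun F : GradedMfd.Hom B B => F.mapD P) e.inv_hom_id⟩

theorem bijective_base {A B : GradedMfd.{u}} (e : A ≅ B) : Function.Bijective e.hom.base :=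
  Function.bijective_iff_has_inverse.mpr ⟨e.inv.base,
    fun m => congrArg (fun F : GradedMfd.Hom A A => F.base m) e.hom_inv_id,
    fun m => congrArg (fun F : GradedMfd.Hom B B => F.base m) e.inv_hom_id⟩

/-- An isomorphism `ℳ(X) ≅ N` takes free generators to a frame: `X` is the space of points of
`ℳ(X)`, hence that of `N`, and free generators are coordinates there. -/
theorem isFrame_of_iso (e : X.toGradedMfd ≅ N) {U : Opens N.base} {r₁ r₂ : ℕ}
    {ξ : Fin r₁ → N.sec U 1} {η : Fin r₂ → N.sec U 2} (hf : N.IsFreelyGenerated U ξ η) :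
    IsFrame (fun i => dualOf (e.hom.app U 1 (ξ i)))
      (fun j => isotropicOf (e.hom.app U 2 (η j))) := fun m hm a b c => by
  have key₁ : ∀ (d : X.D) (_ : e.hom.base (X.toBase d) ∈ U) i,
      (dualOf (e.hom.app U 1 (ξ i))).ev (X.p₁.proj d) =
        GradedMfd.evAt (ξ i) (GradedMfd.Hom.mapD e.hom (toTD d)).p₁ := fun d hd i =>
    (toTD_ev₁ (U := preim e.hom.smooth U) hd _).symm.trans (GradedMfd.evAt_eq (ξ i)
      (x := (GradedMfd.Hom.mapD e.hom (toTD d)).p₁) hd).symm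
  have key₂ : ∀ (d : X.D) (_ : e.hom.base (X.toBase d) ∈ U) i,
      (dualOf (e.hom.app U 1 (ξ i))).ev (X.p₂.proj d) =
        GradedMfd.evAt (ξ i) (GradedMfd.Hom.mapD e.hom (toTD d)).p₂ := fun d hd i =>
    (toTD_ev₂ (U := preim e.hom.smooth U) hd _).symm.trans (GradedMfd.evAt_eq (ξ i)
      (x := (GradedMfd.Hom.mapD e.hom (toTD d)).p₂) hd).symm
  have key₃ : ∀ (d : X.D) (_ : e.hom.base (X.toBase d) ∈ U) j,
      (isotropicOf (e.hom.app U 2 (η j))).ev d =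
        GradedMfd.evAt (η j) ⟨(GradedMfd.Hom.mapD e.hom (toTD d)).1,
          (GradedMfd.Hom.mapD e.hom (toTD d)).2.ψ⟩ := fun d hd j =>
    (toTD_ev (U := preim e.hom.smooth U) hd _).symm.trans
      (GradedMfd.evAt_eq (η j) (x := ⟨(GradedMfd.Hom.mapD e.hom (toTD d)).1,
        (GradedMfd.Hom.mapD e.hom (toTD d)).2.ψ⟩) hd).symm
  have hm' : e.hom.base m ∈ U := hm
  obtain ⟨P, h1, h2, h3⟩ := GradedMfd.DPt.exists_of_free hf hm' a b c
  obtain ⟨P', hP'⟩ := (bijective_mapD e).2 (⟨_, P⟩ : N.TD)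
  obtain ⟨d, rfl⟩ := surjective_toTD P'
  have hd : X.toBase d = m := (bijective_base e).1 (congrArg Sigma.fst hP')
  have hdU : e.hom.base (X.toBase d) ∈ U := by rw [hd]; exact hm'
  have e1 : ∀ i, (dualOf (e.hom.app U 1 (ξ i))).ev (X.p₁.proj d) = a i := fun i =>
    (key₁ d hdU i).trans ((congrArg (fun P : N.TD => GradedMfd.evAt (ξ i) P.p₁) hP').trans
      ((GradedMfd.evAt_mk _ _ hm').trans (h1 i)))
  have e2 : ∀ i, (dualOf (e.hom.app U 1 (ξ i))).ev (X.p₂.proj d) = b i := fun i =>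
    (key₂ d hdU i).trans ((congrArg (fun P : N.TD => GradedMfd.evAt (ξ i) P.p₂) hP').trans
      ((GradedMfd.evAt_mk _ _ hm').trans (h2 i)))
  have e3 : ∀ j, (isotropicOf (e.hom.app U 2 (η j))).ev d = c j := fun j =>
    (key₃ d hdU j).trans ((congrArg (fun P : N.TD =>
      GradedMfd.evAt (η j) ⟨P.1, P.2.ψ⟩) hP').trans ((GradedMfd.evAt_mk _ _ hm').trans (h3 j)))
  refine ⟨d, ⟨hd, e1, e2, e3⟩, ?_⟩
  rintro d' ⟨hd', e1', e2', e3'⟩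
  have hdU' : e.hom.base (X.toBase d') ∈ U := by rw [hd']; exact hm'
  refine injective_toTD ((bijective_mapD e).1 (GradedMfd.TD.ext_evAt_free hf
    (congrArg e.hom.base (hd'.trans hd.symm)) hdU' (fun i => ?_) (fun i => ?_) fun j => ?_))
  · exact (key₁ d' hdU' i).symm.trans (((e1' i).trans (e1 i).symm).trans (key₁ d hdU i))
  · exact (key₂ d' hdU' i).symm.trans (((e2' i).trans (e2 i).symm).trans (key₂ d hdU i))
  · exact (key₃ d' hdU' j).symm.trans (((e3' j).trans (e3 j).symm).trans (key₃ d hdU j))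

/-- The charts defined by free generators do not depend on a particular construction of the
isomorphism `ℳ(X) ≅ N`. -/
theorem isGeometrization (e : X.toGradedMfd ≅ N) : IsGeometrization N X e.hom := by
  intro U r₁ r₂ ξ η hf
  have hfr := isFrame_of_iso e hf
  have hbase : ∀ m, e.hom.base (e.inv.base m) = m := fun m =>
    congrArg (fun F : GradedMfd.Hom N N => F.base m) e.inv_hom_id
  have hbase' : ∀ m, e.inv.base (e.hom.base m) = m := fun m =>
    congrArg (fun F : GradedMfd.Hom X.toGradedMfd X.toGradedMfd => F.base m) e.hom_inv_id
  refine ⟨_, _, fun p => hfr.pt (e.inv.base p.1) p.2.1 p.2.2.1 p.2.2.2,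
    fun i => (ofDual_dualOf _).symm, fun j => (ofIsotropic_isotropicOf _).symm, ?_, ?_⟩
  · refine hfr.smooth_pt.comp (t := (preim e.hom.smooth U : Set X.M) ×ˢ Set.univ)
      (f := fun p : N.base × EuclideanSpace ℝ (Fin r₁) × EuclideanSpace ℝ (Fin r₁) ×
        EuclideanSpace ℝ (Fin r₂) => (e.inv.base p.1, p.2))
      ((e.inv.smooth.comp contMDiff_fst).prodMk contMDiff_snd).contMDiffOn fun p hp => ?_
    exact ⟨(congrArg (· ∈ U) (hbase p.1)).mpr hp.1, Set.mem_univ _⟩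
  · intro m hm a b c d
    have hm' : e.inv.base m ∈ preim e.hom.smooth U := (congrArg (· ∈ U) (hbase m)).mpr hm
    constructor
    · rintro rfl
      obtain ⟨h0, h1, h2, h3⟩ := hfr.pt_spec hm' a b c
      have h0' : e.hom.base (X.toBase (hfr.pt (e.inv.base m) a b c)) = m := by rw [h0, hbase]
      have h4 := (congrArg (· ∈ U) h0').mpr hm
      refine ⟨h4, h0', fun i => ?_, fun i => ?_, fun j => ?_⟩
      · exact (DualSection.ev_eq _ ⟨_, h4⟩ ⟨_, rfl⟩).symm.trans (h1 i)
      · exact (DualSection.ev_eq _ ⟨_, h4⟩ ⟨_, X.proj_p₂ _⟩).symm.trans (h2 i)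
      · exact (IsotropicSection.ev_eq _ ⟨_, h4⟩ _ rfl).symm.trans (h3 j)
    · rintro ⟨h4, h0, h1, h2, h3⟩
      refine hfr.pt_unique hm' ?_ (fun i => ?_) (fun i => ?_) fun j => ?_
      · rw [← h0, hbase']
      · exact (DualSection.ev_eq _ ⟨_, h4⟩ ⟨_, rfl⟩).trans (h1 i)
      · exact (DualSection.ev_eq _ ⟨_, h4⟩ ⟨_, X.proj_p₂ _⟩).trans (h2 i)
      · exact (IsotropicSection.ev_eq _ ⟨_, h4⟩ _ rfl).trans (h3 j)

instance : functions.{u}.Faithful where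
  map_injective h := Hom.toGradedMfd_injective h

instance : functions.{u}.Full where
  map_surjective F := ⟨realize F, toGradedMfd_realize F⟩

instance (h : ∀ X : IDVB.{u}, IsTwoManifold (functions.obj X)) : (functorM h).EssSurj where
  mem_essImage N := by
    obtain ⟨S⟩ := GradedMfd.IsTwoManifold.exists_localGenerators N.property
    have := S.isIso_toHom N.property
    exact ⟨S.toIDVB, ⟨IsTwoManifold.isoMk
      (asIso (C := GradedMfd.{u}) (S.sectionMap.toHom N.property))⟩⟩

end IDVB

end GradedGeometry

theorem theorem3p17 :
    ∃ h : ∀ X : IDVB.{u}, IsTwoManifold (IDVB.functions.obj X),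
      (∀ (X : IDVB.{u}) (U : Opens X.M), Function.Bijective (X.ofDual (U := U))) ∧
      (∀ (X : IDVB.{u}) (U : Opens X.M), Function.Bijective (X.ofIsotropic (U := U))) ∧
      ∃ (𝒢 : TwoMan.{u} ⥤ IDVB.{u})
        (η : 𝟭 IDVB.{u} ≅ IDVB.functorM h ⋙ 𝒢)
        (ε : 𝒢 ⋙ IDVB.functorM h ≅ 𝟭 TwoMan.{u}),
        (∀ X : IDVB.{u},
          (IDVB.functorM h).map (η.hom.app X) ≫ ε.hom.app ((IDVB.functorM h).obj X) = 𝟙 _) ∧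
        (∀ N : TwoMan.{u}, η.hom.app (𝒢.obj N) ≫ 𝒢.map (ε.hom.app N) = 𝟙 _) ∧
        ∀ N : TwoMan.{u},
          IsGeometrization N.obj (𝒢.obj N) (ε.hom.app N).hom := by
  have hE : (IDVB.functorM.{u} IDVB.isTwoManifold).IsEquivalence := {}
  let E := (IDVB.functorM.{u} IDVB.isTwoManifold).asEquivalence
  exact ⟨IDVB.isTwoManifold, IDVB.bijective_ofDual, IDVB.bijective_ofIsotropic, E.inverse,
    E.unitIso, E.counitIso, E.functor_unitIso_comp, E.unit_inverse_comp, fun N =>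
    IDVB.isGeometrization (IsTwoManifold.ι.mapIso (E.counitIso.app N))⟩
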